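/- Let $C\ge 1$ and call $k\in\mathbb C\setminus\{0\}$ strictly admissible if $0\le\arg k<\frac\pi4$, $\operatorname{Im}(k^2)\ge C$ and $|\frac\pi8-\arg k|<\frac\pi{16}$. Fix $1\le L_0<\infty$ and a strictly admissible $k$. For real-valued $q\in H^{-1}(\mathbb R/2L_0\mathbb Z)$ and $\varkappa$ or $\bar\varkappa$ strictly admissible let $g(x;q,\varkappa)=\langle\delta_x,(-\partial_x^2+q+\varkappa^2)^{-1}\delta_x\rangle$ be the diagonal Green's function of the Schrödinger operator on $L^2(\mathbb R)$ with the $2L_0$-periodic potential $q$; here $(-\partial_x^2+q+\varkappa^2)^{-1}\delta_y$ is the unique $u\in H^1(\mathbb R)$ with $\int u'\psi'+qu\psi+\varkappa^2u\psi\,dx=\psi(y)$ for all $\psi\in H^1(\mathbb R)$. The function $g(\cdot;q,\varkappa)$ is a nowhere vanishing element of $H^1(\mathbb R/2L_0\mathbb Z)$. For real-valued $q\in L^2(\mathbb R/2L_0\mathbb Z)$ put $$\mathcal H_k(q)=\operatorname{Re}\Bigl\{-16k^5\int_{-L_0}^{L_0}\rho(x;q,k)\,dx+2k^2\int_{-L_0}^{L_0}q(x)^2\,dx\Bigr\},\qquad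 \rho(x;q,k)=k-\frac1{2g(x;q,k)}+\frac12\int_{\mathbb R}e^{-2k|x-y|}q(y)\,dy.$$ (1) The Hamiltonian flow induced by $\mathcal H_k$ through the Gardner bracket, $\frac{d}{dt}q=\partial_x\frac{\delta\mathcal H_k}{\delta q}$, is $$\tfrac{d}{dt}q=\operatorname{Re}\{16k^5g'(\cdot;q,k)+4k^2q'\}.\qquad(*)$$ (2) The flow $(*)$ is globally well-posed on the space of all real-valued $q\in H^{-1}(\mathbb R/2L_0\mathbb Z)$. That is, there is a jointly continuous map $(t,q)\mapsto\Phi_t(q)$ from $\mathbb R\times H^{-1}$ to $H^{-1}$ such that $\Phi_0=\mathrm{Id}$, such that $t\mapsto\Phi_t(q)\in C(\mathbb R;H^{-1})$ solves $(*)$ (with the time derivative taken in $H^{-2}$) for every $q$, and such that every solution $u\in C(I;H^{-1})$ of $(*)$ on a time interval $I\ni0$ is $u(t)=\Phi_t(u(0))$. (3) The flow commutes with the KdV flow. A KdV solution with initial data $q\in H^{-1}$ is a map $u:\mathbb R\to H^{-1}$ with $u(0)=q$ such that some sequence of smooth solutions of $\partial_tv=-v'''+6vv'$ on $\mathbb R/2L_0\mathbb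 Z$ has initial data converging to $q$ in $H^{-1}$, and every such sequence converges to $u$ in $H^{-1}$, uniformly on compact time intervals; it is unique, and $S_t(q)=u(t)$. Then $\Phi_s\circ S_t=S_t\circ\Phi_s$ for all $s,t\in\mathbb R$, and $t\mapsto\Phi_s(u(t))$ is a KdV solution whenever $u$ is one. (4) If $q(t)$ solves $(*)$ on a time interval, then for every strictly admissible $\varkappa\ne k$, writing $g(\varkappa)=g(\cdot;q(t),\varkappa)$, $$\partial_t\frac1{2g(\varkappa)}=\Bigl[\frac{k^2+\bar k^2}{g(\varkappa)}-\frac{2k^5}{k^2-\varkappa^2}\frac{g(k)}{g(\varkappa)}-\frac{2\bar k^5}{\bar k^2-\varkappa^2}\frac{g(\bar k)}{g(\varkappa)}\Bigr]'$$ with the time derivative taken in $L^2(\mathbb R/2L_0\mathbb Z)$. -/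

import Mathlib

open scoped ENNReal ContDiff ComplexConjugate Topology
open Filter MeasureTheory

noncomputable section

namespace HkFlow

/-- `k` is strictly admissible (with lower bound `C` on `Im k²`): `k ≠ 0`, `0 ≤ arg k < π/4`,
`Im (k²) ≥ C` and `|π/8 - arg k| < π/16`. -/
structure StrictlyAdmissible (C : ℝ) (k : ℂ) : Prop where
  ne_zero : k ≠ 0
  arg_nonneg : 0 ≤ k.arg
  arg_lt : k.arg < Real.pi / 4
  le_im_sq : C ≤ (k ^ 2).im
  arg_near : |Real.pi / 8 - k.arg| < Real.pi / 16

/-! ### Distributions on the circle `ℝ/2Lℤ`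

A distribution on `ℝ/2Lℤ` is represented by its sequence of Fourier coefficients `c : ℤ → ℂ`:
it is `∑ c n * exp (i ξ_n x)` with `ξ_n = π n / L`. -/

/-- The frequency `ξ_n = π n / L`. -/
def freq (L : ℝ) (n : ℤ) : ℝ := Real.pi * n / L

/-- Fourier coefficients of a `2L`-periodic function. -/
def coeffs (L : ℝ) (f : ℝ → ℂ) (n : ℤ) : ℂ :=
  (1 / (2 * L) : ℂ) * ∫ x in (-L)..L, Complex.exp (-(Complex.I * freq L n * x)) * f x

/-- The spatial derivative of a distribution on the circle. -/
def ddx (L : ℝ) (c : ℤ → ℂ) (n : ℤ) : ℂ := Complex.I * freq L n * c n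

/-- The Sobolev weight `(4 + ξ_n²)^s`. -/
def weight (L s : ℝ) (n : ℤ) : ℝ := (4 + freq L n ^ 2) ^ s

lemma weight_pos (L s : ℝ) (n : ℤ) : 0 < weight L s n := by
  unfold weight; positivity

lemma sqrt_weight_pos (L s : ℝ) (n : ℤ) : 0 < √(weight L s n) :=
  Real.sqrt_pos.2 (weight_pos L s n)

/-- The `H^s(ℝ/2Lℤ)` norm of an arbitrary distribution, possibly infinite. -/
def eSobNorm (L s : ℝ) (c : ℤ → ℂ) : ℝ≥0∞ :=
  (∑' n : ℤ, ENNReal.ofReal (weight L s n * ‖c n‖ ^ 2)) ^ (1 / 2 : ℝ)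

lemma memℓp_weighted_iff (L s : ℝ) (c : ℤ → ℂ) :
    Memℓp (fun n => (√(weight L s n) : ℂ) * c n) 2 ↔
      Summable fun n => weight L s n * ‖c n‖ ^ 2 := by
  rw [memℓp_gen_iff (by norm_num)]
  apply summable_congr
  intro n
  have h := (weight_pos L s n).le
  rw [norm_mul, Complex.norm_real, Real.norm_of_nonneg (Real.sqrt_nonneg _)]
  norm_num
  rw [mul_pow, Real.sq_sqrt h]

/-- The real vector space of real-valued distributions of finite `H^s` norm; being real-valued
means `c (-n) = conj (c n)`. -/
def hsSubmodule (L s : ℝ) : Submodule ℝ (ℤ → ℂ) where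
  carrier := {c | (∀ n, c (-n) = conj (c n)) ∧ Summable fun n => weight L s n * ‖c n‖ ^ 2}
  zero_mem' := by simp [summable_zero]
  add_mem' := by
    rintro a b ⟨ha, ha'⟩ ⟨hb, hb'⟩
    refine ⟨fun n => by simp [ha n, hb n], ?_⟩
    rw [← memℓp_weighted_iff] at *
    convert ha'.add hb' using 1
    ext n
    simp [mul_add]
  smul_mem' := by
    rintro r a ⟨ha, ha'⟩
    refine ⟨fun n => by simp [ha n], ?_⟩
    rw [← memℓp_weighted_iff] at *
    convert ha'.const_smul (r : ℂ) using 1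
    ext n
    simp
    ring

/-- The space `H^s(ℝ/2Lℤ; ℝ)`. It is a type of its own, so that its topology is the one of the
`H^s` norm below and not the one of coefficientwise convergence. -/
def Hs (L s : ℝ) : Type := hsSubmodule L s

instance Hs.instAddCommGroup (L s : ℝ) : AddCommGroup (Hs L s) :=
  inferInstanceAs (AddCommGroup (hsSubmodule L s))

instance Hs.instModule (L s : ℝ) : Module ℝ (Hs L s) :=
  inferInstanceAs (Module ℝ (hsSubmodule L s))

/-- The identification of `H^s` with a subspace of `ℓ²` through
`c n ↦ (4 + ξ_n²)^(s/2) * c n`. -/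
def Hs.toLp (L s : ℝ) : Hs L s →ₗ[ℝ] lp (fun _ : ℤ => ℂ) 2 where
  toFun c := ⟨fun n => (√(weight L s n) : ℂ) * c.1 n, (memℓp_weighted_iff L s c.1).2 c.2.2⟩
  map_add' a b := by
    ext n
    exact mul_add (√(weight L s n) : ℂ) (a.1 n) (b.1 n)
  map_smul' r a := by
    ext n
    change (√(weight L s n) : ℂ) * (r • a.1 n) = r • ((√(weight L s n) : ℂ) * a.1 n)
    simp
    ring

lemma Hs.toLp_injective (L s : ℝ) : Function.Injective (Hs.toLp L s) := by
  intro a b h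
  apply Subtype.ext
  ext n
  have h1 : (√(weight L s n) : ℂ) * a.1 n = (√(weight L s n) : ℂ) * b.1 n :=
    congrFun (congrArg Subtype.val h) n
  exact mul_left_cancel₀ (by exact_mod_cast (sqrt_weight_pos L s n).ne') h1

instance Hs.instNormedAddCommGroup (L s : ℝ) : NormedAddCommGroup (Hs L s) :=
  NormedAddCommGroup.induced (Hs L s) (lp (fun _ : ℤ => ℂ) 2) (Hs.toLp L s)
    (Hs.toLp_injective L s)

instance Hs.instNormedSpace (L s : ℝ) : NormedSpace ℝ (Hs L s) :=
  NormedSpace.induced ℝ (Hs L s) (lp (fun _ : ℤ => ℂ) 2) (Hs.toLp L s)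

/-- The norm of `Hs L s` is the usual one, `‖c‖² = ∑ (4 + ξ_n²)^s |c n|²`. -/
lemma Hs.norm_sq (L s : ℝ) (c : Hs L s) :
    ‖c‖ ^ 2 = ∑' n, weight L s n * ‖c.1 n‖ ^ 2 := by
  have h : ‖c‖ = ‖Hs.toLp L s c‖ := rfl
  have h2 := lp.norm_rpow_eq_tsum (p := 2) (by norm_num) (Hs.toLp L s c)
  rw [h]
  norm_num at h2
  rw [h2]
  apply tsum_congr
  intro n
  change ‖(√(weight L s n) : ℂ) * c.1 n‖ ^ 2 = _
  rw [norm_mul, Complex.norm_real, Real.norm_of_nonneg (Real.sqrt_nonneg _), mul_pow,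
    Real.sq_sqrt (weight_pos L s n).le]

/-- `F`, a curve of distributions, has derivative `F'` at time `t` within `I`, the difference
quotients converging in `H^s`. -/
def HasSobDerivWithin (L s : ℝ) (F : ℝ → ℤ → ℂ) (F' : ℤ → ℂ) (I : Set ℝ) (t : ℝ) : Prop :=
  Tendsto (fun τ : ℝ => eSobNorm L s fun n => ((τ - t : ℝ) : ℂ)⁻¹ * (F τ n - F t n) - F' n)
    (𝓝[I \ {t}] t) (𝓝 0)

/-! ### The Schrödinger operator on the line with `2L`-periodic potential -/

/-- `u` is (the continuous representative of) an element of `H¹(ℝ; ℂ)` and `u'` is its weak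
derivative. -/
structure HasH1Deriv (u u' : ℝ → ℂ) : Prop where
  memLp : MemLp u 2 volume
  memLp_deriv : MemLp u' 2 volume
  ftc : ∀ a b : ℝ, u b - u a = ∫ x in a..b, u' x

/-- The pairing `∫_ℝ q(x) h(x) dx` of a periodic distribution `q` with a function `h` on the
line. -/
def pair (L : ℝ) (q : ℤ → ℂ) (h : ℝ → ℂ) : ℂ :=
  ∑' n : ℤ, q n * ∫ x : ℝ, Complex.exp (Complex.I * freq L n * x) * h x

/-- `u = (-∂² + q + k²)⁻¹ δ_y`: `u` is in `H¹(ℝ)` and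
`∫ u' ψ' + ∫ q u ψ + k² ∫ u ψ = ψ(y)` for all `ψ` in `H¹(ℝ)`, so that `u = G(·, y; q, k)`. -/
def IsGreen (L : ℝ) (q : ℤ → ℂ) (k : ℂ) (y : ℝ) (u : ℝ → ℂ) : Prop :=
  ∃ u' : ℝ → ℂ, HasH1Deriv u u' ∧ ∀ ψ ψ' : ℝ → ℂ, HasH1Deriv ψ ψ' →
    (∫ x : ℝ, u' x * ψ' x) + pair L q (fun x => u x * ψ x) + k ^ 2 * ∫ x : ℝ, u x * ψ x = ψ y

open Classical in
/-- The function `R(k) δ_y = G(·, y; q, k)`. -/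
def green (L : ℝ) (q : ℤ → ℂ) (k : ℂ) (y : ℝ) : ℝ → ℂ :=
  if h : ∃ u, IsGreen L q k y u then h.choose else 0

/-- The diagonal Green's function `g(x; q, k) = ⟨δ_x, R(k) δ_x⟩ = G(x, x; q, k)`. -/
def diagGreen (L : ℝ) (q : ℤ → ℂ) (k : ℂ) (x : ℝ) : ℂ := green L q k x x

/-- The Green's function exists and is unique, and its diagonal `g` is a nowhere vanishing
element of `H¹(ℝ/2Lℤ; ℂ)`. -/
structure GreenRegular (L : ℝ) (q : ℤ → ℂ) (k : ℂ) : Prop where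
  existsUnique : ∀ y, ∃! u, IsGreen L q k y u
  ne_zero : ∀ x, diagGreen L q k x ≠ 0
  continuous : Continuous (diagGreen L q k)
  periodic : Function.Periodic (diagGreen L q k) (2 * L)
  memH1 : eSobNorm L 1 (coeffs L (diagGreen L q k)) < ⊤

/-! ### The Hamiltonian -/

/-- `ρ(x; q, k) = k - 1 / (2 g(x; q, k)) + ½ ∫_ℝ exp (-2 k |x - y|) q(y) dy`. -/
def rho (L : ℝ) (q : ℤ → ℂ) (k : ℂ) (x : ℝ) : ℂ :=
  k - 1 / (2 * diagGreen L q k x)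
    + 1 / 2 * pair L q (fun y => Complex.exp (-(2 * k * (|x - y| : ℝ))))

/-- `α(q, k) = ∫_{-L}^{L} ρ(x; q, k) dx`. -/
def alpha (L : ℝ) (q : ℤ → ℂ) (k : ℂ) : ℂ := ∫ x in (-L)..L, rho L q k x

/-- A real-valued `2L`-periodic function which is square integrable over a period. -/
structure IsL2Per (L : ℝ) (q : ℝ → ℝ) : Prop where
  periodic : Function.Periodic q (2 * L)
  memLp : MemLp q 2 (volume.restrict (Set.Ioc (-L) L))

/-- Fourier coefficients of a real-valued periodic function. -/
def rcoeffs (L : ℝ) (q : ℝ → ℝ) : ℤ → ℂ := coeffs L fun x => (q x : ℂ)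

/-- `H_k(q) = Re (-16 k⁵ α(q, k) + 2 k² ∫_{-L}^{L} q²)`. -/
def hamiltonian (L : ℝ) (k : ℂ) (q : ℝ → ℝ) : ℝ :=
  (-16 * k ^ 5 * alpha L (rcoeffs L q) k + 2 * k ^ 2 * ((∫ x in (-L)..L, q x ^ 2 : ℝ) : ℂ)).re

/-- `G` is the functional derivative of `F` at `q`:
`d/ds F(q + s f) = ∫_{-L}^{L} G f` at `s = 0`, for all `f` in `L²`. -/
def IsFunctionalDeriv (L : ℝ) (F : (ℝ → ℝ) → ℝ) (q G : ℝ → ℝ) : Prop :=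
  IsL2Per L G ∧ ∀ f : ℝ → ℝ, IsL2Per L f →
    HasDerivAt (fun s : ℝ => F fun x => q x + s * f x) (∫ x in (-L)..L, G x * f x) 0

/-! ### The flow of the Hamiltonian -/

/-- The vector field `Re (16 k⁵ g'(·; q, k) + 4 k² q')` for real-valued `q`. -/
def hkField (L : ℝ) (k : ℂ) (q : ℤ → ℂ) : ℤ → ℂ :=
  ddx L fun n =>
    rcoeffs L (fun x => (16 * k ^ 5 * diagGreen L q k x).re) n + ((4 * k ^ 2).re : ℂ) * q n

/-- `u ∈ C(I; H⁻¹)` solves `dq/dt = Re (16 k⁵ g' + 4 k² q')` on `I`, where the time derivative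
is taken in `H⁻²` (to which the right-hand side belongs). -/
structure IsHkSolution (L : ℝ) (k : ℂ) (I : Set ℝ) (u : ℝ → Hs L (-1)) : Prop where
  continuousOn : ContinuousOn u I
  eqn : ∀ t ∈ I, HasSobDerivWithin L (-2) (fun τ => (u τ).1) (hkField L k (u t).1) I t

/-- Global well-posedness in `H⁻¹`, with `Φ t q₀` the solution at time `t` with initial data
`q₀`: global existence, uniqueness on every time interval, and continuous dependence. -/
structure IsGlobalHkFlow (L : ℝ) (k : ℂ) (Φ : ℝ → Hs L (-1) → Hs L (-1)) : Prop where
  init : ∀ q, Φ 0 q = q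
  solution : ∀ q, IsHkSolution L k Set.univ fun t => Φ t q
  unique : ∀ (I : Set ℝ) (u : ℝ → Hs L (-1)), I.OrdConnected → 0 ∈ I → IsHkSolution L k I u →
    ∀ t ∈ I, u t = Φ t (u 0)
  continuous : Continuous fun p : ℝ × Hs L (-1) => Φ p.1 p.2

/-! ### The KdV flow -/

/-- `u` is a smooth global solution of `dq/dt = -q''' + 6 q q'` on the circle `ℝ/2Lℤ`. -/
def IsSmoothKdV (L : ℝ) (u : ℝ → Hs L (-1)) : Prop :=
  ∃ v : ℝ → ℝ → ℝ, ContDiff ℝ ∞ (fun p : ℝ × ℝ => v p.1 p.2) ∧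
    (∀ t, Function.Periodic (v t) (2 * L)) ∧
    (∀ t x, deriv (fun τ => v τ x) t = -iteratedDeriv 3 (v t) x + 6 * v t x * deriv (v t) x) ∧
    ∀ t, (u t).1 = rcoeffs L (v t)

/-- `u` is the `H⁻¹` solution of KdV: the limit, locally uniformly in time, of every sequence of
smooth solutions whose initial data converge to `u 0` (and there are such sequences). -/
def IsKdVSolution (L : ℝ) (u : ℝ → Hs L (-1)) : Prop :=
  (∃ v : ℕ → ℝ → Hs L (-1), (∀ j, IsSmoothKdV L (v j)) ∧
    Tendsto (fun j => v j 0) atTop (𝓝 (u 0))) ∧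
  ∀ v : ℕ → ℝ → Hs L (-1), (∀ j, IsSmoothKdV L (v j)) →
    Tendsto (fun j => v j 0) atTop (𝓝 (u 0)) →
    ∀ T : ℝ, TendstoUniformlyOn v u atTop (Set.Icc (-T) T)

/-- The `H⁻¹` solution of KdV with given initial data is unique. -/
lemma IsKdVSolution.unique {L : ℝ} {u v : ℝ → Hs L (-1)} (hu : IsKdVSolution L u)
    (hv : IsKdVSolution L v) (h : u 0 = v 0) : u = v := by
  obtain ⟨w, hw, hw0⟩ := hu.1
  ext1 t
  have ht : t ∈ Set.Icc (-|t|) |t| := ⟨neg_abs_le t, le_abs_self t⟩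
  exact tendsto_nhds_unique ((hu.2 w hw hw0 |t|).tendsto_at ht)
    ((hv.2 w hw (h ▸ hw0) |t|).tendsto_at ht)

open Classical in
/-- The KdV flow on `H⁻¹(ℝ/2Lℤ; ℝ)`: `kdvFlow L t q` is the value at time `t` of the solution of
KdV with initial data `q`. -/
def kdvFlow (L : ℝ) (t : ℝ) (q : Hs L (-1)) : Hs L (-1) :=
  if h : ∃ u, IsKdVSolution L u ∧ u 0 = q then h.choose t else q

end HkFlow

end

open HkFlow

open scoped ENNReal ContDiff ComplexConjugate Topology Real
open Filter MeasureTheory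
open Set (Icc Ioc Ioi Ioo uIcc uIoc univ mem_univ uIoc_of_le indicator_of_mem indicator_of_notMem
  Ioc_subset_Icc_self Ioo_subset_Icc_self uIoc_subset_uIcc left_mem_uIcc)
open Function (Periodic)
open Complex (I exp exp_add real_smul norm_real add_re mul_re neg_re abs_re_le_norm conj_ofReal
  ofReal_re ofReal_im conj_conj conj_ofNat norm_exp normSq_eq_norm_sq norm_I ofReal_inv one_re
  re_le_norm re_ofReal_mul re_mul_ofReal conj_tsum mul_conj reCLM reCLM_apply continuous_ofReal
  continuous_re conj_eq_iff_re conj_im ofReal_pow ofReal_one ofReal_zero ofReal_mul)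
open Real (norm_eq_abs sq_sqrt sqrt_nonneg sqrt_sq sqrt_mul pi_pos exp_le_exp exp_pos
  le_sqrt_of_sq_le sqrt_le_sqrt dist_eq norm_of_nonneg rpow_neg_one continuous_sqrt
  volume_real_Ioc_of_le sqrt_zero)
open ENNReal (ofReal ofReal_le_ofReal ofReal_tsum_of_nonneg ofReal_ne_top ofReal_le_ofReal_iff
  tsum_le_tsum tendsto_ofReal toReal_ofReal ofReal_add)
open intervalIntegral (integral_of_le integral_add_adjacent_intervals integral_congr
  integral_interval_sub_left integral_mono_on integral_symm integral_mono_interval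
  integral_zero_ae)

noncomputable section

namespace HkFlow

variable {L s s' t T C R a b x y : ℝ} {f f' g g' u u' v v' w w' ψ ψ' F W r : ℝ → ℂ} {ι : Type*}
  {k σ ζ ϰ lam : ℂ} {μ : Measure ℝ} {q q₀ q₁ q₂ : Hs L (-1)}

/-- `f` is a primitive of the locally integrable function `f'`. -/
structure IsPrim (f f' : ℝ → ℂ) : Prop where
  intervalIntegrable : ∀ a b : ℝ, IntervalIntegrable f' volume a b
  ftc : ∀ a b : ℝ, f b - f a = ∫ x in a..b, f' x

lemma locallyIntegrable_of_intervalIntegrable (h : ∀ a b : ℝ, IntervalIntegrable f volume a b) :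
    LocallyIntegrable f volume := by
  intro x; refine ⟨Ioc (x - 1) (x + 1), Ioc_mem_nhds (by linarith) (by linarith), ?_⟩
  exact (intervalIntegrable_iff_integrableOn_Ioc_of_le (by linarith)).1 (h (x - 1) (x + 1))

lemma IsPrim.eq (h : IsPrim f f') (a : ℝ) :
    f = fun x => f a + ∫ t in a..x, f' t := by ext x; rw [← h.ftc]; ring

lemma IsPrim.continuous (h : IsPrim f f') : Continuous f := by
  rw [h.eq 0]
  exact continuous_const.add (intervalIntegral.continuous_primitive h.intervalIntegrable 0)

lemma IsPrim.ae_hasDerivAt (h : IsPrim f f') : ∀ᵐ x, HasDerivAt f (f' x) x := by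
  have := LocallyIntegrable.ae_hasDerivAt_integral
    (locallyIntegrable_of_intervalIntegrable h.intervalIntegrable)
  filter_upwards [this] with x hx
  rw [h.eq 0]; exact (hx 0).const_add _

lemma IsPrim.absolutelyContinuous (h : IsPrim f f') (a b : ℝ) : AbsolutelyContinuousOnInterval f a
    b := by
  have h1 := (h.intervalIntegrable a b).norm.absolutelyContinuousOnInterval_intervalIntegral
    (c := a) left_mem_uIcc
  rw [absolutelyContinuousOnInterval_iff] at h1 ⊢; intro ε hε; obtain ⟨δ, hδ, H⟩ := h1 ε hε
  refine ⟨δ, hδ, fun E hE hE' => lt_of_le_of_lt (Finset.sum_le_sum fun i _ => ?_) (H E hE hE')⟩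
  rw [dist_comm, dist_comm (∫ v in a..(E.2 i).1, ‖f' v‖), dist_eq_norm, h.ftc, dist_eq,
    integral_interval_sub_left (h.intervalIntegrable _ _).norm (h.intervalIntegrable _ _).norm]
  exact intervalIntegral.norm_integral_le_abs_integral_norm

lemma IsPrim.of_ae (hac : ∀ a b, AbsolutelyContinuousOnInterval f a b)
    (hd : ∀ᵐ x, HasDerivAt f (f' x) x) (hi : ∀ a b : ℝ, IntervalIntegrable f' volume a b) : IsPrim f
    f' := by
  refine ⟨hi, fun a b => ?_⟩
  have hP : IsPrim (fun x => ∫ t in a..x, f' t) f' := ⟨hi, fun c d => by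
    rw [integral_interval_sub_left (hi _ _) (hi _ _)]⟩
  obtain ⟨C, hC⟩ := ((hac a b).sub (hP.absolutelyContinuous a b)).const_of_ae_hasDerivAt_zero (by
    filter_upwards [hd, hP.ae_hasDerivAt] with x h1 h2 _
    simpa using h1.sub h2)
  have ha := hC a left_mem_uIcc; have hb := hC b Set.right_mem_uIcc
  simp only [Pi.sub_apply, intervalIntegral.integral_same, sub_zero] at ha hb; rw [ha, ← hb]; ring

lemma IsPrim.of_hasDerivAt (hd : ∀ x, HasDerivAt f (f' x) x) (hc : Continuous f') : IsPrim f f' :=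
  ⟨fun a b => hc.intervalIntegrable a b, fun a b =>
    (intervalIntegral.integral_eq_sub_of_hasDerivAt (fun x _ => hd x)
      (hc.intervalIntegrable a b)).symm⟩

lemma IsPrim.congr_ae (h : IsPrim f f') (hg : f' =ᵐ[volume] g') : IsPrim f g' := by
  refine ⟨fun a b => (h.intervalIntegrable a b).congr_ae (ae_restrict_of_ae hg), fun a b => ?_⟩
  rw [h.ftc]; exact intervalIntegral.integral_congr_ae (hg.mono fun x hx _ => hx)

lemma IsPrim.congr_left (h : IsPrim f f') (hg : ∀ x, f x = g x) : IsPrim g f' := by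
  rwa [← show f = g from funext hg]

lemma IsPrim.congr (h : IsPrim f f') (hg : ∀ x, f x = g x) (hg' : ∀ x, f' x = g' x) : IsPrim g
    g' := by
  rwa [← show f = g from funext hg, ← show f' = g' from funext hg']

lemma IsPrim.const (c : ℂ) : IsPrim (fun _ => c) (fun _ => 0) :=
  ⟨fun a b => intervalIntegrable_const, fun a b => by simp⟩

lemma IsPrim.add (hf : IsPrim f f') (hg : IsPrim g g') : IsPrim (fun x => f x + g x)
    (fun x => f' x + g' x) :=
  ⟨fun a b => (hf.1 a b).add (hg.1 a b), fun a b => by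
    rw [intervalIntegral.integral_add (hf.1 a b) (hg.1 a b), ← hf.2, ← hg.2]; ring⟩

lemma IsPrim.const_mul (c : ℂ) (hf : IsPrim f f') : IsPrim (fun x => c * f x) (fun x => c * f' x) :=
  ⟨fun a b => (hf.1 a b).const_mul c, fun a b => by
    rw [intervalIntegral.integral_const_mul, ← hf.2]; ring⟩

lemma IsPrim.neg (hf : IsPrim f f') : IsPrim (fun x => -f x) (fun x => -f' x) :=
  (hf.const_mul (-1)).congr (fun x => by ring) (fun x => by ring)

lemma IsPrim.sub (hf : IsPrim f f') (hg : IsPrim g g') : IsPrim (fun x => f x - g x)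
    (fun x => f' x - g' x) :=
  (hf.add hg.neg).congr (fun x => by ring) (fun x => by ring)

lemma IsPrim.conj (hf : IsPrim f f') : IsPrim (fun x => conj (f x)) (fun x => conj (f' x)) := by
  refine ⟨fun a b => ?_, fun a b => ?_⟩
  · have := hf.1 a b; rw [intervalIntegrable_iff] at this ⊢
    exact (Complex.conjLIE.toLinearIsometry.toContinuousLinearMap.integrable_comp this)
  · rw [← map_sub, hf.2, intervalIntegral, intervalIntegral, map_sub, ← integral_conj,
      ← integral_conj]

lemma IsPrim.mul (hf : IsPrim f f') (hg : IsPrim g g') : IsPrim (fun x => f x * g x)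
    (fun x => f' x * g x + f x * g' x) := by
  refine IsPrim.of_ae (fun a b => (hf.absolutelyContinuous a b).smul (hg.absolutelyContinuous a b))
    ?_ (fun a b => ((hf.1 a b).mul_continuousOn hg.continuous.continuousOn).add
      ((hg.1 a b).continuousOn_mul hf.continuous.continuousOn))
  filter_upwards [hf.ae_hasDerivAt, hg.ae_hasDerivAt] with x h1 h2
  exact h1.mul h2

lemma IsPrim.comp (hf : IsPrim f f') {φ φ' : ℂ → ℂ} (hφ : ∀ x, HasDerivAt φ (φ' (f x)) (f x))
    (hc : Continuous fun x => φ' (f x)) (hs : ∀ x, ContDiffAt ℝ 1 φ (f x)) : IsPrim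
    (fun x => φ (f x)) (fun x => φ' (f x) * f' x) := by
  refine IsPrim.of_ae (fun a b => ?_) ?_ (fun a b => (hf.1 a b).continuousOn_mul hc.continuousOn)
  · obtain ⟨K, hK⟩ := LocallyLipschitzOn.exists_lipschitzOnWith_of_compact
      (isCompact_uIcc.image hf.continuous (s := uIcc a b)) fun _ ⟨x, _, h⟩ => by
        obtain ⟨K, t, ht, hK⟩ := (hs x).exists_lipschitzOnWith
        exact ⟨K, t, mem_nhdsWithin_of_mem_nhds (h ▸ ht), hK⟩
    have h1 := hf.absolutelyContinuous a b; rw [absolutelyContinuousOnInterval_iff] at h1 ⊢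
    intro ε hε; obtain ⟨δ, hδ, H⟩ := h1 (ε / (K + 1)) (by positivity)
    refine ⟨δ, hδ, fun E hE hE' => ?_⟩
    calc _ ≤ ∑ i ∈ Finset.range E.1, (K + 1 : ℝ) * dist (f (E.2 i).1) (f (E.2 i).2) := by
          refine Finset.sum_le_sum fun i hi => ?_
          refine (hK.dist_le_mul _ ⟨_, (hE.1 i hi).1, rfl⟩ _ ⟨_, (hE.1 i hi).2, rfl⟩).trans ?_
          gcongr; linarith
      _ = (K + 1 : ℝ) * ∑ i ∈ Finset.range E.1, dist (f (E.2 i).1) (f (E.2 i).2) := by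
          rw [Finset.mul_sum]
      _ < (K + 1 : ℝ) * (ε / (K + 1)) := by gcongr; exact H E hE hE'
      _ = ε := by field_simp
  · filter_upwards [hf.ae_hasDerivAt] with x h1
    exact (hφ x).comp x h1

lemma IsPrim.exp (hf : IsPrim f f') : IsPrim (fun x => exp (f x)) (fun x => exp (f x) * f' x) :=
  hf.comp (φ' := Complex.exp) (fun x => Complex.hasDerivAt_exp _)
    (Complex.continuous_exp.comp hf.continuous) fun x => Complex.contDiff_exp.contDiffAt

lemma IsPrim.inv (hf : IsPrim f f') (h0 : ∀ x, f x ≠ 0) : IsPrim (fun x => (f x)⁻¹)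
    (fun x => -(f' x) / (f x) ^ 2) := by
  exact (hf.comp (φ := fun z => z⁻¹) (φ' := fun z => -(z ^ 2)⁻¹) (fun x => hasDerivAt_inv (h0 x))
    ((hf.continuous.pow 2).inv₀ (fun x => pow_ne_zero 2 (h0 x))).neg fun x => contDiffAt_inv ℝ (h0 x)).congr
      (fun _ => rfl) (fun x => by ring)

lemma IsPrim.primitive (h : ∀ a b : ℝ, IntervalIntegrable f volume a b) (c : ℝ) : IsPrim
    (fun x => ∫ t in c..x, f t) f :=
  ⟨h, fun a b => by rw [integral_interval_sub_left (h _ _) (h _ _)]⟩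

lemma IsPrim.eq_of_deriv_zero (h : IsPrim f f') (h0 : f' =ᵐ[volume] 0) (a b : ℝ) : f a = f b := by
  have := (h.congr_ae h0).ftc a b; simp at this; exact (sub_eq_zero.1 this).symm

lemma IsPrim.eq_mul_exp {y a : ℝ → ℂ} (ha : ∀ b c : ℝ, IntervalIntegrable a volume b c)
    (h : IsPrim y (fun x => a x * y x)) (b c : ℝ) : y c = y b * Complex.exp (∫ t in b..c, a t) := by
  have hA := (IsPrim.primitive ha b).neg.exp
  have := (h.mul hA).eq_of_deriv_zero (.of_forall fun x => by simp; ring) b c; simp at this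
  rw [this, mul_assoc, ← exp_add]; simp

lemma IsPrim.of_countable {s : Set ℝ} (hs : s.Countable) (hc : Continuous f)
    (hd : ∀ x, x ∉ s → HasDerivAt f (f' x) x) (hi : ∀ a b : ℝ, IntervalIntegrable f' volume a b) :
    IsPrim f f' :=
  ⟨hi, fun a b => (integral_eq_of_hasDerivAt_off_countable f f' hs
    hc.continuousOn (fun x hx => hd x hx.2) (hi a b)).symm⟩

lemma IsPrim.deriv_ae (h : IsPrim f f') : deriv f =ᵐ[volume] f' :=
  h.ae_hasDerivAt.mono fun _ hx => hx.deriv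

/-- The measure on a period. -/
abbrev perMeasure (L : ℝ) : Measure ℝ := volume.restrict (Ioc (-L) L)

instance (L : ℝ) : IsFiniteMeasure (perMeasure L) := ⟨by simp [perMeasure]⟩

lemma intervalIntegrable_iff_perMeasure (hL : 0 < L) : IntervalIntegrable f volume (-L) L ↔
    Integrable f (perMeasure L) :=
  intervalIntegrable_iff_integrableOn_Ioc_of_le (by linarith)

lemma integral_perMeasure {E : Type*} [NormedAddCommGroup E] [NormedSpace ℝ E] (hL : 0 < L)
    (f : ℝ → E) : ∫ x in (-L)..L, f x = ∫ x, f x ∂(perMeasure L) :=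
  integral_of_le (by linarith)

lemma freq_zero (L : ℝ) : freq L 0 = 0 := by simp [freq]

lemma freq_neg (L : ℝ) (n : ℤ) : freq L (-n) = -freq L n := by simp [freq]; ring

lemma freq_ne_zero (hL : 0 < L) {n : ℤ} (hn : n ≠ 0) : freq L n ≠ 0 := by
  simp [freq, Real.pi_ne_zero, hn, hL.ne']

/-- The exponential `exp (i ξ_n x)`. -/
def expi (L : ℝ) (n : ℤ) (x : ℝ) : ℂ := exp (I * freq L n * x)

lemma expi_eq (L : ℝ) (n : ℤ) (x : ℝ) :
    expi L n x = exp ((freq L n * x : ℝ) * I) := by simp [expi]; ring_nf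

lemma norm_expi (L : ℝ) (n : ℤ) (x : ℝ) : ‖expi L n x‖ = 1 := by
  rw [expi_eq, Complex.norm_exp_ofReal_mul_I]

lemma hasDerivAt_expi (L : ℝ) (n : ℤ) (x : ℝ) : HasDerivAt (expi L n) (I * freq L n * expi L n x)
    x := by
  have h := ((hasDerivAt_id x).ofReal_comp.const_mul (I * freq L n)).cexp
  simp only [id, ofReal_one, mul_one] at h; exact h.congr_deriv (by rw [expi, mul_comm])

lemma continuous_expi (L : ℝ) (n : ℤ) : Continuous (expi L n) := by unfold expi; fun_prop

lemma expi_zero (L : ℝ) (x : ℝ) : expi L 0 x = 1 := by simp [expi, freq_zero]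

lemma expi_neg (L : ℝ) (n : ℤ) (x : ℝ) :
    expi L (-n) x = exp (-(I * freq L n * x)) := by simp [expi, freq_neg]

lemma expi_add (L : ℝ) (m n : ℤ) (x : ℝ) : expi L (m + n) x = expi L m x * expi L n x := by
  simp only [expi, ← exp_add, freq]; congr 1; push_cast; ring

lemma conj_expi (L : ℝ) (n : ℤ) (x : ℝ) : conj (expi L n x) = expi L (-n) x := by
  rw [expi, expi_neg, ← Complex.exp_conj]; simp

lemma freq_mul_two (hL : 0 < L) (n : ℤ) : freq L n * (2 * L) = n * (2 * π) := by
  simp only [freq]; field_simp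

lemma expi_periodic (hL : 0 < L) (n : ℤ) : Periodic (expi L n) (2 * L) := by
  intro x; have := freq_mul_two hL n; rw [expi_eq, expi_eq, mul_add, this]
  push_cast
  rw [add_mul, exp_add, show (n : ℂ) * (2 * π) * I
    = n * (2 * π * I) by ring, Complex.exp_int_mul_two_pi_mul_I, mul_one]

lemma coeffs_eq (L : ℝ) (f : ℝ → ℂ) (n : ℤ) : coeffs L f n = (1 / (2 * L) : ℂ) * ∫ x in (-L)..L,
    expi L (-n) x * f x := by
  simp only [coeffs, expi_neg]

lemma coeffs_eq_fourierCoeffOn (hL : 0 < L) (f : ℝ → ℂ) (n : ℤ) : coeffs L f n = fourierCoeffOn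
    (show -L < L by linarith) f n := by
  rw [fourierCoeffOn_eq_integral, coeffs_eq, real_smul]; congr 1
  · push_cast; ring
  · refine integral_congr fun x _ => ?_; simp only [fourier_coe_apply, smul_eq_mul, expi, freq]
    congr 2; have : (L : ℂ) ≠ 0 := by exact_mod_cast hL.ne'
    push_cast; field_simp; ring

lemma parseval (hL : 0 < L) (hf : MemLp f 2 (perMeasure L)) : HasSum (fun n => ‖coeffs L f n‖ ^ 2)
    ((2 * L)⁻¹ * ∫ x in (-L)..L, ‖f x‖ ^ 2) := by
  have := hasSum_sq_fourierCoeffOn (show -L < L by linarith) hf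
  simp only [← coeffs_eq_fourierCoeffOn hL] at this; convert this using 1; rw [smul_eq_mul]; ring_nf

lemma coeffs_congr_ae (hL : 0 < L) (h : f =ᵐ[perMeasure L] g) : coeffs L f = coeffs L g := by
  ext n; rw [coeffs_eq_fourierCoeffOn hL, coeffs_eq_fourierCoeffOn hL, fourierCoeffOn_congr_ae _ h]

lemma intervalIntegrable_expi_mul (hf : IntervalIntegrable f volume a b) (n : ℤ) :
    IntervalIntegrable (fun x => expi L n x * f x) volume a b :=
  hf.continuousOn_mul (continuous_expi L n).continuousOn

lemma coeffs_add (hf : IntervalIntegrable f volume (-L) L) (hg : IntervalIntegrable g volume (-L) L)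
    (n : ℤ) : coeffs L (fun x => f x + g x) n = coeffs L f n + coeffs L g n := by
  simp only [coeffs_eq, mul_add]
  rw [intervalIntegral.integral_add (intervalIntegrable_expi_mul hf _) (intervalIntegrable_expi_mul hg _), mul_add]

lemma coeffs_const_mul (c : ℂ) (f : ℝ → ℂ) (n : ℤ) : coeffs L (fun x => c * f x) n = c * coeffs L f
    n := by
  simp only [coeffs_eq, mul_left_comm _ c, intervalIntegral.integral_const_mul]

lemma coeffs_sub (hf : IntervalIntegrable f volume (-L) L) (hg : IntervalIntegrable g volume (-L) L)
    (n : ℤ) : coeffs L (fun x => f x - g x) n = coeffs L f n - coeffs L g n := by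
  simp only [coeffs_eq, mul_sub]
  rw [intervalIntegral.integral_sub (intervalIntegrable_expi_mul hf _) (intervalIntegrable_expi_mul hg _), mul_sub]

lemma coeffs_zero_eq (L : ℝ) (f : ℝ → ℂ) :
    coeffs L f 0 = (1 / (2 * L) : ℂ) * ∫ x in (-L)..L, f x := by simp [coeffs_eq, expi_zero]

lemma norm_coeffs_le (hL : 0 < L) (f : ℝ → ℂ) (n : ℤ) : ‖coeffs L f n‖ ≤ (2 * L)⁻¹ * ∫ x in (-L)..L,
    ‖f x‖ := by
  rw [coeffs_eq, norm_mul]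
  have h2 : ‖(1 / (2 * L) : ℂ)‖ = (2 * L)⁻¹ := by simp [abs_of_pos hL, mul_comm]
  rw [h2]; gcongr
  refine (intervalIntegral.norm_integral_le_integral_norm (by linarith)).trans (le_of_eq ?_)
  simp [norm_expi]

lemma IsPrim.coeffs_deriv {y s : ℝ → ℂ} (h : IsPrim y s) (hb : y L = y (-L)) : coeffs L s = ddx L
    (coeffs L y) := by
  ext n
  have h1 := (IsPrim.of_hasDerivAt (hasDerivAt_expi L (-n))
    (continuous_const.mul (continuous_expi L (-n)))).mul h
  have h2 := h1.ftc (-L) L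
  have h3 : expi L (-n) L = expi L (-n) (-L) := by
    rcases eq_or_ne L 0 with rfl | hL
    · simp
    simp only [expi, freq]; have hL' : (L : ℂ) ≠ 0 := by exact_mod_cast hL
    rw [Complex.exp_eq_exp_iff_exists_int]; refine ⟨-n, ?_⟩; push_cast
    field_simp; ring
  rw [hb, h3, sub_self, intervalIntegral.integral_add] at h2
  · simp only [ddx, coeffs_eq]
    have : ∫ x in (-L)..L, I * freq L (-n) * expi L (-n) x * y x
        = -(I * freq L n) * ∫ x in (-L)..L, expi L (-n) x * y x := by
      rw [← intervalIntegral.integral_const_mul]; congr 1; ext x; rw [freq_neg]; push_cast; ring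
    grind
  · exact (((continuous_const.mul (continuous_expi L (-n))).mul h.continuous)).intervalIntegrable _ _
  · exact intervalIntegrable_expi_mul (h.1 _ _) _

lemma coeffs_const (hL : 0 < L) (c : ℂ) (n : ℤ) : coeffs L (fun _ => c) n = if n = 0 then c else
    0 := by
  split_ifs with h
  · subst h; rw [coeffs_zero_eq, intervalIntegral.integral_const]
    have : (L : ℂ) ≠ 0 := by exact_mod_cast hL.ne'
    rw [real_smul]; push_cast; field_simp; ring
  · have := congrFun ((IsPrim.const c).coeffs_deriv (L := L) rfl) n; simp only [ddx] at this
    have h0 : coeffs L (fun _ => (0 : ℂ)) n = 0 := by simp [coeffs_eq]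
    rw [h0] at this; have hf := freq_ne_zero hL h; simpa [hf] using this.symm

lemma MemLp.perIntegrable (hL : 0 < L) (hf : MemLp f 2 (perMeasure L)) : IntervalIntegrable f volume
    (-L) L :=
  (intervalIntegrable_iff_perMeasure hL).2 (hf.integrable (by norm_num))

lemma ae_eq_of_coeffs_eq (hL : 0 < L) (hf : MemLp f 2 (perMeasure L))
    (hg : MemLp g 2 (perMeasure L)) (h : coeffs L f = coeffs L g) : f =ᵐ[perMeasure L] g := by
  have h1 := parseval hL (hf.sub hg)
  have h2 : ∀ n, coeffs L (f - g) n = 0 := fun n => by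
    have := coeffs_sub (L := L) (MemLp.perIntegrable hL hf) (MemLp.perIntegrable hL hg) n
    rw [h, sub_self] at this; exact this
  simp only [h2, norm_zero] at h1; have h3 := h1.unique (a₂ := 0) (by simp)
  rw [integral_perMeasure hL] at h3
  have h4 : ∫ x, ‖(f - g) x‖ ^ 2 ∂(perMeasure L) = 0 := by simpa [hL.ne'] using h3
  rw [integral_eq_zero_iff_of_nonneg (fun x => by positivity)
    ((memLp_two_iff_integrable_sq_norm (hf.sub hg).1).1 (hf.sub hg))] at h4
  filter_upwards [h4] with x hx
  simpa [sub_eq_zero] using hx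

lemma exists_primitive_of_ddx (hL : 0 < L) {s : ℝ → ℂ} (hr : MemLp r 2 (perMeasure L))
    (hs : IntervalIntegrable s volume (-L) L) (h : ddx L (coeffs L r) = coeffs L s) :
    (∫ x in (-L)..L, s x = 0) ∧ ∃ C, ∀ᵐ x ∂(perMeasure L), r x = C + ∫ t in (-L)..x, s t := by
  have hs0 : ∫ x in (-L)..L, s x = 0 := by
    have := congrFun h 0; simp only [ddx, freq_zero, coeffs_zero_eq] at this
    have hL' : (L : ℂ) ≠ 0 := by exact_mod_cast hL.ne'
    simpa [hL'] using this.symm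
  refine ⟨hs0, ?_⟩; set s' : ℝ → ℂ := (Ioc (-L) L).indicator s with hs'
  have hi : Integrable s' volume := by
    rw [hs', integrable_indicator_iff measurableSet_Ioc]
    exact (intervalIntegrable_iff_perMeasure hL).1 hs
  have hP := IsPrim.primitive (fun a b => hi.intervalIntegrable (a := a) (b := b)) (-L)
  set y : ℝ → ℂ := fun x => ∫ t in (-L)..x, s' t with hy
  have hss' : s' =ᵐ[perMeasure L] s := by
    filter_upwards [ae_restrict_mem measurableSet_Ioc] with x hx
    rw [hs', indicator_of_mem hx]
  have hyL : y L = y (-L) := by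
    simp only [hy, intervalIntegral.integral_same]
    rw [integral_perMeasure hL, integral_congr_ae hss', ← integral_perMeasure hL, hs0]
  have hym : MemLp y 2 (perMeasure L) := by
    obtain ⟨B, hB⟩ := isCompact_Icc.exists_bound_of_continuousOn (s := Icc (-L) L)
      hP.continuous.continuousOn
    refine MemLp.of_bound hP.continuous.aestronglyMeasurable B ?_
    filter_upwards [ae_restrict_mem measurableSet_Ioc] with x hx
    exact hB x (Ioc_subset_Icc_self hx)
  have hc := hP.coeffs_deriv hyL; rw [coeffs_congr_ae hL hss', ← h] at hc
  have key : (fun x => r x - y x) =ᵐ[perMeasure L] fun _ => coeffs L (fun x => r x - y x) 0 := by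
    refine ae_eq_of_coeffs_eq hL (hr.sub hym) (memLp_const _) ?_; ext n; rw [coeffs_const hL]
    split_ifs with hn
    · rw [hn]
    · rw [coeffs_sub (MemLp.perIntegrable hL hr) (MemLp.perIntegrable hL hym)]
      have := congrFun hc n; simp only [ddx] at this; rw [sub_eq_zero]
      exact mul_left_cancel₀ (mul_ne_zero Complex.I_ne_zero
        (by exact_mod_cast freq_ne_zero hL hn)) this
  refine ⟨coeffs L (fun x => r x - y x) 0, ?_⟩
  filter_upwards [key, ae_restrict_mem measurableSet_Ioc] with x hx hxm
  have : y x = ∫ t in (-L)..x, s t := by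
    simp only [hy]; refine intervalIntegral.integral_congr_ae (.of_forall fun t ht => ?_)
    rw [uIoc_of_le hxm.1.le] at ht
    rw [hs', indicator_of_mem (show t ∈ Ioc (-L) L from ⟨ht.1, ht.2.trans hxm.2⟩)]
  rw [← this, ← hx]; ring

/-- A measurable periodic function, square integrable over a period. -/
structure L2Per (L : ℝ) (f : ℝ → ℂ) : Prop where
  periodic : Periodic f (2 * L)
  measurable : Measurable f
  memLp : MemLp f 2 (perMeasure L)

lemma riesz_fischer (hL : 0 < L) {c : ℤ → ℂ} (hc : Summable fun n => ‖c n‖ ^ 2) : ∃ f, L2Per L f ∧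
    coeffs L f = c := by
  have : Fact (0 < 2 * L) := ⟨by linarith⟩
  have hm : Memℓp c 2 := by rw [memℓp_gen_iff (by norm_num)]; simpa using hc
  set F := (fourierBasis (T := 2 * L)).repr.symm ⟨c, hm⟩ with hF
  have hco : ∀ n, fourierCoeff F n = c n := fun n => by
    rw [← fourierBasis_repr, hF, LinearIsometryEquiv.apply_symm_apply]
  have hFm := Lp.stronglyMeasurable F; have hmp := AddCircle.measurePreserving_mk (2 * L) (-L)
  rw [show -L + 2 * L = L by ring] at hmp
  refine ⟨fun x => F (x : AddCircle (2 * L)), ⟨fun x => ?_, ?_, ?_⟩, ?_⟩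
  · simp
  · fun_prop
  · exact (MemLp.of_haarAddCircle (Lp.memLp F)).comp_measurePreserving hmp
  · ext n
    rw [← hco, fourierCoeff_eq_intervalIntegral _ _ (-L), coeffs_eq, real_smul,
      show -L + 2 * L = L by ring]
    congr 1
    · push_cast; ring
    · refine integral_congr fun x _ => ?_; simp only [fourier_coe_apply, smul_eq_mul, expi, freq]
      congr 2; have : (L : ℂ) ≠ 0 := by exact_mod_cast hL.ne'
      push_cast; field_simp

lemma coeffs_conj (L : ℝ) (f : ℝ → ℂ) (n : ℤ) : coeffs L (fun x => conj (f x)) n = conj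
    (coeffs L f (-n)) := by
  simp only [coeffs_eq, map_mul, neg_neg]; congr 1
  · simp [conj_ofNat]
  · simp only [intervalIntegral, map_sub]; rw [← integral_conj, ← integral_conj]; simp [conj_expi]

lemma coeffs_real (L : ℝ) (f : ℝ → ℝ) (n : ℤ) : rcoeffs L f (-n) = conj (rcoeffs L f n) := by
  have := coeffs_conj L (fun x => (f x : ℂ)) (-n); simp only [conj_ofReal, neg_neg] at this
  exact this

lemma summable_weight_neg_one (hL : 0 < L) : Summable (weight L (-1)) := by
  have h1 : Summable fun n : ℤ => (L / π) ^ 2 * (1 / (n : ℝ) ^ 2) :=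
    (Real.summable_one_div_int_pow.2 (by norm_num)).mul_left _
  rw [← (Finset.summable_compl_iff {(0 : ℤ)})] at h1 ⊢
  refine h1.of_nonneg_of_le (fun n => (weight_pos _ _ _).le) fun n => ?_
  have hn : (n : ℤ) ≠ 0 := by simpa using n.2
  have hn' : ((n : ℤ) : ℝ) ≠ 0 := by exact_mod_cast hn
  have hf := freq_ne_zero hL hn; rw [weight, rpow_neg_one]
  calc (4 + freq L n ^ 2)⁻¹ ≤ (freq L n ^ 2)⁻¹ := by
        gcongr; linarith
    _ = _ := by simp only [freq]; field_simp

lemma L2Per.intervalIntegrable (hL : 0 < L) (hf : L2Per L f) (a b : ℝ) : IntervalIntegrable f volume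
    a b := by
  refine hf.periodic.intervalIntegrable (by linarith) (t := -L) ?_ a b
  rw [show -L + 2 * L = L by ring]; exact MemLp.perIntegrable hL hf.memLp

/-- The `L²` norm. -/
def l2 (μ : Measure ℝ) (f : ℝ → ℂ) : ℝ := √(∫ x, ‖f x‖ ^ 2 ∂μ)

lemma l2_nonneg (μ : Measure ℝ) (f : ℝ → ℂ) : 0 ≤ l2 μ f := sqrt_nonneg _

lemma l2_sq (μ : Measure ℝ) (f : ℝ → ℂ) : l2 μ f ^ 2 = ∫ x, ‖f x‖ ^ 2 ∂μ :=
  sq_sqrt (integral_nonneg fun _ => by positivity)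

lemma integrable_norm_sq (hf : MemLp f 2 μ) : Integrable (fun x => ‖f x‖ ^ 2) μ :=
  (memLp_two_iff_integrable_sq_norm hf.1).1 hf

lemma integrable_mul_two (hf : MemLp f 2 μ) (hg : MemLp g 2 μ) :
    Integrable (fun x => f x * g x) μ := hf.integrable_mul hg

lemma integrable_norm_mul_norm (hf : MemLp f 2 μ) (hg : MemLp g 2 μ) : Integrable
    (fun x => ‖f x‖ * ‖g x‖) μ := by
  simpa using (integrable_mul_two hf hg).norm

lemma integral_norm_mul_norm_le (hf : MemLp f 2 μ) (hg : MemLp g 2 μ) : ∫ x, ‖f x‖ * ‖g x‖ ∂μ ≤ l2 μ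
    f * l2 μ g := by
  have := integral_mul_le_Lp_mul_Lq_of_nonneg (μ := μ) Real.HolderConjugate.two_two
    (f := fun x => ‖f x‖) (g := fun x => ‖g x‖) (.of_forall fun x => norm_nonneg _)
    (.of_forall fun x => norm_nonneg _) (by simpa using hf.norm) (by simpa using hg.norm)
  simpa [l2, Real.sqrt_eq_rpow] using this

lemma norm_integral_mul_le (hf : MemLp f 2 μ) (hg : MemLp g 2 μ) : ‖∫ x, f x * g x ∂μ‖ ≤ l2 μ f * l2
    μ g := by
  refine (norm_integral_le_integral_norm _).trans ?_; simpa using integral_norm_mul_norm_le hf hg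

lemma HasH1Deriv.isPrim (h : HasH1Deriv u u') : IsPrim u u' := ⟨fun a b => by
    rw [intervalIntegrable_iff]
    exact ((h.memLp_deriv.locallyIntegrable (by norm_num)).integrableOn_isCompact
      isCompact_uIcc).mono_set uIoc_subset_uIcc, h.ftc⟩

lemma IsPrim.hasH1Deriv (h : IsPrim u u') (h1 : MemLp u 2 volume)
    (h2 : MemLp u' 2 volume) : HasH1Deriv u u' := ⟨h1, h2, h.ftc⟩

lemma HasH1Deriv.conj (h : HasH1Deriv u u') : HasH1Deriv (fun x => conj (u x))
    (fun x => conj (u' x)) :=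
  h.isPrim.conj.hasH1Deriv h.memLp.star h.memLp_deriv.star

lemma HasH1Deriv.add (h : HasH1Deriv u u') (hv : HasH1Deriv v v') : HasH1Deriv (fun x => u x + v x)
    (fun x => u' x + v' x) :=
  (h.isPrim.add hv.isPrim).hasH1Deriv (h.memLp.add hv.memLp) (h.memLp_deriv.add hv.memLp_deriv)

lemma HasH1Deriv.const_mul (c : ℂ) (h : HasH1Deriv u u') : HasH1Deriv (fun x => c * u x)
    (fun x => c * u' x) :=
  (h.isPrim.const_mul c).hasH1Deriv (h.memLp.const_mul c) (h.memLp_deriv.const_mul c)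

lemma HasH1Deriv.sub (h : HasH1Deriv u u') (hv : HasH1Deriv v v') : HasH1Deriv (fun x => u x - v x)
    (fun x => u' x - v' x) :=
  (h.isPrim.sub hv.isPrim).hasH1Deriv (h.memLp.sub hv.memLp) (h.memLp_deriv.sub hv.memLp_deriv)

/-- The density controlling `|u|²` pointwise. -/
def ptDensity (T : ℝ) (u u' : ℝ → ℂ) (t : ℝ) : ℝ := T⁻¹ * ‖u t‖ ^ 2 + 2 * (‖u t‖ * ‖u' t‖)

lemma HasH1Deriv.integrable_ptDensity (h : HasH1Deriv u u') (T : ℝ) : Integrable (ptDensity T u u')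
    volume :=
  ((integrable_norm_sq h.memLp).const_mul _).add
    ((integrable_norm_mul_norm h.memLp h.memLp_deriv).const_mul _)

lemma ptDensity_nonneg (hT : 0 < T) (u u' : ℝ → ℂ) (t : ℝ) : 0 ≤ ptDensity T u u' t := by
  unfold ptDensity; positivity

lemma HasH1Deriv.norm_sq_le (h : HasH1Deriv u u') (hT : 0 < T) (x : ℝ) : ‖u x‖ ^ 2 ≤ ∫ t in Ioc x
    (x + T), ptDensity T u u' t := by
  have hxT : x ≤ x + T := by linarith
  have hP := h.isPrim.mul h.isPrim.conj
  have hi : Integrable (fun t => ‖u t‖ * ‖u' t‖) volume :=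
    integrable_norm_mul_norm h.memLp h.memLp_deriv
  set J := ∫ t in Ioc x (x + T), ‖u t‖ * ‖u' t‖ with hJ
  have hpt : ∀ t ∈ Ioc x (x + T), ‖u x‖ ^ 2 ≤ ‖u t‖ ^ 2 + 2 * J := by
    intro t ht; have h1 := hP.ftc x t; simp only [mul_conj, normSq_eq_norm_sq] at h1
    have h2 : ‖u x‖ ^ 2 - ‖u t‖ ^ 2 ≤ ‖((‖u t‖ ^ 2 : ℝ) : ℂ) - ((‖u x‖ ^ 2 : ℝ) : ℂ)‖ := by
      rw [← Complex.ofReal_sub, norm_real, norm_eq_abs, ← neg_sub]; exact neg_le_abs _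
    rw [h1] at h2
    have h3 : ‖∫ s in x..t, (u' s * conj (u s) + u s * conj (u' s))‖ ≤ 2 * J := by
      rw [integral_of_le ht.1.le]
      calc _ ≤ ∫ s in Ioc x t, ‖u' s * conj (u s) + u s * conj (u' s)‖ :=
            norm_integral_le_integral_norm _
        _ ≤ ∫ s in Ioc x t, 2 * (‖u s‖ * ‖u' s‖) := by
            refine integral_mono_of_nonneg (.of_forall fun _ => norm_nonneg _)
              (hi.const_mul 2).restrict (.of_forall fun s => ?_)
            refine (norm_add_le _ _).trans (le_of_eq ?_); simp; ring
        _ ≤ ∫ s in Ioc x (x + T), 2 * (‖u s‖ * ‖u' s‖) := by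
            refine setIntegral_mono_set (hi.const_mul 2).integrableOn
              (.of_forall fun s => by positivity) ?_
            exact (Set.Ioc_subset_Ioc_right ht.2).eventuallyLE
        _ = 2 * J := by rw [integral_const_mul]
    linarith
  have h4 := setIntegral_mono_on (s := Ioc x (x + T)) (μ := volume) (f := fun _ => ‖u x‖ ^ 2)
    (g := fun t => ‖u t‖ ^ 2 + 2 * J) (integrable_const _)
    ((integrable_norm_sq h.memLp).integrableOn.add (integrable_const _))
    measurableSet_Ioc hpt
  rw [integral_add (integrable_norm_sq h.memLp).integrableOn (integrable_const _)] at h4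
  simp only [integral_const, MeasurableSet.univ, measureReal_restrict_apply, Set.univ_inter,
    volume_real_Ioc_of_le hxT, add_sub_cancel_left, smul_eq_mul] at h4
  unfold ptDensity
  rw [integral_add ((integrable_norm_sq h.memLp).const_mul _).integrableOn
    (hi.const_mul _).integrableOn, integral_const_mul, integral_const_mul]
  have h5 : ‖u x‖ ^ 2 = T⁻¹ * (T * ‖u x‖ ^ 2) := by field_simp
  rw [h5]
  calc _ ≤ T⁻¹ * ((∫ t in Ioc x (x + T), ‖u t‖ ^ 2) + T * (2 * J)) := by gcongr
    _ = _ := by rw [← hJ]; field_simp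

/-- The squared `H¹` norm. -/
def h1sq (u u' : ℝ → ℂ) : ℝ := (∫ x, ‖u x‖ ^ 2) + ∫ x, ‖u' x‖ ^ 2

lemma h1sq_nonneg (u u' : ℝ → ℂ) : 0 ≤ h1sq u u' :=
  add_nonneg (integral_nonneg fun _ => by positivity) (integral_nonneg fun _ => by positivity)

lemma l2_le_sqrt_h1sq (u u' : ℝ → ℂ) : l2 volume u ≤ √(h1sq u u') :=
  sqrt_le_sqrt (le_add_of_nonneg_right (integral_nonneg fun _ => by positivity))

lemma l2_deriv_le_sqrt_h1sq (u u' : ℝ → ℂ) : l2 volume u' ≤ √(h1sq u u') :=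
  sqrt_le_sqrt (le_add_of_nonneg_left (integral_nonneg fun _ => by positivity))

lemma HasH1Deriv.integral_ptDensity (h : HasH1Deriv u u') (T : ℝ) : ∫ t, ptDensity T u u' t = T⁻¹ *
    l2 volume u ^ 2 + 2 * ∫ t, ‖u t‖ * ‖u' t‖ := by
  unfold ptDensity
  rw [integral_add ((integrable_norm_sq h.memLp).const_mul _)
    ((integrable_norm_mul_norm h.memLp h.memLp_deriv).const_mul _), integral_const_mul,
    integral_const_mul, l2_sq]

lemma HasH1Deriv.integral_ptDensity_le (h : HasH1Deriv u u') (T : ℝ) : ∫ t, ptDensity T u u' t ≤ T⁻¹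
    * l2 volume u ^ 2 + 2 * (l2 volume u * l2 volume u') := by
  rw [h.integral_ptDensity]; gcongr; exact integral_norm_mul_norm_le h.memLp h.memLp_deriv

lemma HasH1Deriv.integral_ptDensity_le' (h : HasH1Deriv u u') (hT : 1 ≤ T) : ∫ t, ptDensity T u u' t
    ≤ 2 * h1sq u u' := by
  refine (h.integral_ptDensity_le T).trans ?_; rw [h1sq, ← l2_sq, ← l2_sq]
  have : T⁻¹ ≤ 1 := inv_le_one_of_one_le₀ hT
  nlinarith [sq_nonneg (l2 volume u - l2 volume u'), sq_nonneg (l2 volume u), sq_nonneg (l2 volume u')]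

lemma HasH1Deriv.norm_le (h : HasH1Deriv u u') (x : ℝ) : ‖u x‖ ≤ 2 * √(h1sq u u') := by
  have h1 := (h.norm_sq_le one_pos x).trans (setIntegral_le_integral (h.integrable_ptDensity 1)
    (.of_forall fun t => ptDensity_nonneg one_pos _ _ _))
  have h2 := h1.trans (h.integral_ptDensity_le' le_rfl); have h3 := sq_sqrt (h1sq_nonneg u u')
  refine abs_le_of_sq_le_sq' ?_ (by positivity) |>.2; nlinarith [h1sq_nonneg u u']

lemma L2Per.lintegral_Ico (hL : 0 < L) (hW : L2Per L W) (t : ℝ) : ∫⁻ x in Set.Ico (t - 2 * L) t,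
    ofReal (‖W x‖ ^ 2) = ofReal (l2 (perMeasure L) W ^ 2) := by
  have hper : Periodic (fun x => ‖W x‖ ^ 2) (2 * L) := fun x => by simp only [hW.periodic x]
  have hi0 : IntervalIntegrable (fun x => ‖W x‖ ^ 2) volume (-L) L := by
    rw [intervalIntegrable_iff_integrableOn_Ioc_of_le (by linarith)]
    exact integrable_norm_sq hW.memLp
  have hi : IntegrableOn (fun x => ‖W x‖ ^ 2) (Ioc (t - 2 * L) t) volume := by
    rw [← intervalIntegrable_iff_integrableOn_Ioc_of_le (by linarith)]
    exact hper.intervalIntegrable (by linarith) (t := -L) (by convert hi0 using 1; ring) _ _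
  rw [Measure.restrict_congr_set Ico_ae_eq_Ioc, ← ofReal_integral_eq_lintegral_ofReal hi
    (.of_forall fun _ => by positivity), l2_sq, ← integral_perMeasure hL,
    ← integral_of_le (by linarith)]
  congr 1; have := hper.intervalIntegral_add_eq (t - 2 * L) (-L); grind

lemma HasH1Deriv.lintegral_mul_le (hL : 0 < L) (hW : L2Per L W) (h : HasH1Deriv u u') : ∫⁻ x, ofReal
    (‖W x * u x‖ ^ 2) ≤ ofReal (l2 (perMeasure L) W ^ 2 * ∫ t, ptDensity (2 * L) u u' t) := by
  have h2L : 0 < 2 * L := by linarith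
  set F : ℝ → ℝ≥0∞ := fun t => ofReal (ptDensity (2 * L) u u' t) with hF
  have hFm : AEMeasurable F volume :=
    (h.integrable_ptDensity (2 * L)).aestronglyMeasurable.aemeasurable.ennreal_ofReal
  have hWm : Measurable fun x => ofReal (‖W x‖ ^ 2) :=
    (hW.measurable.norm.pow_const 2).ennreal_ofReal
  set A := {p : ℝ × ℝ | p.1 < p.2 ∧ p.2 ≤ p.1 + 2 * L} with hA
  have hset : MeasurableSet A := (measurableSet_lt measurable_fst measurable_snd).inter
    (measurableSet_le measurable_snd (measurable_fst.add_const _))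
  set G := A.indicator fun p => ofReal (‖W p.1‖ ^ 2) * F p.2
  calc ∫⁻ x, ofReal (‖W x * u x‖ ^ 2) ≤ ∫⁻ x, ∫⁻ t, G (x, t) := by
        refine lintegral_mono fun x => ?_
        have e1 : ∫⁻ t, G (x, t) = ofReal (‖W x‖ ^ 2) * ∫⁻ t in Ioc x (x + 2 * L), F t := by
          rw [← lintegral_const_mul' _ _ ofReal_ne_top, ← lintegral_indicator measurableSet_Ioc]
          rfl
        rw [e1, hF, ← ofReal_integral_eq_lintegral_ofReal (h.integrable_ptDensity _).integrableOn
          (.of_forall fun t => ptDensity_nonneg h2L _ _ _), norm_mul, mul_pow,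
          ENNReal.ofReal_mul (by positivity)]
        gcongr; exact h.norm_sq_le h2L x
    _ = ∫⁻ t, ∫⁻ x, G (x, t) := lintegral_lintegral_swap (f := fun x t => G (x, t))
        (.indicator ((hWm.comp measurable_fst).aemeasurable.mul hFm.comp_snd) hset)
    _ = ∫⁻ t, F t * ofReal (l2 (perMeasure L) W ^ 2) := by
        refine lintegral_congr fun t => ?_
        rw [← hW.lintegral_Ico hL t, ← lintegral_const_mul' _ _ ofReal_ne_top,
          ← lintegral_indicator measurableSet_Ico]
        refine lintegral_congr fun x => ?_
        simp only [G, hA, Set.indicator, Set.mem_ofPred_eq, Set.mem_Ico]; grind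
    _ = _ := by
        rw [lintegral_mul_const' _ _ ofReal_ne_top, hF,
          ← ofReal_integral_eq_lintegral_ofReal (h.integrable_ptDensity _)
          (.of_forall fun t => ptDensity_nonneg h2L _ _ _), mul_comm,
          ENNReal.ofReal_mul (by positivity)]

lemma HasH1Deriv.memLp_per_mul (hL : 0 < L) (hW : L2Per L W) (h : HasH1Deriv u u') : MemLp
    (fun x => W x * u x) 2 volume := by
  have hm : AEStronglyMeasurable (fun x => W x * u x) volume :=
    hW.measurable.aestronglyMeasurable.mul h.memLp.1
  rw [memLp_two_iff_integrable_sq_norm hm]; refine ⟨(hm.norm.pow 2), ?_⟩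
  rw [hasFiniteIntegral_iff_ofReal (.of_forall fun _ => by positivity)]
  exact (h.lintegral_mul_le hL hW).trans_lt ENNReal.ofReal_lt_top

lemma HasH1Deriv.l2_per_mul_sq_le (hL : 0 < L) (hW : L2Per L W) (h : HasH1Deriv u u') : l2 volume
    (fun x => W x * u x) ^ 2 ≤ l2 (perMeasure L) W ^ 2 * ∫ t, ptDensity (2 * L) u u' t := by
  rw [l2_sq, ← ofReal_le_ofReal_iff, ofReal_integral_eq_lintegral_ofReal
    (integrable_norm_sq (h.memLp_per_mul hL hW)) (.of_forall fun _ => by positivity)]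
  · exact h.lintegral_mul_le hL hW
  · exact mul_nonneg (by positivity) (integral_nonneg fun t => ptDensity_nonneg (by linarith) _ _ _)

lemma HasH1Deriv.l2_per_mul_le (hL : 1 ≤ L) (hW : L2Per L W) (h : HasH1Deriv u u') : l2 volume
    (fun x => W x * u x) ≤ 2 * l2 (perMeasure L) W * √(h1sq u u') := by
  have h1 := h.l2_per_mul_sq_le (by linarith) hW
  have h2 := h.integral_ptDensity_le' (T := 2 * L) (by linarith)
  have h3 := sq_sqrt (h1sq_nonneg u u'); have h4 := l2_nonneg (perMeasure L) W
  refine abs_le_of_sq_le_sq' ?_ (by positivity) |>.2; nlinarith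

lemma IsPrim.integral_eq_zero (h : IsPrim f f') (hf : Integrable f volume)
    (hf' : Integrable f' volume) : ∫ x, f' x = 0 := by
  have h1 : Tendsto f atTop (𝓝 (f 0 + ∫ x in Ioi 0, f' x)) := by
    rw [h.eq 0]
    simpa using (intervalIntegral_tendsto_integral_Ioi 0 hf'.integrableOn tendsto_id).const_add (f 0)
  have h2 : Tendsto f atBot (𝓝 (f 0 - ∫ x in Set.Iic 0, f' x)) := by
    have : f = fun x => f 0 - ∫ t in x..0, f' t := by ext x; rw [← h.ftc]; ring
    rw [this]
    simpa using (intervalIntegral_tendsto_integral_Iic 0 hf'.integrableOn tendsto_id).const_sub (f 0)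
  have e1 := IntegrableAtFilter.eq_zero_of_tendsto (μ := volume) (hf.integrableAtFilter _)
    (fun s hs => by
      obtain ⟨b, hb⟩ := mem_atTop_sets.1 hs; rw [← top_le_iff, ← Real.volume_Ici (a := b)]
      exact measure_mono hb) h1
  have e2 := IntegrableAtFilter.eq_zero_of_tendsto (μ := volume) (hf.integrableAtFilter _)
    (fun s hs => by
      obtain ⟨b, hb⟩ := mem_atBot_sets.1 hs; rw [← top_le_iff, ← Real.volume_Iic (a := b)]
      exact measure_mono hb) h2
  rw [← intervalIntegral.integral_Iic_add_Ioi (b := 0) hf'.integrableOn hf'.integrableOn]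
  linear_combination e1 - e2

lemma IsPrim.mul_expi (L : ℝ) (n : ℤ) (h : IsPrim f f') : IsPrim (fun x => expi L n x * f x)
    (fun x => I * freq L n * expi L n x * f x + expi L n x * f' x) :=
  (IsPrim.of_hasDerivAt (hasDerivAt_expi L n) (continuous_const.mul (continuous_expi L n))).mul h

lemma integrable_expi_mul (L : ℝ) (n : ℤ) (hf : Integrable f μ) : Integrable
    (fun x => expi L n x * f x) μ :=
  hf.bdd_mul (c := 1) (continuous_expi L n).aestronglyMeasurable
    (.of_forall fun x => (norm_expi L n x).le)

lemma IsPrim.integral_expi_mul (L : ℝ) (n : ℤ) (h : IsPrim f f') (hf : Integrable f volume)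
    (hf' : Integrable f' volume) : I * freq L n * ∫ x, expi L n x * f x = -∫ x, expi L n x * f'
    x := by
  have h1 := integrable_expi_mul L n hf; have h2 := integrable_expi_mul L n hf'
  have := (h.mul_expi L n).integral_eq_zero h1 (((h1.const_mul (I * freq L n)).congr
      (.of_forall fun x => by simp only []; ring)).add h2)
  rw [integral_add ((h1.const_mul (I * freq L n)).congr
      (.of_forall fun x => by simp only []; ring)) h2] at this
  rw [← integral_const_mul, eq_neg_iff_add_eq_zero, ← this]; simp only [mul_assoc]

section

lemma Hs.summable (q : Hs L s) : Summable fun n => weight L s n * ‖q.1 n‖ ^ 2 := q.2.2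

lemma Hs.conj_coeff (q : Hs L s) (n : ℤ) : q.1 (-n) = conj (q.1 n) := q.2.1 n

lemma Hs.weight_mul_le (q : Hs L s) (n : ℤ) : weight L s n * ‖q.1 n‖ ^ 2 ≤ ‖q‖ ^ 2 := by
  rw [Hs.norm_sq]
  exact q.summable.le_tsum n fun m _ => mul_nonneg (weight_pos L s m).le (by positivity)

lemma Hs.norm_zero_coeff_le (q : Hs L (-1)) : ‖q.1 0‖ ≤ 2 * ‖q‖ := by
  have h := q.weight_mul_le 0; rw [weight, freq_zero, rpow_neg_one] at h
  refine abs_le_of_sq_le_sq' ?_ (by positivity) |>.2; norm_num at h; linarith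

lemma coeffs_expi (hL : 0 < L) (m n : ℤ) : coeffs L (expi L m) n = if n = m then 1 else 0 := by
  have : coeffs L (expi L m) n = coeffs L (fun _ => 1) (n - m) := by
    simp only [coeffs_eq, ← expi_add, mul_one]; congr 3; ext x; congr 1; ring
  rw [this, coeffs_const hL]; simp [sub_eq_zero]

lemma memLp_of_continuous (hf : Continuous f) : MemLp f 2 (perMeasure L) := by
  obtain ⟨B, hB⟩ := isCompact_Icc.exists_bound_of_continuousOn (s := Icc (-L) L) hf.continuousOn
  refine MemLp.of_bound hf.aestronglyMeasurable B ?_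
  filter_upwards [ae_restrict_mem measurableSet_Ioc] with x hx
  exact hB x (Ioc_subset_Icc_self hx)

/-- Trigonometric polynomials. -/
def trigSum (L : ℝ) (c : ℤ → ℂ) (s : Finset ℤ) (x : ℝ) : ℂ := ∑ n ∈ s, c n * expi L n x

lemma continuous_trigSum (L : ℝ) (c : ℤ → ℂ) (s : Finset ℤ) : Continuous (trigSum L c s) :=
  continuous_finsetSum _ fun n _ => continuous_const.mul (continuous_expi L n)

lemma coeffs_trigSum (hL : 0 < L) (c : ℤ → ℂ) (s : Finset ℤ) (n : ℤ) : coeffs L (trigSum L c s) n =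
    if n ∈ s then c n else 0 := by
  induction s using Finset.induction_on with
  | empty => simp [trigSum, coeffs_eq]
  | insert m s hm ih =>
    have : trigSum L c (insert m s) = fun x => c m * expi L m x + trigSum L c s x := by
      ext x; simp [trigSum, Finset.sum_insert hm]
    rw [this, coeffs_add (f := fun x => c m * expi L m x)
      ((continuous_const.mul (continuous_expi L m)).intervalIntegrable _ _)
      ((continuous_trigSum L c s).intervalIntegrable _ _), coeffs_const_mul, coeffs_expi hL, ih]
    grind

lemma l2Per_trigSum (hL : 0 < L) (c : ℤ → ℂ) (s : Finset ℤ) : L2Per L (trigSum L c s) :=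
  ⟨fun x => by simp [trigSum, expi_periodic hL _ x], (continuous_trigSum L c s).measurable,
    memLp_of_continuous (continuous_trigSum L c s)⟩

lemma L2Per.sub (hf : L2Per L f) (hg : L2Per L g) : L2Per L (fun x => f x - g x) :=
  ⟨hf.periodic.sub hg.periodic, hf.measurable.sub hg.measurable, hf.memLp.sub hg.memLp⟩

lemma tendsto_trigSum (hL : 0 < L) (hW : L2Per L W) : Tendsto (fun s => l2 (perMeasure L)
    (fun x => W x - trigSum L (coeffs L W) s x)) atTop (𝓝 0) := by
  have hp := parseval hL hW.memLp
  have hs : ∀ s : Finset ℤ, l2 (perMeasure L) (fun x => W x - trigSum L (coeffs L W) s x) =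
      √(2 * L * ((2 * L)⁻¹ * (∫ x in (-L)..L, ‖W x‖ ^ 2) - ∑ n ∈ s, ‖coeffs L W n‖ ^ 2)) := by
    intro s; have h2 := parseval hL (hW.sub (l2Per_trigSum hL (coeffs L W) s)).memLp
    rw [l2, ← integral_perMeasure hL]
    have h3 : HasSum (fun n => if n ∈ s then ‖coeffs L W n‖ ^ 2 else 0)
        (∑ n ∈ s, ‖coeffs L W n‖ ^ 2) := by
      have : HasSum (fun n => if n ∈ s then ‖coeffs L W n‖ ^ 2 else 0)
          (∑ n ∈ s, if n ∈ s then ‖coeffs L W n‖ ^ 2 else 0) :=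
        hasSum_sum_of_ne_finset_zero fun n hn => by simp [hn]
      rwa [Finset.sum_congr rfl (fun n hn => if_pos hn)] at this
    have h4 := h2.unique ((hp.sub h3).congr_fun fun n => by
      rw [coeffs_sub (hW.intervalIntegrable hL _ _)
        ((continuous_trigSum _ _ _).intervalIntegrable _ _), coeffs_trigSum hL]
      split_ifs <;> simp)
    rw [← h4]; congr 1; field_simp
  simp only [hs]
  rw [show (0 : ℝ) = √(2 * L * ((2 * L)⁻¹ * (∫ x in (-L)..L, ‖W x‖ ^ 2)
    - (2 * L)⁻¹ * (∫ x in (-L)..L, ‖W x‖ ^ 2))) by simp]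
  exact (continuous_sqrt.tendsto _).comp ((hp.const_sub _).const_mul _)

/-- `W` is the mean-zero antiderivative of `q - q 0`. -/
structure IsAntideriv (L : ℝ) (q : ℤ → ℂ) (W : ℝ → ℂ) : Prop where
  l2Per : L2Per L W
  zero : coeffs L W 0 = 0
  ddx : ∀ n, n ≠ 0 → I * freq L n * coeffs L W n = q n

lemma exists_antideriv (hL : 1 ≤ L) (q : Hs L (-1)) : ∃ W, IsAntideriv L q.1 W ∧ l2 (perMeasure L) W
    ≤ 4 * L ^ 2 * ‖q‖ := by
  have hL0 : 0 < L := by linarith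
  set c : ℤ → ℂ := fun n => if n = 0 then 0 else q.1 n / (I * freq L n) with hc
  have hle : ∀ n, ‖c n‖ ^ 2 ≤ 8 * L ^ 2 * (weight L (-1) n * ‖q.1 n‖ ^ 2) := by
    intro n; simp only [hc]
    split_ifs with hn
    · rw [norm_zero, zero_pow two_ne_zero]
      exact mul_nonneg (by positivity) (mul_nonneg (weight_pos L (-1) n).le (by positivity))
    · have hf := freq_ne_zero hL0 hn; have hf2 : 0 < freq L n ^ 2 := by positivity
      rw [norm_div, norm_mul, norm_I, one_mul, norm_real, div_pow,
        norm_eq_abs, sq_abs, weight, rpow_neg_one]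
      rw [div_le_iff₀ hf2]
      have h1 : 4 + freq L n ^ 2 ≤ 8 * L ^ 2 * freq L n ^ 2 := by
        have : π ^ 2 ≤ L ^ 2 * freq L n ^ 2 := by
          have h2 : L ^ 2 * freq L n ^ 2 = π ^ 2 * (n : ℝ) ^ 2 := by simp only [freq]; field_simp
          rw [h2]
          have : (1 : ℝ) ≤ (n : ℝ) ^ 2 := by
            exact_mod_cast Int.add_one_le_iff.2 (by positivity : 0 < n ^ 2)
          nlinarith [sq_nonneg π]
        nlinarith [Real.pi_gt_three, mul_nonneg (show 0 ≤ L ^ 2 - 1 by nlinarith) hf2.le]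
      calc ‖q.1 n‖ ^ 2 = (4 + freq L n ^ 2) * ((4 + freq L n ^ 2)⁻¹ * ‖q.1 n‖ ^ 2) := by field_simp
        _ ≤ (8 * L ^ 2 * freq L n ^ 2) * ((4 + freq L n ^ 2)⁻¹ * ‖q.1 n‖ ^ 2) := by gcongr
        _ = _ := by ring
  have hsum : Summable fun n => ‖c n‖ ^ 2 :=
    (q.summable.mul_left (8 * L ^ 2)).of_nonneg_of_le (fun n => by positivity) hle
  obtain ⟨W, hW, hWc⟩ := riesz_fischer hL0 hsum
  refine ⟨W, ⟨hW, by rw [hWc]; simp [hc], fun n hn => ?_⟩, ?_⟩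
  · have hf : (freq L n : ℂ) ≠ 0 := by exact_mod_cast freq_ne_zero hL0 hn
    rw [hWc]; simp only [hc, if_neg hn]; field_simp
  · have h1 := (parseval hL0 hW.memLp).tsum_eq; rw [hWc] at h1
    have h2 : ∑' n, ‖c n‖ ^ 2 ≤ 8 * L ^ 2 * ‖q‖ ^ 2 := by
      rw [Hs.norm_sq, ← tsum_mul_left]; exact hsum.tsum_le_tsum hle (q.summable.mul_left _)
    rw [h1, integral_perMeasure hL0, ← l2_sq] at h2
    refine abs_le_of_sq_le_sq' ?_ (by positivity) |>.2; rw [inv_mul_le_iff₀ (by positivity)] at h2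
    nlinarith

section
/-- The derivative of a product. -/
def dmul (u u' ψ ψ' : ℝ → ℂ) (x : ℝ) : ℂ := u' x * ψ x + u x * ψ' x

lemma HasH1Deriv.isPrim_mul (hu : HasH1Deriv u u') (hψ : HasH1Deriv ψ ψ') :
    IsPrim (fun x => u x * ψ x) (dmul u u' ψ ψ') := hu.isPrim.mul hψ.isPrim

lemma HasH1Deriv.integrable_mul (hu : HasH1Deriv u u') (hψ : HasH1Deriv ψ ψ') :
    Integrable (fun x => u x * ψ x) volume := integrable_mul_two hu.memLp hψ.memLp

lemma HasH1Deriv.integrable_dmul (hu : HasH1Deriv u u') (hψ : HasH1Deriv ψ ψ') : Integrable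
    (dmul u u' ψ ψ') volume :=
  (integrable_mul_two hu.memLp_deriv hψ.memLp).add (integrable_mul_two hu.memLp hψ.memLp_deriv)

lemma HasH1Deriv.integrable_per_mul (hL : 0 < L) (hW : L2Per L W) (hu : HasH1Deriv u u')
    (hψ : HasH1Deriv ψ ψ') : Integrable (fun x => W x * dmul u u' ψ ψ' x) volume := by
  have h1 := integrable_mul_two hu.memLp_deriv (hψ.memLp_per_mul hL hW)
  have h2 := integrable_mul_two (hu.memLp_per_mul hL hW) hψ.memLp_deriv
  refine (h1.add h2).congr (.of_forall fun x => ?_); simp only [dmul, Pi.add_apply]; ring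

lemma HasH1Deriv.norm_integral_per_mul_le' (hL : 0 < L) (hW : L2Per L W) (hu : HasH1Deriv u u')
    (hψ : HasH1Deriv ψ ψ') : ‖∫ x, W x * dmul u u' ψ ψ' x‖ ≤ l2 volume u' * l2 volume
    (fun x => W x * ψ x) + l2 volume (fun x => W x * u x) * l2 volume ψ' := by
  have h1 := integrable_mul_two hu.memLp_deriv (hψ.memLp_per_mul hL hW)
  have h2 := integrable_mul_two (hu.memLp_per_mul hL hW) hψ.memLp_deriv
  have : ∫ x, W x * dmul u u' ψ ψ' x = (∫ x, u' x * (W x * ψ x)) + ∫ x, W x * u x * ψ' x := by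
    rw [← integral_add h1 h2]; congr 1; ext x; simp only [dmul]; ring
  rw [this]
  exact (norm_add_le _ _).trans (add_le_add
    (norm_integral_mul_le hu.memLp_deriv (hψ.memLp_per_mul hL hW))
    (norm_integral_mul_le (hu.memLp_per_mul hL hW) hψ.memLp_deriv))

variable (hL : 1 ≤ L)
include hL

lemma HasH1Deriv.norm_integral_per_mul_le (hW : L2Per L W) (hu : HasH1Deriv u u')
    (hψ : HasH1Deriv ψ ψ') : ‖∫ x, W x * dmul u u' ψ ψ' x‖ ≤ 4 * l2 (perMeasure L) W *
    (√(h1sq u u') * √(h1sq ψ ψ')) := by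
  have hL0 : 0 < L := by linarith
  refine (hu.norm_integral_per_mul_le' hL0 hW hψ).trans ?_; have h3 := l2_deriv_le_sqrt_h1sq u u'
  have h4 := l2_deriv_le_sqrt_h1sq ψ ψ'; have h5 := hu.l2_per_mul_le hL hW
  have h6 := hψ.l2_per_mul_le hL hW; have h0 := l2_nonneg (perMeasure L) W
  calc _ ≤ √(h1sq u u') * (2 * l2 (perMeasure L) W * √(h1sq ψ ψ'))
        + (2 * l2 (perMeasure L) W * √(h1sq u u')) * √(h1sq ψ ψ') := by
        gcongr <;> exact l2_nonneg _ _
    _ = _ := by ring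

lemma IsAntideriv.hasSum_pair {q : ℤ → ℂ} (hW : IsAntideriv L q W) (hu : HasH1Deriv u u')
    (hψ : HasH1Deriv ψ ψ') : HasSum (fun n => q n * ∫ x : ℝ, exp (I * freq L n * x) * (u x * ψ x))
    (q 0 * (∫ x, u x * ψ x) - ∫ x, W x * dmul u u' ψ ψ' x) := by
  have hL0 : 0 < L := by linarith
  have hd := hu.integrable_dmul hψ
  have h1 : HasSum (fun n => coeffs L W n * ∫ x, expi L n x * dmul u u' ψ ψ' x)
      (∫ x, W x * dmul u u' ψ ψ' x) := by
    rw [HasSum, SummationFilter.unconditional_filter, tendsto_iff_norm_sub_tendsto_zero]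
    have hlim := ((tendsto_trigSum hL0 hW.l2Per).const_mul 4).mul_const (√(h1sq u u') * √(h1sq ψ ψ'))
    simp only [mul_zero, zero_mul] at hlim
    refine squeeze_zero (fun s => norm_nonneg _) (fun s => ?_) hlim
    refine le_trans (le_of_eq ?_) (hu.norm_integral_per_mul_le hL
      (hW.l2Per.sub (l2Per_trigSum hL0 (coeffs L W) s)) hψ)
    have e1 : ∑ n ∈ s, coeffs L W n * ∫ x, expi L n x * dmul u u' ψ ψ' x
        = ∫ x, trigSum L (coeffs L W) s x * dmul u u' ψ ψ' x := by
      simp only [trigSum, Finset.sum_mul, mul_assoc]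
      rw [integral_finsetSum _ fun n _ => (integrable_expi_mul L n hd).const_mul _]
      simp only [integral_const_mul]
    rw [e1, norm_sub_rev]; simp only [sub_mul]
    rw [integral_sub (hu.integrable_per_mul hL0 hW.l2Per hψ)
      (hu.integrable_per_mul hL0 (l2Per_trigSum hL0 _ _) hψ)]
  have h0 : HasSum (fun n : ℤ => if n = 0 then q 0 * ∫ x, u x * ψ x else 0)
      (q 0 * ∫ x, u x * ψ x) := hasSum_ite_eq 0 _
  refine (h0.sub h1).congr_fun fun n => ?_; change _ * ∫ x, expi L n x * (u x * ψ x) = _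
  split_ifs with hn
  · subst hn; simp [hW.zero, expi_zero]
  · have := (hu.isPrim_mul hψ).integral_expi_mul L n (hu.integrable_mul hψ) hd; rw [← hW.ddx n hn]
    linear_combination coeffs L W n * this

lemma IsAntideriv.pair_eq {q : ℤ → ℂ} (hW : IsAntideriv L q W) (hu : HasH1Deriv u u')
    (hψ : HasH1Deriv ψ ψ') : pair L q (fun x => u x * ψ x) = q 0 * (∫ x, u x * ψ x) - ∫ x, W x *
    dmul u u' ψ ψ' x :=
  (hW.hasSum_pair hL hu hψ).tsum_eq

lemma summable_pair (q : Hs L (-1)) (hu : HasH1Deriv u u') (hψ : HasH1Deriv ψ ψ') : Summable fun n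
    => q.1 n * ∫ x : ℝ, exp (I * freq L n * x) * (u x * ψ x) := by
  obtain ⟨W, hW, -⟩ := exists_antideriv hL q; exact (hW.hasSum_pair hL hu hψ).summable

lemma norm_pair_le (q : Hs L (-1)) (hu : HasH1Deriv u u') (hψ : HasH1Deriv ψ ψ') : ‖pair L q.1
    (fun x => u x * ψ x)‖ ≤ 18 * L ^ 2 * ‖q‖ * (√(h1sq u u') * √(h1sq ψ ψ')) := by
  obtain ⟨W, hW, hWn⟩ := exists_antideriv hL q; rw [hW.pair_eq hL hu hψ]
  refine (norm_sub_le _ _).trans ?_; rw [norm_mul]; have h1 := q.norm_zero_coeff_le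
  have h2 := norm_integral_mul_le hu.memLp hψ.memLp
  have h3 := hu.norm_integral_per_mul_le hL hW.l2Per hψ; have h4 := l2_le_sqrt_h1sq u u'
  have h5 := l2_le_sqrt_h1sq ψ ψ'
  calc _ ≤ 2 * ‖q‖ * (√(h1sq u u') * √(h1sq ψ ψ'))
        + 4 * (4 * L ^ 2 * ‖q‖) * (√(h1sq u u') * √(h1sq ψ ψ')) := by
        refine add_le_add (mul_le_mul h1 (h2.trans ?_) (norm_nonneg _) (by positivity))
          (h3.trans ?_)
        · exact mul_le_mul h4 h5 (l2_nonneg _ _) (sqrt_nonneg _)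
        · gcongr
    _ ≤ _ := by
        have : 0 ≤ ‖q‖ * (√(h1sq u u') * √(h1sq ψ ψ')) := by positivity
        nlinarith [mul_nonneg (show 0 ≤ L ^ 2 - 1 by nlinarith) this]

omit hL

lemma h1sq_conj (u u' : ℝ → ℂ) : h1sq (fun x => conj (u x)) (fun x => conj (u' x)) = h1sq u u' := by
  simp [h1sq]

/-- The constant in the lower bound for the quadratic form. -/
def gardingConst (L R : ℝ) : ℝ := 2 * R + 4 * (4 * L ^ 2 * R) ^ 2 + 64 * (4 * L ^ 2 * R) ^ 4

lemma norm_pair_self_le (hL : 1 ≤ L) (q : Hs L (-1)) (hq : ‖q‖ ≤ R) (hu : HasH1Deriv u u') : ‖pair L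
    q.1 (fun x => u x * conj (u x))‖ ≤ 1 / 2 * (∫ x, ‖u' x‖ ^ 2) + gardingConst L R * ∫ x, ‖u x‖ ^ 2
    := by
  have hL0 : 0 < L := by linarith
  obtain ⟨W, hW, hWn⟩ := exists_antideriv hL q; rw [hW.pair_eq hL hu hu.conj]
  refine (norm_sub_le _ _).trans ?_; rw [norm_mul, ← l2_sq, ← l2_sq]
  have h1 := q.norm_zero_coeff_le; have h2 := norm_integral_mul_le hu.memLp hu.conj.memLp
  have h3 := hu.norm_integral_per_mul_le' hL0 hW.l2Per hu.conj
  have hc1 : l2 volume (fun x => conj (u x)) = l2 volume u := by simp [l2]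
  have hc2 : l2 volume (fun x => conj (u' x)) = l2 volume u' := by simp [l2]
  have hc3 : l2 volume (fun x => W x * conj (u x)) = l2 volume fun x => W x * u x := by simp [l2]
  rw [hc1] at h2; rw [hc2, hc3] at h3
  have h4 := (hu.l2_per_mul_sq_le hL0 hW.l2Per).trans (mul_le_mul_of_nonneg_left
    (hu.integral_ptDensity_le (2 * L)) (sq_nonneg _))
  set x := l2 volume u'; set y := l2 volume u; set z := l2 volume fun x => W x * u x
  have hx : 0 ≤ x := l2_nonneg _ _; have hy : 0 ≤ y := l2_nonneg _ _
  have hw : l2 (perMeasure L) W ≤ 4 * L ^ 2 * R := hWn.trans (by gcongr)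
  have hw0 := l2_nonneg (perMeasure L) W; set w := 4 * L ^ 2 * R with hwdef
  have h5 : z ^ 2 ≤ w ^ 2 * (y ^ 2 + 2 * (y * x)) := by
    refine h4.trans ?_; gcongr; have : (2 * L)⁻¹ ≤ 1 := inv_le_one_of_one_le₀ (by linarith)
    nlinarith [sq_nonneg y]
  have h6 : ‖∫ x, W x * dmul u u' (fun x => conj (u x)) (fun x => conj (u' x)) x‖
      ≤ 1 / 2 * x ^ 2 + (4 * w ^ 2 + 64 * w ^ 4) * y ^ 2 := by
    nlinarith [sq_nonneg (x / 2 - 2 * z), sq_nonneg (x / 2 - 8 * w ^ 2 * y)]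
  have h7 : ‖q.1 0‖ * ‖∫ x, u x * conj (u x)‖ ≤ 2 * R * y ^ 2 := by
    calc _ ≤ (2 * R) * (y * y) := mul_le_mul (h1.trans (by linarith)) h2 (norm_nonneg _)
          (by linarith [norm_nonneg q])
      _ = _ := by ring
  unfold gardingConst; rw [← hwdef]; linarith

lemma pair_self_im (q : Hs L (-1)) (u : ℝ → ℂ) : (pair L q.1 (fun x => u x * conj (u x))).im =
    0 := by
  rw [← Complex.conj_eq_iff_im]; unfold pair; rw [conj_tsum, ← (Equiv.neg ℤ).tsum_eq]
  refine tsum_congr fun n => ?_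
  rw [map_mul, Equiv.neg_apply, ← integral_conj, q.conj_coeff, conj_conj]; congr 2; ext x
  rw [map_mul, map_mul, conj_conj, ← Complex.exp_conj]; simp [freq_neg, mul_comm (u x)]

/-- The bilinear form of the Schrödinger operator. -/
def form (L : ℝ) (q : ℤ → ℂ) (lam : ℂ) (u u' ψ ψ' : ℝ → ℂ) : ℂ :=
  (∫ x, u' x * ψ' x) + pair L q (fun x => u x * ψ x) + lam * ∫ x, u x * ψ x

/-- The form is coercive after multiplication with `ζ`. -/
structure CoerciveForm (L : ℝ) (q : ℤ → ℂ) (lam ζ : ℂ) : Prop where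
  ne_zero : ζ ≠ 0
  le : ∀ u u' : ℝ → ℂ, HasH1Deriv u u' → 1 / 2 * h1sq u u' ≤
    (ζ * form L q lam u u' (fun x => conj (u x)) (fun x => conj (u' x))).re

lemma integral_mul_conj (u : ℝ → ℂ) : ∫ x, u x * conj (u x) = ((∫ x, ‖u x‖ ^ 2 : ℝ) : ℂ) := by
  rw [← integral_complex_ofReal]; simp [mul_conj, normSq_eq_norm_sq]

lemma exists_coercive_of_im_ne_zero (hL : 1 ≤ L) (R : ℝ) (hlam : lam.im ≠ 0) : ∃ ζ, ∀ q : Hs L (-1),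
    ‖q‖ ≤ R → CoerciveForm L q.1 lam ζ := by
  refine ⟨1 - ((gardingConst L R + 1 + |lam.re|) / lam.im : ℝ) * I, fun q hq =>
    ⟨fun h => by simpa using congrArg Complex.re h, fun u u' hu => ?_⟩⟩
  set s := (gardingConst L R + 1 + |lam.re|) / lam.im with hs
  have h1 := (abs_le.1 ((abs_re_le_norm _).trans (norm_pair_self_le hL q hq hu))).1
  have h2 := pair_self_im q u
  have hsl : s * lam.im = gardingConst L R + 1 + |lam.re| := by rw [hs]; field_simp
  rw [form, integral_mul_conj, integral_mul_conj, h1sq]; set A := ∫ x, ‖u x‖ ^ 2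
  set D := ∫ x, ‖u' x‖ ^ 2; have hA : 0 ≤ A := integral_nonneg fun _ => by positivity
  have hD : 0 ≤ D := integral_nonneg fun _ => by positivity
  simp only [mul_re, Complex.sub_re, Complex.sub_im, one_re, Complex.one_im,
    ofReal_re, ofReal_im, Complex.I_re, Complex.I_im, add_re,
    Complex.add_im, Complex.mul_im, h2]
  have h3 : -|lam.re| * A ≤ lam.re * A := by gcongr; exact neg_abs_le _
  nlinarith

lemma exists_coercive_of_large (hL : 1 ≤ L) {lam : ℝ} (hlam : gardingConst L R + 1 ≤ lam) : ∀ q : Hs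
    L (-1), ‖q‖ ≤ R → CoerciveForm L q.1 lam 1 := by
  refine fun q hq => ⟨one_ne_zero, fun u u' hu => ?_⟩
  have h1 := (abs_le.1 ((abs_re_le_norm _).trans (norm_pair_self_le hL q hq hu))).1
  rw [form, integral_mul_conj, integral_mul_conj, h1sq]; set A := ∫ x, ‖u x‖ ^ 2
  set D := ∫ x, ‖u' x‖ ^ 2; have hA : 0 ≤ A := integral_nonneg fun _ => by positivity
  have hD : 0 ≤ D := integral_nonneg fun _ => by positivity
  simp only [one_mul, add_re, mul_re, ofReal_re, ofReal_im]; nlinarith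

end

end

lemma pair_congr (L : ℝ) (q : ℤ → ℂ) (h : ∀ x, f x = g x) : pair L q f = pair L q g := by
  rw [show f = g from funext h]

lemma pair_add_fun (hL : 1 ≤ L) (q : Hs L (-1)) (hu : HasH1Deriv u u') (hv : HasH1Deriv v v')
    (hψ : HasH1Deriv ψ ψ') : pair L q.1 (fun x => (u x + v x) * ψ x) = pair L q.1
    (fun x => u x * ψ x) + pair L q.1 (fun x => v x * ψ x) := by
  unfold pair; rw [← (summable_pair hL q hu hψ).tsum_add (summable_pair hL q hv hψ)]
  refine tsum_congr fun n => ?_; rw [← mul_add, ← integral_add]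
  · congr 2; ext x; ring
  · exact integrable_expi_mul L n (hu.integrable_mul hψ)
  · exact integrable_expi_mul L n (hv.integrable_mul hψ)

lemma pair_const_mul (L : ℝ) (q : ℤ → ℂ) (c : ℂ) (f : ℝ → ℂ) : pair L q (fun x => c * f x) = c *
    pair L q f := by
  unfold pair; rw [← tsum_mul_left]; refine tsum_congr fun n => ?_
  simp only [mul_left_comm _ c, integral_const_mul]

lemma form_add_left (hL : 1 ≤ L) (q : Hs L (-1)) (lam : ℂ) (hu : HasH1Deriv u u')
    (hv : HasH1Deriv v v') (hψ : HasH1Deriv ψ ψ') : form L q.1 lam (fun x => u x + v x)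
    (fun x => u' x + v' x) ψ ψ' = form L q.1 lam u u' ψ ψ' + form L q.1 lam v v' ψ ψ' := by
  unfold form; rw [pair_add_fun hL q hu hv hψ]; simp only [add_mul]
  rw [integral_add (integrable_mul_two hu.memLp_deriv hψ.memLp_deriv)
    (integrable_mul_two hv.memLp_deriv hψ.memLp_deriv),
    integral_add (hu.integrable_mul hψ) (hv.integrable_mul hψ)]
  ring

lemma form_const_mul_left (L : ℝ) (q : ℤ → ℂ) (lam c : ℂ) (u u' ψ ψ' : ℝ → ℂ) : form L q lam
    (fun x => c * u x) (fun x => c * u' x) ψ ψ' = c * form L q lam u u' ψ ψ' := by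
  unfold form; simp only [mul_assoc, integral_const_mul, pair_const_mul]; ring

lemma form_comm (L : ℝ) (q : ℤ → ℂ) (lam : ℂ) (u u' ψ ψ' : ℝ → ℂ) : form L q lam u u' ψ ψ' = form L
    q lam ψ ψ' u u' := by
  unfold form; simp only [mul_comm]

lemma form_add_right (hL : 1 ≤ L) (q : Hs L (-1)) (lam : ℂ) (hu : HasH1Deriv u u')
    (hv : HasH1Deriv v v') (hψ : HasH1Deriv ψ ψ') : form L q.1 lam ψ ψ' (fun x => u x + v x)
    (fun x => u' x + v' x) = form L q.1 lam ψ ψ' u u' + form L q.1 lam ψ ψ' v v' := by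
  rw [form_comm, form_add_left hL q lam hu hv hψ, form_comm _ _ _ u, form_comm _ _ _ v]

lemma form_const_mul_right (L : ℝ) (q : ℤ → ℂ) (lam c : ℂ) (u u' ψ ψ' : ℝ → ℂ) : form L q lam u u'
    (fun x => c * ψ x) (fun x => c * ψ' x) = c * form L q lam u u' ψ ψ' := by
  rw [form_comm, form_const_mul_left, form_comm]

lemma form_sub_left (hL : 1 ≤ L) (q : Hs L (-1)) (lam : ℂ) (hu : HasH1Deriv u u')
    (hv : HasH1Deriv v v') (hψ : HasH1Deriv ψ ψ') : form L q.1 lam (fun x => u x - v x)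
    (fun x => u' x - v' x) ψ ψ' = form L q.1 lam u u' ψ ψ' - form L q.1 lam v v' ψ ψ' := by
  have := form_add_left hL q lam hu (hv.const_mul (-1)) hψ; rw [form_const_mul_left] at this
  simp only [neg_mul, one_mul, ← sub_eq_add_neg] at this; exact this

lemma form_congr_ae (L : ℝ) (q : ℤ → ℂ) (lam : ℂ) {χ χ' : ℝ → ℂ} (h1 : u =ᵐ[volume] w)
    (h2 : u' =ᵐ[volume] w') (h3 : ψ =ᵐ[volume] χ) (h4 : ψ' =ᵐ[volume] χ') : form L q lam u u' ψ ψ' =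
    form L q lam w w' χ χ' := by
  unfold form pair; congr 2
  · exact integral_congr_ae (h2.mul h4)
  · refine tsum_congr fun n => ?_; congr 1; refine integral_congr_ae ?_
    filter_upwards [h1, h3] with x hx hx'
    rw [hx, hx']
  · exact integral_congr_ae (h1.mul h3)

lemma norm_form_le (hL : 1 ≤ L) (q : Hs L (-1)) (lam : ℂ) (hu : HasH1Deriv u u')
    (hψ : HasH1Deriv ψ ψ') : ‖form L q.1 lam u u' ψ ψ'‖ ≤ (1 + 18 * L ^ 2 * ‖q‖ + ‖lam‖) *
    (√(h1sq u u') * √(h1sq ψ ψ')) := by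
  unfold form; have h1 := norm_integral_mul_le hu.memLp_deriv hψ.memLp_deriv
  have h2 := norm_integral_mul_le hu.memLp hψ.memLp; have h3 := norm_pair_le hL q hu hψ
  have e1 := mul_le_mul (l2_deriv_le_sqrt_h1sq u u') (l2_deriv_le_sqrt_h1sq ψ ψ') (l2_nonneg _ _)
    (sqrt_nonneg _)
  have e2 := mul_le_mul (l2_le_sqrt_h1sq u u') (l2_le_sqrt_h1sq ψ ψ') (l2_nonneg _ _)
    (sqrt_nonneg _)
  refine (norm_add₃_le).trans ?_; rw [norm_mul]
  have := mul_le_mul_of_nonneg_left (h2.trans e2) (norm_nonneg lam); linarith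

/-- The space in which `H¹(ℝ)` is embedded by `u ↦ (u, u')`. -/
abbrev PairSpace : Type := WithLp 2 (Lp ℂ 2 (volume : Measure ℝ) × Lp ℂ 2 (volume : Measure ℝ))

/-- `H¹(ℝ)` as a subspace of `L² × L²`. -/
def h1Submodule : Submodule ℝ PairSpace where
  carrier := {p | ∃ u : ℝ → ℂ, HasH1Deriv u p.snd ∧ p.fst =ᵐ[volume] u}
  zero_mem' := ⟨fun _ => 0, ((IsPrim.const 0).congr_ae (Lp.coeFn_zero _ _ _).symm).hasH1Deriv
    (by simp) (Lp.memLp _), Lp.coeFn_zero _ _ _⟩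
  add_mem' := by
    rintro a b ⟨u, hu, hu'⟩ ⟨v, hv, hv'⟩
    refine ⟨fun x => u x + v x, ?_, (Lp.coeFn_add _ _).trans (hu'.add hv')⟩
    exact ((hu.add hv).isPrim.congr_ae (Lp.coeFn_add a.snd b.snd).symm).hasH1Deriv
      (hu.add hv).memLp (Lp.memLp _)
  smul_mem' := by
    rintro c a ⟨u, hu, hu'⟩; refine ⟨fun x => (c : ℂ) * u x, ?_, ?_⟩
    · refine ((hu.const_mul (c : ℂ)).isPrim.congr_ae ?_).hasH1Deriv
        (hu.const_mul (c : ℂ)).memLp (Lp.memLp _)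
      filter_upwards [Lp.coeFn_smul c a.snd] with x hx
      simp [*]
    · filter_upwards [Lp.coeFn_smul c a.fst, hu'] with x hx hx'
      simp [*]

/-- The continuous representative. -/
def h1rep (p : h1Submodule) : ℝ → ℂ := p.2.choose

/-- The derivative. -/
def h1der (p : h1Submodule) : ℝ → ℂ := p.1.snd

lemma h1rep_spec (p : h1Submodule) : HasH1Deriv (h1rep p) (h1der p) := p.2.choose_spec.1

lemma h1rep_ae (p : h1Submodule) : p.1.fst =ᵐ[volume] h1rep p := p.2.choose_spec.2

lemma norm_sq_eq_l2_sq (f : Lp ℂ 2 (volume : Measure ℝ)) : ‖f‖ ^ 2 = ∫ x, ‖f x‖ ^ 2 := by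
  have h := L2.inner_def (𝕜 := ℂ) f f; rw [inner_self_eq_norm_sq_to_K] at h
  have : ∀ x, inner ℂ (f x) (f x) = ((‖f x‖ ^ 2 : ℝ) : ℂ) := fun x => by
    rw [inner_self_eq_norm_sq_to_K]; simp
  simp only [this, integral_complex_ofReal] at h; rw [← Complex.ofReal_inj, ← h]; simp

lemma norm_sq_h1 (p : h1Submodule) : ‖p‖ ^ 2 = h1sq (h1rep p) (h1der p) := by
  rw [Submodule.coe_norm, WithLp.prod_norm_sq_eq_of_L2, norm_sq_eq_l2_sq, norm_sq_eq_l2_sq, h1sq]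
  congr 1; exact integral_congr_ae ((h1rep_ae p).mono fun x hx => by simp only []; rw [hx])

lemma norm_h1 (p : h1Submodule) : ‖p‖ = √(h1sq (h1rep p) (h1der p)) := by
  rw [← norm_sq_h1, sqrt_sq (norm_nonneg _)]

lemma h1rep_eq {p : h1Submodule} (hu : Continuous u) (h : p.1.fst =ᵐ[volume] u) : h1rep p = u :=
  (h1rep_spec p).isPrim.continuous.ae_eq_iff_eq volume hu |>.1 ((h1rep_ae p).symm.trans h)

lemma h1rep_add (p r : h1Submodule) (x : ℝ) : h1rep (p + r) x = h1rep p x + h1rep r x :=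
  congrFun (h1rep_eq (p := p + r) (u := fun x => h1rep p x + h1rep r x)
    ((h1rep_spec p).isPrim.continuous.add (h1rep_spec r).isPrim.continuous)
    ((Lp.coeFn_add p.1.fst r.1.fst).trans ((h1rep_ae p).add (h1rep_ae r)))) x

lemma h1rep_smul (c : ℝ) (p : h1Submodule) (x : ℝ) : h1rep (c • p) x = (c : ℂ) * h1rep p x :=
  congrFun (h1rep_eq (p := c • p) (u := fun x => (c : ℂ) * h1rep p x)
    (continuous_const.mul (h1rep_spec p).isPrim.continuous) (by
      filter_upwards [Lp.coeFn_smul c p.1.fst, h1rep_ae p] with x hx hx'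
      simp [*])) x

/-- The element of `H¹` given by a function. -/
def mkH1 (h : HasH1Deriv u u') : h1Submodule :=
  ⟨WithLp.toLp 2 (h.memLp.toLp u, h.memLp_deriv.toLp u'), u,
    (h.isPrim.congr_ae h.memLp_deriv.coeFn_toLp.symm).hasH1Deriv h.memLp (Lp.memLp _),
    h.memLp.coeFn_toLp⟩

lemma h1rep_mk (h : HasH1Deriv u u') : h1rep (mkH1 h) = u :=
  h1rep_eq h.isPrim.continuous h.memLp.coeFn_toLp

lemma h1der_mk (h : HasH1Deriv u u') : h1der (mkH1 h) =ᵐ[volume] u' := h.memLp_deriv.coeFn_toLp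

lemma isClosed_h1 : IsClosed (h1Submodule : Set PairSpace) := by
  refine IsSeqClosed.isClosed fun p r hp hr => ?_
  set P : ℕ → h1Submodule := fun n => ⟨p n, hp n⟩ with hP
  have hcP : CauchySeq P := by
    have := hr.cauchySeq; rw [Metric.cauchySeq_iff'] at this ⊢; exact this
  have hbd : ∀ m n x, ‖h1rep (P m) x - h1rep (P n) x‖ ≤ 2 * ‖P m - P n‖ := by
    intro m n x
    have e : h1rep (P m) x - h1rep (P n) x = h1rep (P m - P n) x := by
      have := h1rep_add (P m - P n) (P n) x; rw [sub_add_cancel] at this; rw [this]; ring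
    rw [e, norm_h1]; exact (h1rep_spec (P m - P n)).norm_le x
  have hex : ∀ x, ∃ y, Tendsto (fun n => h1rep (P n) x) atTop (𝓝 y) := fun x => by
    refine cauchySeq_tendsto_of_complete (Metric.cauchySeq_iff'.2 fun ε hε => ?_)
    obtain ⟨N, hN⟩ := Metric.cauchySeq_iff'.1 hcP (ε / 2) (by positivity)
    refine ⟨N, fun n hn => ?_⟩; have := hN n hn; rw [dist_eq_norm] at this ⊢
    linarith [hbd n N x]
  choose u hu using hex
  have h1 : Tendsto (fun n => (p n).fst) atTop (𝓝 r.fst) :=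
    ((WithLp.prod_continuous_ofLp 2 _ _).fst.tendsto r).comp hr
  have h2 : Tendsto (fun n => (p n).snd) atTop (𝓝 r.snd) :=
    ((WithLp.prod_continuous_ofLp 2 _ _).snd.tendsto r).comp hr
  have hae : r.fst =ᵐ[volume] u := by
    obtain ⟨ns, hns, hlim⟩ := (tendstoInMeasure_of_tendsto_Lp h1).exists_seq_tendsto_ae
    have hall : ∀ᵐ x, ∀ n, (p n).fst x = h1rep (P n) x := ae_all_iff.2 fun n => h1rep_ae (P n)
    filter_upwards [hlim, hall] with x hx hx'
    refine tendsto_nhds_unique hx (((hu x).comp hns.tendsto_atTop).congr fun n => ?_)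
    rw [Function.comp_apply, hx' (ns n)]
  have hint : ∀ f : Lp ℂ 2 (volume : Measure ℝ), ∀ a b : ℝ, IntervalIntegrable f volume a b := by
    intro f a b; rw [intervalIntegrable_iff]
    exact (((Lp.memLp f).locallyIntegrable (by norm_num)).integrableOn_isCompact
      isCompact_uIcc).mono_set uIoc_subset_uIcc
  have hprim : IsPrim u r.snd := by
    refine ⟨hint _, fun a b => ?_⟩
    have e1 := ((hu b).sub (hu a)).congr fun n => (h1rep_spec (P n)).ftc a b
    refine tendsto_nhds_unique e1 ?_
    have hh : MemLp ((uIoc a b).indicator fun _ => (1 : ℂ)) 2 volume :=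
      memLp_indicator_const 2 measurableSet_uIoc 1 (Or.inr (by simp [uIoc]))
    rw [tendsto_iff_norm_sub_tendsto_zero]
    have e2 : ∀ n, ‖(∫ x in a..b, h1der (P n) x) - ∫ x in a..b, r.snd x‖ ≤
        ‖(p n).snd - r.snd‖ * l2 volume ((uIoc a b).indicator fun _ => (1 : ℂ)) := by
      intro n
      rw [← intervalIntegral.integral_sub ((h1rep_spec (P n)).isPrim.1 _ _) (hint _ _ _),
        intervalIntegral.norm_intervalIntegral_eq, ← integral_indicator measurableSet_uIoc]
      have e3 := norm_integral_mul_le (Lp.memLp ((p n).snd - r.snd)) hh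
      rw [show l2 volume ((p n).snd - r.snd : Lp ℂ 2 (volume : Measure ℝ)) = ‖(p n).snd - r.snd‖ by
        rw [l2, ← norm_sq_eq_l2_sq, sqrt_sq (norm_nonneg _)]] at e3
      refine le_trans (le_of_eq ?_) e3; congr 1; refine integral_congr_ae ?_
      filter_upwards [Lp.coeFn_sub (p n).snd r.snd] with x hx
      rw [hx, Pi.sub_apply]
      by_cases hxm : x ∈ uIoc a b
      · simp only [indicator_of_mem hxm, mul_one]; rfl
      · simp [*]
    refine squeeze_zero (fun n => norm_nonneg _) e2 ?_
    simpa using (tendsto_iff_norm_sub_tendsto_zero.1 h2).mul_const _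
  exact ⟨u, hprim.hasH1Deriv ((memLp_congr_ae hae).1 (Lp.memLp _)) (Lp.memLp _), hae⟩

instance : CompleteSpace h1Submodule := isClosed_h1.completeSpace_coe

lemma h1der_add (p r : h1Submodule) :
    h1der (p + r) =ᵐ[volume] fun x => h1der p x + h1der r x := Lp.coeFn_add p.1.snd r.1.snd

lemma h1der_smul (c : ℝ) (p : h1Submodule) : h1der (c • p) =ᵐ[volume] fun x => (c : ℂ) * h1der p
    x := by
  unfold h1der
  filter_upwards [Lp.coeFn_smul c p.1.snd] with x hx
  simp [*]

/-- The values of the real bilinear form on `H¹`. -/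
def formVal (L : ℝ) (q : ℤ → ℂ) (lam ζ : ℂ) (p r : h1Submodule) : ℝ :=
  (ζ * form L q lam (h1rep p) (h1der p) (fun x => conj (h1rep r x)) (fun x => conj (h1der r x))).re

lemma formVal_add_left (hL : 1 ≤ L) (q : Hs L (-1)) (lam ζ : ℂ) (p₁ p₂ r : h1Submodule) : formVal L
    q.1 lam ζ (p₁ + p₂) r = formVal L q.1 lam ζ p₁ r + formVal L q.1 lam ζ p₂ r := by
  unfold formVal
  rw [← add_re, ← mul_add, ← form_add_left hL q lam (h1rep_spec p₁) (h1rep_spec p₂)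
    (h1rep_spec r).conj]
  congr 2
  exact form_congr_ae _ _ _ (.of_forall (h1rep_add p₁ p₂)) (h1der_add p₁ p₂)
    (ae_eq_refl _) (ae_eq_refl _)

lemma formVal_smul_left (L : ℝ) (q : ℤ → ℂ) (lam ζ : ℂ) (c : ℝ) (p r : h1Submodule) : formVal L q
    lam ζ (c • p) r = c • formVal L q lam ζ p r := by
  unfold formVal
  rw [smul_eq_mul, ← re_ofReal_mul, mul_left_comm, ← form_const_mul_left L q lam (c : ℂ)]; congr 2
  exact form_congr_ae _ _ _ (.of_forall (h1rep_smul c p)) (h1der_smul c p)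
    (ae_eq_refl _) (ae_eq_refl _)

lemma formVal_add_right (hL : 1 ≤ L) (q : Hs L (-1)) (lam ζ : ℂ) (p r₁ r₂ : h1Submodule) : formVal L
    q.1 lam ζ p (r₁ + r₂) = formVal L q.1 lam ζ p r₁ + formVal L q.1 lam ζ p r₂ := by
  unfold formVal
  rw [← add_re, ← mul_add, ← form_add_right hL q lam (h1rep_spec r₁).conj
    (h1rep_spec r₂).conj (h1rep_spec p)]
  congr 2
  refine form_congr_ae _ _ _ (ae_eq_refl _) (ae_eq_refl _)
    (.of_forall fun x => by simp only [h1rep_add, map_add]) ?_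
  filter_upwards [h1der_add r₁ r₂] with x hx
  rw [hx, map_add]

lemma formVal_smul_right (L : ℝ) (q : ℤ → ℂ) (lam ζ : ℂ) (c : ℝ) (p r : h1Submodule) : formVal L q
    lam ζ p (c • r) = c • formVal L q lam ζ p r := by
  unfold formVal
  rw [smul_eq_mul, ← re_ofReal_mul, mul_left_comm, ← form_const_mul_right L q lam (c : ℂ)]; congr 2
  refine form_congr_ae _ _ _ (ae_eq_refl _) (ae_eq_refl _)
    (.of_forall fun x => by simp only [h1rep_smul, map_mul, conj_ofReal]) ?_
  filter_upwards [h1der_smul c r] with x hx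
  rw [hx, map_mul, conj_ofReal]

lemma norm_formVal_le (hL : 1 ≤ L) (q : Hs L (-1)) (lam ζ : ℂ) (p r : h1Submodule) : ‖formVal L q.1
    lam ζ p r‖ ≤ ‖ζ‖ * (1 + 18 * L ^ 2 * ‖q‖ + ‖lam‖) * ‖p‖ * ‖r‖ := by
  rw [norm_h1, norm_h1, norm_eq_abs, formVal]; refine (abs_re_le_norm _).trans ?_
  have := norm_form_le hL q lam (h1rep_spec p) (h1rep_spec r).conj; rw [h1sq_conj] at this
  rw [norm_mul, mul_assoc, mul_assoc]; gcongr

/-- The real bilinear form on `H¹`. -/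
def realForm (L : ℝ) (hL : 1 ≤ L) (q : Hs L (-1)) (lam ζ : ℂ) : h1Submodule →L[ℝ] h1Submodule →L[ℝ]
    ℝ :=
  LinearMap.mkContinuous₂ (LinearMap.mk₂ ℝ (formVal L q.1 lam ζ) (formVal_add_left hL q lam ζ)
    (formVal_smul_left L q.1 lam ζ) (formVal_add_right hL q lam ζ) (formVal_smul_right L q.1 lam ζ))
    (‖ζ‖ * (1 + 18 * L ^ 2 * ‖q‖ + ‖lam‖)) (norm_formVal_le hL q lam ζ)

lemma realForm_apply (L : ℝ) (hL : 1 ≤ L) (q : Hs L (-1)) (lam ζ : ℂ) (p r : h1Submodule) :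
    realForm L hL q lam ζ p r = formVal L q.1 lam ζ p r := rfl

lemma eval_add (ζ : ℂ) (y : ℝ) (r s : h1Submodule) : (ζ * conj (h1rep (r + s) y)).re =
    (ζ * conj (h1rep r y)).re + (ζ * conj (h1rep s y)).re := by
  rw [h1rep_add, map_add, mul_add, add_re]

lemma eval_smul (ζ : ℂ) (y : ℝ) (c : ℝ) (r : h1Submodule) : (ζ * conj (h1rep (c • r) y)).re = c •
    (ζ * conj (h1rep r y)).re := by
  rw [h1rep_smul, map_mul, conj_ofReal, mul_left_comm, re_ofReal_mul, smul_eq_mul]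

lemma norm_eval_le (ζ : ℂ) (y : ℝ) (r : h1Submodule) : ‖(ζ * conj (h1rep r y)).re‖ ≤ ‖ζ‖ * 2 *
    ‖r‖ := by
  refine (abs_re_le_norm _).trans ?_; rw [norm_mul, RCLike.norm_conj, norm_h1, mul_assoc]; gcongr
  exact (h1rep_spec r).norm_le y

/-- Evaluation of the conjugate at a point. -/
def evalForm (ζ : ℂ) (y : ℝ) : h1Submodule →L[ℝ] ℝ := LinearMap.mkContinuous
    { toFun := fun r => (ζ * conj (h1rep r y)).re
      map_add' := eval_add ζ y
      map_smul' := eval_smul ζ y }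
    (‖ζ‖ * 2) (norm_eval_le ζ y)

lemma evalForm_apply (ζ : ℂ) (y : ℝ) (r : h1Submodule) :
    evalForm ζ y r = (ζ * conj (h1rep r y)).re := rfl

lemma CoerciveForm.exists_green (hL : 1 ≤ L) (hc : CoerciveForm L q.1 lam ζ) (y : ℝ) : ∃ u u',
    HasH1Deriv u u' ∧ ∀ ψ ψ', HasH1Deriv ψ ψ' → form L q.1 lam u u' ψ ψ' = ψ y := by
  have hco : IsCoercive (realForm L hL q lam ζ) := ⟨1 / 2, by norm_num, fun p => by
    have := hc.le _ _ (h1rep_spec p); rw [← norm_sq_h1] at this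
    rw [realForm_apply, formVal, mul_assoc, ← sq]
    exact this⟩
  set p := hco.continuousLinearEquivOfBilin.symm
    ((InnerProductSpace.toDual ℝ h1Submodule).symm (evalForm ζ y)) with hp
  have hkey : ∀ r, realForm L hL q lam ζ p r = evalForm ζ y r := by
    intro r
    rw [← hco.continuousLinearEquivOfBilin_apply, hp, ContinuousLinearEquiv.apply_symm_apply,
      InnerProductSpace.toDual_symm_apply]
  have hre : ∀ ψ ψ', HasH1Deriv ψ ψ' →
      (ζ * form L q.1 lam (h1rep p) (h1der p) ψ ψ').re = (ζ * ψ y).re := by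
    intro ψ ψ' hψ; have h := hkey (mkH1 hψ.conj)
    rw [realForm_apply, formVal, evalForm_apply, h1rep_mk] at h; simp only [conj_conj] at h
    rw [← h]; congr 2; refine form_congr_ae _ _ _ (ae_eq_refl _) (ae_eq_refl _) (ae_eq_refl _) ?_
    filter_upwards [h1der_mk hψ.conj] with x hx
    rw [hx, conj_conj]
  refine ⟨h1rep p, h1der p, h1rep_spec p, fun ψ ψ' hψ => mul_left_cancel₀ hc.ne_zero ?_⟩
  refine Complex.ext (hre ψ ψ' hψ) ?_; have := hre _ _ (hψ.const_mul I)
  rw [form_const_mul_right, mul_left_comm, mul_left_comm ζ, Complex.I_mul_re, Complex.I_mul_re,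
    neg_inj] at this
  exact this

section

/-- A function which is constant outside of `[c, c + h]` and has slope one inside. -/
def ramp (c h x : ℝ) : ℂ := (max 0 (min (x - c) h) : ℝ)

lemma ramp_of_le {c h : ℝ} (hx : x ≤ c) : ramp c h x = 0 := by
  rw [ramp, max_eq_left ((min_le_left _ _).trans (by linarith)), ofReal_zero]

lemma ramp_of_mem {c h : ℝ} (hx : c ≤ x) (hx' : x ≤ c + h) : ramp c h x = (x - c : ℝ) := by
  rw [ramp, min_eq_left (by linarith), max_eq_right (by linarith)]

lemma ramp_of_ge {c h : ℝ} (hh : 0 ≤ h) (hx : c + h ≤ x) : ramp c h x = h := by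
  rw [ramp, min_eq_right (by linarith), max_eq_right hh]

/-- The derivative of `ramp`. -/
def rampDeriv (c h : ℝ) : ℝ → ℂ := (Ioc c (c + h)).indicator fun _ => 1

lemma memLp_rampDeriv (c h : ℝ) : MemLp (rampDeriv c h) 2 volume :=
  memLp_indicator_const 2 measurableSet_Ioc 1 (Or.inr (by simp))

lemma isPrim_ramp {c h : ℝ} (hh : 0 ≤ h) : IsPrim (ramp c h) (rampDeriv c h) := by
  have hi : ∀ a b : ℝ, IntervalIntegrable (rampDeriv c h) volume a b := fun a b => by
    have : Integrable (rampDeriv c h) volume :=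
      (integrable_indicator_iff measurableSet_Ioc).2 (by simp)
    exact this.intervalIntegrable
  refine (IsPrim.primitive hi c).congr_left fun x => ?_
  rcases le_total x c with hx | hx
  · rw [ramp_of_le hx, integral_symm, neg_eq_zero]
    refine integral_zero_ae (.of_forall fun t ht => ?_); rw [uIoc_of_le hx] at ht
    exact indicator_of_notMem (fun h' => by linarith [h'.1, ht.2]) _
  · rw [integral_of_le hx, rampDeriv, setIntegral_indicator measurableSet_Ioc,
      Set.Ioc_inter_Ioc, max_self, setIntegral_const]
    rcases le_total x (c + h) with hx' | hx'
    · rw [ramp_of_mem hx hx', min_eq_left hx', volume_real_Ioc_of_le hx]; simp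
    · rw [ramp_of_ge hh hx', min_eq_right hx', volume_real_Ioc_of_le (by linarith)]; simp

lemma hasH1Deriv_ramp_sub (c d : ℝ) {h : ℝ} (hh : 0 ≤ h) : HasH1Deriv
    (fun x => ramp c h x - ramp d h x) (fun x => rampDeriv c h x - rampDeriv d h x) := by
  have hP := (isPrim_ramp (c := c) hh).sub (isPrim_ramp (c := d) hh)
  refine hP.hasH1Deriv ?_ ((memLp_rampDeriv c h).sub (memLp_rampDeriv d h))
  refine hP.continuous.memLp_of_hasCompactSupport (HasCompactSupport.of_support_subset_isCompact
    (isCompact_Icc (a := min c d) (b := max c d + h)) fun x hx => ?_)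
  by_contra hx'; apply hx; simp only [ramp, sub_eq_zero]
  grind

lemma HasH1Deriv.mul (hu : HasH1Deriv u u') (hψ : HasH1Deriv ψ ψ') : HasH1Deriv (fun x => u x * ψ x)
    (dmul u u' ψ ψ') := by
  have b1 : ∀ {w w' f : ℝ → ℂ}, HasH1Deriv w w' → MemLp f 2 volume →
      MemLp (fun x => w x * f x) 2 volume := by
    intro w w' f hw hf
    refine hf.of_le_mul (c := 2 * √(h1sq w w'))
      (hw.isPrim.continuous.aestronglyMeasurable.mul hf.1) (.of_forall fun x => ?_)
    rw [norm_mul]; gcongr; exact hw.norm_le x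
  refine (hu.isPrim_mul hψ).hasH1Deriv (b1 hu hψ.memLp) ?_
  have := (b1 hψ hu.memLp_deriv).add (b1 hu hψ.memLp_deriv)
  refine (memLp_congr_ae (.of_forall fun x => ?_)).1 this; simp only [dmul, Pi.add_apply]; ring

lemma HasH1Deriv.truncate (hv : HasH1Deriv v v') (hb : v b = 0) : HasH1Deriv ((Ioi b).indicator v)
    ((Ioi b).indicator v') := by
  have hm := hv.memLp_deriv.indicator (s := Ioi b) measurableSet_Ioi
  have hi : ∀ a c : ℝ, IntervalIntegrable ((Ioi b).indicator v') volume a c := fun a c => by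
    have := hv.isPrim.1 a c; rw [intervalIntegrable_iff] at this ⊢
    exact this.indicator measurableSet_Ioi
  refine ((IsPrim.primitive hi b).congr_left fun x => ?_).hasH1Deriv
    (hv.memLp.indicator measurableSet_Ioi) hm
  rcases le_or_gt x b with hx | hx
  · rw [indicator_of_notMem (by simpa using hx), integral_symm, neg_eq_zero]
    refine integral_zero_ae (.of_forall fun t ht => ?_); rw [uIoc_of_le hx] at ht
    exact indicator_of_notMem (by simpa using ht.2) _
  · rw [indicator_of_mem (show x ∈ Ioi b from hx)]; have := hv.ftc b x; rw [hb, sub_zero] at this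
    rw [this]; refine intervalIntegral.integral_congr_ae (.of_forall fun t ht => ?_)
    rw [uIoc_of_le hx.le] at ht; exact indicator_of_mem (show t ∈ Ioi b from ht.1) _

section coercive
lemma CoerciveForm.eq_zero (hc : CoerciveForm L q.1 lam ζ) (hu : HasH1Deriv u u') (h : form L q.1
    lam u u' (fun x => conj (u x)) (fun x => conj (u' x)) = 0) (x : ℝ) : u x = 0 := by
  have h1 := hc.le u u' hu; rw [h, mul_zero, Complex.zero_re] at h1
  have h2 : h1sq u u' = 0 := le_antisymm (by linarith) (h1sq_nonneg _ _); have h3 := hu.norm_le x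
  rw [h2, sqrt_zero, mul_zero] at h3; exact norm_le_zero_iff.1 h3

lemma CoerciveForm.eq_zero_of_ge (hc : CoerciveForm L q.1 lam ζ) (hv : HasH1Deriv v v')
    (hb : v b = 0) (h : ∀ ψ ψ', HasH1Deriv ψ ψ' → (∀ x ≤ b, ψ x = 0) → form L q.1 lam v v' ψ ψ' = 0)
    (x : ℝ) (hx : b ≤ x) : v x = 0 := by
  rcases hx.eq_or_lt with rfl | hx
  · exact hb
  have hw := hv.truncate hb
  have h0 := hc.eq_zero hw (x := x) (by
    rw [← h _ _ hw.conj fun y hy => by simp [*]]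
    have e : ∀ f g : ℝ → ℂ, ∀ y, (Ioi b).indicator f y * conj ((Ioi b).indicator g y)
        = f y * conj ((Ioi b).indicator g y) := by simp only [Set.indicator]; grind
    simp only [form, e])
  rwa [indicator_of_mem (show x ∈ Ioi b from hx)] at h0

lemma CoerciveForm.sqrt_h1sq_le (hc : CoerciveForm L q.1 lam ζ) (hu : HasH1Deriv u u')
    (h : ∀ ψ ψ', HasH1Deriv ψ ψ' → form L q.1 lam u u' ψ ψ' = ψ y) : √(h1sq u u') ≤ 4 * ‖ζ‖ := by
  have h1 := hc.le u u' hu; rw [h _ _ hu.conj] at h1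
  have h2 : (ζ * conj (u y)).re ≤ ‖ζ‖ * (2 * √(h1sq u u')) := by
    refine (re_le_norm _).trans ?_; rw [norm_mul, RCLike.norm_conj]; gcongr; exact hu.norm_le y
  have h3 := sq_sqrt (h1sq_nonneg u u'); set s := √(h1sq u u')
  rcases (show 0 ≤ s from sqrt_nonneg _).eq_or_lt with h0 | h0
  · rw [← h0]; positivity
  · nlinarith

end coercive

/-- The Schrödinger form with parameter `k` is coercive up to a factor. -/
def Coercive (L : ℝ) (q : Hs L (-1)) (k : ℂ) : Prop := ∃ ζ, CoerciveForm L q.1 (k ^ 2) ζ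

section green
variable (hL : 1 ≤ L)
include hL

lemma Coercive.existsUnique (hc : Coercive L q k) (y : ℝ) : ∃! u, IsGreen L q.1 k y u := by
  obtain ⟨ζ, hc⟩ := hc; obtain ⟨u, u', hu, h⟩ := hc.exists_green hL y; refine ⟨u, ⟨u', hu, h⟩, ?_⟩
  rintro v ⟨v', hv, h'⟩; ext x
  have := hc.eq_zero (hv.sub hu) (x := x) (by
    rw [form_sub_left hL q _ hv hu (hv.sub hu).conj, h _ _ (hv.sub hu).conj]
    exact sub_eq_zero.2 (h' _ _ (hv.sub hu).conj))
  exact sub_eq_zero.1 this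

lemma Coercive.isGreen (hc : Coercive L q k) (y : ℝ) : IsGreen L q.1 k y (green L q.1 k y) := by
  have h : ∃ u, IsGreen L q.1 k y u := (hc.existsUnique hL y).exists; rw [green, dif_pos h]
  exact h.choose_spec

lemma Coercive.exists_deriv (hc : Coercive L q k) (y : ℝ) : ∃ u', HasH1Deriv (green L q.1 k y) u' ∧
    ∀ ψ ψ', HasH1Deriv ψ ψ' → form L q.1 (k ^ 2) (green L q.1 k y) u' ψ ψ' = ψ y :=
  hc.isGreen hL y

lemma Coercive.continuous_green (hc : Coercive L q k) (y : ℝ) : Continuous (green L q.1 k y) := by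
  obtain ⟨u', hu, -⟩ := hc.exists_deriv hL y; exact hu.isPrim.continuous

lemma Coercive.green_symm (hc : Coercive L q k) (a b : ℝ) : green L q.1 k a b = green L q.1 k b
    a := by
  obtain ⟨u', hu, h⟩ := hc.exists_deriv hL a; obtain ⟨v', hv, h'⟩ := hc.exists_deriv hL b
  rw [← h' _ _ hu, form_comm, h _ _ hv]

lemma Coercive.green_mul (hc : Coercive L q k) (hab : a ≤ b) (hbx : b ≤ x)
    (hg : green L q.1 k b b ≠ 0) : green L q.1 k a x * green L q.1 k b b = green L q.1 k a b * green
    L q.1 k b x := by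
  obtain ⟨u', hu, h⟩ := hc.exists_deriv hL a; obtain ⟨v', hv, h'⟩ := hc.exists_deriv hL b
  obtain ⟨ζ, hζ⟩ := hc; set c := green L q.1 k a b / green L q.1 k b b
  have hw := hu.sub (hv.const_mul c)
  have := hζ.eq_zero_of_ge hw (b := b) (by simp only [c]; field_simp; simp) (fun ψ ψ' hψ h0 => by
    rw [form_sub_left hL q _ hu (hv.const_mul c) hψ, form_const_mul_left, h _ _ hψ, h' _ _ hψ,
      h0 a hab, h0 b le_rfl, mul_zero, sub_zero]) x hbx
  grind

lemma Coercive.green_diag_ne_zero (hc : Coercive L q k) (y : ℝ) : green L q.1 k y y ≠ 0 := by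
  obtain ⟨u', hu, h⟩ := hc.exists_deriv hL y; intro h0; obtain ⟨ζ, hζ⟩ := hc
  have hh := hasH1Deriv_ramp_sub (y - 1) y zero_le_one; have h1 := h _ _ hh
  have h2 := norm_form_le hL q (k ^ 2) hu hh
  have h4 : h1sq (green L q.1 k y) u' = 0 := by
    have := hζ.le _ _ hu; rw [h _ _ hu.conj, h0, map_zero, mul_zero, Complex.zero_re] at this
    exact le_antisymm (by linarith) (h1sq_nonneg _ _)
  rw [h1, h4, sqrt_zero, zero_mul, mul_zero, ramp_of_ge zero_le_one (by linarith),
    ramp_of_le le_rfl] at h2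
  norm_num at h2

lemma Coercive.green_ne_zero (hc : Coercive L q k) (a b : ℝ) : green L q.1 k a b ≠ 0 := by
  wlog hab : a ≤ b generalizing a b
  · rw [hc.green_symm hL]; exact this b a (le_of_not_ge hab)
  intro h0; set S := {x | a ≤ x ∧ green L q.1 k a x = 0} with hS
  have hcl : IsClosed S := isClosed_Ici.inter
    (isClosed_eq (hc.continuous_green hL a) continuous_const)
  have hbd : BddBelow S := ⟨a, fun x hx => hx.1⟩
  have hx1 : sInf S ∈ S := hcl.csInf_mem ⟨b, hab, h0⟩ hbd; set c := sInf S
  have hac : a < c := lt_of_le_of_ne hx1.1 fun h => hc.green_diag_ne_zero hL a (by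
    have := hx1.2; rwa [← h] at this)
  have hev : ∀ᶠ x in 𝓝[<] c, green L q.1 k c x ≠ 0 :=
    ((hc.continuous_green hL c).continuousAt.eventually_ne
      (hc.green_diag_ne_zero hL c)).filter_mono nhdsWithin_le_nhds
  have hev2 : ∀ᶠ x in 𝓝[<] c, a < x := by
    filter_upwards [Ioo_mem_nhdsLT hac] with x hx using hx.1
  obtain ⟨x, ⟨hx, hxa⟩, hxc⟩ := ((hev.and hev2).and self_mem_nhdsWithin).exists
  have hxc : x < c := hxc; have := hc.green_mul hL hxa.le hxc.le (hc.green_diag_ne_zero hL x)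
  rw [hx1.2, zero_mul, hc.green_symm hL x c] at this; have hzero : green L q.1 k a x = 0 := by grind
  exact absurd (csInf_le hbd (show x ∈ S from ⟨hxa.le, hzero⟩)) (not_le.2 hxc)

lemma Coercive.diagGreen_eq (hc : Coercive L q k) (hax : a ≤ x) (hxb : x ≤ b) : diagGreen L q.1 k x
    = green L q.1 k a x * green L q.1 k b x / green L q.1 k a b := by
  have := hc.green_mul hL hax hxb (hc.green_diag_ne_zero hL x)
  rw [eq_div_iff (hc.green_ne_zero hL a b), diagGreen, mul_comm, this, hc.green_symm hL x b]

lemma pair_sub_left (q₁ q₂ : Hs L (-1)) (hu : HasH1Deriv u u') (hψ : HasH1Deriv ψ ψ') : pair L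
    (q₁ - q₂).1 (fun x => u x * ψ x) = pair L q₁.1 (fun x => u x * ψ x) - pair L q₂.1
    (fun x => u x * ψ x) := by
  unfold pair; rw [← (summable_pair hL q₁ hu hψ).tsum_sub (summable_pair hL q₂ hu hψ)]
  refine tsum_congr fun n => ?_; rw [← sub_mul]; rfl

lemma norm_green_sub_le (h₁ : CoerciveForm L q₁.1 (k ^ 2) ζ) (h₂ : CoerciveForm L q₂.1 (k ^ 2) ζ)
    (x y : ℝ) : ‖green L q₁.1 k x y - green L q₂.1 k x y‖ ≤ 288 * L ^ 2 * ‖ζ‖ ^ 2 * ‖q₁ - q₂‖ := by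
  have c1 : Coercive L q₁ k := ⟨ζ, h₁⟩; have c2 : Coercive L q₂ k := ⟨ζ, h₂⟩
  obtain ⟨u', hu, hu1⟩ := c1.exists_deriv hL x; obtain ⟨v', hv, hv1⟩ := c2.exists_deriv hL y
  have e1 := hu1 _ _ hv; have e2 := hv1 _ _ hu; rw [form_comm] at e2
  have e3 : green L q₁.1 k x y - green L q₂.1 k x y =
      pair L (q₂ - q₁).1 (fun t => green L q₁.1 k x t * green L q₂.1 k y t) := by
    rw [pair_sub_left hL q₂ q₁ hu hv, c2.green_symm hL x y, ← e1, ← e2]; simp only [form]; ring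
  rw [e3]; refine (norm_pair_le hL _ hu hv).trans ?_; have b1 := h₁.sqrt_h1sq_le hu hu1
  have b2 := h₂.sqrt_h1sq_le hv hv1; rw [norm_sub_rev]
  calc _ ≤ 18 * L ^ 2 * ‖q₁ - q₂‖ * ((4 * ‖ζ‖) * (4 * ‖ζ‖)) := by gcongr
    _ = _ := by ring

lemma norm_green_le (h : CoerciveForm L q.1 (k ^ 2) ζ) (x y : ℝ) : ‖green L q.1 k x y‖ ≤ 8 *
    ‖ζ‖ := by
  obtain ⟨u', hu, hu1⟩ := Coercive.exists_deriv hL ⟨ζ, h⟩ x; have := h.sqrt_h1sq_le hu hu1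
  linarith [hu.norm_le y]

omit hL

lemma ae_eq_zero_of_forall_deriv (hf : Integrable f volume)
    (h : ∀ φ φ', HasH1Deriv φ φ' → ∫ x, f x * φ' x = 0) : f =ᵐ[volume] 0 := by
  have hii : ∀ a b : ℝ, IntervalIntegrable f volume a b := fun a b => hf.intervalIntegrable
  have key : ∀ c d s : ℝ, 0 ≤ s → ∫ x in c..(c + s), f x = ∫ x in d..(d + s), f x := by
    intro c d s hs; have h1 := h _ _ (hasH1Deriv_ramp_sub c d hs)
    have e : ∀ c x, f x * rampDeriv c s x = (Ioc c (c + s)).indicator f x := by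
      simp only [rampDeriv, Set.indicator]; grind
    simp only [mul_sub, e] at h1
    rw [integral_sub (hf.indicator measurableSet_Ioc) (hf.indicator measurableSet_Ioc),
      integral_indicator measurableSet_Ioc, integral_indicator measurableSet_Ioc] at h1
    rw [integral_of_le (by linarith), integral_of_le (by linarith)]; exact sub_eq_zero.1 h1
  have hP := IsPrim.primitive hii 0; set F : ℝ → ℂ := fun x => ∫ t in (0 : ℝ)..x, f t with hF
  have hlim : Tendsto F atTop (𝓝 (∫ x in Ioi 0, f x)) :=
    intervalIntegral_tendsto_integral_Ioi 0 hf.integrableOn tendsto_id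
  have hconst : ∀ c s, 0 ≤ s → F (c + s) = F c := by
    intro c s hs
    have h1 : ∀ d, F (d + s) - F d = F (c + s) - F c := fun d => by
      rw [hP.ftc, hP.ftc, key d c s hs]
    have h2 : Tendsto (fun d => F (d + s) - F d) atTop
        (𝓝 ((∫ x in Ioi 0, f x) - ∫ x in Ioi 0, f x)) :=
      (hlim.comp (tendsto_atTop_add_const_right _ s tendsto_id)).sub hlim
    simp only [h1, sub_self] at h2; exact sub_eq_zero.1 (tendsto_nhds_unique tendsto_const_nhds h2)
  have hF0 : ∀ x, F x = F 0 := fun x => by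
    rcases le_total 0 x with hx | hx
    · simpa using hconst 0 x hx
    · simpa using (hconst x (-x) (by linarith)).symm
  filter_upwards [hP.ae_hasDerivAt] with x hx
  have hc : HasDerivAt F 0 x := by
    rw [show F = fun _ => F 0 from funext hF0]; exact hasDerivAt_const _ _
  exact hx.unique hc

lemma Coercive.wronskian (hL : 1 ≤ L) (hc : Coercive L q k) (hab : a ≤ b)
    (hu : HasH1Deriv (green L q.1 k a) u') (hv : HasH1Deriv (green L q.1 k b) v') (hu1 : ∀ ψ ψ',
    HasH1Deriv ψ ψ' → form L q.1 (k ^ 2) (green L q.1 k a) u' ψ ψ' = ψ a) (hv1 : ∀ ψ ψ', HasH1Deriv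
    ψ ψ' → form L q.1 (k ^ 2) (green L q.1 k b) v' ψ ψ' = ψ b) : ∀ᵐ x, x ∈ Ioc a b → u' x * green L
    q.1 k b x - green L q.1 k a x * v' x = -green L q.1 k a b := by
  set U := green L q.1 k a with hU; set V := green L q.1 k b with hV
  set f : ℝ → ℂ := fun x => u' x * V x - U x * v' x + (Ioc a b).indicator (fun _ => U b) x with hf
  have hI : Integrable ((Ioc a b).indicator fun _ => U b) volume :=
    (integrable_indicator_iff measurableSet_Ioc).2 (by simp)
  have hfi : Integrable f volume := ((integrable_mul_two hu.memLp_deriv hv.memLp).sub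
      (integrable_mul_two hu.memLp hv.memLp_deriv)).add hI
  have h0 := ae_eq_zero_of_forall_deriv hfi fun φ φ' hφ => by
    have e1 := hu1 _ _ (hv.mul hφ); have e2 := hv1 _ _ (hu.mul hφ)
    have hs : V a = U b := hc.green_symm hL b a
    have e3 : (∫ x, u' x * dmul V v' φ φ' x) - ∫ x, v' x * dmul U u' φ φ' x
        = U b * (φ a - φ b) := by
      have p1 : pair L q.1 (fun x => U x * (V x * φ x)) = pair L q.1 (fun x => V x * (U x * φ x)) :=
        pair_congr _ _ fun x => by ring
      have p2 : ∫ x, U x * (V x * φ x) = ∫ x, V x * (U x * φ x) := by congr 1; ext x; ring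
      simp only [form, p1, p2] at e1 e2; grind
    have i1 := integrable_mul_two hu.memLp_deriv (hv.mul hφ).memLp_deriv
    have i2 := integrable_mul_two hv.memLp_deriv (hu.mul hφ).memLp_deriv
    rw [← integral_sub i1 i2] at e3
    have e0 : ∀ x, (Ioc a b).indicator (fun _ => U b) x * φ' x =
        (Ioc a b).indicator (fun x => U b * φ' x) x := by simp only [Set.indicator]; grind
    have i3 := (integrable_indicator_iff measurableSet_Ioc).2 ((hφ.isPrim.1 a b).1.const_mul (U b))
    have e4 : ∫ x, (Ioc a b).indicator (fun x => U b * φ' x) x = U b * (φ b - φ a) := by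
      rw [hφ.ftc a b, integral_of_le hab, ← integral_const_mul, integral_indicator measurableSet_Ioc]
    have : ∀ x, f x * φ' x = (u' x * dmul V v' φ φ' x - v' x * dmul U u' φ φ' x)
        + (Ioc a b).indicator (fun x => U b * φ' x) x := fun x => by
      simp only [hf, dmul, ← e0]; ring
    simp only [this]
    rw [integral_add (f := fun x => u' x * dmul V v' φ φ' x - v' x * dmul U u' φ φ' x)
      (i1.sub i2) i3, e3, e4]
    ring
  filter_upwards [h0] with x hx hxm
  simp only [hf, indicator_of_mem hxm, Pi.zero_apply] at hx; linear_combination hx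

end green

end

section

/-- Translation `q(x) ↦ q(x + a)` of a distribution on the circle. -/
def trans (L a : ℝ) (c : ℤ → ℂ) (n : ℤ) : ℂ := expi L n a * c n

lemma trans_two_mul (hL : 0 < L) (c : ℤ → ℂ) : trans L (2 * L) c = c := by
  ext n; have := expi_periodic hL n 0; rw [zero_add] at this
  rw [trans, this]; simp [expi]

lemma expi_add_right (L : ℝ) (n : ℤ) (x y : ℝ) : expi L n (x + y) = expi L n x * expi L n y := by
  simp only [expi, ← exp_add]; congr 1; push_cast; ring

lemma pair_trans (L a : ℝ) (q : ℤ → ℂ) (h : ℝ → ℂ) : pair L (trans L a q) (fun x => h (x + a)) =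
    pair L q h := by
  unfold pair; refine tsum_congr fun n => ?_
  rw [trans, mul_comm (expi L n a), mul_assoc, ← integral_const_mul,
    ← integral_add_right_eq_self (fun x : ℝ => exp (I * freq L n * x) * h x) a]
  congr 2; ext x; have := expi_add_right L n x a; simp only [expi] at this ⊢
  rw [this]; ring

lemma HasH1Deriv.translate (h : HasH1Deriv u u') (a : ℝ) : HasH1Deriv (fun x => u (x + a))
    (fun x => u' (x + a)) := by
  have hm := measurePreserving_add_right (volume : Measure ℝ) a
  refine ⟨h.memLp.comp_measurePreserving hm, h.memLp_deriv.comp_measurePreserving hm, fun b c => ?_⟩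
  rw [h.ftc, intervalIntegral.integral_comp_add_right]

lemma IsGreen.translate {q : ℤ → ℂ} (a : ℝ) (h : IsGreen L q k (y + a) u) : IsGreen L (trans L a q)
    k y (fun x => u (x + a)) := by
  obtain ⟨u', hu, h⟩ := h; refine ⟨_, hu.translate a, fun ψ ψ' hψ => ?_⟩
  have := h _ _ (hψ.translate (-a)); simp only [add_neg_cancel_right] at this
  rw [← this, ← pair_trans L a q, ← integral_add_right_eq_self (fun x => u' x * ψ' (x + -a)) a,
    ← integral_add_right_eq_self (fun x => u x * ψ (x + -a)) a]
  simp only [add_neg_cancel_right]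

lemma pair_conj (q : Hs L s) (h : ℝ → ℂ) : pair L q.1 (fun x => conj (h x)) = conj
    (pair L q.1 h) := by
  unfold pair; rw [conj_tsum, ← (Equiv.neg ℤ).tsum_eq]; refine tsum_congr fun n => ?_
  rw [Equiv.neg_apply, q.conj_coeff, map_mul, ← integral_conj]; congr 2; ext x
  have := conj_expi L n x; simp only [expi] at this; rw [map_mul, this]

lemma IsGreen.conj (h : IsGreen L q.1 k y u) : IsGreen L q.1 (conj k) y (fun x => conj (u x)) := by
  obtain ⟨u', hu, h⟩ := h; refine ⟨_, hu.conj, fun ψ ψ' hψ => ?_⟩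
  have := congrArg conj (h _ _ hψ.conj); simp only [conj_conj] at this
  rw [← this, map_add, map_add, map_mul, ← pair_conj, ← integral_conj, ← integral_conj, map_pow]
  simp only [map_mul, conj_conj]

section green
lemma Coercive.green_eq (hL : 1 ≤ L) (hc : Coercive L q k) (h : IsGreen L q.1 k y u) :
    u = green L q.1 k y := (hc.existsUnique hL y).unique h (hc.isGreen hL y)

lemma CoerciveForm.conj (hc : CoerciveForm L q.1 (k ^ 2) ζ) : CoerciveForm L q.1 ((conj k) ^ 2)
    (starRingEnd ℂ ζ) := by
  refine ⟨by simpa using hc.ne_zero, fun u u' hu => (hc.le _ _ hu.conj).trans' ?_ |>.trans_eq ?_⟩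
  · rw [h1sq_conj]
  · rw [← Complex.conj_re, map_mul, form]; congr 2
    rw [form, map_add, map_add, map_mul, ← pair_conj, ← integral_conj, ← integral_conj, map_pow]
    simp only [map_mul, conj_conj]

variable (hL : 1 ≤ L)
include hL

lemma Coercive.green_conj (hc : Coercive L q k) (x y : ℝ) : green L q.1 (conj k) x y = conj
    (green L q.1 k x y) := by
  have hc' : Coercive L q (conj k) := hc.elim fun ζ h => ⟨_, h.conj⟩
  exact (congrFun (hc'.green_eq hL (hc.isGreen hL x).conj) y).symm

lemma Coercive.green_trans (hc : Coercive L q k) {r : Hs L (-1)} (hr : r.1 = trans L a q.1)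
    (hc' : Coercive L r k) (x y : ℝ) : green L r.1 k x y = green L q.1 k (x + a) (y + a) := by
  have h := (hc.isGreen hL (x + a)).translate a; rw [← hr] at h
  exact (congrFun (hc'.green_eq hL h) y).symm

lemma Coercive.green_periodic (hc : Coercive L q k) (x y : ℝ) : green L q.1 k (x + 2 * L)
    (y + 2 * L) = green L q.1 k x y :=
  (hc.green_trans hL (trans_two_mul (by linarith) q.1).symm hc x y).symm

lemma Coercive.diagGreen_periodic (hc : Coercive L q k) :
    Periodic (diagGreen L q.1 k) (2 * L) := fun x => hc.green_periodic hL x x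

lemma Coercive.norm_multiplier_lt (hc : Coercive L q k) (y : ℝ) : ‖green L q.1 k y (y + 2 * L) /
    green L q.1 k y y‖ < 1 := by
  set ρ := green L q.1 k y (y + 2 * L) / green L q.1 k y y with hρ
  set c := green L q.1 k y y with hcdef; have hc0 : c ≠ 0 := hc.green_diag_ne_zero hL y
  have hper : ∀ n : ℕ, ∀ a b : ℝ,
      green L q.1 k (a + n * (2 * L)) (b + n * (2 * L)) = green L q.1 k a b := by
    intro n
    induction n with
    | zero => simp
    | succ n ih =>
      intro a b; rw [← ih a b, ← hc.green_periodic hL (a + n * (2 * L))]; push_cast; ring_nf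
  have hpow : ∀ n : ℕ, green L q.1 k y (y + n * (2 * L)) = c * ρ ^ n := by
    intro n
    induction n with
    | zero => simp [hcdef]
    | succ n ih =>
      have h1 : y ≤ y + n * (2 * L) := by nlinarith
      have h2 := hc.green_mul hL h1 (x := y + (n + 1 : ℕ) * (2 * L)) (by push_cast; linarith)
        (hc.green_diag_ne_zero hL _)
      rw [hper n y y, show y + ((n + 1 : ℕ) : ℝ) * (2 * L) = (y + 2 * L) + n * (2 * L) by
        grind] at h2
      grind
  by_contra hge; rw [not_lt] at hge; obtain ⟨u', hu, -⟩ := hc.exists_deriv hL y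
  set D := ptDensity (2 * L) (green L q.1 k y) u'; have hD := hu.integrable_ptDensity (2 * L)
  have hlow : ∀ n : ℕ, ‖c‖ ^ 2 ≤ ∫ t in (y + n * (2 * L))..(y + (n + 1 : ℕ) * (2 * L)), D t := by
    intro n; have h1 := hu.norm_sq_le (T := 2 * L) (by linarith) (y + n * (2 * L))
    rw [hpow n, norm_mul, norm_pow] at h1
    rw [integral_of_le (by push_cast; linarith),
      show y + ((n + 1 : ℕ) : ℝ) * (2 * L) = y + n * (2 * L) + 2 * L by push_cast; ring]
    refine le_trans ?_ h1; gcongr; exact le_mul_of_one_le_right (norm_nonneg _) (one_le_pow₀ hge)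
  have hG := intervalIntegral_tendsto_integral_Ioi y hD.integrableOn
    (tendsto_atTop_add_const_left _ y
      (tendsto_natCast_atTop_atTop.atTop_mul_const (show 0 < 2 * L by linarith)))
  have h := (hG.comp (tendsto_add_atTop_nat 1)).sub hG; rw [sub_self] at h
  refine (pow_pos (norm_pos_iff.2 hc0) 2).not_ge (ge_of_tendsto' h fun n => (hlow n).trans ?_)
  rw [← integral_interval_sub_left hD.intervalIntegrable hD.intervalIntegrable]; rfl

end green

/-! ### Unfolding -/

/-- A partition of unity on the circle. -/
def hat (L x : ℝ) : ℂ := (2 * L : ℂ)⁻¹ * (ramp (-(2 * L)) (2 * L) x - ramp 0 (2 * L) x)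

/-- The derivative of `hat`. -/
def hatDeriv (L x : ℝ) : ℂ :=
  (2 * L : ℂ)⁻¹ * (rampDeriv (-(2 * L)) (2 * L) x - rampDeriv 0 (2 * L) x)

lemma hasH1Deriv_hat (hL : 0 < L) : HasH1Deriv (hat L) (hatDeriv L) :=
  (hasH1Deriv_ramp_sub _ _ (by linarith)).const_mul _

lemma hat_of_notMem (hL : 0 < L) (hx : x ∉ Ioo (-(2 * L)) (2 * L)) : hat L x = 0 := by
  simp only [Set.mem_Ioo, not_and_or, not_lt] at hx
  rcases hx with hx | hx
  · rw [hat, ramp_of_le hx, ramp_of_le (by linarith), sub_self, mul_zero]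
  · rw [hat, ramp_of_ge (by linarith) (by linarith), ramp_of_ge (by linarith) (by linarith),
      sub_self, mul_zero]

lemma hatDeriv_of_notMem (hL : 0 < L) (hx : x ∉ Ioc (-(2 * L)) (2 * L)) : hatDeriv L x = 0 := by
  simp only [hatDeriv, rampDeriv, Set.indicator]; grind

lemma hat_add (hL : 0 < L) (hx : x ∈ Ioc 0 (2 * L)) : hat L x + hat L (x - 2 * L) = 1 := by
  obtain ⟨h1, h2⟩ := hx; have : (L : ℂ) ≠ 0 := by exact_mod_cast hL.ne'
  rw [hat, hat, ramp_of_ge (by linarith) (by linarith), ramp_of_mem h1.le (by linarith),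
    ramp_of_mem (by linarith) (by linarith), ramp_of_le (by linarith)]
  push_cast; field_simp; ring

lemma hatDeriv_add (hx : x ∈ Ioc 0 (2 * L)) : hatDeriv L x + hatDeriv L (x - 2 * L) = 0 := by
  simp only [hatDeriv, rampDeriv, Set.indicator]; grind

lemma integral_mul_of_partition (hL : 0 < L) {χ : ℝ → ℂ} {c : ℂ} (hper : Periodic F (2 * L))
    (hi : ∀ a b : ℝ, IntervalIntegrable (fun x => F x * χ x) volume a b)
    (hs : ∀ x ∉ Ioc (-(2 * L)) (2 * L), χ x = 0)
    (hadd : ∀ x ∈ Ioc 0 (2 * L), χ x + χ (x - 2 * L) = c) : Integrable (fun x => F x * χ x) volume ∧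
    ∫ x, F x * χ x = c * ∫ x in (-L)..L, F x := by
  have hle : -(2 * L) ≤ 2 * L := by linarith
  have hs' : ∀ x ∉ Ioc (-(2 * L)) (2 * L), F x * χ x = 0 := fun x hx => by rw [hs x hx, mul_zero]
  constructor
  · rw [← integrableOn_univ]
    exact ((intervalIntegrable_iff_integrableOn_Ioc_of_le hle).1 (hi _ _)).of_forall_sdiff_eq_zero
      .univ fun x hx => hs' x hx.2
  have h := intervalIntegral.integral_comp_sub_right (a := 0) (b := 2 * L) (fun x => F x * χ x) (2 * L)
  have i := (hi (0 - 2 * L) (2 * L - 2 * L)).comp_sub_right (2 * L)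
  have e := hper.intervalIntegral_add_eq (-L) 0; rw [show -L + 2 * L = L by ring, zero_add] at e
  simp only [hper.sub_eq, sub_add_cancel] at h i; rw [zero_sub, sub_self] at h
  rw [← setIntegral_eq_integral_of_forall_compl_eq_zero hs', ← integral_of_le hle,
    ← integral_add_adjacent_intervals (hi _ 0) (hi 0 _), ← h, e,
    ← intervalIntegral.integral_add i (hi _ _), ← intervalIntegral.integral_const_mul]
  refine intervalIntegral.integral_congr_ae (.of_forall fun x hx => ?_)
  rw [uIoc_of_le (by linarith)] at hx; rw [← hadd x hx]; ring

lemma integral_mul_hat (hL : 0 < L) (hper : Periodic F (2 * L))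
    (hF : ∀ a b : ℝ, IntervalIntegrable F volume a b) : Integrable (fun x => F x * hat L x) volume ∧
    ∫ x, F x * hat L x = ∫ x in (-L)..L, F x := by
  simpa using! integral_mul_of_partition hL hper (fun a b =>
    (hF a b).mul_continuousOn (hasH1Deriv_hat hL).isPrim.continuous.continuousOn)
    (fun x hx => hat_of_notMem hL fun h => hx ⟨h.1, h.2.le⟩) fun x => hat_add hL

lemma integral_mul_hatDeriv (hL : 0 < L) (hper : Periodic F (2 * L))
    (hF : ∀ a b : ℝ, IntervalIntegrable F volume a b) : Integrable (fun x => F x * hatDeriv L x)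
    volume ∧ ∫ x, F x * hatDeriv L x = 0 := by
  have hb : ∀ x, ‖hatDeriv L x‖ ≤ ‖(2 * L : ℂ)⁻¹‖ := fun x => by
    simp only [hatDeriv, rampDeriv, Set.indicator]
    split_ifs <;> simp
  have hm := (hasH1Deriv_hat hL).memLp_deriv.1
  simpa using! integral_mul_of_partition hL hper (fun a b =>
    ⟨Integrable.mul_bdd (hF a b).1 hm.restrict (.of_forall hb),
      Integrable.mul_bdd (hF a b).2 hm.restrict (.of_forall hb)⟩)
    (fun x hx => hatDeriv_of_notMem hL hx) fun x => hatDeriv_add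

end

section

/-- The logarithmic derivatives of the Weyl solutions, for `σ = 1` and `σ = -1`. -/
def weyl (L : ℝ) (q : ℤ → ℂ) (k σ : ℂ) (x : ℝ) : ℂ :=
  (deriv (diagGreen L q k) x + σ) / (2 * diagGreen L q k x)

/-- The Floquet multiplier. -/
def mult (L : ℝ) (q : ℤ → ℂ) (k : ℂ) : ℂ := green L q k (-L) L / green L q k (-L) (-L)

/-- `v' + v² = q + λ` in the sense of distributions on the circle. -/
structure IsRiccati (L : ℝ) (q : ℤ → ℂ) (lam : ℂ) (v : ℝ → ℂ) : Prop where
  l2Per : L2Per L v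
  eqn : ∀ n, ddx L (coeffs L v) n + coeffs L (fun x => v x ^ 2) n = q n + if n = 0 then lam else 0

lemma L2Per.integrable_mul (hL : 0 < L) (hu : L2Per L u) (hv : L2Per L v) (a b : ℝ) :
    IntervalIntegrable (fun x => u x * v x) volume a b := by
  refine (hu.periodic.mul hv.periodic).intervalIntegrable (by linarith) (t := -L) ?_ a b
  rw [show -L + 2 * L = L by ring, intervalIntegrable_iff_perMeasure hL]
  exact integrable_mul_two hu.memLp hv.memLp

lemma HasH1Deriv.div (hu : HasH1Deriv u u') (hv : HasH1Deriv v v') (h0 : ∀ x, v x ≠ 0)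
    (hs : ∀ x, x ∉ Icc a b → u x = 0) (hs' : ∀ x, x ∉ Icc a b → u' x = 0) : HasH1Deriv
    (fun x => u x * (v x)⁻¹) (fun x => u' x * (v x)⁻¹ - u x * ((v x)⁻¹ * (v x)⁻¹ * v' x)) := by
  have hci : Continuous fun x => (v x)⁻¹ := hv.isPrim.continuous.inv₀ h0
  obtain ⟨B, hB⟩ := isCompact_Icc.exists_bound_of_continuousOn (s := Icc a b) hci.continuousOn
  have hP := (hu.isPrim.mul (hv.isPrim.inv h0)).congr (g' := fun x => u' x * (v x)⁻¹ -
    u x * ((v x)⁻¹ * (v x)⁻¹ * v' x)) (fun _ => rfl) fun x => by ring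
  have key : ∀ {f : ℝ → ℂ}, MemLp f 2 volume → (∀ x, x ∉ Icc a b → f x = 0) →
      MemLp (fun x => f x * (v x)⁻¹) 2 volume := by
    intro f hf h
    refine hf.of_le_mul (c := B) (hf.1.mul hci.aestronglyMeasurable) (.of_forall fun x => ?_)
    by_cases hx : x ∈ Icc a b
    · rw [norm_mul, mul_comm]; gcongr; exact hB x hx
    · simp [h x hx]
  refine hP.hasH1Deriv (key hu.memLp hs) ((key hu.memLp_deriv hs').sub ?_)
  refine hv.memLp_deriv.of_le_mul (c := (2 * √(h1sq u u')) * (B * B))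
    (hu.memLp.1.mul ((hci.aestronglyMeasurable.mul hci.aestronglyMeasurable).mul hv.memLp_deriv.1))
    (.of_forall fun x => ?_)
  by_cases hx : x ∈ Icc a b
  · rw [norm_mul, norm_mul, norm_mul, mul_assoc _ (B * B)]; have := hB x hx
    have hB0 : 0 ≤ B := (norm_nonneg _).trans this; gcongr; exact hu.norm_le x
  · rw [hs x hx, zero_mul, norm_zero]; have : 0 ≤ B * B := mul_self_nonneg B; positivity

section green
variable (hL : 1 ≤ L)
include hL

lemma Coercive.deriv_diagGreen_ae (hc : Coercive L q k) (hu : HasH1Deriv (green L q.1 k a) u')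
    (hv : HasH1Deriv (green L q.1 k b) v') : ∀ᵐ x, x ∈ Ioc a b → deriv (diagGreen L q.1 k) x =
    (green L q.1 k a b)⁻¹ * (u' x * green L q.1 k b x + green L q.1 k a x * v' x) := by
  have hP := (hu.isPrim.mul hv.isPrim).const_mul (green L q.1 k a b)⁻¹
  have hne : ∀ᵐ x : ℝ, x ≠ b := by simp [ae_iff]
  filter_upwards [hP.deriv_ae, hne] with x hx hxb hxm
  rw [← hx]; refine EventuallyEq.deriv_eq ?_
  filter_upwards [Ioo_mem_nhds hxm.1 (lt_of_le_of_ne hxm.2 hxb)] with t ht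
  rw [hc.diagGreen_eq hL ht.1.le ht.2.le]; ring

lemma Coercive.isPrim_diagGreen (hc : Coercive L q k) : IsPrim (diagGreen L q.1 k)
    (deriv (diagGreen L q.1 k)) := by
  have key : ∀ a b : ℝ, a ≤ b → IntervalIntegrable (deriv (diagGreen L q.1 k)) volume a b ∧
      diagGreen L q.1 k b - diagGreen L q.1 k a = ∫ x in a..b, deriv (diagGreen L q.1 k) x := by
    intro a b hab; obtain ⟨u', hu, -⟩ := hc.exists_deriv hL a
    obtain ⟨v', hv, -⟩ := hc.exists_deriv hL b
    have hP := (hu.isPrim.mul hv.isPrim).const_mul (green L q.1 k a b)⁻¹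
    have hae := hc.deriv_diagGreen_ae hL hu hv; constructor
    · refine (hP.1 a b).congr_ae ?_; rw [uIoc_of_le hab]
      filter_upwards [ae_restrict_mem measurableSet_Ioc, ae_restrict_of_ae hae] with x hx h
      exact (h hx).symm
    · rw [hc.diagGreen_eq hL hab le_rfl, hc.diagGreen_eq hL le_rfl hab]
      rw [intervalIntegral.integral_congr_ae (g := fun x => (green L q.1 k a b)⁻¹ *
        (u' x * green L q.1 k b x + green L q.1 k a x * v' x))]
      · rw [← hP.ftc]; ring
      · grind
  refine ⟨fun a b => ?_, fun a b => ?_⟩ <;> rcases le_total a b with hab | hab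
  · exact (key a b hab).1
  · exact (key b a hab).1.symm
  · exact (key a b hab).2
  · rw [integral_symm, ← (key b a hab).2]; ring

lemma Coercive.diagGreen_ne_zero (hc : Coercive L q k) (x : ℝ) :
    diagGreen L q.1 k x ≠ 0 := hc.green_diag_ne_zero hL x

lemma Coercive.two_mul_weyl (hc : Coercive L q k) (σ : ℂ) (x : ℝ) : 2 * diagGreen L q.1 k x * weyl L
    q.1 k σ x = deriv (diagGreen L q.1 k) x + σ :=
  mul_div_cancel₀ _ (mul_ne_zero two_ne_zero (hc.diagGreen_ne_zero hL x))

lemma Coercive.weyl_sub (hc : Coercive L q k) (x : ℝ) : weyl L q.1 k 1 x - weyl L q.1 k (-1) x =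
    (diagGreen L q.1 k x)⁻¹ := by
  have := hc.diagGreen_ne_zero hL x; rw [weyl, weyl]; field_simp; ring

lemma Coercive.deriv_diagGreen (hc : Coercive L q k) (x : ℝ) : deriv (diagGreen L q.1 k) x =
    (weyl L q.1 k 1 x + weyl L q.1 k (-1) x) * diagGreen L q.1 k x := by
  have := hc.diagGreen_ne_zero hL x; rw [weyl, weyl]; field_simp; ring

lemma Coercive.weyl_one_ae (hc : Coercive L q k) (hab : a ≤ b)
    (hv : HasH1Deriv (green L q.1 k b) v') (hv1 : ∀ ψ ψ', HasH1Deriv ψ ψ' → form L q.1 (k ^ 2)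
    (green L q.1 k b) v' ψ ψ' = ψ b) : ∀ᵐ x, x ∈ Ioc a b → weyl L q.1 k 1 x = v' x / green L q.1 k b
    x := by
  obtain ⟨u', hu, hu1⟩ := hc.exists_deriv hL a
  filter_upwards [hc.deriv_diagGreen_ae hL hu hv, hc.wronskian hL hab hu hv hu1 hv1] with x h1 h2 hx
  have h3 := hc.green_ne_zero hL a x; have h4 := hc.green_ne_zero hL b x
  have h5 := hc.green_ne_zero hL a b; rw [weyl, h1 hx, hc.diagGreen_eq hL hx.1.le hx.2]; field_simp
  linear_combination h2 hx

lemma Coercive.weyl_neg_one_ae (hc : Coercive L q k) (hab : a ≤ b)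
    (hu : HasH1Deriv (green L q.1 k a) u') (hu1 : ∀ ψ ψ', HasH1Deriv ψ ψ' → form L q.1 (k ^ 2)
    (green L q.1 k a) u' ψ ψ' = ψ a) : ∀ᵐ x, x ∈ Ioc a b → weyl L q.1 k (-1) x = u' x / green L q.1
    k a x := by
  obtain ⟨v', hv, hv1⟩ := hc.exists_deriv hL b
  filter_upwards [hc.deriv_diagGreen_ae hL hu hv, hc.wronskian hL hab hu hv hu1 hv1] with x h1 h2 hx
  have h3 := hc.green_ne_zero hL a x; have h4 := hc.green_ne_zero hL b x
  have h5 := hc.green_ne_zero hL a b; rw [weyl, h1 hx, hc.diagGreen_eq hL hx.1.le hx.2]; field_simp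
  linear_combination -h2 hx

lemma Coercive.exists_weyl (hc : Coercive L q k) (hσ : σ = 1 ∨ σ = -1) : ∃ u', HasH1Deriv
    (green L q.1 k (2 * L * σ.re)) u' ∧ (∀ ψ ψ', HasH1Deriv ψ ψ' → form L q.1 (k ^ 2)
    (green L q.1 k (2 * L * σ.re)) u' ψ ψ' = ψ (2 * L * σ.re)) ∧ ∀ᵐ x, x ∈ Ioc (-(2 * L)) (2 * L) →
    weyl L q.1 k σ x = u' x / green L q.1 k (2 * L * σ.re) x := by
  obtain ⟨u', hu, hu1⟩ := hc.exists_deriv hL (2 * L * σ.re); refine ⟨u', hu, hu1, ?_⟩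
  rcases hσ with rfl | rfl
  · simp only [one_re, mul_one] at hu hu1 ⊢; exact hc.weyl_one_ae hL (by linarith) hu hu1
  · simp only [neg_re, one_re, mul_neg, mul_one] at hu hu1 ⊢
    exact hc.weyl_neg_one_ae hL (by linarith) hu hu1

lemma Coercive.l2Per_weyl (hc : Coercive L q k) (hσ : σ = 1 ∨ σ = -1) : L2Per L
    (weyl L q.1 k σ) := by
  obtain ⟨u', hu, -, hae⟩ := hc.exists_weyl hL hσ; have hper := hc.diagGreen_periodic hL
  have hm : Measurable (weyl L q.1 k σ) := ((measurable_deriv _).add_const _).div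
    ((hc.isPrim_diagGreen hL).continuous.measurable.const_mul _)
  refine ⟨fun x => ?_, hm, ?_⟩
  · have : deriv (diagGreen L q.1 k) (x + 2 * L) = deriv (diagGreen L q.1 k) x := by
      rw [← deriv_comp_add_const]; congr 1; ext t; exact hper t
    rw [weyl, weyl, this, hper x]
  · have hci : Continuous fun x => (green L q.1 k (2 * L * σ.re) x)⁻¹ :=
      hu.isPrim.continuous.inv₀ fun x => hc.green_ne_zero hL _ x
    obtain ⟨B, hB⟩ := isCompact_Icc.exists_bound_of_continuousOn (s := Icc (-L) L) hci.continuousOn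
    refine (hu.memLp_deriv.restrict (Ioc (-L) L)).of_le_mul (c := B) hm.aestronglyMeasurable ?_
    filter_upwards [ae_restrict_mem measurableSet_Ioc, ae_restrict_of_ae hae] with x hx h
    rw [h ⟨by linarith [hx.1], by linarith [hx.2]⟩, div_eq_mul_inv, norm_mul, mul_comm]; gcongr
    exact hB x ⟨hx.1.le, hx.2⟩

lemma Coercive.isRiccati (hc : Coercive L q k) (hσ : σ = 1 ∨ σ = -1) : IsRiccati L q.1 (k ^ 2)
    (weyl L q.1 k σ) := by
  have hL0 : 0 < L := by linarith
  have hLc : (L : ℂ) ≠ 0 := by exact_mod_cast hL0.ne'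
  refine ⟨hc.l2Per_weyl hL hσ, fun n => ?_⟩; obtain ⟨u', hu, hu1, hae⟩ := hc.exists_weyl hL hσ
  have hV := hc.l2Per_weyl hL hσ; set y := 2 * L * σ.re with hy; set U := green L q.1 k y
  set V := weyl L q.1 k σ; set e := expi L (-n) with he
  have hU0 : ∀ x, U x ≠ 0 := hc.green_ne_zero hL y
  have hde : ∀ x, HasDerivAt e (I * freq L (-n) * e x) x := hasDerivAt_expi L (-n)
  set d : ℂ := I * freq L (-n); have hh := hasH1Deriv_hat hL0
  have hP : IsPrim (fun x => e x * hat L x) (fun x => d * e x * hat L x + e x * hatDeriv L x) :=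
    hh.isPrim.mul_expi L (-n)
  have hmul : ∀ {f : ℝ → ℂ}, MemLp f 2 volume → MemLp (fun x => e x * f x) 2 volume := by
    intro f hf
    refine hf.of_le_mul (c := 1) ((continuous_expi L (-n)).aestronglyMeasurable.mul hf.1)
      (.of_forall fun x => ?_)
    rw [norm_mul, norm_expi]
  have hχ : HasH1Deriv (fun x => e x * hat L x)
      (fun x => d * e x * hat L x + e x * hatDeriv L x) := by
    refine hP.hasH1Deriv (hmul hh.memLp) ?_
    have := ((hmul hh.memLp).const_mul d).add (hmul hh.memLp_deriv)
    refine (memLp_congr_ae (.of_forall fun x => ?_)).1 this; simp only [Pi.add_apply]; ring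
  have hnot : ∀ x, x ∉ Icc (-(2 * L)) (2 * L) → hat L x = 0 ∧ hatDeriv L x = 0 := fun x hx =>
    ⟨hat_of_notMem hL0 fun h => hx ⟨h.1.le, h.2.le⟩,
      hatDeriv_of_notMem hL0 fun h => hx ⟨h.1.le, h.2⟩⟩
  have hψ := hχ.div hu hU0 (a := -(2 * L)) (b := 2 * L) (fun x hx => by rw [(hnot x hx).1, mul_zero])
    (fun x hx => by rw [(hnot x hx).1, (hnot x hx).2]; ring)
  have key := hu1 _ _ hψ
  have hyn : hat L y = 0 := hat_of_notMem hL0 (by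
    rcases hσ with h | h <;> simp [hy, h])
  rw [hyn, mul_zero, zero_mul] at key
  have c1 : ∀ x, U x * (e x * hat L x * (U x)⁻¹) = e x * hat L x := fun x => by
    have := hU0 x; field_simp
  have hae2 : ∀ᵐ x, u' x * ((d * e x * hat L x + e x * hatDeriv L x) * (U x)⁻¹ -
      e x * hat L x * ((U x)⁻¹ * (U x)⁻¹ * u' x)) = (d * (e x * V x) * hat L x +
        e x * V x * hatDeriv L x) - e x * V x ^ 2 * hat L x := by
    filter_upwards [hae] with x hx
    by_cases hm : x ∈ Ioc (-(2 * L)) (2 * L)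
    · rw [hx hm]; ring
    · rw [hatDeriv_of_notMem hL0 hm, hat_of_notMem hL0 fun h => hm ⟨h.1, h.2.le⟩]; ring
  rw [form, integral_congr_ae hae2] at key; simp only [c1] at key
  have hper := expi_periodic hL0 (-n)
  have hV2 : ∀ a b : ℝ, IntervalIntegrable (fun x => V x ^ 2) volume a b := fun a b => by
    simpa only [sq] using hV.integrable_mul hL0 hV a b
  have F1 := integral_mul_hat hL0 (F := fun x => e x * V x) (hper.mul hV.periodic)
    fun a b => intervalIntegrable_expi_mul (hV.intervalIntegrable hL0 a b) _
  have F2 := integral_mul_hatDeriv hL0 (F := fun x => e x * V x) (hper.mul hV.periodic)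
    fun a b => intervalIntegrable_expi_mul (hV.intervalIntegrable hL0 a b) _
  have F3 := integral_mul_hat hL0 (F := fun x => e x * V x ^ 2)
    (hper.mul (fun x => by simp only [hV.periodic x]))
    fun a b => intervalIntegrable_expi_mul (hV2 a b) _
  have F4 : ∀ m : ℤ, ∫ x, expi L m x * hat L x = if m = 0 then 2 * (L : ℂ) else 0 := by
    intro m
    rw [(integral_mul_hat hL0 (expi_periodic hL0 m)
      fun a b => (continuous_expi L m).intervalIntegrable a b).2]
    have := coeffs_const hL0 1 (-m); rw [coeffs_eq, neg_neg] at this; grind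
  have F6 : ∫ x, e x * hat L x = if n = 0 then 2 * (L : ℂ) else 0 := by simp [*]
  have F5 : pair L q.1 (fun x => e x * hat L x) = q.1 n * (2 * L) := by
    have : ∀ m : ℤ, ∫ x : ℝ, exp (I * freq L m * x) * (e x * hat L x) =
        if m = n then 2 * (L : ℂ) else 0 := fun m => by
      have h4 := F4 (m + -n); simp only [add_neg_eq_zero] at h4; rw [← h4]
      congr 1; ext x; rw [expi_add, ← mul_assoc]; rfl
    unfold pair; simp only [this]; simp
  have i1 : Integrable (fun x => d * (e x * V x) * hat L x) volume := by
    simpa only [mul_assoc] using F1.1.const_mul d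
  rw [integral_sub (f := fun x => d * (e x * V x) * hat L x + e x * V x * hatDeriv L x)
    (i1.add F2.1) F3.1, integral_add i1 F2.1, F2.2, F3.2, F5, F6] at key
  have e1 : ∫ x, d * (e x * V x) * hat L x = d * ∫ x in (-L)..L, e x * V x := by
    rw [← F1.2, ← integral_const_mul]; congr 1; ext x; ring
  rw [e1] at key; rw [ddx, coeffs_eq, coeffs_eq, ← he]
  have hd : d = -(I * freq L n) := by simp only [d, freq_neg]; push_cast; ring
  grind

lemma Coercive.exp_integral_eq (hc : Coercive L q k) (hσ : σ = 1 ∨ σ = -1) : exp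
    (∫ x in (-L)..L, weyl L q.1 k σ x) = green L q.1 k (2 * L * σ.re) L / green L q.1 k
    (2 * L * σ.re) (-L) := by
  obtain ⟨u', hu, -, hae⟩ := hc.exists_weyl hL hσ; set U := green L q.1 k (2 * L * σ.re) with hU
  have hU0 : ∀ x, U x ≠ 0 := hc.green_ne_zero hL _
  have h1 := IsPrim.eq_mul_exp (y := U) (a := fun x => u' x * (U x)⁻¹)
    (fun b c => (hu.isPrim.1 b c).mul_continuousOn (hu.isPrim.continuous.inv₀ hU0).continuousOn)
    (hu.isPrim.congr (fun _ => rfl) fun x => by have := hU0 x; field_simp) (-L) L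
  rw [h1, mul_comm, mul_div_assoc, div_self (hU0 _), mul_one]; congr 1
  refine intervalIntegral.integral_congr_ae ?_
  filter_upwards [hae] with x h hx
  grind

lemma Coercive.mult_ne_zero (hc : Coercive L q k) : mult L q.1 k ≠ 0 :=
  div_ne_zero (hc.green_ne_zero hL _ _) (hc.green_ne_zero hL _ _)

lemma Coercive.norm_mult_lt (hc : Coercive L q k) : ‖mult L q.1 k‖ < 1 := by
  have := hc.norm_multiplier_lt hL (-L); rwa [show -L + 2 * L = L by ring] at this

lemma Coercive.exp_integral_weyl_one (hc : Coercive L q k) : exp (∫ x in (-L)..L, weyl L q.1 k 1 x)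
    = (mult L q.1 k)⁻¹ := by
  rw [hc.exp_integral_eq hL (Or.inl rfl), one_re, mul_one]
  have h1 := hc.green_mul hL (show -L ≤ L by linarith) (show L ≤ 2 * L by linarith)
    (hc.green_diag_ne_zero hL L)
  have h2 := hc.green_periodic hL (-L) (-L); rw [show -L + 2 * L = L by ring] at h2
  have h3 := hc.green_ne_zero hL (-L) L; have h4 := hc.green_ne_zero hL (-L) (2 * L)
  rw [mult, hc.green_symm hL (2 * L) L, hc.green_symm hL (2 * L) (-L), ← h2]; field_simp
  linear_combination -h1

lemma Coercive.exp_integral_weyl_neg_one (hc : Coercive L q k) : exp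
    (∫ x in (-L)..L, weyl L q.1 k (-1) x) = mult L q.1 k := by
  rw [hc.exp_integral_eq hL (Or.inr rfl)]; simp only [neg_re, one_re, mul_neg, mul_one]
  have h1 := hc.green_mul hL (show -(2 * L) ≤ -L by linarith) (show -L ≤ L by linarith)
    (hc.green_diag_ne_zero hL _)
  have h3 := hc.green_ne_zero hL (-L) (-L); have h4 := hc.green_ne_zero hL (-(2 * L)) (-L)
  rw [mult]; field_simp; linear_combination h1

end green

end

/-! ### Norms -/

lemma l2_eq_eLpNorm (hf : MemLp f 2 μ) : l2 μ f = (eLpNorm f 2 μ).toReal := by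
  rw [hf.eLpNorm_eq_integral_rpow_norm two_ne_zero ENNReal.ofNat_ne_top,
    toReal_ofReal (by positivity), l2, Real.sqrt_eq_rpow]
  norm_num

lemma l2_add_le (hf : MemLp f 2 μ) (hg : MemLp g 2 μ) : l2 μ (fun x => f x + g x) ≤ l2 μ f + l2 μ
    g := by
  have h := eLpNorm_add_le hf.1 hg.1 (show (1 : ℝ≥0∞) ≤ 2 by norm_num)
  rw [l2_eq_eLpNorm hf, l2_eq_eLpNorm hg, l2_eq_eLpNorm (f := fun x => f x + g x) (hf.add hg),
    ← ENNReal.toReal_add hf.2.ne hg.2.ne]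
  exact ENNReal.toReal_mono (ENNReal.add_ne_top.2 ⟨hf.2.ne, hg.2.ne⟩) h

lemma l2_congr_ae (h : f =ᵐ[μ] g) : l2 μ f = l2 μ g := by
  unfold l2; congr 1; exact integral_congr_ae (h.mono fun x hx => by simp only [hx])

lemma l2_const_mul (μ : Measure ℝ) (c : ℂ) (f : ℝ → ℂ) : l2 μ (fun x => c * f x) = ‖c‖ * l2 μ
    f := by
  simp only [l2, norm_mul, mul_pow, integral_const_mul]; simp

lemma l2_neg (μ : Measure ℝ) (f : ℝ → ℂ) : l2 μ (fun x => -f x) = l2 μ f := by simp [l2]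

lemma l2_sub_le (hf : MemLp f 2 μ) (hg : MemLp g 2 μ) : l2 μ (fun x => f x - g x) ≤ l2 μ f + l2 μ
    g := by
  have := l2_add_le hf hg.neg; simp only [Pi.neg_apply, ← sub_eq_add_neg] at this
  rw [← l2_neg μ g]; exact this

lemma l2_le_of_bound (hL : 0 < L) {B : ℝ} (hB : 0 ≤ B) (h : ∀ᵐ x ∂(perMeasure L), ‖f x‖ ≤ B) : l2
    (perMeasure L) f ≤ √(2 * L) * B := by
  rw [← sqrt_sq hB, ← sqrt_mul (by linarith)]; refine sqrt_le_sqrt ?_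
  have : ∫ x, B ^ 2 ∂(perMeasure L) = 2 * L * B ^ 2 := by
    rw [← integral_perMeasure hL, intervalIntegral.integral_const, smul_eq_mul]; ring
  rw [← this]
  refine integral_mono_of_nonneg (.of_forall fun _ => by positivity)
    (integrable_const _) (h.mono fun x hx => by simp only []; gcongr)

lemma integral_norm_le_l2 (hL : 0 < L) (hf : MemLp f 2 (perMeasure L)) : ∫ x in (-L)..L, ‖f x‖ ≤
    √(2 * L) * l2 (perMeasure L) f := by
  have h1 := integral_norm_mul_norm_le (memLp_of_continuous (L := L) (continuous_const (y := (1 : ℂ)))) hf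
  simp only [norm_one, one_mul] at h1; rw [integral_perMeasure hL]; refine h1.trans ?_
  have := l2_le_of_bound hL zero_le_one (f := fun _ => (1 : ℂ)) (.of_forall fun _ => by simp)
  rw [mul_one] at this; gcongr; exact l2_nonneg _ _

lemma L2Per.add (hf : L2Per L f) (hg : L2Per L g) : L2Per L (fun x => f x + g x) :=
  ⟨hf.periodic.add hg.periodic, hf.measurable.add hg.measurable, hf.memLp.add hg.memLp⟩

lemma L2Per.const_mul (c : ℂ) (hf : L2Per L f) : L2Per L (fun x => c * f x) :=
  ⟨fun x => by simp only [hf.periodic x], hf.measurable.const_mul c, hf.memLp.const_mul c⟩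

lemma ae_of_ae_perMeasure (hL : 0 < L) {p : ℝ → Prop} (hp : ∀ x, p (x + 2 * L) ↔ p x)
    (h : ∀ᵐ x ∂(perMeasure L), p x) : ∀ᵐ x, p x := by
  have hpz (n : ℤ) (x) : p (x + n * (2 * L)) ↔ p x :=
    iff_of_eq (Periodic.int_mul (fun x => propext (hp x)) n x)
  rw [perMeasure, ae_restrict_iff' measurableSet_Ioc] at h
  have h1 : ∀ n : ℤ, ∀ᵐ x : ℝ, x + n * (2 * L) ∈ Ioc (-L) L → p x := fun n => by
    have := (measurePreserving_add_right (volume : Measure ℝ) (n * (2 * L))).quasiMeasurePreserving.ae h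
    grind
  filter_upwards [ae_all_iff.2 h1] with x hx
  obtain ⟨n, hn, -⟩ := existsUnique_add_zsmul_mem_Ioc (show 0 < 2 * L by linarith) x (-L); grind

lemma exists_periodic_prim (hL : 0 < L) {d s : ℝ → ℂ} (hd : L2Per L d) (hF : L2Per L F)
    (hs : Periodic s (2 * L)) (hsi : ∀ a b : ℝ, IntervalIntegrable s volume a b)
    (h : ∀ n, ddx L (coeffs L d) n = ddx L (coeffs L F) n + coeffs L s n) : ∃ r, IsPrim r s ∧
    Periodic r (2 * L) ∧ d =ᵐ[volume] fun x => F x + r x := by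
  have h1 : ddx L (coeffs L fun x => d x - F x) = coeffs L s := by
    ext n; have := h n; simp only [ddx] at this ⊢
    rw [coeffs_sub (MemLp.perIntegrable hL hd.memLp) (MemLp.perIntegrable hL hF.memLp)]
    linear_combination this
  obtain ⟨h0, C, hC⟩ := exists_primitive_of_ddx hL (hd.sub hF).memLp (hsi _ _) h1
  have hr := (IsPrim.const C).add (IsPrim.primitive hsi (-L))
  have hrp : Periodic (fun x => C + ∫ t in (-L)..x, s t) (2 * L) := fun x => by
    have e := hs.intervalIntegral_add_eq x (-L); rw [show -L + 2 * L = L by ring, h0] at e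
    simp only []
    rw [← integral_add_adjacent_intervals (hsi (-L) x) (hsi x (x + 2 * L)), e, add_zero]
  refine ⟨_, hr.congr (fun _ => rfl) (fun x => zero_add _), hrp, ?_⟩
  refine ae_of_ae_perMeasure hL (fun x => ?_) (hC.mono fun x hx => ?_)
  · simp only []; have := hrp x; simp only [] at this
    rw [hd.periodic, hF.periodic, this]
  · simp only []; rw [← hx]; ring

lemma antideriv_eq_ddx {q : ℤ → ℂ} (hW : IsAntideriv L q W) (n : ℤ) : q n = ddx L (coeffs L W) n +
    if n = 0 then q 0 else 0 := by
  split_ifs with h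
  · rw [h, ddx, freq_zero]; simp
  · rw [ddx, hW.ddx n h, add_zero]

lemma exists_l2_bound (hL : 1 ≤ L) (A : ℝ) {δ : ℝ} (hδ : 0 < δ) : ∃ C, 0 ≤ C ∧ ∀ (a d s : ℝ → ℂ)
    (f : Hs L (-1)), L2Per L a → L2Per L d → Periodic s (2 * L) →
    (∀ b c : ℝ, IntervalIntegrable s volume b c) → l2 (perMeasure L) a ≤ A → δ ≤ ‖exp
    (∫ x in (-L)..L, a x) - 1‖ → (∀ n, ddx L (coeffs L d) n + coeffs L (fun x => a x * d x) n = f.1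
    n + coeffs L s n) → l2 (perMeasure L) d ≤ C * (‖f‖ + ∫ x in (-L)..L, ‖s x‖) := by
  have hL0 : 0 < L := by linarith
  set A' := max A 0; set e := Real.exp (√(2 * L) * A') with he; set B := e * e * (1 / δ + 1) with hB
  set H := 4 * L + 1 + A' * (4 * L ^ 2) with hH; have hA'0 : 0 ≤ A' := le_max_right _ _
  have he0 : 0 < e := exp_pos _; have hB0 : 0 ≤ B := by positivity
  have hH0 : 0 ≤ H := by positivity
  refine ⟨4 * L ^ 2 + √(2 * L) * (B * H), by positivity, ?_⟩; intro a d s f ha hd hs hsi haA haδ heq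
  have haA' : l2 (perMeasure L) a ≤ A' := haA.trans (le_max_left _ _)
  obtain ⟨F, hF, hFn⟩ := exists_antideriv hL f; set S := ∫ x in (-L)..L, ‖s x‖ with hS
  have hS0 : 0 ≤ S := intervalIntegral.integral_nonneg (by linarith) fun _ _ => norm_nonneg _
  have had := ha.integrable_mul hL0 hd; have haF := ha.integrable_mul hL0 hF.l2Per
  have hcs : ∀ c : ℂ, ∀ b b' : ℝ, IntervalIntegrable (fun x => c + s x) volume b b' :=
    fun c b b' => intervalIntegrable_const.add (hsi b b')
  obtain ⟨r, hr, hrp, hdr⟩ := exists_periodic_prim hL0 hd hF.l2Per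
    (s := fun x => f.1 0 + s x - a x * d x)
    (fun x => by simp only [hs x, ha.periodic x, hd.periodic x])
    (fun b c => (hcs _ b c).sub (had b c)) fun n => by
      rw [coeffs_sub (hcs _ _ _) (had _ _), coeffs_add intervalIntegrable_const (hsi _ _),
        coeffs_const hL0]
      have h1 := heq n; rw [antideriv_eq_ddx hF n] at h1; linear_combination h1
  set h : ℝ → ℂ := fun x => f.1 0 + s x - a x * F x with hh
  have hhi : ∀ b c : ℝ, IntervalIntegrable h volume b c := fun b c => (hcs _ b c).sub (haF b c)
  have hr2 : IsPrim r (fun x => h x - a x * r x) := hr.congr_ae (by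
    filter_upwards [hdr] with x hx
    rw [hx, hh]; ring)
  have hE := (IsPrim.primitive (fun b c => ha.intervalIntegrable hL0 b c) (-L)).exp
  set E : ℝ → ℂ := fun x => exp (∫ t in (-L)..x, a t) with hEdef
  have hrE : IsPrim (fun x => r x * E x) (fun x => h x * E x) :=
    (hr2.mul hE).congr (fun _ => rfl) fun x => by simp only [hEdef]; ring
  have hα : ∀ x ∈ Icc (-L) L, ‖∫ t in (-L)..x, a t‖ ≤ √(2 * L) * A' := by
    intro x hx; refine (intervalIntegral.norm_integral_le_integral_norm hx.1).trans ?_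
    refine le_trans ?_ ((integral_norm_le_l2 hL0 ha.memLp).trans (by gcongr))
    exact integral_mono_interval le_rfl hx.1 hx.2
      (.of_forall fun _ => norm_nonneg _) (ha.intervalIntegrable hL0 _ _).norm
  have hE1 : ∀ x ∈ Icc (-L) L, ‖E x‖ ≤ e := fun x hx => by
    rw [hEdef, norm_exp]; exact exp_le_exp.2 ((re_le_norm _).trans (hα x hx))
  have hE2 : ∀ x ∈ Icc (-L) L, ‖(E x)⁻¹‖ ≤ e := fun x hx => by
    rw [hEdef, ← Complex.exp_neg, norm_exp]; refine exp_le_exp.2 ((re_le_norm _).trans ?_)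
    rw [norm_neg]; exact hα x hx
  have hint : ∫ x in (-L)..L, ‖h x‖ ≤ H * (‖f‖ + S) := by
    have i1 : ∀ x, ‖h x‖ ≤ (‖f.1 0‖ + ‖s x‖) + ‖a x * F x‖ := fun x =>
      (norm_sub_le _ _).trans (by gcongr; exact norm_add_le _ _)
    have hi0 : IntervalIntegrable (fun x => ‖f.1 0‖ + ‖s x‖) volume (-L) L :=
      intervalIntegrable_const.add (hsi _ _).norm
    have i2 : ∫ x in (-L)..L, ‖h x‖ ≤ ∫ x in (-L)..L, (‖f.1 0‖ + ‖s x‖) + ‖a x * F x‖ :=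
      integral_mono_on (by linarith) (hhi _ _).norm (hi0.add (haF _ _).norm) fun x _ => i1 x
    have i3 : ∫ x in (-L)..L, ‖a x * F x‖ ≤ A' * (4 * L ^ 2 * ‖f‖) := by
      rw [integral_perMeasure hL0]; simp only [norm_mul]
      refine (integral_norm_mul_norm_le ha.memLp hF.l2Per.memLp).trans ?_; gcongr
      exact l2_nonneg _ _
    rw [intervalIntegral.integral_add hi0 (haF _ _).norm,
      intervalIntegral.integral_add intervalIntegrable_const (hsi _ _).norm,
      intervalIntegral.integral_const, smul_eq_mul, ← hS] at i2
    have i4 := f.norm_zero_coeff_le; have i5 : (L - -L) * ‖f.1 0‖ ≤ 4 * L * ‖f‖ := by nlinarith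
    have i6 : 0 ≤ (4 * L + A' * (4 * L ^ 2)) * S := by positivity
    have i7 : 0 ≤ ‖f‖ := norm_nonneg _; rw [hH]; nlinarith
  have hI : ∀ x ∈ Icc (-L) L, ‖∫ t in (-L)..x, h t * E t‖ ≤ e * (H * (‖f‖ + S)) := by
    intro x hx; refine (intervalIntegral.norm_integral_le_integral_norm hx.1).trans ?_
    have j1 : ∫ t in (-L)..x, ‖h t * E t‖ ≤ ∫ t in (-L)..L, ‖h t * E t‖ :=
      integral_mono_interval le_rfl hx.1 hx.2 (.of_forall fun _ => norm_nonneg _) (hrE.1 _ _).norm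
    have j2 : ∫ t in (-L)..L, ‖h t * E t‖ ≤ ∫ t in (-L)..L, e * ‖h t‖ :=
      integral_mono_on (by linarith) (hrE.1 _ _).norm ((hhi _ _).norm.const_mul _)
        fun t ht => by rw [norm_mul, mul_comm]; gcongr; exact hE1 t ht
    rw [intervalIntegral.integral_const_mul] at j2; exact (j1.trans j2).trans (by gcongr)
  have hEL : E (-L) = 1 := by simp [hEdef]
  have hrL : r L = r (-L) := by have := hrp (-L); rwa [show -L + 2 * L = L by ring] at this
  have hr0 : ‖r (-L)‖ ≤ e * (H * (‖f‖ + S)) / δ := by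
    have h1 := hrE.ftc (-L) L; simp only [hrL, hEL] at h1; have h2 := hI L ⟨by linarith, le_rfl⟩
    rw [← h1, ← mul_sub, norm_mul] at h2; rw [le_div_iff₀ hδ]; refine le_trans ?_ h2
    gcongr
  have hrb : ∀ x ∈ Icc (-L) L, ‖r x‖ ≤ B * (H * (‖f‖ + S)) := by
    intro x hx; have h1 := hrE.ftc (-L) x; simp only [hEL] at h1
    have h2 : r x = (r (-L) + ∫ t in (-L)..x, h t * E t) * (E x)⁻¹ := by
      rw [← h1]; simp [*]
    rw [h2, norm_mul]
    calc _ ≤ (e * (H * (‖f‖ + S)) / δ + e * (H * (‖f‖ + S))) * e := by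
          gcongr
          · exact (norm_add_le _ _).trans (add_le_add hr0 (hI x hx))
          · exact hE2 x hx
      _ = _ := by rw [hB]; ring
  rw [l2_congr_ae (ae_restrict_of_ae hdr)]
  have hrm : MemLp r 2 (perMeasure L) := memLp_of_continuous hr.continuous
  have h3 := l2_le_of_bound hL0 (f := r) (B := B * (H * (‖f‖ + S))) (by positivity) (by
    filter_upwards [ae_restrict_mem measurableSet_Ioc] with x hx
    exact hrb x (Ioc_subset_Icc_self hx))
  refine (l2_add_le hF.l2Per.memLp hrm).trans ?_; have : 0 ≤ 4 * L ^ 2 * S := by positivity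
  linarith

lemma IsRiccati.sub {v₁ v₂ : ℝ → ℂ} (hL : 0 < L) (h₁ : IsRiccati L q₁.1 lam v₁)
    (h₂ : IsRiccati L q₂.1 lam v₂) (n : ℤ) : ddx L (coeffs L fun x => v₁ x - v₂ x) n + coeffs L
    (fun x => (v₁ x + v₂ x) * (v₁ x - v₂ x)) n = (q₁ - q₂).1 n := by
  have i1 := h₁.l2Per.integrable_mul hL h₁.l2Per (-L) L
  have i2 := h₂.l2Per.integrable_mul hL h₂.l2Per (-L) L; have e1 := h₁.eqn n; have e2 := h₂.eqn n
  simp only [sq] at e1 e2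
  have : (fun x => (v₁ x + v₂ x) * (v₁ x - v₂ x)) = fun x => v₁ x * v₁ x - v₂ x * v₂ x := by
    ext x; ring
  rw [this, coeffs_sub i1 i2]; change _ = q₁.1 n - q₂.1 n; simp only [ddx] at e1 e2 ⊢
  rw [coeffs_sub (h₁.l2Per.intervalIntegrable hL _ _) (h₂.l2Per.intervalIntegrable hL _ _)]
  linear_combination e1 - e2

section

variable (hL : 1 ≤ L)
include hL

lemma CoerciveForm.eventually (h : CoerciveForm L q₀.1 lam ζ) : ∃ ζ', ∀ᶠ q : Hs L (-1) in 𝓝 q₀,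
    CoerciveForm L q.1 lam ζ' := by
  refine ⟨2 * ζ, ?_⟩
  have h0 : 0 < 36 * L ^ 2 * ‖ζ‖ := by
    have := norm_pos_iff.2 h.ne_zero; positivity
  have hball : Metric.ball q₀ (1 / (2 * (36 * L ^ 2 * ‖ζ‖))) ∈ 𝓝 q₀ :=
    Metric.ball_mem_nhds _ (by positivity)
  filter_upwards [hball] with q hq
  refine ⟨mul_ne_zero two_ne_zero h.ne_zero, fun u u' hu => ?_⟩; rw [mem_ball_iff_norm] at hq
  have h1 := h.le u u' hu; have h2 := norm_pair_le hL (q - q₀) hu hu.conj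
  rw [h1sq_conj, Real.mul_self_sqrt (h1sq_nonneg _ _), pair_sub_left hL q q₀ hu hu.conj] at h2
  have e : form L q.1 lam u u' (fun x => conj (u x)) (fun x => conj (u' x)) =
      form L q₀.1 lam u u' (fun x => conj (u x)) (fun x => conj (u' x)) +
      (pair L q.1 (fun x => u x * conj (u x)) - pair L q₀.1 (fun x => u x * conj (u x))) := by
    unfold form; ring
  rw [e]; set P := pair L q.1 (fun x => u x * conj (u x)) - pair L q₀.1 (fun x => u x * conj (u x))
  have h3 : -(‖ζ‖ * (18 * L ^ 2 * ‖q - q₀‖ * h1sq u u')) ≤ (ζ * P).re := by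
    have := (abs_le.1 (abs_re_le_norm (ζ * P))).1; rw [norm_mul] at this; refine le_trans ?_ this
    gcongr
  have h4 : ‖ζ‖ * (18 * L ^ 2 * ‖q - q₀‖ * h1sq u u') ≤ 1 / 4 * h1sq u u' := by
    have h5 : ‖ζ‖ * (18 * L ^ 2 * ‖q - q₀‖) ≤ 1 / 4 := by
      rw [lt_div_iff₀ (by positivity)] at hq; nlinarith
    have := mul_le_mul_of_nonneg_right h5 (h1sq_nonneg u u'); linarith
  rw [show 2 * ζ * (form L q₀.1 lam u u' (fun x => conj (u x)) (fun x => conj (u' x)) + P) =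
    ζ * form L q₀.1 lam u u' (fun x => conj (u x)) (fun x => conj (u' x)) +
    ζ * form L q₀.1 lam u u' (fun x => conj (u x)) (fun x => conj (u' x)) + (ζ * P + ζ * P) by ring]
  simp only [add_re]; linarith

section
lemma Coercive.eventually (hc : Coercive L q₀ k) : ∀ᶠ q : Hs L (-1) in 𝓝 q₀, Coercive L q k := by
  obtain ⟨ζ, hζ⟩ := hc; obtain ⟨ζ', h⟩ := hζ.eventually hL; exact h.mono fun q hq => ⟨ζ', hq⟩

lemma Coercive.exists_green_lipschitz (hc : Coercive L q₀ k) : ∃ K, 0 ≤ K ∧ ∀ᶠ q : Hs L (-1) in 𝓝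
    q₀, ∀ x y, ‖green L q.1 k x y - green L q₀.1 k x y‖ ≤ K * ‖q - q₀‖ := by
  obtain ⟨ζ, hζ⟩ := hc; obtain ⟨ζ', h⟩ := hζ.eventually hL
  refine ⟨288 * L ^ 2 * ‖ζ'‖ ^ 2, by positivity, h.mono fun q hq x y => ?_⟩
  exact norm_green_sub_le hL hq h.self_of_nhds x y

lemma Coercive.continuousAt_green (hc : Coercive L q₀ k) (x y : ℝ) : ContinuousAt
    (fun q : Hs L (-1) => green L q.1 k x y) q₀ := by
  obtain ⟨K, -, hK⟩ := hc.exists_green_lipschitz hL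
  rw [ContinuousAt, tendsto_iff_norm_sub_tendsto_zero]
  have : Tendsto (fun q : Hs L (-1) => K * ‖q - q₀‖) (𝓝 q₀) (𝓝 0) := by
    have h : Continuous fun q : Hs L (-1) => K * ‖q - q₀‖ := by fun_prop
    simpa using h.tendsto q₀
  exact squeeze_zero' (.of_forall fun _ => norm_nonneg _) (hK.mono fun q h => h x y) this

lemma Coercive.continuousAt_mult (hc : Coercive L q₀ k) : ContinuousAt
    (fun q : Hs L (-1) => mult L q.1 k) q₀ :=
  (hc.continuousAt_green hL _ _).div (hc.continuousAt_green hL _ _) (hc.green_ne_zero hL _ _)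

lemma Coercive.exists_weyl_bound (hc : Coercive L q₀ k) (hσ : σ = 1 ∨ σ = -1) : ∃ A, ∀ᶠ q : Hs L
    (-1) in 𝓝 q₀, l2 (perMeasure L) (weyl L q.1 k σ) ≤ A := by
  have hL0 : 0 < L := by linarith
  obtain ⟨K, hK0, hK⟩ := hc.exists_green_lipschitz hL
  obtain ⟨ζ, hζ⟩ : ∃ ζ, ∀ᶠ q : Hs L (-1) in 𝓝 q₀, CoerciveForm L q.1 (k ^ 2) ζ :=
    hc.elim fun ζ h => h.eventually hL
  set y := 2 * L * σ.re with hy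
  have hci : Continuous fun x => (green L q₀.1 k y x)⁻¹ :=
    (hc.continuous_green hL y).inv₀ fun x => hc.green_ne_zero hL _ x
  obtain ⟨B, hB⟩ := isCompact_Icc.exists_bound_of_continuousOn (s := Icc (-L) L) hci.continuousOn
  have hB0 : 0 < B := (norm_pos_iff.2 (inv_ne_zero (hc.green_ne_zero hL y L))).trans_le
    (hB L ⟨by linarith, le_rfl⟩)
  refine ⟨2 * B * (4 * ‖ζ‖), ?_⟩
  have hsm : ∀ᶠ q : Hs L (-1) in 𝓝 q₀, K * ‖q - q₀‖ < 1 / (2 * B) := by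
    have h : Continuous fun q : Hs L (-1) => K * ‖q - q₀‖ := by fun_prop
    refine (h.tendsto q₀).eventually_lt_const ?_; simp; positivity
  filter_upwards [hK, hζ, hsm] with q hq1 hq2 hq3
  have hcq : Coercive L q k := ⟨ζ, hq2⟩; obtain ⟨u', hu, hu1, hae⟩ := hcq.exists_weyl hL hσ
  rw [← hy] at hu hu1 hae
  have hb : ∀ x ∈ Ioc (-L) L, ‖(green L q.1 k y x)⁻¹‖ ≤ 2 * B := by
    intro x hx; have h1 := hB x (Ioc_subset_Icc_self hx); have h2 := hc.green_ne_zero hL y x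
    have h3 := hq1 y x; rw [norm_inv] at h1 ⊢
    have h4 : 1 / B ≤ ‖green L q₀.1 k y x‖ := by
      rw [one_div]; exact inv_le_of_inv_le₀ (norm_pos_iff.2 h2) h1
    have h5 := norm_sub_norm_le (green L q₀.1 k y x) (green L q.1 k y x); rw [norm_sub_rev] at h5
    have h6 : 1 / B = 2 * (1 / (2 * B)) := by field_simp
    have h7 : 1 / (2 * B) ≤ ‖green L q.1 k y x‖ := by linarith
    rw [inv_le_comm₀ (norm_pos_iff.2 (hcq.green_ne_zero hL y x)) (by positivity), ← one_div]
    exact h7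
  have hle : ∀ᵐ x ∂(perMeasure L), ‖weyl L q.1 k σ x‖ ≤ 2 * B * ‖u' x‖ := by
    filter_upwards [ae_restrict_mem measurableSet_Ioc, ae_restrict_of_ae hae] with x hx h
    rw [h ⟨by linarith [hx.1], by linarith [hx.2]⟩, div_eq_mul_inv, norm_mul, mul_comm]; gcongr
    exact hb x hx
  have h1 : l2 (perMeasure L) (weyl L q.1 k σ) ≤ 2 * B * l2 volume u' := by
    rw [← sqrt_sq (show 0 ≤ 2 * B by positivity), l2, l2, ← sqrt_mul (by positivity)]
    refine sqrt_le_sqrt ?_; rw [← integral_const_mul]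
    have i1 := (integrable_norm_sq hu.memLp_deriv).const_mul ((2 * B) ^ 2)
    refine le_trans ?_ (setIntegral_le_integral (s := Ioc (-L) L) i1
      (.of_forall fun x => by simp only [Pi.zero_apply]; positivity))
    refine integral_mono_of_nonneg (.of_forall fun _ => by positivity)
      i1.integrableOn (hle.mono fun x hx => ?_)
    simp only []; rw [← mul_pow]; gcongr
  refine h1.trans ?_; have h2 := hq2.sqrt_h1sq_le hu hu1
  have h3 := l2_deriv_le_sqrt_h1sq (green L q.1 k y) u'; gcongr; exact h3.trans h2

lemma exp_weyl_sub_one_ge (h₁ : Coercive L q₁ k) (h₂ : Coercive L q₂ k) (hσ : σ = 1 ∨ σ = -1)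
    {δ : ℝ} (hδ : 0 ≤ δ) (hm₁ : ‖mult L q₁.1 k‖ ≤ 1 - δ) (hm₂ : ‖mult L q₂.1 k‖ ≤ 1 - δ) : δ ≤ ‖exp
    (∫ x in (-L)..L, (weyl L q₁.1 k σ x + weyl L q₂.1 k σ x)) - 1‖ := by
  have hL0 : 0 < L := by linarith
  rw [intervalIntegral.integral_add ((h₁.l2Per_weyl hL hσ).intervalIntegrable hL0 _ _)
    ((h₂.l2Per_weyl hL hσ).intervalIntegrable hL0 _ _), exp_add]
  have n1 := norm_pos_iff.2 (h₁.mult_ne_zero hL); have n2 := norm_pos_iff.2 (h₂.mult_ne_zero hL)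
  have hmm : ‖mult L q₁.1 k‖ * ‖mult L q₂.1 k‖ ≤ 1 - δ := by nlinarith
  rcases hσ with rfl | rfl
  · rw [h₁.exp_integral_weyl_one hL, h₂.exp_integral_weyl_one hL, ← mul_inv]
    have h3 := norm_sub_norm_le (mult L q₁.1 k * mult L q₂.1 k)⁻¹ 1
    rw [norm_one, norm_inv, norm_mul] at h3; refine le_trans ?_ h3
    set m := ‖mult L q₁.1 k‖ * ‖mult L q₂.1 k‖; have hm0 : 0 < m := mul_pos n1 n2
    have : 1 + δ ≤ m⁻¹ := by
      rw [le_inv_comm₀ (by linarith) hm0, inv_eq_one_div, le_div_iff₀ (by linarith)]; nlinarith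
    linarith
  · rw [h₁.exp_integral_weyl_neg_one hL, h₂.exp_integral_weyl_neg_one hL, norm_sub_rev]
    have h3 := norm_sub_norm_le (1 : ℂ) (mult L q₁.1 k * mult L q₂.1 k)
    rw [norm_one, norm_mul] at h3; linarith

lemma Coercive.exists_weyl_lipschitz (hc : Coercive L q₀ k) (hσ : σ = 1 ∨ σ = -1) : ∃ K, 0 ≤ K ∧ ∀ᶠ
    q : Hs L (-1) in 𝓝 q₀, Coercive L q k ∧ l2 (perMeasure L)
    (fun x => weyl L q.1 k σ x - weyl L q₀.1 k σ x) ≤ K * ‖q - q₀‖ := by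
  have hL0 : 0 < L := by linarith
  obtain ⟨A, hA⟩ := hc.exists_weyl_bound hL hσ
  obtain ⟨δ, hδ, hδm⟩ : ∃ δ, 0 < δ ∧ ‖mult L q₀.1 k‖ < 1 - δ :=
    ⟨(1 - ‖mult L q₀.1 k‖) / 2, by linarith [hc.norm_mult_lt hL], by linarith [hc.norm_mult_lt hL]⟩
  have hm := (hc.continuousAt_mult hL).norm.eventually_lt_const hδm
  obtain ⟨C, hC0, hC⟩ := exists_l2_bound hL (A + A) hδ; refine ⟨C, hC0, ?_⟩
  filter_upwards [hA, hm, hc.eventually hL] with q h1 h2 h3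
  refine ⟨h3, ?_⟩; have w1 := h3.l2Per_weyl hL hσ; have w2 := hc.l2Per_weyl hL hσ
  have := hC _ _ (fun _ => 0) (q - q₀) (w1.add w2) (w1.sub w2) (fun _ => rfl)
    (fun _ _ => intervalIntegrable_const)
    ((l2_add_le w1.memLp w2.memLp).trans (add_le_add h1 hA.self_of_nhds))
    (exp_weyl_sub_one_ge hL h3 hc hσ hδ.le h2.le hδm.le) fun n => by
      rw [(h3.isRiccati hL hσ).sub hL0 (hc.isRiccati hL hσ) n, coeffs_const hL0]; simp
  simpa using this

lemma tendsto_weyl_slope (hσ : σ = 1 ∨ σ = -1) {q : ℝ → Hs L (-1)} {X : Hs L (-1)} {s : Set ℝ}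
    (hq : HasDerivWithinAt q X s t) (hc : Coercive L (q t) k) (hw : L2Per L w) (heq : ∀ n, ddx L
    (coeffs L w) n + coeffs L (fun x => (2 * weyl L (q t).1 k σ x) * w x) n = X.1 n) : Tendsto (fun
    τ : ℝ => l2 (perMeasure L) fun x => ((τ - t : ℝ) : ℂ)⁻¹ *
    (weyl L (q τ).1 k σ x - weyl L (q t).1 k σ x) - w x) (𝓝[s \ {t}] t) (𝓝 0) := by
  have hL0 : 0 < L := by linarith
  have hcont : Tendsto q (𝓝[s \ {t}] t) (𝓝 (q t)) := hq.continuousWithinAt.mono Set.sdiff_subset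
  have hslope := hasDerivWithinAt_iff_tendsto_slope.1 hq
  obtain ⟨K, hK0, hK⟩ := hc.exists_weyl_lipschitz hL hσ
  have hδ : 0 < 1 - ‖mult L (q t).1 k‖ := by linarith [hc.norm_mult_lt hL]
  set v := weyl L (q t).1 k σ with hv; have hvp : L2Per L v := hc.l2Per_weyl hL hσ
  obtain ⟨C, hC0, hC⟩ := exists_l2_bound hL (l2 (perMeasure L) fun x => 2 * v x) hδ
  have hexp : 1 - ‖mult L (q t).1 k‖ ≤ ‖exp (∫ x in (-L)..L, 2 * v x) - 1‖ := by
    have := exp_weyl_sub_one_ge hL hc hc hσ hδ.le (by linarith) (by linarith)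
    simpa only [two_mul] using this
  have hle : ∀ᶠ τ in 𝓝[s \ {t}] t, l2 (perMeasure L) (fun x => ((τ - t : ℝ) : ℂ)⁻¹ *
      (weyl L (q τ).1 k σ x - v x) - w x) ≤
      C * (‖slope q t τ - X‖ + K ^ 2 * ‖slope q t τ‖ * ‖q τ - q t‖) := by
    filter_upwards [hcont.eventually hK, self_mem_nhdsWithin] with τ h1 hτ
    have hτt : (τ - t : ℝ) ≠ 0 := sub_ne_zero.2 hτ.2; obtain ⟨hcτ, hlip⟩ := h1
    set V := weyl L (q τ).1 k σ; have hVp : L2Per L V := hcτ.l2Per_weyl hL hσ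
    set c : ℂ := ((τ - t : ℝ) : ℂ)⁻¹; have hdp := hVp.sub hvp; have hep := (hdp.const_mul c).sub hw
    have hsp : ∀ a b : ℝ, IntervalIntegrable (fun x => -c * ((V x - v x) * (V x - v x))) volume a b :=
      fun a b => (hdp.integrable_mul hL0 hdp a b).const_mul _
    have hR := (hcτ.isRiccati hL hσ).sub hL0 (hc.isRiccati hL hσ)
    have key := hC _ _ (fun x => -c * ((V x - v x) * (V x - v x))) (slope q t τ - X)
      (hvp.const_mul 2) hep (fun x => by simp only [hdp.periodic x]) hsp le_rfl hexp fun n => by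
        have e1 := hR n; have e2 := heq n; have i1 := hdp.intervalIntegrable hL0 (-L) L
        have i2 := hdp.integrable_mul hL0 hdp (-L) L
        have i3 := (hvp.const_mul 2).integrable_mul hL0 hdp (-L) L
        have i4 := (hvp.const_mul 2).integrable_mul hL0 hw (-L) L
        have i5 := hw.intervalIntegrable hL0 (-L) L
        have f1 : (fun x => (V x + v x) * (V x - v x)) =
            fun x => 2 * v x * (V x - v x) + (V x - v x) * (V x - v x) := by ext x; ring
        have f2 : (fun x => 2 * v x * (c * (V x - v x) - w x)) =
            fun x => c * (2 * v x * (V x - v x)) - 2 * v x * w x := by ext x; ring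
        have f3 : (slope q t τ - X).1 n = c * (q τ - q t).1 n - X.1 n := by
          simp only [slope, vsub_eq_sub]; change ((τ - t)⁻¹ : ℝ) • (q τ - q t).1 n - X.1 n = _
          rw [real_smul, ofReal_inv]
        rw [f1, coeffs_add i3 i2] at e1
        rw [f2, f3, coeffs_sub (i3.const_mul c) i4, coeffs_const_mul, coeffs_const_mul, ← e1, ← e2]
        simp only [ddx]; rw [coeffs_sub (i1.const_mul c) i5, coeffs_const_mul]; ring
    refine key.trans ?_; gcongr; simp only [norm_mul, norm_neg]
    rw [intervalIntegral.integral_const_mul, integral_perMeasure hL0]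
    have h3 : ∫ x, ‖V x - v x‖ * ‖V x - v x‖ ∂(perMeasure L) = l2 (perMeasure L) (fun x => V x - v x) ^ 2 := by
      rw [l2_sq]; congr 1; ext x; ring
    rw [h3]
    have h4 : ‖slope q t τ‖ = ‖c‖ * ‖q τ - q t‖ := by
      rw [slope, vsub_eq_sub, norm_smul, norm_inv, norm_inv, norm_real]
    rw [h4]; have h5 := pow_le_pow_left₀ (l2_nonneg _ _) hlip 2
    calc _ ≤ ‖c‖ * (K * ‖q τ - q t‖) ^ 2 := by gcongr
      _ = _ := by ring
  refine squeeze_zero' (.of_forall fun _ => l2_nonneg _ _) hle ?_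
  have t1 : Tendsto (fun τ => ‖slope q t τ - X‖) (𝓝[s \ {t}] t) (𝓝 0) :=
    tendsto_iff_norm_sub_tendsto_zero.1 hslope
  have t2 : Tendsto (fun τ => ‖q τ - q t‖) (𝓝[s \ {t}] t) (𝓝 0) :=
    tendsto_iff_norm_sub_tendsto_zero.1 hcont
  have t3 := (t1.add ((hslope.norm.const_mul (K ^ 2)).mul t2)).const_mul C; simpa using t3

end

end

section

lemma Hs.isometry_toLp (L s : ℝ) : Isometry (Hs.toLp L s) :=
  AddMonoidHomClass.isometry_of_norm (Hs.toLp L s) fun _ => rfl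

lemma weight_neg (L s : ℝ) (n : ℤ) : weight L s (-n) = weight L s n := by simp [weight, freq_neg]

instance Hs.instCompleteSpace (L s : ℝ) : CompleteSpace (Hs L s) := by
  rw [completeSpace_iff_isComplete_range (Hs.isometry_toLp L s).isUniformInducing]
  have : Set.range (Hs.toLp L s) = {a : lp (fun _ : ℤ => ℂ) 2 | ∀ n : ℤ, a (-n) = conj (a n)} := by
    ext a; constructor
    · rintro ⟨c, rfl⟩ n
      change (√(weight L s (-n)) : ℂ) * c.1 (-n) = conj ((√(weight L s n) : ℂ) * c.1 n)
      rw [weight_neg, c.conj_coeff, map_mul, conj_ofReal]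
    · intro ha
      have h0 : ∀ n, (√(weight L s n) : ℂ) ≠ 0 := fun n => by
        exact_mod_cast (sqrt_weight_pos L s n).ne'
      have e : ∀ n, (√(weight L s n) : ℂ) * ((√(weight L s n) : ℂ)⁻¹ * a n) = a n := fun n =>
        mul_inv_cancel_left₀ (h0 n) _
      refine ⟨⟨fun n => (√(weight L s n) : ℂ)⁻¹ * a n, fun n => ?_, ?_⟩, ?_⟩
      · change (√(weight L s (-n)) : ℂ)⁻¹ * a (-n) = conj ((√(weight L s n) : ℂ)⁻¹ * a n)
        rw [weight_neg, show a (-n) = conj (a n) from ha n, map_mul, map_inv₀, conj_ofReal]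
      · rw [← memℓp_weighted_iff]; simp only [e]; exact a.2
      · ext n; exact e n
  rw [this]
  have hev : ∀ n : ℤ, Continuous fun a : lp (fun _ : ℤ => ℂ) 2 => a n := fun n =>
    (lp.evalCLM ℂ (fun _ : ℤ => ℂ) 2 n).continuous
  refine IsClosed.isComplete ?_; simp only [Set.ofPred_forall]
  exact isClosed_iInter fun n => isClosed_eq (hev _) (Complex.continuous_conj.comp (hev _))

lemma summable_ddx (hL : 0 < L) (hf : MemLp f 2 (perMeasure L)) :
    (Summable fun n => weight L (-1) n * ‖ddx L (coeffs L f) n‖ ^ 2) ∧ ∑' n, weight L (-1) n * ‖ddx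
    L (coeffs L f) n‖ ^ 2 ≤ (2 * L)⁻¹ * l2 (perMeasure L) f ^ 2 := by
  have hp := parseval hL hf; rw [integral_perMeasure hL, ← l2_sq] at hp
  have hle : ∀ n, weight L (-1) n * ‖ddx L (coeffs L f) n‖ ^ 2 ≤ ‖coeffs L f n‖ ^ 2 := by
    intro n
    rw [ddx, norm_mul, norm_mul, norm_I, one_mul, norm_real, mul_pow,
      norm_eq_abs, sq_abs, weight, rpow_neg_one, ← mul_assoc]
    refine mul_le_of_le_one_left (by positivity) ?_; rw [inv_mul_le_iff₀ (by positivity)]; linarith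
  have hs := hp.summable.of_nonneg_of_le (fun n => mul_nonneg (weight_pos L _ n).le (by positivity)) hle
  refine ⟨hs, ?_⟩; rw [← hp.tsum_eq]; exact hs.tsum_le_tsum hle hp.summable

/-- An element of `H^s` from its coefficients. -/
def Hs.mk (c : ℤ → ℂ) (h : (∀ n, c (-n) = conj (c n)) ∧
    Summable fun n => weight L s n * ‖c n‖ ^ 2) : Hs L s := (⟨c, h⟩ : hsSubmodule L s)

lemma Hs.mk_coe (c : ℤ → ℂ) (h : (∀ n, c (-n) = conj (c n)) ∧
    Summable fun n => weight L s n * ‖c n‖ ^ 2) : (Hs.mk c h).1 = c := rfl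

open Classical in
/-- The derivative of a real-valued square integrable function, as an element of `H⁻¹`. -/
def gradVec (L : ℝ) (f : ℝ → ℝ) : Hs L (-1) :=
  if h : (∀ n, ddx L (rcoeffs L f) (-n) = conj (ddx L (rcoeffs L f) n)) ∧
    Summable fun n => weight L (-1) n * ‖ddx L (rcoeffs L f) n‖ ^ 2 then Hs.mk _ h else 0

lemma ddx_conj {c : ℤ → ℂ} (h : ∀ n, c (-n) = conj (c n)) (n : ℤ) :
    ddx L c (-n) = conj (ddx L c n) := by simp [ddx, freq_neg, h n]

lemma gradVec_coe (hL : 0 < L) {f : ℝ → ℝ} (hf : MemLp (fun x => (f x : ℂ)) 2 (perMeasure L)) :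
    (gradVec L f).1 = ddx L (rcoeffs L f) := by
  have h : gradVec L f = Hs.mk _ _ := dif_pos ⟨ddx_conj (coeffs_real L f), (summable_ddx hL hf).1⟩
  rw [h, Hs.mk_coe]

lemma norm_gradVec_le (hL : 0 < L) {f : ℝ → ℝ} (hf : MemLp (fun x => (f x : ℂ)) 2 (perMeasure L))
    {B : ℝ} (hB : 0 ≤ B) (h : ∀ x, |f x| ≤ B) : ‖gradVec L f‖ ≤ B := by
  refine abs_le_of_sq_le_sq' ?_ hB |>.2; rw [Hs.norm_sq, gradVec_coe hL hf]
  refine (summable_ddx hL hf).2.trans ?_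
  have h1 := l2_le_of_bound hL hB (f := fun x => (f x : ℂ)) (.of_forall fun x => by simpa using h x)
  have h2 := pow_le_pow_left₀ (l2_nonneg _ _) h1 2; rw [mul_pow, sq_sqrt (by linarith)] at h2
  rw [inv_mul_le_iff₀ (by linarith)]; exact h2

lemma memLp_ofReal_sub {f g : ℝ → ℝ} (hf : MemLp (fun x => (f x : ℂ)) 2 (perMeasure L))
    (hg : MemLp (fun x => (g x : ℂ)) 2 (perMeasure L)) : MemLp (fun x => ((f x - g x : ℝ) : ℂ)) 2
    (perMeasure L) :=
  (memLp_congr_ae (.of_forall fun x => by simp)).1 (hf.sub hg)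

lemma gradVec_sub (hL : 0 < L) {f g : ℝ → ℝ} (hf : MemLp (fun x => (f x : ℂ)) 2 (perMeasure L))
    (hg : MemLp (fun x => (g x : ℂ)) 2 (perMeasure L)) : gradVec L (fun x => f x - g x) = gradVec L
    f - gradVec L g := by
  apply Subtype.ext; change _ = (gradVec L f).1 - (gradVec L g).1
  rw [gradVec_coe hL (memLp_ofReal_sub hf hg), gradVec_coe hL hf, gradVec_coe hL hg]; ext n
  simp only [ddx, rcoeffs, Complex.ofReal_sub, Pi.sub_apply]
  rw [coeffs_sub (MemLp.perIntegrable hL hf) (MemLp.perIntegrable hL hg)]; ring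

/-- The vector field in the moving frame, `q ↦ ∂ Re (16 k⁵ g(k))`. -/
def movingField (L : ℝ) (k : ℂ) (q : Hs L (-1)) : Hs L (-1) :=
  gradVec L fun x => (16 * k ^ 5 * diagGreen L q.1 k x).re

variable (hL : 1 ≤ L)
include hL

lemma coercive_of_im (hk : (k ^ 2).im ≠ 0) (q : Hs L (-1)) : Coercive L q k := by
  obtain ⟨ζ, hζ⟩ := exists_coercive_of_im_ne_zero hL ‖q‖ hk; exact ⟨ζ, hζ q le_rfl⟩

lemma Coercive.continuous_diagGreen (hc : Coercive L q k) :
    Continuous (diagGreen L q.1 k) := (hc.isPrim_diagGreen hL).continuous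

lemma memLp_re_diagGreen (hc : Coercive L q k) (c : ℂ) : MemLp
    (fun x => (((c * diagGreen L q.1 k x).re : ℝ) : ℂ)) 2 (perMeasure L) :=
  memLp_of_continuous (continuous_ofReal.comp (continuous_re.comp
    (continuous_const.mul (hc.continuous_diagGreen hL))))

lemma movingField_coe (hk : (k ^ 2).im ≠ 0) (q : Hs L (-1)) : (movingField L k q).1 = ddx L
    (rcoeffs L fun x => (16 * k ^ 5 * diagGreen L q.1 k x).re) :=
  gradVec_coe (by linarith) (memLp_re_diagGreen hL (coercive_of_im hL hk q) _)

lemma exists_diagGreen_bound (hk : (k ^ 2).im ≠ 0) (R : ℝ) : ∃ K, 0 ≤ K ∧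
    (∀ q : Hs L (-1), ‖q‖ ≤ R → ∀ x y, ‖green L q.1 k x y‖ ≤ K) ∧ (∀ q₁ q₂ : Hs L (-1), ‖q₁‖ ≤ R →
    ‖q₂‖ ≤ R → ∀ x y, ‖green L q₁.1 k x y - green L q₂.1 k x y‖ ≤ K * ‖q₁ - q₂‖) := by
  obtain ⟨ζ, hζ⟩ := exists_coercive_of_im_ne_zero hL R hk
  refine ⟨max (8 * ‖ζ‖) (288 * L ^ 2 * ‖ζ‖ ^ 2), le_max_of_le_left (by positivity),
    fun q hq x y => (norm_green_le hL (hζ q hq) x y).trans (le_max_left _ _),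
    fun q₁ q₂ h1 h2 x y => (norm_green_sub_le hL (hζ q₁ h1) (hζ q₂ h2) x y).trans ?_⟩
  gcongr; exact le_max_right _ _

lemma exists_movingField_bound (hk : (k ^ 2).im ≠ 0) (R : ℝ) : ∃ K, 0 ≤ K ∧
    (∀ q : Hs L (-1), ‖q‖ ≤ R → ‖movingField L k q‖ ≤ K) ∧ (∀ q₁ q₂ : Hs L (-1), ‖q₁‖ ≤ R → ‖q₂‖ ≤ R
    → ‖movingField L k q₁ - movingField L k q₂‖ ≤ K * ‖q₁ - q₂‖) := by
  have hL0 : 0 < L := by linarith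
  obtain ⟨K, hK0, h1, h2⟩ := exists_diagGreen_bound hL hk R
  refine ⟨‖16 * k ^ 5‖ * K, by positivity, fun q hq => ?_, fun q₁ q₂ hq₁ hq₂ => ?_⟩
  · refine norm_gradVec_le hL0 (memLp_re_diagGreen hL (coercive_of_im hL hk q) _) (by positivity)
      fun x => ?_
    refine (abs_re_le_norm _).trans ?_; rw [norm_mul]; gcongr; exact h1 q hq x x
  · have m1 := memLp_re_diagGreen hL (coercive_of_im hL hk q₁) (16 * k ^ 5)
    have m2 := memLp_re_diagGreen hL (coercive_of_im hL hk q₂) (16 * k ^ 5)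
    rw [movingField, movingField, ← gradVec_sub hL0 m1 m2]
    refine norm_gradVec_le hL0 (memLp_ofReal_sub m1 m2) (by positivity) fun x => ?_
    rw [← Complex.sub_re, ← mul_sub, mul_assoc ‖16 * k ^ 5‖]; refine (abs_re_le_norm _).trans ?_
    rw [norm_mul]; gcongr; exact h2 q₁ q₂ hq₁ hq₂ x x

lemma coeffs_deriv_diagGreen (hc : Coercive L q k) : coeffs L (deriv (diagGreen L q.1 k)) = ddx L
    (coeffs L (diagGreen L q.1 k)) := by
  refine (hc.isPrim_diagGreen hL).coeffs_deriv ?_; have := hc.diagGreen_periodic hL (-L); grind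

omit hL

lemma coeffs_deriv_of_periodic (hf : IsPrim f f') (hp : Periodic f (2 * L)) : coeffs L f' = ddx L
    (coeffs L f) := by
  refine hf.coeffs_deriv ?_; have := hp (-L); grind

lemma l2Per_of_continuous (hf : Continuous f) (hp : Periodic f (2 * L)) :
    L2Per L f := ⟨hp, hf.measurable, memLp_of_continuous hf⟩

lemma exists_linearized (hL : 1 ≤ L) (hk : Coercive L q k) (hϰ : Coercive L q ϰ)
    (hσ : σ = 1 ∨ σ = -1) : ∃ w, L2Per L w ∧ (∀ n, ddx L (coeffs L w) n + coeffs L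
    (fun x => (2 * weyl L q.1 ϰ σ x) * w x) n = 2 * (ϰ ^ 2 - k ^ 2) * ddx L
    (coeffs L (diagGreen L q.1 k)) n) ∧ coeffs L w = ddx L (coeffs L fun x => diagGreen L q.1 k x *
    weyl L q.1 ϰ σ x - deriv (diagGreen L q.1 k) x / 2) :=
    by
  have hL0 : 0 < L := by linarith
  set p := diagGreen L q.1 k with hp; set v := weyl L q.1 ϰ σ with hv
  set a := weyl L q.1 k 1 with ha; set b := weyl L q.1 k (-1) with hb
  set δ := ϰ ^ 2 - k ^ 2 with hδ; have hvp : L2Per L v := hϰ.l2Per_weyl hL hσ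
  have hap : L2Per L a := hk.l2Per_weyl hL (Or.inl rfl)
  have hbp : L2Per L b := hk.l2Per_weyl hL (Or.inr rfl)
  have hpP : IsPrim p (deriv p) := hk.isPrim_diagGreen hL
  have hpper : Periodic p (2 * L) := hk.diagGreen_periodic hL
  have hp0 : ∀ x, p x ≠ 0 := hk.diagGreen_ne_zero hL
  have hdp : ∀ x, deriv p x = (a x + b x) * p x := hk.deriv_diagGreen hL
  have hab : ∀ x, a x - b x = (p x)⁻¹ := hk.weyl_sub hL; have ivv := hvp.integrable_mul hL0 hvp
  have iaa := hap.integrable_mul hL0 hap; have ibb := hbp.integrable_mul hL0 hbp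
  have iv := hvp.intervalIntegrable hL0; have ia := hap.intervalIntegrable hL0
  have ib := hbp.intervalIntegrable hL0
  obtain ⟨r, hr, hrp, hvr⟩ := exists_periodic_prim hL0 hvp
    (F := fun x => (1 / 2 : ℂ) * (a x + b x)) ((hap.add hbp).const_mul _)
    (s := fun x => (δ + (1 / 2 : ℂ) * (a x * a x + b x * b x)) - v x * v x)
    (fun x => by simp only [hap.periodic x, hbp.periodic x, hvp.periodic x])
    (fun c d => (intervalIntegrable_const.add (((iaa c d).add (ibb c d)).const_mul _)).sub (ivv c d))
    fun n => by
      have e1 := (hϰ.isRiccati hL hσ).eqn n; have e2 := (hk.isRiccati hL (Or.inl rfl)).eqn n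
      have e3 := (hk.isRiccati hL (Or.inr rfl)).eqn n; simp only [sq (weyl _ _ _ _ _)] at e1 e2 e3
      simp only [ddx] at e1 e2 e3 ⊢
      rw [coeffs_sub (intervalIntegrable_const.add (((iaa _ _).add (ibb _ _)).const_mul _)) (ivv _ _),
        coeffs_add intervalIntegrable_const (((iaa _ _).add (ibb _ _)).const_mul _),
        coeffs_const_mul, coeffs_const_mul, coeffs_add (iaa _ _) (ibb _ _), coeffs_add (ia _ _) (ib _ _),
        coeffs_const hL0]
      grind
  have hr2 : IsPrim r (fun x => δ - r x * r x - r x * (a x + b x) + (1 / 4) * ((p x)⁻¹ * (p x)⁻¹)) :=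
    hr.congr_ae (by
      filter_upwards [hvr] with x hx
      rw [hx, ← hab]; ring)
  have hprP : IsPrim (fun x => p x * r x) (fun x => p x * (δ - r x * r x) + (1 / 4) * (p x)⁻¹) :=
    (hpP.mul hr2).congr (fun _ => rfl) fun x => by grind
  have hwc : Continuous fun x => p x * (δ - r x * r x) + (1 / 4) * (p x)⁻¹ :=
    (hpP.continuous.mul (continuous_const.sub (hr.continuous.mul hr.continuous))).add
      (continuous_const.mul (hpP.continuous.inv₀ hp0))
  have hwper : Periodic (fun x => p x * (δ - r x * r x) + (1 / 4) * (p x)⁻¹) (2 * L) :=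
    fun x => by simp only [hpper x, hrp x]
  refine ⟨_, l2Per_of_continuous hwc hwper, fun n => ?_, ?_⟩
  · have hw := (hpP.mul ((IsPrim.const δ).sub (hr2.mul hr2))).add ((hpP.inv hp0).const_mul (1 / 4))
    have hw1 := coeffs_deriv_of_periodic hw hwper
    have hw2 := hw.congr_ae (g' := fun x => 2 * δ * deriv p x - 2 * v x *
      (p x * (δ - r x * r x) + (1 / 4) * (p x)⁻¹)) (by
        filter_upwards [hvr] with x hx
        grind)
    rw [← coeffs_deriv_of_periodic hw2 hwper, coeffs_sub ((hpP.1 _ _).const_mul _)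
      ((hvp.const_mul 2).integrable_mul hL0 (l2Per_of_continuous hwc hwper) _ _),
      coeffs_const_mul, coeffs_deriv_of_periodic hpP hpper]
    ring
  · rw [coeffs_deriv_of_periodic hprP (fun x => by simp only [hpper x, hrp x])]; congr 1
    refine coeffs_congr_ae hL0 ?_
    filter_upwards [ae_restrict_of_ae hvr] with x hx
    rw [hx, hdp]; ring

end

section

lemma IsRiccati.form_eq (hL : 1 ≤ L) (hv : IsRiccati L q.1 lam v) (hu : HasH1Deriv u u')
    (hψ : HasH1Deriv ψ ψ') : form L q.1 lam u u' ψ ψ' = ∫ x, (u' x - v x * u x) *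
    (ψ' x - v x * ψ x) := by
  have hL0 : 0 < L := by linarith
  obtain ⟨W, hW, -⟩ := exists_antideriv hL q; have hvp := hv.l2Per
  have ivv := hvp.integrable_mul hL0 hvp
  obtain ⟨r, hr, hrp, hvr⟩ := exists_periodic_prim hL0 hvp hW.l2Per
    (s := fun x => (q.1 0 + lam) - v x * v x)
    (fun x => by simp only [hvp.periodic x]) (fun a b => intervalIntegrable_const.sub (ivv a b))
    fun n => by
      have e1 := hv.eqn n; rw [antideriv_eq_ddx hW n] at e1; simp only [sq] at e1
      rw [coeffs_sub intervalIntegrable_const (ivv _ _), coeffs_const hL0]; grind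
  have hrL : L2Per L r := l2Per_of_continuous hr.continuous hrp
  have mvu := hu.memLp_per_mul hL0 hvp; have mvψ := hψ.memLp_per_mul hL0 hvp
  have iuψ := hu.integrable_mul hψ; have i2 := integrable_mul_two mvu mvψ
  have i3 := integrable_mul_two hu.memLp_deriv hψ.memLp_deriv
  have iW := hu.integrable_per_mul hL0 hW.l2Per hψ; have ir := hu.integrable_per_mul hL0 hrL hψ
  have is : Integrable (fun x => ((q.1 0 + lam) - v x * v x) * (u x * ψ x)) volume :=
    ((iuψ.const_mul (q.1 0 + lam)).sub i2).congr (.of_forall fun x => by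
      simp only [Pi.sub_apply]; ring)
  have hz := (hr.mul (hu.isPrim_mul hψ)).integral_eq_zero
    ((integrable_mul_two (hu.memLp_per_mul hL0 hrL) hψ.memLp).congr
      (.of_forall fun x => by simp only []; ring)) (is.add ir)
  rw [integral_add is ir] at hz
  have e1 : ∫ x, ((q.1 0 + lam) - v x * v x) * (u x * ψ x) =
      (q.1 0 + lam) * (∫ x, u x * ψ x) - ∫ x, v x * u x * (v x * ψ x) := by
    rw [← integral_const_mul, ← integral_sub (iuψ.const_mul _) i2]; congr 1; ext x; ring
  have iv : Integrable (fun x => v x * dmul u u' ψ ψ' x) volume := hu.integrable_per_mul hL0 hvp hψ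
  have e2 : ∫ x, v x * dmul u u' ψ ψ' x =
      (∫ x, W x * dmul u u' ψ ψ' x) + ∫ x, r x * dmul u u' ψ ψ' x := by
    rw [← integral_add iW ir]; refine integral_congr_ae ?_
    filter_upwards [hvr] with x hx
    rw [hx]; ring
  have e3 : ∫ x, (u' x - v x * u x) * (ψ' x - v x * ψ x) = (∫ x, u' x * ψ' x) -
      (∫ x, v x * dmul u u' ψ ψ' x) + ∫ x, v x * u x * (v x * ψ x) := by
    rw [← integral_sub i3 iv, ← integral_add (f := fun x => u' x * ψ' x - v x * dmul u u' ψ ψ' x)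
      (i3.sub iv) i2]
    congr 1; ext x; simp only [dmul]; ring
  rw [e3, form, hW.pair_eq hL hu hψ]; linear_combination hz - e1 + e2

lemma memLp_bdd_mul {P : ℝ → ℂ} (hf : MemLp f 2 volume) (hP : Continuous P) {B : ℝ}
    (hB : ∀ x, ‖P x‖ ≤ B) : MemLp (fun x => P x * f x) 2 volume :=
  hf.of_le_mul (c := B) (hP.aestronglyMeasurable.mul hf.1) (.of_forall fun x => by
    rw [norm_mul]; gcongr; exact hB x)

lemma exists_lower_bound (hL : 1 ≤ L) (hv : L2Per L v) {M m : ℝ} (hM : l2 (perMeasure L) v ≤ M)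
    (hm : ∫ x in (-L)..L, v x = m) (hu : HasH1Deriv u u') : (m / (2 * L)) ^ 2 * Real.exp
    (-(8 * (√(2 * L) * M))) * (∫ x, ‖u x‖ ^ 2) ≤ ∫ x, ‖u' x - v x * u x‖ ^ 2 := by
  have hL0 : 0 < L := by linarith
  set A := √(2 * L) * M with hA; have hvi := hv.intervalIntegrable hL0
  have hint : ∫ x in (-L)..L, ‖v x‖ ≤ A :=
    (integral_norm_le_l2 hL0 hv.memLp).trans (by rw [hA]; gcongr)
  have hmA : |m| ≤ A := by
    have := intervalIntegral.norm_integral_le_integral_norm (f := v) (μ := volume)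
      (show -L ≤ L by linarith)
    rw [hm, norm_real] at this; exact this.trans hint
  set μ := m / (2 * L) with hμ; have hμL : μ * (2 * L) = m := by rw [hμ]; field_simp
  -- the phase
  have hθ := ((IsPrim.of_hasDerivAt (f := fun x : ℝ => (μ : ℂ) * x) (f' := fun _ => (μ : ℂ))
    (fun x => by simpa using ((hasDerivAt_id x).ofReal_comp.const_mul (μ : ℂ)))
    continuous_const).sub (IsPrim.primitive hvi 0))
  set θ : ℝ → ℂ := fun x => (μ : ℂ) * x - ∫ t in (0 : ℝ)..x, v t with hθdef
  have hθper : Periodic θ (2 * L) := fun x => by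
    have e := hv.periodic.intervalIntegral_add_eq x (-L); rw [show -L + 2 * L = L by ring, hm] at e
    simp only [hθdef]
    rw [← integral_add_adjacent_intervals (hvi 0 x) (hvi x (x + 2 * L)), e, ← hμL]
    push_cast; ring
  have hθb0 : ∀ x ∈ Icc (-L) L, ‖θ x‖ ≤ 2 * A := by
    intro x hx
    have h1 : ‖∫ t in (0 : ℝ)..x, v t‖ ≤ A := by
      refine (intervalIntegral.norm_integral_le_abs_integral_norm).trans (le_trans ?_ hint)
      rw [intervalIntegral.abs_integral_eq_abs_integral_uIoc, abs_of_nonneg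
        (setIntegral_nonneg measurableSet_uIoc fun _ _ => norm_nonneg _),
        integral_of_le (by linarith)]
      refine setIntegral_mono_set ((intervalIntegrable_iff_integrableOn_Ioc_of_le
        (by linarith)).1 (hvi (-L) L)).norm (.of_forall fun _ => norm_nonneg _)
        (LE.le.eventuallyLE fun t ht => ?_)
      grind
    have h2 : ‖(μ : ℂ) * x‖ ≤ A := by
      rw [norm_mul, norm_real, norm_real, norm_eq_abs, norm_eq_abs]
      have hx' : |x| ≤ 2 * L := (abs_le.2 hx).trans (by linarith)
      calc |μ| * |x| ≤ |μ| * (2 * L) := by gcongr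
        _ = |m| := by rw [← hμL, abs_mul, abs_of_pos (show 0 < 2 * L by linarith)]
        _ ≤ A := hmA
    calc _ ≤ ‖(μ : ℂ) * x‖ + ‖∫ t in (0 : ℝ)..x, v t‖ := norm_sub_le _ _
      _ ≤ _ := by linarith
  have hθb : ∀ x, ‖θ x‖ ≤ 2 * A := fun x => by
    obtain ⟨y, hy, hxy⟩ := hθper.exists_mem_Ioc (show 0 < 2 * L by linarith) x (-L); grind
  set P : ℝ → ℂ := fun x => exp (θ x) with hP; have hPp := hθ.exp; set b := Real.exp (2 * A) with hb
  have hb0 : 0 < b := exp_pos _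
  have hP1 : ∀ x, ‖P x‖ ≤ b := fun x => by
    rw [hP, norm_exp]; exact exp_le_exp.2 ((re_le_norm _).trans (hθb x))
  have hP2 : ∀ x, b⁻¹ ≤ ‖P x‖ := fun x => by
    rw [hP, norm_exp, hb, ← Real.exp_neg]
    exact exp_le_exp.2 (neg_le_of_abs_le ((abs_re_le_norm _).trans (hθb x)))
  have hPc : Continuous P := hPp.continuous
  have hf : MemLp (fun x => u' x - v x * u x) 2 volume :=
    hu.memLp_deriv.sub (hu.memLp_per_mul hL0 hv)
  have ht : HasH1Deriv (fun x => P x * u x)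
      (fun x => P x * (u' x - v x * u x) + μ * (P x * u x)) := by
    refine ((hPp.mul hu.isPrim).congr (fun _ => rfl) fun x => ?_).hasH1Deriv
      (memLp_bdd_mul hu.memLp hPc hP1)
      ((memLp_bdd_mul hf hPc hP1).add ((memLp_bdd_mul hu.memLp hPc hP1).const_mul _))
    simp only [hP]; ring
  have m1 := memLp_bdd_mul hf hPc hP1; have m2 := memLp_bdd_mul hu.memLp hPc hP1
  have hz := (ht.isPrim_mul ht.conj).integral_eq_zero (ht.integrable_mul ht.conj)
    (ht.integrable_dmul ht.conj)
  have key : μ ^ 2 * (∫ x, ‖P x * u x‖ ^ 2) ≤ ∫ x, ‖P x * (u' x - v x * u x)‖ ^ 2 := by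
    have j2 := integrable_norm_sq m2
    set D := dmul (fun x => P x * u x) (fun x => P x * (u' x - v x * u x) + μ * (P x * u x))
      (fun x => conj (P x * u x)) (fun x => conj (P x * (u' x - v x * u x) + μ * (P x * u x)))
      with hD
    have j3 : Integrable D volume := ht.integrable_dmul ht.conj
    have e2 : ∫ x, (D x).re = 0 := (integral_re (𝕜 := ℂ) j3).trans (congrArg _ hz)
    have j4 : Integrable (fun x => (D x).re) volume := Integrable.re (𝕜 := ℂ) j3
    have := integral_mono (f := fun x => μ ^ 2 * ‖P x * u x‖ ^ 2 - μ * (D x).re)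
      ((j2.const_mul _).sub (j4.const_mul μ)) (integrable_norm_sq m1) fun x => by
        simp only [hD, dmul]; set z := P x * (u' x - v x * u x); set w := P x * u x
        simp only [← normSq_eq_norm_sq, Complex.normSq_apply, add_re, Complex.add_im, mul_re,
          Complex.mul_im, Complex.conj_re, conj_im, ofReal_re, ofReal_im, map_add, map_mul, conj_ofReal]
        nlinarith [sq_nonneg (z.re + μ * w.re), sq_nonneg (z.im + μ * w.im)]
    rw [integral_sub (j2.const_mul _) (j4.const_mul μ), integral_const_mul, integral_const_mul,
      e2] at this
    linarith
  have up : ∫ x, ‖P x * (u' x - v x * u x)‖ ^ 2 ≤ b ^ 2 * ∫ x, ‖u' x - v x * u x‖ ^ 2 := by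
    rw [← integral_const_mul]
    refine integral_mono (integrable_norm_sq m1) ((integrable_norm_sq hf).const_mul _) fun x => ?_
    simp only [norm_mul, mul_pow]; gcongr; exact hP1 x
  have lo : (b⁻¹) ^ 2 * ∫ x, ‖u x‖ ^ 2 ≤ ∫ x, ‖P x * u x‖ ^ 2 := by
    rw [← integral_const_mul]
    refine integral_mono ((integrable_norm_sq hu.memLp).const_mul _) (integrable_norm_sq m2) fun x => ?_
    simp only [norm_mul, mul_pow]; gcongr; exact hP2 x
  have hexp : Real.exp (-(8 * A)) = (b⁻¹) ^ 2 * (b⁻¹) ^ 2 := by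
    rw [hb, ← Real.exp_neg, ← pow_add, ← Real.exp_nat_mul]; congr 1; push_cast; ring
  rw [hexp]; have h1 := mul_le_mul_of_nonneg_left lo (sq_nonneg μ)
  have h2 := (h1.trans key).trans up; have h3 := mul_le_mul_of_nonneg_left h2 (sq_nonneg b⁻¹)
  have hbb : b⁻¹ ^ 2 * (b ^ 2 * ∫ x, ‖u' x - v x * u x‖ ^ 2) = ∫ x, ‖u' x - v x * u x‖ ^ 2 := by
    field_simp
  linarith

lemma Coercive.weyl_real {κ : ℝ} (hL : 1 ≤ L) (hc : Coercive L q κ) (x : ℝ) : conj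
    (weyl L q.1 κ s x) = weyl L q.1 κ s x := by
  have hg : ∀ x, conj (diagGreen L q.1 κ x) = diagGreen L q.1 κ x := fun x => by
    have := hc.green_conj hL x x; rw [conj_ofReal] at this; exact this.symm
  have hd : conj (deriv (diagGreen L q.1 κ) x) = deriv (diagGreen L q.1 κ) x := by
    have h := deriv.star (𝕜 := ℝ) (f := diagGreen L q.1 (κ : ℂ)) (x := x)
    have e : (fun y => star (diagGreen L q.1 (κ : ℂ) y)) = diagGreen L q.1 (κ : ℂ) := funext hg
    rw [e] at h; exact h.symm
  rw [weyl, map_div₀, map_mul, map_add, hg, hd, conj_ofReal, conj_ofNat]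

variable (hL : 1 ≤ L)
include hL

lemma IsRiccati.integral_sq (hv : IsRiccati L q.1 lam v) : ∫ x in (-L)..L, v x ^ 2 = 2 * L *
    (q.1 0 + lam) := by
  have h := hv.eqn 0; have hL0 : (L : ℂ) ≠ 0 := by exact_mod_cast (show L ≠ 0 by linarith)
  rw [ddx, freq_zero, coeffs_zero_eq, coeffs_zero_eq, if_pos rfl] at h; rw [← h]
  simp only [ofReal_zero, mul_zero, zero_mul, zero_add]; field_simp

lemma exists_norm_bound (lam : ℂ) (M : ℝ) : ∃ B, ∀ (q : Hs L (-1)) (v : ℝ → ℂ), IsRiccati L q.1 lam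
    v → l2 (perMeasure L) v ≤ M → ‖q‖ ≤ B := by
  have hL0 : 0 < L := by linarith
  set S := ∑' n, weight L (-1) n with hS; have hSs := summable_weight_neg_one hL0
  refine ⟨√(3 * M ^ 2 + 3 * (S * (M ^ 2) ^ 2) + 3 * (S * ‖lam‖ ^ 2)), fun q v hv hM => ?_⟩
  refine le_sqrt_of_sq_le ?_; rw [Hs.norm_sq]; obtain ⟨h1, h2⟩ := summable_ddx hL0 hv.l2Per.memLp
  have hM0 := (l2_nonneg (perMeasure L) v).trans hM
  have hl : l2 (perMeasure L) v ^ 2 ≤ M ^ 2 := pow_le_pow_left₀ (l2_nonneg _ _) hM 2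
  have h2L : (2 * L)⁻¹ ≤ 1 := inv_le_one_of_one_le₀ (by linarith)
  have hc : ∀ n, ‖coeffs L (fun x => v x ^ 2) n‖ ≤ M ^ 2 := fun n => by
    refine (norm_coeffs_le hL0 _ n).trans ?_; rw [integral_perMeasure hL0]; simp only [norm_pow]
    rw [← l2_sq]; nlinarith
  have hle : ∀ n, weight L (-1) n * ‖q.1 n‖ ^ 2 ≤ 3 * (weight L (-1) n * ‖ddx L (coeffs L v) n‖ ^ 2) +
      3 * (weight L (-1) n * (M ^ 2) ^ 2) + 3 * (weight L (-1) n * ‖lam‖ ^ 2) := by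
    intro n
    have e : q.1 n = ddx L (coeffs L v) n + coeffs L (fun x => v x ^ 2) n - if n = 0 then lam else 0 := by
      rw [hv.eqn n]; ring
    have hi : ‖(if n = 0 then lam else 0 : ℂ)‖ ≤ ‖lam‖ := by split_ifs <;> simp
    have hq : ‖q.1 n‖ ≤ ‖ddx L (coeffs L v) n‖ + M ^ 2 + ‖lam‖ := by
      rw [e]; refine (norm_sub_le _ _).trans (add_le_add ((norm_add_le _ _).trans ?_) hi); gcongr
      exact hc n
    have hq2 : ‖q.1 n‖ ^ 2 ≤ 3 * ‖ddx L (coeffs L v) n‖ ^ 2 + 3 * (M ^ 2) ^ 2 + 3 * ‖lam‖ ^ 2 := by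
      refine (pow_le_pow_left₀ (norm_nonneg _) hq 2).trans ?_
      nlinarith [sq_nonneg (‖ddx L (coeffs L v) n‖ - M ^ 2), sq_nonneg (M ^ 2 - ‖lam‖),
        sq_nonneg (‖ddx L (coeffs L v) n‖ - ‖lam‖)]
    have := mul_le_mul_of_nonneg_left hq2 (weight_pos L (-1) n).le; linarith
  have s1 := h1.mul_left 3; have s2 := (hSs.mul_right ((M ^ 2) ^ 2)).mul_left 3
  have s3 := (hSs.mul_right (‖lam‖ ^ 2)).mul_left 3
  refine (q.summable.tsum_le_tsum hle ((s1.add s2).add s3)).trans ?_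
  rw [(s1.add s2).tsum_add s3, s1.tsum_add s2, tsum_mul_left, tsum_mul_left, tsum_mul_left,
    tsum_mul_right, tsum_mul_right]
  nlinarith

lemma coercive_of_lower_bound {lam c : ℝ} (hlam : 0 ≤ lam) (hc : 0 < c) (h : ∀ u u' : ℝ → ℂ,
    HasH1Deriv u u' → c * (∫ x, ‖u x‖ ^ 2) ≤
    (form L q.1 lam u u' (fun x => conj (u x)) (fun x => conj (u' x))).re) : ∃ ζ, CoerciveForm L q.1
    lam ζ := by
  set G := gardingConst L ‖q‖ with hG; have hG0 : 0 ≤ G := by rw [hG, gardingConst]; positivity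
  refine ⟨((1 + (G + 1 / 2) / c : ℝ) : ℂ), ?_, fun u u' hu => ?_⟩
  · have : 0 < 1 + (G + 1 / 2) / c := by positivity
    exact_mod_cast this.ne'
  · rw [re_ofReal_mul]; have h1 := h u u' hu
    have h2 := (abs_le.1 ((abs_re_le_norm _).trans (norm_pair_self_le hL q le_rfl hu))).1
    set F := (form L q.1 lam u u' (fun x => conj (u x)) (fun x => conj (u' x))).re with hF
    have h3 : F = (∫ x, ‖u' x‖ ^ 2) + (pair L q.1 fun x => u x * conj (u x)).re +
        lam * ∫ x, ‖u x‖ ^ 2 := by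
      rw [hF, form, integral_mul_conj, integral_mul_conj, add_re, add_re,
        ofReal_re, ← ofReal_mul, ofReal_re]
    have hA : 0 ≤ ∫ x, ‖u x‖ ^ 2 := integral_nonneg fun _ => by positivity
    rw [h1sq]; set A := ∫ x, ‖u x‖ ^ 2; set D := ∫ x, ‖u' x‖ ^ 2
    have h4 : (G + 1 / 2) * A ≤ (G + 1 / 2) / c * F := by
      have := mul_le_mul_of_nonneg_left h1 (show 0 ≤ (G + 1 / 2) / c by positivity)
      refine le_trans (le_of_eq ?_) this; field_simp
    nlinarith

lemma form_sub_pot (q₁ q₂ : Hs L (-1)) (lam : ℂ) (hu : HasH1Deriv u u') (hψ : HasH1Deriv ψ ψ') :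
    form L q₁.1 lam u u' ψ ψ' = form L q₂.1 lam u u' ψ ψ' + pair L (q₁ - q₂).1
    (fun x => u x * ψ x) := by
  rw [pair_sub_left hL q₁ q₂ hu hψ, form, form]; ring

end

section

lemma im_conj_sq_ne (hk : (k ^ 2).im ≠ 0) : ((conj k) ^ 2).im ≠ 0 := by
  rw [← map_pow, conj_im]; exact neg_ne_zero.2 hk

lemma L2Per.coeffs_add (hL : 0 < L) (hf : L2Per L f) (hg : L2Per L g) (n : ℤ) : coeffs L
    (fun x => f x + g x) n = coeffs L f n + coeffs L g n :=
  HkFlow.coeffs_add (hf.intervalIntegrable hL _ _) (hg.intervalIntegrable hL _ _) n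

lemma l2Per_diagGreen (hL : 1 ≤ L) {q : Hs L (-1)} (hk : Coercive L q k) : L2Per L
    (diagGreen L q.1 k) :=
  l2Per_of_continuous (hk.continuous_diagGreen hL) (hk.diagGreen_periodic hL)

lemma movingField_apply (hL : 1 ≤ L) (hk : (k ^ 2).im ≠ 0) (q : Hs L (-1)) (n : ℤ) :
    (movingField L k q).1 n = 8 * k ^ 5 * ddx L (coeffs L (diagGreen L q.1 k)) n + 8 * (conj k) ^ 5
    * ddx L (coeffs L (diagGreen L q.1 (conj k))) n := by
  have hL0 : 0 < L := by linarith
  have hc := coercive_of_im hL hk q; have hc' := coercive_of_im hL (im_conj_sq_ne hk) q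
  rw [movingField_coe hL hk]; simp only [ddx, rcoeffs]
  have : (fun x => (((16 * k ^ 5 * diagGreen L q.1 k x).re : ℝ) : ℂ)) = fun x =>
      8 * k ^ 5 * diagGreen L q.1 k x + 8 * (conj k) ^ 5 * diagGreen L q.1 (conj k) x := by
    ext x
    have e : diagGreen L q.1 (conj k) x = conj (diagGreen L q.1 k x) := hc.green_conj hL x x
    rw [e, Complex.re_eq_add_conj, map_mul, map_mul, map_pow, conj_ofNat]; ring
  rw [this, ((l2Per_diagGreen hL hc).const_mul _).coeffs_add hL0
    ((l2Per_diagGreen hL hc').const_mul _), coeffs_const_mul, coeffs_const_mul]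
  ring

lemma exists_weyl_deriv (hL : 1 ≤ L) (hk : (k ^ 2).im ≠ 0) {q : Hs L (-1)} (hϰ : Coercive L q ϰ)
    (h1 : ϰ ^ 2 ≠ k ^ 2) (h2 : ϰ ^ 2 ≠ (conj k) ^ 2) (hσ : σ = 1 ∨ σ = -1) : ∃ w, L2Per L w ∧ (∀ n,
    ddx L (coeffs L w) n + coeffs L (fun x => (2 * weyl L q.1 ϰ σ x) * w x) n =
    (movingField L k q).1 n) ∧ coeffs L w = ddx L (coeffs L fun x => 4 * k ^ 5 / (ϰ ^ 2 - k ^ 2) *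
    (diagGreen L q.1 k x * weyl L q.1 ϰ σ x - deriv (diagGreen L q.1 k) x / 2) + 4 * (conj k) ^ 5 /
    (ϰ ^ 2 - (conj k) ^ 2) *
    (diagGreen L q.1 (conj k) x * weyl L q.1 ϰ σ x - deriv (diagGreen L q.1 (conj k)) x / 2)) :=
    by
  have hL0 : 0 < L := by linarith
  have hc := coercive_of_im hL hk q; have hc' := coercive_of_im hL (im_conj_sq_ne hk) q
  obtain ⟨w, hw, e1, e2⟩ := exists_linearized hL hc hϰ hσ
  obtain ⟨w', hw', e1', e2'⟩ := exists_linearized hL hc' hϰ hσ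
  set A := 4 * k ^ 5 / (ϰ ^ 2 - k ^ 2) with hA
  set B := 4 * (conj k) ^ 5 / (ϰ ^ 2 - (conj k) ^ 2) with hB
  have hA' : A * (2 * (ϰ ^ 2 - k ^ 2)) = 8 * k ^ 5 := by grind
  have hB' : B * (2 * (ϰ ^ 2 - (conj k) ^ 2)) = 8 * (conj k) ^ 5 := by grind
  have hv := (hϰ.l2Per_weyl hL hσ).const_mul 2
  have hD : ∀ {l : ℂ}, Coercive L q l → ∀ a b, IntervalIntegrable (fun x =>
      diagGreen L q.1 l x * weyl L q.1 ϰ σ x - deriv (diagGreen L q.1 l) x / 2) volume a b :=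
    fun hl a b => ((l2Per_diagGreen hL hl).integrable_mul hL0 (hϰ.l2Per_weyl hL hσ) a b).sub
      (((hl.isPrim_diagGreen hL).1 a b).div_const 2)
  refine ⟨fun x => A * w x + B * w' x, (hw.const_mul A).add (hw'.const_mul B), fun n => ?_, ?_⟩
  · have f : (fun x => 2 * weyl L q.1 ϰ σ x * (A * w x + B * w' x)) = fun x =>
        A * (2 * weyl L q.1 ϰ σ x * w x) + B * (2 * weyl L q.1 ϰ σ x * w' x) := by ext x; ring
    have g1 := e1 n; have g2 := e1' n
    rw [f, HkFlow.coeffs_add ((hv.integrable_mul hL0 hw _ _).const_mul A)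
      ((hv.integrable_mul hL0 hw' _ _).const_mul B), coeffs_const_mul, coeffs_const_mul,
      movingField_apply hL hk, ← hA', ← hB']
    rw [ddx, (hw.const_mul A).coeffs_add hL0 (hw'.const_mul B), coeffs_const_mul, coeffs_const_mul]
    simp only [ddx] at g1 g2 ⊢; linear_combination A * g1 + B * g2
  · ext n
    rw [(hw.const_mul A).coeffs_add hL0 (hw'.const_mul B), coeffs_const_mul, coeffs_const_mul,
      ddx, HkFlow.coeffs_add ((hD hc _ _).const_mul A) ((hD hc' _ _).const_mul B), coeffs_const_mul,
      coeffs_const_mul, e2, e2']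
    simp only [ddx]; ring

lemma norm_integral_le_l2 (hL : 0 < L) (hf : MemLp f 2 (perMeasure L)) : ‖∫ x in (-L)..L, f x‖ ≤
    √(2 * L) * l2 (perMeasure L) f :=
  (intervalIntegral.norm_integral_le_integral_norm (by linarith)).trans (integral_norm_le_l2 hL hf)

lemma hasDerivWithinAt_integral_weyl (hL : 1 ≤ L) (hσ : σ = 1 ∨ σ = -1) {q : ℝ → Hs L (-1)}
    {X : Hs L (-1)} {s : Set ℝ} (hq : HasDerivWithinAt q X s t) (hc : Coercive L (q t) k)
    (hw : L2Per L w) (heq : ∀ n, ddx L (coeffs L w) n + coeffs L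
    (fun x => (2 * weyl L (q t).1 k σ x) * w x) n = X.1 n) : HasDerivWithinAt
    (fun τ => ∫ x in (-L)..L, weyl L (q τ).1 k σ x) (∫ x in (-L)..L, w x) s t := by
  have hL0 : 0 < L := by linarith
  rw [hasDerivWithinAt_iff_tendsto_slope, tendsto_iff_norm_sub_tendsto_zero]
  have hcont : Tendsto q (𝓝[s \ {t}] t) (𝓝 (q t)) := hq.continuousWithinAt.mono Set.sdiff_subset
  have h := (tendsto_weyl_slope hL hσ hq hc hw heq).const_mul (√(2 * L)); rw [mul_zero] at h
  refine squeeze_zero' (.of_forall fun _ => norm_nonneg _) ?_ h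
  filter_upwards [hcont.eventually (hc.eventually hL)] with τ hτ
  have hv := hτ.l2Per_weyl hL hσ; have hv' := hc.l2Per_weyl hL hσ
  refine le_trans (le_of_eq ?_) (norm_integral_le_l2 hL0 (((hv.sub hv').const_mul _).sub hw).memLp)
  rw [intervalIntegral.integral_sub (((hv.sub hv').const_mul _).intervalIntegrable hL0 _ _)
    (hw.intervalIntegrable hL0 _ _), intervalIntegral.integral_const_mul,
    intervalIntegral.integral_sub (hv.intervalIntegrable hL0 _ _) (hv'.intervalIntegrable hL0 _ _),
    slope, vsub_eq_sub, real_smul, ofReal_inv]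

lemma Hs.norm_coeff_le (q : Hs L s) (n : ℤ) : ‖q.1 n‖ ≤ (√(weight L s n))⁻¹ * ‖q‖ := by
  rw [← div_eq_inv_mul, le_div_iff₀ (sqrt_weight_pos L s n)]
  refine abs_le_of_sq_le_sq' ?_ (norm_nonneg _) |>.2
  rw [mul_pow, sq_sqrt (weight_pos L s n).le, mul_comm]; rw [Hs.norm_sq]
  exact q.summable.le_tsum n fun m _ => mul_nonneg (weight_pos L s m).le (by positivity)

/-- Evaluation of a Fourier coefficient, as a continuous linear map. -/
def coeffCLM (L s : ℝ) (n : ℤ) : Hs L s →L[ℝ] ℂ :=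
  LinearMap.mkContinuous ⟨⟨fun q => q.1 n, fun _ _ => rfl⟩, fun _ _ => rfl⟩ (√(weight L s n))⁻¹ fun q => q.norm_coeff_le n

lemma coeffCLM_apply (s : ℝ) (n : ℤ) (q : Hs L s) : coeffCLM L s n q = q.1 n := rfl

lemma const_of_deriv_zero_Icc {E : Type*} [NormedAddCommGroup E] [NormedSpace ℝ E] {f : ℝ → E}
    (h : ∀ t ∈ Icc a b, HasDerivWithinAt f 0 (Icc a b) t) : ∀ t ∈ Icc a b, f t = f a := by
  refine constant_of_has_deriv_right_zero (fun t ht => (h t ht).continuousWithinAt) fun t ht => ?_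
  exact (h t ⟨ht.1, ht.2.le⟩).mono_of_mem_nhdsWithin (Icc_mem_nhdsGE_of_mem ht)

section apriori
variable {q : ℝ → Hs L (-1)} {c : ℝ → ℝ} {κ : ℝ}

variable (hL : 1 ≤ L)
include hL

lemma movingField_zero (hk : (k ^ 2).im ≠ 0) (q : Hs L (-1)) :
    (movingField L k q).1 0 = 0 := by rw [movingField_coe hL hk, ddx, freq_zero]; simp

lemma coeff_zero_conserved (hk : (k ^ 2).im ≠ 0) (hq : ∀ t ∈ Icc 0 b, HasDerivWithinAt q
    (c t • movingField L k (q t)) (Icc 0 b) t) (t : ℝ) (ht : t ∈ Icc 0 b) : (q t).1 0 = (q 0).1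
    0 := by
  refine const_of_deriv_zero_Icc (f := fun t => (q t).1 0) (fun t ht => ?_) t ht
  have := (coeffCLM L (-1) 0).hasFDerivAt.comp_hasDerivWithinAt t (hq t ht)
  refine this.congr_deriv ?_; rw [map_smul, coeffCLM_apply, movingField_zero hL hk, smul_zero]

lemma integral_weyl_conserved (hk : (k ^ 2).im ≠ 0) (hq : ∀ t ∈ Icc 0 b, HasDerivWithinAt q
    (c t • movingField L k (q t)) (Icc 0 b) t) (hc : ∀ t ∈ Icc 0 b, Coercive L (q t) κ) (t : ℝ)
    (ht : t ∈ Icc 0 b) : ∫ x in (-L)..L, weyl L (q t).1 κ 1 x = ∫ x in (-L)..L, weyl L (q 0).1 κ 1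
    x := by
  have hne : ∀ z : ℂ, (z ^ 2).im ≠ 0 → (κ : ℂ) ^ 2 ≠ z ^ 2 := fun z hz h => by
    rw [← h, ← ofReal_pow, ofReal_im] at hz; exact hz rfl
  refine const_of_deriv_zero_Icc (f := fun t => ∫ x in (-L)..L, weyl L (q t).1 κ 1 x)
    (fun t ht => ?_) t ht
  obtain ⟨w, hw, e1, e2⟩ := exists_weyl_deriv hL hk (hc t ht) (hne k hk)
    (hne _ (im_conj_sq_ne hk)) (σ := 1) (Or.inl rfl)
  have hcw := hw.const_mul (c t)
  refine (hasDerivWithinAt_integral_weyl hL (Or.inl rfl) (hq t ht) (hc t ht) hcw fun n => ?_).congr_deriv ?_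
  · have f : (fun x => 2 * weyl L (q t).1 κ 1 x * (c t * w x)) = fun x =>
      (c t : ℂ) * (2 * weyl L (q t).1 κ 1 x * w x) := by ext x; ring
    have := e1 n; change _ = c t • (movingField L k (q t)).1 n
    rw [real_smul, ← this, f, coeffs_const_mul, ddx, coeffs_const_mul, ddx]; ring
  · have := congrFun e2 0; have hL0 : (L : ℂ) ≠ 0 := by exact_mod_cast (show L ≠ 0 by linarith)
    rw [ddx, freq_zero, coeffs_zero_eq] at this; simp only [ofReal_zero, mul_zero, zero_mul] at this
    rw [intervalIntegral.integral_const_mul]; grind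

lemma Coercive.l2_weyl_sq {q : Hs L (-1)} (hc : Coercive L q κ) : l2 (perMeasure L) (weyl L q.1 κ 1)
    ^ 2 = 2 * L * ((q.1 0).re + κ ^ 2) := by
  have h := (hc.isRiccati hL (Or.inl rfl)).integral_sq hL
  rw [integral_perMeasure (by linarith)] at h
  have e : ∀ x, weyl L q.1 κ 1 x ^ 2 = ((‖weyl L q.1 κ 1 x‖ ^ 2 : ℝ) : ℂ) := fun x => by
    have := hc.weyl_real hL (s := 1) x; rw [ofReal_one] at this
    rw [← normSq_eq_norm_sq, ← mul_conj, this, sq]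
  simp only [e] at h; rw [integral_complex_ofReal, ← l2_sq] at h; have := congrArg Complex.re h
  rw [ofReal_re] at this
  rw [this, show 2 * (L : ℂ) * (q.1 0 + (κ : ℂ) ^ 2) =
    ((2 * L : ℝ) : ℂ) * (q.1 0 + ((κ ^ 2 : ℝ) : ℂ)) by push_cast; ring, re_ofReal_mul,
    add_re, ofReal_re]

lemma Coercive.integral_weyl_real {q : Hs L (-1)} (hc : Coercive L q κ) : ∃ m : ℝ, 0 < m ∧ ∫ x in
    (-L)..L, weyl L q.1 κ 1 x = m := by
  refine ⟨(∫ x in (-L)..L, weyl L q.1 κ 1 x).re, ?_, ?_⟩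
  · have h1 := congrArg norm (hc.exp_integral_weyl_one hL); rw [norm_exp, norm_inv] at h1
    rw [← Real.exp_lt_exp, Real.exp_zero, h1]
    exact (one_lt_inv₀ (norm_pos_iff.2 (hc.mult_ne_zero hL))).2 (hc.norm_mult_lt hL)
  · rw [eq_comm, ← conj_eq_iff_re, integral_of_le (by linarith), ← integral_conj]
    congr 1; ext x; have := hc.weyl_real hL (s := 1) x; rwa [ofReal_one] at this

lemma coercive_persists (hk : (k ^ 2).im ≠ 0) (hq : ∀ t ∈ Icc 0 b, HasDerivWithinAt q
    (c t • movingField L k (q t)) (Icc 0 b) t) (h0 : Coercive L (q 0) κ) : ∀ t ∈ Icc 0 b, Coercive L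
    (q t) κ := by
  have hqc : ContinuousOn q (Icc 0 b) := fun t ht => (hq t ht).continuousWithinAt
  obtain ⟨m, hm0, hm⟩ := h0.integral_weyl_real hL
  set M := l2 (perMeasure L) (weyl L (q 0).1 κ 1) with hM
  set C := (m / (2 * L)) ^ 2 * Real.exp (-(8 * (√(2 * L) * M))) with hC
  have hC0 : 0 < C := by positivity
  -- the lower bound on an interval where coercivity is known
  have low : ∀ t ∈ Icc 0 b, (∀ s ∈ Icc 0 t, Coercive L (q s) κ) →
      ∀ u u' : ℝ → ℂ, HasH1Deriv u u' → C * (∫ x, ‖u x‖ ^ 2) ≤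
      (form L (q t).1 ((κ : ℂ) ^ 2) u u' (fun x => conj (u x)) (fun x => conj (u' x))).re := by
    intro t ht hco u u' hu
    have hq' : ∀ s ∈ Icc 0 t,
        HasDerivWithinAt q (c s • movingField L k (q s)) (Icc 0 t) s := fun s hs =>
      (hq s ⟨hs.1, hs.2.trans ht.2⟩).mono (Set.Icc_subset_Icc_right ht.2)
    have htt : t ∈ Icc 0 t := ⟨ht.1, le_rfl⟩; have hct := hco t htt
    have e1 := integral_weyl_conserved hL hk hq' hco t htt
    have e2 : l2 (perMeasure L) (weyl L (q t).1 κ 1) = M := by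
      rw [hM, ← sq_eq_sq₀ (l2_nonneg _ _) (l2_nonneg _ _), hct.l2_weyl_sq hL, h0.l2_weyl_sq hL,
        coeff_zero_conserved hL hk hq' t htt]
    have hR := hct.isRiccati hL (σ := 1) (Or.inl rfl)
    refine (exists_lower_bound hL hR.l2Per e2.le (e1.trans hm) hu).trans (le_of_eq ?_)
    rw [hR.form_eq hL hu hu.conj]
    have : ∀ x, (u' x - weyl L (q t).1 κ 1 x * u x) * (conj (u' x) -
        weyl L (q t).1 κ 1 x * conj (u x)) = ((‖u' x - weyl L (q t).1 κ 1 x * u x‖ ^ 2 : ℝ) : ℂ) := by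
      intro x; have hr := hct.weyl_real hL (s := 1) x; rw [ofReal_one] at hr
      rw [← normSq_eq_norm_sq, ← mul_conj, map_sub, map_mul, hr]
    simp only [this]; rw [integral_complex_ofReal, ofReal_re]
  set S := {t | ∀ s ∈ Icc 0 t, Coercive L (q s) κ} with hS
  have hclosed : IsClosed (S ∩ Icc 0 b) := by
    refine isClosed_of_closure_subset fun t ht => ?_
    have htI : t ∈ Icc 0 b := isClosed_Icc.closure_subset (closure_mono Set.inter_subset_right ht)
    refine ⟨?_, htI⟩
    have hlt : ∀ s ∈ Set.Ico 0 t, Coercive L (q s) κ := by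
      intro s hs; obtain ⟨t', ht', hst⟩ := mem_closure_iff.1 ht (Ioi s) isOpen_Ioi hs.2
      exact hst.1 s ⟨hs.1, le_of_lt ht'⟩
    intro s hs
    rcases hs.2.lt_or_eq with h | rfl
    · exact hlt s ⟨hs.1, h⟩
    · rcases hs.1.eq_or_lt with h | hs0
      · rwa [← h]
      · have key : ∀ u u' : ℝ → ℂ, HasH1Deriv u u' → C * (∫ x, ‖u x‖ ^ 2) ≤
            (form L (q s).1 ((κ ^ 2 : ℝ) : ℂ) u u' (fun x => conj (u x)) (fun x => conj (u' x))).re := by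
          intro u u' hu; rw [ofReal_pow]
          have hcont : Tendsto (fun r => (form L (q r).1 ((κ : ℂ) ^ 2) u u' (fun x => conj (u x))
              (fun x => conj (u' x))).re) (𝓝[<] s) (𝓝 ((form L (q s).1 ((κ : ℂ) ^ 2) u u'
              (fun x => conj (u x)) (fun x => conj (u' x))).re)) := by
            refine (continuous_re.tendsto _).comp ?_; rw [tendsto_iff_norm_sub_tendsto_zero]
            have hqs : Tendsto q (𝓝[<] s) (𝓝 (q s)) :=
              (hqc s htI).mono_left (nhdsWithin_le_of_mem (by
                filter_upwards [Ioo_mem_nhdsLT hs0] with r hr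
                grind))
            have hq2 := (tendsto_iff_norm_sub_tendsto_zero.1 hqs).const_mul (18 * L ^ 2)
            have hq3 := hq2.mul_const (√(h1sq u u') * √(h1sq u u')); rw [mul_zero, zero_mul] at hq3
            refine squeeze_zero (fun _ => norm_nonneg _) (fun r => ?_) hq3
            rw [form_sub_pot hL (q r) (q s) _ hu hu.conj, add_sub_cancel_left]
            have := norm_pair_le hL (q r - q s) hu hu.conj; rwa [h1sq_conj] at this
          refine ge_of_tendsto hcont ?_
          filter_upwards [Ioo_mem_nhdsLT hs0] with r hr
          grind
        obtain ⟨ζ, hζ⟩ := coercive_of_lower_bound hL (sq_nonneg κ) hC0 key; refine ⟨ζ, ?_⟩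
        rwa [ofReal_pow] at hζ
  have hsub := hclosed.Icc_subset_of_forall_mem_nhdsWithin (a := 0) (b := b)
    (fun s hs => by rw [show s = 0 from le_antisymm hs.2 hs.1]; exact h0) fun t ht => by
      have htI : t ∈ Icc 0 b := ⟨ht.2.1, ht.2.2.le⟩
      have h1 := (hqc t htI).eventually ((ht.1 t ⟨ht.2.1, le_rfl⟩).eventually hL)
      have h2 : ∀ᶠ s in 𝓝[>] t, s ∈ Icc 0 b := by
        filter_upwards [Ioo_mem_nhdsGT ht.2.2] with s hs
        grind
      rw [eventually_nhdsWithin_iff, Metric.eventually_nhds_iff] at h1; obtain ⟨ε, hε, h1⟩ := h1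
      have h3 : ∀ᶠ s in 𝓝[>] t, s < t + ε := by
        filter_upwards [Ioo_mem_nhdsGT (show t < t + ε by linarith)] with s hs using hs.2
      filter_upwards [h2, h3] with s hs1 hs2 r hr
      rcases le_total r t with hrt | hrt
      · exact ht.1 r ⟨hr.1, hrt⟩
      · refine h1 ?_ ⟨hr.1, hr.2.trans hs1.2⟩; rw [dist_eq, abs_of_nonneg (by linarith)]
        linarith [hr.2]
  grind

end apriori

lemma exists_apriori_bound (hL : 1 ≤ L) (hk : (k ^ 2).im ≠ 0) (r : ℝ) : ∃ B, ∀ (q : ℝ → Hs L (-1))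
    (c : ℝ → ℝ) (b : ℝ), 0 ≤ b → (∀ t ∈ Icc 0 b, HasDerivWithinAt q (c t • movingField L k (q t))
    (Icc 0 b) t) → ‖q 0‖ ≤ r → ∀ t ∈ Icc 0 b, ‖q t‖ ≤ B := by
  set κ := √(max (gardingConst L r + 1) 0) with hκ
  have hκ2 : κ ^ 2 = max (gardingConst L r + 1) 0 := sq_sqrt (le_max_right _ _)
  obtain ⟨B, hB⟩ := exists_norm_bound hL ((κ : ℂ) ^ 2) (√(2 * L * (2 * r + κ ^ 2)))
  refine ⟨B, fun q c b hb hq hr t ht => ?_⟩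
  have h0 : Coercive L (q 0) κ := ⟨1, by
    have := exists_coercive_of_large hL (R := r) (lam := κ ^ 2) (by rw [hκ2]; exact le_max_left _ _)
      (q 0) hr
    rwa [ofReal_pow] at this⟩
  have hct := coercive_persists hL hk hq h0 t ht
  refine hB (q t) _ (hct.isRiccati hL (Or.inl rfl)) ?_; refine le_sqrt_of_sq_le ?_
  rw [hct.l2_weyl_sq hL, coeff_zero_conserved hL hk hq t ht]
  have := (abs_re_le_norm _).trans ((q 0).norm_zero_coeff_le); have := (abs_le.1 this).2; gcongr
  linarith

end

section

set_option linter.unusedSectionVars false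

section ode
variable {E : Type*} [NormedAddCommGroup E] [NormedSpace ℝ E]

/-- Bounded and Lipschitz on bounded sets. -/
def BddLip (N : E → E) : Prop := ∀ R : ℝ, ∃ K, 0 ≤ K ∧ (∀ q, ‖q‖ ≤ R → ‖N q‖ ≤ K) ∧
  ∀ q₁ q₂, ‖q₁‖ ≤ R → ‖q₂‖ ≤ R → ‖N q₁ - N q₂‖ ≤ K * ‖q₁ - q₂‖

/-- Curves driven by a multiple of the vector field `N` are bounded in terms of their starting
point. -/
def AprioriBdd (N : E → E) : Prop := ∀ r : ℝ, ∃ B, ∀ (q : ℝ → E) (c : ℝ → ℝ) (b : ℝ), 0 ≤ b →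
  (∀ t ∈ Icc 0 b, HasDerivWithinAt q (c t • N (q t)) (Icc 0 b) t) →
    ‖q 0‖ ≤ r → ∀ t ∈ Icc 0 b, ‖q t‖ ≤ B

lemma BddLip.neg {N : E → E} (h : BddLip N) : BddLip fun q => -N q := fun R => by
  obtain ⟨K, h0, h1, h2⟩ := h R
  refine ⟨K, h0, fun q hq => by rw [norm_neg]; exact h1 q hq, fun q₁ q₂ hq₁ hq₂ => ?_⟩
  rw [← neg_sub', norm_neg]; exact h2 q₁ q₂ hq₁ hq₂

lemma HasDerivWithinAt.comp_neg {α : ℝ → E} {α' : E} {s : Set ℝ}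
    (h : HasDerivWithinAt α α' s (-t)) : HasDerivWithinAt (fun τ => α (-τ)) (-α') (-s) t := by
  have := HasDerivWithinAt.scomp (h := fun τ : ℝ => -τ) (s := -s) (t' := s) (h' := -1) t h
    (hasDerivAt_neg t).hasDerivWithinAt (fun x hx => hx)
  rwa [neg_one_smul] at this

lemma AprioriBdd.two_sided {N : E → E} (h : AprioriBdd N) (r : ℝ) : ∃ B, ∀ (q : ℝ → E) (c : ℝ → ℝ)
    (T : ℝ), (∀ t ∈ Icc (-T) T, HasDerivWithinAt q (c t • N (q t)) (Icc (-T) T) t) → ‖q 0‖ ≤ r → ∀ t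
    ∈ Icc (-T) T, ‖q t‖ ≤ B := by
  obtain ⟨B, hB⟩ := h r; refine ⟨B, fun q c T hq h0 t ht => ?_⟩
  have hT : 0 ≤ T := by linarith [ht.1, ht.2]
  rcases le_total 0 t with h' | h'
  · exact hB q c T hT (fun s hs => (hq s ⟨by linarith [hs.1], hs.2⟩).mono
      (Set.Icc_subset_Icc_left (by linarith))) h0 t ⟨h', ht.2⟩
  · have := hB (fun s => q (-s)) (fun s => -c (-s)) T hT (fun s hs => ?_) (by simpa using h0) (-t)
      ⟨by linarith, by linarith [ht.1]⟩
    · simpa using this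
    · have := HasDerivWithinAt.comp_neg (hq (-s) ⟨by linarith [hs.2], by linarith [hs.1]⟩)
      rw [neg_smul]; refine this.mono fun x hx => ?_; rw [Set.mem_neg]
      grind

lemma dist_trajectories_le {N : E → E} {K : ℝ} (hK : 0 ≤ K)
    (hN : ∀ q₁ q₂, ‖q₁‖ ≤ R → ‖q₂‖ ≤ R → ‖N q₁ - N q₂‖ ≤ K * ‖q₁ - q₂‖) {α β : ℝ → E}
    (hα : ∀ t ∈ Icc 0 b, HasDerivWithinAt α (N (α t)) (Icc 0 b) t)
    (hβ : ∀ t ∈ Icc 0 b, HasDerivWithinAt β (N (β t)) (Icc 0 b) t) (hαR : ∀ t ∈ Icc 0 b, ‖α t‖ ≤ R)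
    (hβR : ∀ t ∈ Icc 0 b, ‖β t‖ ≤ R) : ∀ t ∈ Icc 0 b, ‖α t - β t‖ ≤ ‖α 0 - β 0‖ * Real.exp
    (K * t) := by
  intro t ht
  have key := dist_le_of_trajectories_ODE_of_mem (v := fun _ => N) (K := ⟨K, hK⟩)
    (s := fun _ => {q | ‖q‖ ≤ R}) (f := α) (g := β) (a := 0) (b := b) (δ := ‖α 0 - β 0‖)
    (fun t _ => LipschitzOnWith.of_dist_le_mul fun q₁ h₁ q₂ h₂ => by
      rw [dist_eq_norm, dist_eq_norm]; exact hN q₁ q₂ h₁ h₂)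
    (fun t ht => (hα t ht).continuousWithinAt)
    (fun t ht => (hα t ⟨ht.1, ht.2.le⟩).mono_of_mem_nhdsWithin (Icc_mem_nhdsGE_of_mem ht))
    (fun t ht => hαR t ⟨ht.1, ht.2.le⟩)
    (fun t ht => (hβ t ht).continuousWithinAt)
    (fun t ht => (hβ t ⟨ht.1, ht.2.le⟩).mono_of_mem_nhdsWithin (Icc_mem_nhdsGE_of_mem ht))
    (fun t ht => hβR t ⟨ht.1, ht.2.le⟩) (dist_eq_norm _ _).le t ht
  rw [dist_eq_norm, sub_zero] at key; exact key

lemma dist_trajectories_le_two_sided {N : E → E} {K : ℝ} (hK : 0 ≤ K)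
    (hN : ∀ q₁ q₂, ‖q₁‖ ≤ R → ‖q₂‖ ≤ R → ‖N q₁ - N q₂‖ ≤ K * ‖q₁ - q₂‖) {α β : ℝ → E}
    (hα : ∀ t ∈ Icc (-T) T, HasDerivWithinAt α (N (α t)) (Icc (-T) T) t)
    (hβ : ∀ t ∈ Icc (-T) T, HasDerivWithinAt β (N (β t)) (Icc (-T) T) t)
    (hαR : ∀ t ∈ Icc (-T) T, ‖α t‖ ≤ R) (hβR : ∀ t ∈ Icc (-T) T, ‖β t‖ ≤ R) : ∀ t ∈ Icc (-T) T, ‖α t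
    - β t‖ ≤ ‖α 0 - β 0‖ * Real.exp (K * T) := by
  intro t ht; have hT : 0 ≤ T := by linarith [ht.1, ht.2]
  rcases le_total 0 t with h' | h'
  · have hs : Icc 0 T ⊆ Icc (-T) T := Set.Icc_subset_Icc_left (by linarith)
    refine (dist_trajectories_le hK hN (fun s h => (hα s (hs h)).mono hs)
      (fun s h => (hβ s (hs h)).mono hs) (fun s h => hαR s (hs h)) (fun s h => hβR s (hs h)) t
      ⟨h', ht.2⟩).trans ?_
    gcongr; exact ht.2
  · have hs : Icc 0 T ⊆ -Icc (-T) T := fun s hs => by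
      rw [Set.mem_neg]; exact ⟨by linarith [hs.2], by linarith [hs.1]⟩
    have := dist_trajectories_le (N := fun q => -N q) hK
      (fun q₁ q₂ h1 h2 => by rw [← neg_sub', norm_neg]; exact hN q₁ q₂ h1 h2)
      (fun s h => (HasDerivWithinAt.comp_neg (hα _ (hs h))).mono hs)
      (fun s h => (HasDerivWithinAt.comp_neg (hβ _ (hs h))).mono hs)
      (fun s h => hαR _ (hs h)) (fun s h => hβR _ (hs h)) (-t) ⟨by linarith, by linarith [ht.1]⟩
    simp only [neg_neg, neg_zero] at this; refine this.trans ?_; gcongr; linarith [ht.1]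

lemma trajectory_unique {N : E → E} (hN : BddLip N) {I : Set ℝ} (hI : I.OrdConnected) (h0 : 0 ∈ I)
    {α β : ℝ → E} (hα : ∀ t ∈ I, HasDerivWithinAt α (N (α t)) I t)
    (hβ : ∀ t ∈ I, HasDerivWithinAt β (N (β t)) I t) (h : α 0 = β 0) : ∀ t ∈ I, α t = β t := by
  have key : ∀ {N : E → E} (_ : BddLip N) {α β : ℝ → E} {b : ℝ}
      (_ : ∀ t ∈ Icc 0 b, HasDerivWithinAt α (N (α t)) (Icc 0 b) t)
      (_ : ∀ t ∈ Icc 0 b, HasDerivWithinAt β (N (β t)) (Icc 0 b) t)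
      (_ : α 0 = β 0), ∀ t ∈ Icc 0 b, α t = β t := by
    intro N hN α β b hα hβ h t ht
    obtain ⟨R₁, hR₁⟩ := isCompact_Icc.exists_bound_of_continuousOn (s := Icc 0 b)
      (fun t ht => (hα t ht).continuousWithinAt)
    obtain ⟨R₂, hR₂⟩ := isCompact_Icc.exists_bound_of_continuousOn (s := Icc 0 b)
      (fun t ht => (hβ t ht).continuousWithinAt)
    obtain ⟨K, hK, -, hlip⟩ := hN (max R₁ R₂)
    have := dist_trajectories_le hK hlip hα hβ (fun t ht => (hR₁ t ht).trans (le_max_left _ _))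
      (fun t ht => (hR₂ t ht).trans (le_max_right _ _)) t ht
    rw [h, sub_self, norm_zero, zero_mul] at this; exact sub_eq_zero.1 (norm_le_zero_iff.1 this)
  intro t ht
  rcases le_total 0 t with h' | h'
  · have hs : Icc 0 t ⊆ I := hI.out h0 ht
    exact key hN (fun s h => (hα s (hs h)).mono hs) (fun s h => (hβ s (hs h)).mono hs) h t
      ⟨h', le_rfl⟩
  · have hs : Icc t 0 ⊆ I := hI.out ht h0
    have hs' : Icc 0 (-t) ⊆ -I := fun s h => hs ⟨by linarith [h.2], by linarith [h.1]⟩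
    have := key hN.neg (α := fun s => α (-s)) (β := fun s => β (-s)) (b := -t)
      (fun s h => (HasDerivWithinAt.comp_neg (hα _ (hs' h))).mono hs')
      (fun s h => (HasDerivWithinAt.comp_neg (hβ _ (hs' h))).mono hs')
      (by simpa using h) (-t) ⟨by linarith, le_rfl⟩
    simpa using this

lemma exists_trajectory_of_lipschitz [CompleteSpace E] {f : E → E} {K M : ℝ} (hK : 0 ≤ K)
    (hM : 0 ≤ M) (hf : ∀ q₁ q₂, ‖f q₁ - f q₂‖ ≤ K * ‖q₁ - q₂‖) (hb : ∀ q, ‖f q‖ ≤ M) (x₀ : E)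
    (hT : 0 ≤ T) : ∃ α : ℝ → E, α 0 = x₀ ∧ ∀ t ∈ Icc (-T) T, HasDerivWithinAt α (f (α t))
    (Icc (-T) T) t := by
  have : IsPicardLindelof (fun _ => f) (tmin := -T) (tmax := T)
      ⟨0, by linarith, by linarith⟩ x₀ ⟨M * T, by positivity⟩ 0 ⟨M, hM⟩ ⟨K, hK⟩ :=
    { lipschitzOnWith := fun t _ => LipschitzOnWith.of_dist_le_mul fun q₁ _ q₂ _ => by
        rw [dist_eq_norm, dist_eq_norm]; exact hf q₁ q₂
      continuousOn := fun _ _ => continuousOn_const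
      norm_le := fun _ _ x _ => hb x
      mul_max_le := by simp; exact le_rfl }
  exact this.exists_eq_forall_mem_Icc_hasDerivWithinAt₀

/-- The radial cutoff. -/
def cutoff (R : ℝ) (q : E) : ℝ := max 0 (min 1 (R + 1 - ‖q‖))

lemma cutoff_nonneg (R : ℝ) (q : E) : 0 ≤ cutoff R q := le_max_left _ _

lemma cutoff_le_one (R : ℝ) (q : E) : cutoff R q ≤ 1 := max_le zero_le_one (min_le_left _ _)

lemma cutoff_eq_one {q : E} (h : ‖q‖ ≤ R) : cutoff R q = 1 := by
  rw [cutoff, min_eq_left (by linarith), max_eq_right zero_le_one]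

lemma cutoff_eq_zero {q : E} (h : R + 1 ≤ ‖q‖) : cutoff R q = 0 := by
  rw [cutoff, max_eq_left]; simp [*]

lemma abs_cutoff_sub_le (R : ℝ) (q₁ q₂ : E) : |cutoff R q₁ - cutoff R q₂| ≤ ‖q₁ - q₂‖ := by
  refine (abs_max_sub_max_le_max _ _ _ _).trans ?_; rw [sub_self, abs_zero]
  refine max_le (norm_nonneg _) ((abs_min_sub_min_le_max _ _ _ _).trans ?_); rw [sub_self, abs_zero]
  refine max_le (norm_nonneg _) ?_; rw [sub_sub_sub_cancel_left, norm_sub_rev]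
  exact abs_norm_sub_norm_le _ _

lemma BddLip.cutoff {N : E → E} (hN : BddLip N) (R : ℝ) : ∃ K, 0 ≤ K ∧ (∀ q, ‖cutoff R q • N q‖ ≤ K)
    ∧ ∀ q₁ q₂, ‖HkFlow.cutoff R q₁ • N q₁ - HkFlow.cutoff R q₂ • N q₂‖ ≤ K * ‖q₁ - q₂‖ := by
  obtain ⟨K, hK, h1, h2⟩ := hN (R + 1)
  have hle : ∀ q₁ q₂ : E, ‖q₁‖ ≤ R + 1 →
      ‖HkFlow.cutoff R q₁ • N q₁ - HkFlow.cutoff R q₂ • N q₂‖ ≤ (2 * K) * ‖q₁ - q₂‖ := by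
    intro q₁ q₂ hq₁
    have e1 : ‖(HkFlow.cutoff R q₁ - HkFlow.cutoff R q₂) • N q₁‖ ≤ ‖q₁ - q₂‖ * K := by
      rw [norm_smul]; gcongr
      · exact abs_cutoff_sub_le _ _ _
      · exact h1 _ hq₁
    rcases le_total ‖q₂‖ (R + 1) with h | h
    · rw [show HkFlow.cutoff R q₁ • N q₁ - HkFlow.cutoff R q₂ • N q₂ =
        (HkFlow.cutoff R q₁ - HkFlow.cutoff R q₂) • N q₁ + HkFlow.cutoff R q₂ • (N q₁ - N q₂) by
        rw [sub_smul, smul_sub]; abel]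
      have e2 : ‖HkFlow.cutoff R q₂ • (N q₁ - N q₂)‖ ≤ 1 * (K * ‖q₁ - q₂‖) := by
        rw [norm_smul, norm_of_nonneg (cutoff_nonneg _ _)]; gcongr
        · exact cutoff_le_one _ _
        · exact h2 _ _ hq₁ h
      refine (norm_add_le _ _).trans ?_; linarith
    · rw [cutoff_eq_zero h] at e1 ⊢; rw [zero_smul, sub_zero]; rw [sub_zero] at e1
      nlinarith [norm_nonneg (q₁ - q₂)]
  refine ⟨2 * K, by positivity, fun q => ?_, fun q₁ q₂ => ?_⟩
  · rcases le_total ‖q‖ (R + 1) with h | h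
    · rw [norm_smul, norm_of_nonneg (cutoff_nonneg _ _)]
      nlinarith [h1 q h, cutoff_le_one R q, cutoff_nonneg R q, norm_nonneg (N q)]
    · rw [cutoff_eq_zero h, zero_smul, norm_zero]; positivity
  · rcases le_total ‖q₁‖ (R + 1) with h | h
    · exact hle q₁ q₂ h
    · rcases le_total ‖q₂‖ (R + 1) with h' | h'
      · rw [norm_sub_rev, norm_sub_rev q₁]; exact hle q₂ q₁ h'
      · rw [cutoff_eq_zero h, cutoff_eq_zero h', zero_smul, zero_smul, sub_zero, norm_zero]
        positivity

lemma exists_trajectory [CompleteSpace E] {N : E → E} (hN : BddLip N) (ha : AprioriBdd N) (x₀ : E)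
    (hT : 0 ≤ T) : ∃ α : ℝ → E, α 0 = x₀ ∧ ∀ t ∈ Icc (-T) T, HasDerivWithinAt α (N (α t))
    (Icc (-T) T) t := by
  obtain ⟨B, hB⟩ := ha.two_sided ‖x₀‖; obtain ⟨K, hK, h1, h2⟩ := hN.cutoff B
  obtain ⟨α, hα0, hα⟩ := exists_trajectory_of_lipschitz hK hK h2 h1 x₀ hT
  refine ⟨α, hα0, fun t ht => ?_⟩; have := hα t ht
  rwa [cutoff_eq_one (hB α (fun t => cutoff B (α t)) T hα (by rw [hα0]) t ht), one_smul] at this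

/-- The global flow of a vector field. -/
structure IsFlow (N : E → E) (Ψ : ℝ → E → E) : Prop where
  init : ∀ q, Ψ 0 q = q
  hasDerivAt : ∀ t q, HasDerivAt (fun τ => Ψ τ q) (N (Ψ t q)) t
  bound : ∀ T r : ℝ, ∃ B, 0 ≤ B ∧ ∀ q, ‖q‖ ≤ r → ∀ t ∈ Icc (-T) T, ‖Ψ t q‖ ≤ B
  lip : ∀ T r : ℝ, ∃ K, 0 ≤ K ∧ ∀ q₁ q₂, ‖q₁‖ ≤ r → ‖q₂‖ ≤ r → ∀ t ∈ Icc (-T) T,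
    ‖Ψ t q₁ - Ψ t q₂‖ ≤ K * ‖q₁ - q₂‖

lemma exists_flow [CompleteSpace E] {N : E → E} (hN : BddLip N) (ha : AprioriBdd N) : ∃ Ψ, IsFlow N
    Ψ := by
  choose α hα0 hα using fun (q : E) (n : ℕ) => exists_trajectory hN ha q (T := n) n.cast_nonneg
  have hmono : ∀ q (m n : ℕ), m ≤ n → ∀ t ∈ Icc (-m : ℝ) m, α q n t = α q m t := by
    intro q m n hmn
    have hs : Icc (-m : ℝ) m ⊆ Icc (-n : ℝ) n := Set.Icc_subset_Icc
      (by exact_mod_cast neg_le_neg (Nat.cast_le (α := ℤ).2 hmn)) (by exact_mod_cast hmn)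
    exact trajectory_unique hN Set.ordConnected_Icc ⟨by simp, by simp⟩
      (fun t ht => (hα q n t (hs ht)).mono hs) (hα q m) (by rw [hα0, hα0])
  have hΨ : ∀ q (n : ℕ), ∀ t ∈ Icc (-n : ℝ) n, α q ⌈|t|⌉₊ t = α q n t := by
    intro q n t ht
    exact (hmono q _ n (Nat.ceil_le.2 (abs_le.2 ht)) t (abs_le.1 (Nat.le_ceil _))).symm
  have hd : ∀ t q, HasDerivAt (fun τ => α q ⌈|τ|⌉₊ τ) (N (α q ⌈|t|⌉₊ t)) t := by
    intro t q; set n := ⌈|t|⌉₊ + 1 with hn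
    have ht : |t| < n := by rw [hn]; push_cast; linarith [Nat.le_ceil |t|]
    have hnhds : Icc (-n : ℝ) n ∈ 𝓝 t := Icc_mem_nhds (abs_lt.1 ht).1 (abs_lt.1 ht).2
    have h1 := (hα q n t (abs_le.1 ht.le)).hasDerivAt hnhds; rw [← hΨ q n t (abs_le.1 ht.le)] at h1
    exact h1.congr_of_eventuallyEq (by filter_upwards [hnhds] with τ hτ using hΨ q n τ hτ)
  have hbd : ∀ T r : ℝ, ∃ B, 0 ≤ B ∧ ∀ q, ‖q‖ ≤ r → ∀ t ∈ Icc (-T) T, ‖α q ⌈|t|⌉₊ t‖ ≤ B := by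
    intro T r; obtain ⟨B, hB⟩ := ha.two_sided r
    refine ⟨max B 0, le_max_right _ _, fun q hq t ht => le_max_of_le_left ?_⟩
    refine hB (fun τ => α q ⌈|τ|⌉₊ τ) (fun _ => 1) T (fun s _ => ?_) ?_ t ht
    · rw [one_smul]; exact (hd s q).hasDerivWithinAt
    · simpa [hα0] using hq
  refine ⟨fun t q => α q ⌈|t|⌉₊ t, fun q => by simp [hα0], hd, hbd, fun T r => ?_⟩
  obtain ⟨B, hB0, hB⟩ := hbd T r; obtain ⟨K, hK, -, hlip⟩ := hN B
  refine ⟨Real.exp (K * T), (exp_pos _).le, fun q₁ q₂ h1 h2 t ht => ?_⟩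
  have := dist_trajectories_le_two_sided hK hlip (fun t _ => (hd t q₁).hasDerivWithinAt)
    (fun t _ => (hd t q₂).hasDerivWithinAt) (hB q₁ h1) (hB q₂ h2) t ht
  simp only [abs_zero, Nat.ceil_zero, hα0] at this; rwa [mul_comm]

lemma IsFlow.continuous {N : E → E} {Ψ : ℝ → E → E} (h : IsFlow N Ψ) : Continuous fun p : ℝ × E => Ψ
    p.1 p.2 := by
  rw [continuous_iff_continuousAt]; rintro ⟨t₀, q₀⟩
  obtain ⟨K, -, hK⟩ := h.lip (|t₀| + 1) (‖q₀‖ + 1)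
  rw [ContinuousAt, tendsto_iff_norm_sub_tendsto_zero]
  have h1 : Tendsto (fun p : ℝ × E => K * ‖p.2 - q₀‖ + ‖Ψ p.1 q₀ - Ψ t₀ q₀‖) (𝓝 (t₀, q₀)) (𝓝 0) := by
    have c : Continuous fun p : ℝ × E => K * ‖p.2 - q₀‖ + ‖Ψ p.1 q₀ - Ψ t₀ q₀‖ := by
      have : Continuous fun t => Ψ t q₀ :=
        continuous_iff_continuousAt.2 fun t => (h.hasDerivAt t q₀).continuousAt
      fun_prop
    have := c.tendsto (t₀, q₀); simpa using this
  refine squeeze_zero' (.of_forall fun _ => norm_nonneg _) ?_ h1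
  filter_upwards [prod_mem_nhds (Metric.ball_mem_nhds t₀ one_pos) (Metric.ball_mem_nhds q₀ one_pos)]
    with p hp
  have hp1 : |p.1| ≤ |t₀| + 1 := by
    have := hp.1; rw [Metric.mem_ball, dist_eq] at this; grind
  have hp2 : ‖p.2‖ ≤ ‖q₀‖ + 1 := by
    have := hp.2; rw [Metric.mem_ball, dist_eq_norm] at this
    have := norm_sub_norm_le p.2 q₀; linarith
  have := hK p.2 q₀ hp2 (by linarith) p.1 (abs_le.1 hp1)
  have h3 := norm_sub_le_norm_sub_add_norm_sub (Ψ p.1 p.2) (Ψ p.1 q₀) (Ψ t₀ q₀); linarith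

lemma IsFlow.unique {N : E → E} {Ψ : ℝ → E → E} (h : IsFlow N Ψ) (hN : BddLip N) {I : Set ℝ}
    (hI : I.OrdConnected) (h0 : 0 ∈ I) {α : ℝ → E}
    (hα : ∀ t ∈ I, HasDerivWithinAt α (N (α t)) I t) : ∀ t ∈ I, α t = Ψ t (α 0) :=
  trajectory_unique hN hI h0 hα (fun t _ => (h.hasDerivAt t (α 0)).hasDerivWithinAt) (h.init _).symm

lemma IsFlow.add {N : E → E} {Ψ : ℝ → E → E} (h : IsFlow N Ψ) (hN : BddLip N) (s t : ℝ) (q : E) : Ψ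
    (s + t) q = Ψ s (Ψ t q) := by
  have := h.unique hN Set.ordConnected_univ (mem_univ 0) (α := fun s => Ψ (s + t) q)
    (fun s _ => ((h.hasDerivAt (s + t) q).comp_add_const s t).hasDerivWithinAt) s (mem_univ _)
  simpa using this

end ode

lemma bddLip_movingField (hL : 1 ≤ L) (hk : (k ^ 2).im ≠ 0) :
    BddLip (movingField L k) := exists_movingField_bound hL hk

lemma aprioriBdd_movingField (hL : 1 ≤ L) (hk : (k ^ 2).im ≠ 0) :
    AprioriBdd (movingField L k) := exists_apriori_bound hL hk

end

/-- The square of the Sobolev norm. -/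
def sobSq (L s : ℝ) (c : ℤ → ℂ) : ℝ≥0∞ := ∑' n : ℤ, ofReal (weight L s n * ‖c n‖ ^ 2)

lemma hasSobDerivWithin_iff {F : ℝ → ℤ → ℂ} {F' : ℤ → ℂ} {I : Set ℝ} : HasSobDerivWithin L s F F' I
    t ↔ Tendsto (fun τ : ℝ => sobSq L s fun n => ((τ - t : ℝ) : ℂ)⁻¹ * (F τ n - F t n) - F' n)
    (𝓝[I \ {t}] t) (𝓝 0) := by
  unfold HasSobDerivWithin eSobNorm; constructor
  · intro h; have := h.ennrpow_const 2
    simp only [← ENNReal.rpow_mul, show (1 / 2 : ℝ) * 2 = 1 by norm_num, ENNReal.rpow_one,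
      ENNReal.zero_rpow_of_pos (show (0 : ℝ) < 2 by norm_num)] at this
    exact this
  · intro h; have := h.ennrpow_const (1 / 2)
    rw [ENNReal.zero_rpow_of_pos (show (0 : ℝ) < 1 / 2 by norm_num)] at this; exact this

lemma sobSq_congr_norm {a b : ℤ → ℂ} (h : ∀ n, ‖a n‖ = ‖b n‖) : sobSq L s a = sobSq L s b := by
  unfold sobSq; simp only [h]

lemma sobSq_add_le (s : ℝ) (a b : ℤ → ℂ) : sobSq L s (fun n => a n + b n) ≤ 2 * sobSq L s a + 2 *
    sobSq L s b := by
  unfold sobSq; rw [← ENNReal.tsum_mul_left, ← ENNReal.tsum_mul_left, ← ENNReal.tsum_add]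
  refine tsum_le_tsum fun n => ?_; have hw := (weight_pos L s n).le
  rw [← ENNReal.ofReal_ofNat 2, ← ENNReal.ofReal_mul (by norm_num), ← ENNReal.ofReal_mul (by norm_num),
    ← ofReal_add (by positivity) (by positivity)]
  refine ofReal_le_ofReal ?_
  have h1 : ‖a n + b n‖ ^ 2 ≤ 2 * ‖a n‖ ^ 2 + 2 * ‖b n‖ ^ 2 := by
    have := pow_le_pow_left₀ (norm_nonneg _) (norm_add_le (a n) (b n)) 2
    nlinarith [sq_nonneg (‖a n‖ - ‖b n‖)]
  nlinarith

lemma tendsto_sobSq_add {l : Filter ι} {a b : ι → ℤ → ℂ}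
    (ha : Tendsto (fun i => sobSq L s (a i)) l (𝓝 0))
    (hb : Tendsto (fun i => sobSq L s (b i)) l (𝓝 0)) : Tendsto
    (fun i => sobSq L s fun n => a i n + b i n) l (𝓝 0) := by
  have h := (ENNReal.Tendsto.const_mul (a := 2) ha (Or.inr (by simp))).add
    (ENNReal.Tendsto.const_mul (a := 2) hb (Or.inr (by simp)))
  simp only [mul_zero, add_zero] at h
  exact tendsto_of_tendsto_of_tendsto_of_le_of_le tendsto_const_nhds h (fun _ => zero_le)
    fun i => sobSq_add_le s (a i) (b i)

lemma sobSq_mono (h : s ≤ s') (a : ℤ → ℂ) : sobSq L s a ≤ sobSq L s' a := by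
  refine tsum_le_tsum fun n => ofReal_le_ofReal ?_; gcongr
  exact Real.rpow_le_rpow_of_exponent_le (by nlinarith [sq_nonneg (freq L n)]) h

lemma Hs.sobSq_eq (q : Hs L s) : sobSq L s q.1 = ofReal (‖q‖ ^ 2) := by
  rw [sobSq, Hs.norm_sq, ofReal_tsum_of_nonneg
    (fun n => mul_nonneg (weight_pos L s n).le (by positivity)) q.2.2]

lemma summable_of_sobSq {a : ℤ → ℂ} (h : sobSq L s a ≠ ⊤) : Summable fun n => weight L s n * ‖a n‖ ^
    2 := by
  have := ENNReal.summable_toReal h; refine this.congr fun n => ?_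
  rw [toReal_ofReal (mul_nonneg (weight_pos L s n).le (by positivity))]

lemma tendsto_sobSq_mul {l : Filter ι} {B : ℝ} {m : ι → ℤ → ℂ} {a : ℤ → ℂ} (ha : sobSq L s' a ≠ ⊤)
    (hm : ∀ n, Tendsto (fun i => m i n) l (𝓝 0))
    (hB : ∀ i n, weight L s n * ‖m i n‖ ^ 2 ≤ B * weight L s' n) : Tendsto
    (fun i => sobSq L s fun n => m i n * a n) l (𝓝 0) := by
  have hs := (summable_of_sobSq ha).mul_left B
  have hle : ∀ i n, weight L s n * ‖m i n * a n‖ ^ 2 ≤ B * (weight L s' n * ‖a n‖ ^ 2) := by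
    intro i n; rw [norm_mul, mul_pow, ← mul_assoc, ← mul_assoc]
    exact mul_le_mul_of_nonneg_right (hB i n) (by positivity)
  have h0 : ∀ i n, 0 ≤ weight L s n * ‖m i n * a n‖ ^ 2 := fun i n =>
    mul_nonneg (weight_pos L s n).le (by positivity)
  have key := tendsto_tsum_of_dominated_convergence hs
    (f := fun i n => weight L s n * ‖m i n * a n‖ ^ 2) (g := fun _ => (0 : ℝ)) (𝓕 := l) (fun n => by
      have := ((((hm n).mul_const (a n)).norm).pow 2).const_mul (weight L s n)
      simpa using this) (.of_forall fun i n => by rw [norm_of_nonneg (h0 i n)]; exact hle i n)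
  rw [tsum_zero] at key; have := tendsto_ofReal key; rw [ENNReal.ofReal_zero] at this
  refine this.congr fun i => ?_
  rw [sobSq, ofReal_tsum_of_nonneg (h0 i) (hs.of_nonneg_of_le (h0 i) (hle i))]

lemma trans_zero (c : ℤ → ℂ) : trans L 0 c = c := by ext n; simp [trans, expi]

lemma trans_trans (a b : ℝ) (c : ℤ → ℂ) : trans L a (trans L b c) = trans L (a + b) c := by
  ext n; rw [trans, trans, trans, expi_add_right]; ring

lemma ddx_trans (a : ℝ) (c : ℤ → ℂ) : ddx L (trans L a c) = trans L a (ddx L c) := by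
  ext n; simp only [ddx, trans]; ring

lemma sobSq_trans (s a : ℝ) (c : ℤ → ℂ) : sobSq L s (trans L a c) = sobSq L s c :=
  sobSq_congr_norm fun n => by rw [trans, norm_mul, norm_expi, one_mul]

lemma weight_succ (s : ℝ) (n : ℤ) : weight L (s + 1) n = weight L s n * (4 + freq L n ^ 2) := by
  rw [weight, weight, Real.rpow_add (by positivity), Real.rpow_one]

lemma hasDerivAt_expi_mul (n : ℤ) (a t : ℝ) : HasDerivAt (fun τ : ℝ => expi L n (a * τ))
    (a * (I * freq L n * expi L n (a * t))) t := by
  refine ((hasDerivAt_expi L n (a * t)).scomp (h := fun τ : ℝ => a * τ) t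
    ((hasDerivAt_id t).const_mul a)).congr_deriv ?_
  simp

lemma norm_expi_sub_le (n : ℤ) (x y : ℝ) : ‖expi L n x - expi L n y‖ ≤ |freq L n| * |x - y| := by
  have := Convex.norm_image_sub_le_of_norm_hasDerivWithin_le (f := expi L n) (C := |freq L n|)
    (s := univ) (fun z _ => (hasDerivAt_expi L n z).hasDerivWithinAt) (fun z _ => by
      simp [norm_expi]) convex_univ (mem_univ y) (mem_univ x)
  simpa using this

lemma HasSobDerivWithin.trans {F : ℝ → ℤ → ℂ} {F' : ℤ → ℂ} {I : Set ℝ} (h : HasSobDerivWithin L s F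
    F' I t) (h1 : sobSq L (s + 1) (F t) ≠ ⊤) (h2 : sobSq L s F' ≠ ⊤) : HasSobDerivWithin L s (fun τ
    => HkFlow.trans L (a * τ) (F τ)) (HkFlow.trans L (a * t) fun n => F' n + a * ddx L (F t) n) I t
    := by
  rw [hasSobDerivWithin_iff] at h ⊢
  have A : Tendsto (fun τ : ℝ => sobSq L s (HkFlow.trans L (a * τ) fun n =>
      ((τ - t : ℝ) : ℂ)⁻¹ * (F τ n - F t n) - F' n)) (𝓝[I \ {t}] t) (𝓝 0) := by
    simpa only [sobSq_trans] using h
  have hcont : ∀ n, Tendsto (fun τ : ℝ => expi L n (a * τ)) (𝓝[I \ {t}] t) (𝓝 (expi L n (a * t))) :=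
    fun n => (hasDerivAt_expi_mul n a t).continuousAt.mono_left nhdsWithin_le_nhds
  have B := tendsto_sobSq_mul (l := 𝓝[I \ {t}] t) (s := s) (s' := s) (B := 4)
    (m := fun τ n => expi L n (a * τ) - expi L n (a * t)) h2
    (fun n => by simpa using (hcont n).sub_const (expi L n (a * t))) fun τ n => by
      have : ‖expi L n (a * τ) - expi L n (a * t)‖ ≤ 2 := (norm_sub_le _ _).trans (by
        rw [norm_expi, norm_expi]; norm_num)
      have h0 := (weight_pos L s n).le; have := pow_le_pow_left₀ (norm_nonneg _) this 2; nlinarith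
  have D := tendsto_sobSq_mul (l := 𝓝[I \ {t}] t) (s := s) (s' := s + 1) (B := 4 * a ^ 2)
    (m := fun τ n => ((τ - t : ℝ) : ℂ)⁻¹ * (expi L n (a * τ) - expi L n (a * t)) -
      a * (Complex.I * freq L n * expi L n (a * t))) h1 (fun n => by
        have := hasDerivAt_iff_tendsto_slope.1 (hasDerivAt_expi_mul (L := L) n a t)
        have := (this.mono_left (nhdsWithin_mono t (s := I \ {t}) fun x hx => hx.2)).sub_const
          (a * (Complex.I * freq L n * expi L n (a * t)))
        rw [sub_self] at this; refine this.congr fun τ => ?_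
        rw [slope, vsub_eq_sub, real_smul, ofReal_inv]) fun τ n => by
      have e1 : ‖((τ - t : ℝ) : ℂ)⁻¹ * (expi L n (a * τ) - expi L n (a * t))‖ ≤ |a| * |freq L n| := by
        rw [norm_mul, norm_inv, norm_real, norm_eq_abs]
        rcases eq_or_ne τ t with rfl | hne
        · simp; positivity
        · rw [inv_mul_le_iff₀ (abs_pos.2 (sub_ne_zero.2 hne))]
          refine (norm_expi_sub_le n _ _).trans (le_of_eq ?_); rw [← mul_sub, abs_mul]; ring
      have e2 : ‖(a : ℂ) * (Complex.I * freq L n * expi L n (a * t))‖ = |a| * |freq L n| := by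
        simp [norm_expi]
      have e3 := (norm_sub_le (((τ - t : ℝ) : ℂ)⁻¹ * (expi L n (a * τ) - expi L n (a * t)))
        ((a : ℂ) * (Complex.I * freq L n * expi L n (a * t)))).trans (add_le_add e1 e2.le)
      have e4 := pow_le_pow_left₀ (norm_nonneg _) e3 2
      have e5 : (|a| * |freq L n| + |a| * |freq L n|) ^ 2 = 4 * a ^ 2 * freq L n ^ 2 := by grind
      rw [e5] at e4; rw [weight_succ]; have h0 := (weight_pos L s n).le
      nlinarith
  refine (tendsto_sobSq_add (tendsto_sobSq_add A B) D).congr fun τ => ?_; congr 1; ext n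
  simp only [HkFlow.trans, ddx]; ring

/-- Translations of `H^s`. -/
def Hs.translate (a : ℝ) (q : Hs L s) : Hs L s := Hs.mk (trans L a q.1) ⟨fun n => by
    rw [trans, trans, map_mul, conj_expi, q.conj_coeff], by
    have := q.2.2
    simpa only [trans, norm_mul, norm_expi, one_mul] using this⟩

lemma Hs.translate_coe (a : ℝ) (q : Hs L s) : (q.translate a).1 = trans L a q.1 := rfl

lemma Hs.translate_translate (a b : ℝ) (q : Hs L s) :
    (q.translate b).translate a = q.translate (a + b) := Subtype.ext (trans_trans a b q.1)

lemma Hs.translate_zero (q : Hs L s) : q.translate 0 = q := Subtype.ext (trans_zero q.1)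

lemma Hs.norm_translate (a : ℝ) (q : Hs L s) : ‖q.translate a‖ = ‖q‖ := by
  rw [← sq_eq_sq₀ (norm_nonneg _) (norm_nonneg _), Hs.norm_sq, Hs.norm_sq]
  refine tsum_congr fun n => ?_; rw [Hs.translate_coe, trans, norm_mul, norm_expi, one_mul]

lemma Hs.translate_sub (a : ℝ) (p q : Hs L s) : (p - q).translate a = p.translate a - q.translate
    a :=
  Subtype.ext (funext fun n => mul_sub (expi L n a) (p.1 n) (q.1 n))

lemma Hs.tendsto_iff_sobSq {l : Filter ι} {f : ι → Hs L s} {q : Hs L s} : Tendsto f l (𝓝 q) ↔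
    Tendsto (fun i => sobSq L s fun n => (f i).1 n - q.1 n) l (𝓝 0) := by
  have e : ∀ i, sobSq L s (fun n => (f i).1 n - q.1 n) = ofReal (‖f i - q‖ ^ 2) := fun i =>
    Hs.sobSq_eq (f i - q)
  simp only [e]; rw [tendsto_iff_norm_sub_tendsto_zero]; constructor
  · intro h; simpa using tendsto_ofReal (h.pow 2)
  · intro h; have := (ENNReal.tendsto_toReal (by simp)).comp h
    have := (continuous_sqrt.tendsto _).comp this
    simp only [ENNReal.toReal_zero, sqrt_zero] at this; refine this.congr fun i => ?_; simp

lemma Hs.continuous_translate : Continuous fun p : ℝ × Hs L s => p.2.translate p.1 := by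
  rw [continuous_iff_continuousAt]; rintro ⟨a₀, q₀⟩
  have h1 : Tendsto (fun p : ℝ × Hs L s => p.2.translate p.1 - q₀.translate p.1) (𝓝 (a₀, q₀)) (𝓝 0) := by
    rw [tendsto_zero_iff_norm_tendsto_zero]; simp only [← Hs.translate_sub, Hs.norm_translate]
    have c : Continuous fun p : ℝ × Hs L s => ‖p.2 - q₀‖ := by fun_prop
    simpa using c.tendsto (a₀, q₀)
  have h2 : Tendsto (fun p : ℝ × Hs L s => q₀.translate p.1) (𝓝 (a₀, q₀)) (𝓝 (q₀.translate a₀)) := by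
    rw [Hs.tendsto_iff_sobSq]
    have := tendsto_sobSq_mul (l := 𝓝 (a₀, q₀)) (s := s) (s' := s) (B := 4) (a := q₀.1)
      (m := fun p n => expi L n p.1 - expi L n a₀) (by rw [Hs.sobSq_eq]; simp) (fun n => by
        have c : Continuous fun p : ℝ × Hs L s => expi L n p.1 - expi L n a₀ :=
          ((continuous_expi L n).comp continuous_fst).sub continuous_const
        simpa using c.tendsto (a₀, q₀)) fun p n => by
        have : ‖expi L n p.1 - expi L n a₀‖ ≤ 2 := (norm_sub_le _ _).trans (by
          rw [norm_expi, norm_expi]; norm_num)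
        have h0 := (weight_pos L s n).le; have := pow_le_pow_left₀ (norm_nonneg _) this 2; nlinarith
    refine this.congr fun p => ?_; congr 1; ext n
    rw [Hs.translate_coe, Hs.translate_coe, trans, trans, sub_mul]
  have := h1.add h2; rw [zero_add] at this; refine this.congr fun p => ?_
  rw [sub_add_cancel]

lemma Coercive.diagGreen_translate (hL : 1 ≤ L) (hc : Coercive L q k)
    (hc' : Coercive L (q.translate a) k) (x : ℝ) : diagGreen L (q.translate a).1 k x = diagGreen L
    q.1 k (x + a) :=
  hc.green_trans hL rfl hc' x x

lemma coeffs_translate (hL : 0 < L) (hf : Periodic f (2 * L)) (a : ℝ) : coeffs L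
    (fun x => f (x + a)) = trans L a (coeffs L f) := by
  ext n; rw [trans, coeffs_eq, coeffs_eq]
  have e : ∀ x, expi L (-n) x * f (x + a) = expi L n a * (expi L (-n) (x + a) * f (x + a)) := by
    intro x
    have : expi L n a * expi L (-n) (x + a) = expi L (-n) x := by
      rw [expi_add_right, mul_comm (expi L (-n) x), ← mul_assoc, ← expi_add, add_neg_cancel,
        expi_zero, one_mul]
    rw [← mul_assoc, this]
  simp only [e]
  rw [intervalIntegral.integral_const_mul,
    intervalIntegral.integral_comp_add_right (fun x => expi L (-n) x * f x) a]
  have hp : Periodic (fun x => expi L (-n) x * f x) (2 * L) := fun x => by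
    simp only [expi_periodic hL (-n) x, hf x]
  have := hp.intervalIntegral_add_eq (-L + a) (-L)
  rw [show -L + a + 2 * L = L + a by ring, show -L + 2 * L = L by ring] at this; rw [this]; ring

lemma movingField_translate (hL : 1 ≤ L) (hk : (k ^ 2).im ≠ 0) (a : ℝ) (q : Hs L (-1)) : movingField
    L k (q.translate a) = (movingField L k q).translate a := by
  apply Subtype.ext; have hc := coercive_of_im hL hk q
  have hc' := coercive_of_im hL hk (q.translate a)
  rw [Hs.translate_coe, movingField_coe hL hk, movingField_coe hL hk, ← ddx_trans]; congr 1
  rw [rcoeffs, rcoeffs, ← coeffs_translate (by linarith) (fun x => by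
    rw [hc.diagGreen_periodic hL x])]
  simp only [hc.diagGreen_translate hL hc']

lemma hkField_eq (hL : 1 ≤ L) (hk : (k ^ 2).im ≠ 0) (q : Hs L (-1)) (n : ℤ) : hkField L k q.1 n =
    (movingField L k q).1 n + ((4 * k ^ 2).re : ℝ) * ddx L q.1 n := by
  rw [movingField_coe hL hk, hkField]; simp only [ddx]; ring

lemma hasDerivWithinAt_of_coeff {I : Set ℝ} (hI : I.OrdConnected) {p X : ℝ → Hs L s}
    (hX : ContinuousOn X I) (h : ∀ n, ∀ t ∈ I, HasDerivWithinAt (fun τ => (p τ).1 n) ((X t).1 n) I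
    t) : ∀ t ∈ I, HasDerivWithinAt p (X t) I t := by
  have hint : ∀ t ∈ I, ∀ τ ∈ I, IntervalIntegrable X volume t τ := fun t ht τ hτ =>
    (hX.mono (hI.uIcc_subset ht hτ)).intervalIntegrable
  have ftc : ∀ t ∈ I, ∀ τ ∈ I, ∫ r in t..τ, X r = p τ - p t := by
    intro t ht τ hτ; have hsub := hI.uIcc_subset ht hτ; refine Subtype.ext (funext fun n => ?_)
    have e1 := (coeffCLM L s n).intervalIntegral_comp_comm (hint t ht τ hτ)
    refine Eq.trans (b := coeffCLM L s n (∫ r in t..τ, X r)) rfl ?_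
    refine Eq.trans ?_ (show coeffCLM L s n (p τ - p t) = _ from rfl); rw [← e1, map_sub]
    refine intervalIntegral.integral_eq_sub_of_hasDeriv_right (f := fun r => coeffCLM L s n (p r))
      (fun r hr => ((h n r (hsub hr)).continuousWithinAt.mono hsub)) (fun r hr => ?_)
      ((coeffCLM L s n).continuous.comp_continuousOn (hX.mono hsub)).intervalIntegrable
    have hr' : r ∈ I := hsub (Ioo_subset_Icc_self hr)
    refine ((h n r hr').hasDerivAt ?_).hasDerivWithinAt
    exact mem_of_superset (Icc_mem_nhds hr.1 hr.2) hsub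
  intro t ht; rw [hasDerivWithinAt_iff_isLittleO, Asymptotics.isLittleO_iff]; intro ε hε
  have hev := Metric.continuousWithinAt_iff.1 (hX t ht) ε hε; obtain ⟨δ, hδ, hδ'⟩ := hev
  filter_upwards [self_mem_nhdsWithin, mem_nhdsWithin_of_mem_nhds (Metric.ball_mem_nhds t hδ)]
    with τ hτ hτδ
  have e : p τ - p t - (τ - t) • X t = ∫ r in t..τ, (X r - X t) := by simp [*]
  rw [e, norm_eq_abs]; refine intervalIntegral.norm_integral_le_of_norm_le_const fun r hr => ?_
  have hr2 := uIoc_subset_uIcc hr; rw [← dist_eq_norm]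
  refine (hδ' (hI.uIcc_subset ht hτ hr2) ?_).le; rw [dist_eq]
  refine (Set.abs_sub_left_of_mem_uIcc hr2).trans_lt ?_; rwa [Metric.mem_ball, dist_eq] at hτδ

lemma HasSobDerivWithin.coeff {F : ℝ → ℤ → ℂ} {F' : ℤ → ℂ} {I : Set ℝ}
    (h : HasSobDerivWithin L s F F' I t) (n : ℤ) : HasDerivWithinAt (fun τ => F τ n) (F' n) I
    t := by
  rw [hasSobDerivWithin_iff] at h
  rw [hasDerivWithinAt_iff_tendsto_slope, tendsto_iff_norm_sub_tendsto_zero]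
  have h1 : Tendsto (fun τ : ℝ => ofReal (weight L s n *
      ‖((τ - t : ℝ) : ℂ)⁻¹ * (F τ n - F t n) - F' n‖ ^ 2)) (𝓝[I \ {t}] t) (𝓝 0) :=
    tendsto_of_tendsto_of_tendsto_of_le_of_le tendsto_const_nhds h (fun _ => zero_le)
      fun τ => ENNReal.le_tsum n
  have h2 := (ENNReal.tendsto_toReal (by simp)).comp h1
  have h3 := (continuous_sqrt.tendsto _).comp (h2.const_mul (weight L s n)⁻¹)
  simp only [ENNReal.toReal_zero, mul_zero, sqrt_zero] at h3; refine h3.congr fun τ => ?_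
  have hw := weight_pos L s n; simp only [Function.comp]
  rw [toReal_ofReal (by positivity), inv_mul_cancel_left₀ hw.ne', sqrt_sq (norm_nonneg _),
    slope, vsub_eq_sub, real_smul, ofReal_inv]

lemma HasDerivWithinAt.hasSobDerivWithin {p : ℝ → Hs L s} {X : Hs L s} {I : Set ℝ}
    (h : HasDerivWithinAt p X I t) : HasSobDerivWithin L s (fun τ => (p τ).1) X.1 I t := by
  rw [hasSobDerivWithin_iff]; rw [hasDerivWithinAt_iff_tendsto_slope, Hs.tendsto_iff_sobSq] at h
  refine h.congr fun τ => ?_; congr 1; ext n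
  change ((τ - t)⁻¹ : ℝ) • ((p τ).1 n - (p t).1 n) - X.1 n = _; rw [real_smul, ofReal_inv]

lemma HasSobDerivWithin.mono (hs : s ≤ s') {F : ℝ → ℤ → ℂ} {F' : ℤ → ℂ} {I : Set ℝ} (h : HasSobDerivWithin L s' F F' I t) : HasSobDerivWithin L s F F' I t := by
  rw [hasSobDerivWithin_iff] at h ⊢
  exact tendsto_of_tendsto_of_tendsto_of_le_of_le tendsto_const_nhds h (fun _ => zero_le)
    fun τ => sobSq_mono hs _

lemma ContinuousWithinAt.translate {I : Set ℝ} {a : ℝ → ℝ} {p : ℝ → Hs L s}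
    (ha : ContinuousWithinAt a I t) (hp : ContinuousWithinAt p I t) : ContinuousWithinAt
    (fun τ => (p τ).translate (a τ)) I t :=
  Hs.continuous_translate.continuousAt.comp_continuousWithinAt (f := fun τ => (a τ, p τ))
    (ha.prodMk hp)

lemma isHkSolution_translate (hL : 1 ≤ L) (hk : (k ^ 2).im ≠ 0) {I : Set ℝ} {p : ℝ → Hs L (-1)}
    (hp : ∀ t ∈ I, HasDerivWithinAt p (movingField L k (p t)) I t) : IsHkSolution L k I fun t =>
    (p t).translate ((4 * k ^ 2).re * t) := by
  refine ⟨fun t ht => ?_, fun t ht => ?_⟩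
  · exact ContinuousWithinAt.translate (by fun_prop) (hp t ht).continuousWithinAt
  · have h := (HasDerivWithinAt.hasSobDerivWithin (hp t ht)).mono (s := -2) (by norm_num)
    have := h.trans (a := (4 * k ^ 2).re) (by
      norm_num; rw [Hs.sobSq_eq]; simp) (ne_top_of_le_ne_top (by rw [Hs.sobSq_eq]; simp)
        (sobSq_mono (L := L) (s' := -1) (by norm_num) _))
    refine Eq.mp (congrArg (fun X => HasSobDerivWithin L (-2) _ X I t) ?_) this; ext n
    rw [hkField_eq hL hk, movingField_translate hL hk]
    simp only [Hs.translate_coe, HkFlow.trans, ddx]; ring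

lemma IsHkSolution.hasDerivWithinAt (hL : 1 ≤ L) (hk : (k ^ 2).im ≠ 0) {I : Set ℝ}
    (hI : I.OrdConnected) {u : ℝ → Hs L (-1)} (hu : IsHkSolution L k I u) : ∀ t ∈ I,
    HasDerivWithinAt (fun t => (u t).translate (-((4 * k ^ 2).re * t)))
    (movingField L k ((u t).translate (-((4 * k ^ 2).re * t)))) I t := by
  have hc : ContinuousOn (fun t => (u t).translate (-((4 * k ^ 2).re * t))) I := fun t ht =>
    ContinuousWithinAt.translate (by fun_prop) (hu.continuousOn t ht)
  have hN : Continuous (movingField L k) := by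
    rw [continuous_iff_continuousAt]; intro q
    obtain ⟨K, -, -, hK⟩ := exists_movingField_bound hL hk (‖q‖ + 1)
    rw [ContinuousAt, tendsto_iff_norm_sub_tendsto_zero]
    have h1 : Tendsto (fun p : Hs L (-1) => K * ‖p - q‖) (𝓝 q) (𝓝 0) := by
      have c : Continuous fun p : Hs L (-1) => K * ‖p - q‖ := by fun_prop
      simpa using c.tendsto q
    refine squeeze_zero' (.of_forall fun _ => norm_nonneg _) ?_ h1
    filter_upwards [Metric.ball_mem_nhds q one_pos] with p hp
    rw [Metric.mem_ball, dist_eq_norm] at hp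
    exact hK p q (by linarith [norm_sub_norm_le p q]) (by linarith)
  refine hasDerivWithinAt_of_coeff hI (hN.comp_continuousOn hc) fun n t ht => ?_
  have h1 := (hu.eqn t ht).coeff n
  have h2 := (hasDerivAt_expi_mul (L := L) n (-(4 * k ^ 2).re) t).hasDerivWithinAt (s := I)
  have h3 := h2.mul h1; refine (h3.congr_of_mem (fun τ _ => ?_) ht).congr_deriv ?_
  · rw [Hs.translate_coe, HkFlow.trans, Pi.mul_apply, ← neg_mul]
  · rw [hkField_eq hL hk, movingField_translate hL hk]
    simp only [Hs.translate_coe, HkFlow.trans, ddx, neg_mul]; push_cast; ring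

/-- The flow in the original frame. -/
def hkFlowOf (L : ℝ) (k : ℂ) (Ψ : ℝ → Hs L (-1) → Hs L (-1)) (t : ℝ) (q : Hs L (-1)) : Hs L (-1) :=
  (Ψ t q).translate ((4 * k ^ 2).re * t)

lemma IsFlow.isGlobalHkFlow (hL : 1 ≤ L) (hk : (k ^ 2).im ≠ 0) {Ψ : ℝ → Hs L (-1) → Hs L (-1)}
    (h : IsFlow (movingField L k) Ψ) : IsGlobalHkFlow L k (hkFlowOf L k Ψ) where
  init q := by rw [hkFlowOf, mul_zero, Hs.translate_zero, h.init]
  solution q := isHkSolution_translate hL hk fun t _ => (h.hasDerivAt t q).hasDerivWithinAt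
  unique I u hI h0 hu t ht := by
    have := h.unique (bddLip_movingField hL hk) hI h0 (hu.hasDerivWithinAt hL hk hI) t ht
    rw [hkFlowOf]; simp only [mul_zero, neg_zero, Hs.translate_zero] at this
    rw [← this, Hs.translate_translate, add_neg_cancel, Hs.translate_zero]
  continuous := by
    have : Continuous fun p : ℝ × Hs L (-1) => ((4 * k ^ 2).re * p.1, Ψ p.1 p.2) :=
      (continuous_const.mul continuous_fst).prodMk h.continuous
    exact Hs.continuous_translate.comp this

lemma StrictlyAdmissible.im_pos (hC : 1 ≤ C) (h : StrictlyAdmissible C k) :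
    0 < (k ^ 2).im := by linarith [h.le_im_sq]

lemma StrictlyAdmissible.re_pos (h : StrictlyAdmissible C k) : 0 < k.re := by
  have := (Complex.abs_arg_lt_pi_div_two_iff (z := k)).1 (by
    rw [abs_of_nonneg h.arg_nonneg]; linarith [h.arg_lt, pi_pos])
  exact this.resolve_right h.ne_zero

lemma StrictlyAdmissible.sq_ne (h : StrictlyAdmissible C k) (h' : StrictlyAdmissible C ϰ)
    (hne : ϰ ≠ k) : ϰ ^ 2 ≠ k ^ 2 := by
  intro e
  rcases sq_eq_sq_iff_eq_or_eq_neg.1 e with e | e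
  · exact hne e
  · have h1 := h.re_pos; have h2 := h'.re_pos; rw [e, neg_re] at h2
    linarith

lemma StrictlyAdmissible.sq_ne_conj (hC : 1 ≤ C) (h : StrictlyAdmissible C k)
    (h' : StrictlyAdmissible C ϰ) : ϰ ^ 2 ≠ (conj k) ^ 2 := by
  intro e; have h1 := h.im_pos hC; have h2 := h'.im_pos hC
  rw [e, ← map_pow, conj_im] at h2; linarith

lemma weight_zero (n : ℤ) : weight L 0 n = 1 := Real.rpow_zero _

lemma weight_one (n : ℤ) : weight L 1 n = 4 + freq L n ^ 2 := Real.rpow_one _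

lemma sobSq_zero_coeffs (hL : 0 < L) (hf : MemLp f 2 (perMeasure L)) : sobSq L 0 (coeffs L f) =
    ofReal ((2 * L)⁻¹ * l2 (perMeasure L) f ^ 2) := by
  have hp := parseval hL hf; rw [integral_perMeasure hL, ← l2_sq] at hp
  rw [← hp.tsum_eq, ofReal_tsum_of_nonneg (fun n => by positivity) hp.summable, sobSq]
  simp only [weight_zero, one_mul]

lemma sobSq_one_coeffs_ne_top (hL : 0 < L) (hf : IsPrim f f') (hp : Periodic f (2 * L))
    (hf' : MemLp f' 2 (perMeasure L)) : sobSq L 1 (coeffs L f) ≠ ⊤ := by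
  have h1 := parseval hL (memLp_of_continuous hf.continuous); have h2 := parseval hL hf'
  have h3 := (h1.summable.mul_left 4).add h2.summable; rw [coeffs_deriv_of_periodic hf hp] at h3
  have e : ∀ n, 4 * ‖coeffs L f n‖ ^ 2 + ‖ddx L (coeffs L f) n‖ ^ 2 =
      weight L 1 n * ‖coeffs L f n‖ ^ 2 := fun n => by
    rw [ddx, norm_mul, norm_mul, norm_I, one_mul, norm_real, mul_pow,
      norm_eq_abs, sq_abs, weight_one]
    ring
  simp only [e] at h3
  rw [sobSq, ← ofReal_tsum_of_nonneg (fun n => mul_nonneg (weight_pos L 1 n).le (by positivity)) h3]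
  exact ofReal_ne_top

lemma memLp_per_bdd_mul {P : ℝ → ℂ} (hf : MemLp f 2 (perMeasure L)) (hP : Continuous P) : MemLp
    (fun x => P x * f x) 2 (perMeasure L) := by
  obtain ⟨B, hB⟩ := (isCompact_Icc (a := -L) (b := L)).exists_bound_of_continuousOn hP.continuousOn
  refine hf.of_le_mul (c := B) (hP.aestronglyMeasurable.mul hf.1) ?_
  rw [ae_restrict_iff' measurableSet_Ioc]; refine .of_forall fun x hx => ?_; rw [norm_mul]
  gcongr; exact hB x (Ioc_subset_Icc_self hx)

lemma Coercive.memLp_deriv_diagGreen (hL : 1 ≤ L) (hc : Coercive L q k) : MemLp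
    (deriv (diagGreen L q.1 k)) 2 (perMeasure L) := by
  have h := memLp_per_bdd_mul ((hc.l2Per_weyl hL (Or.inl rfl)).add
    (hc.l2Per_weyl hL (Or.inr rfl))).memLp (hc.continuous_diagGreen hL)
  refine (memLp_congr_ae (.of_forall fun x => ?_)).1 h; rw [hc.deriv_diagGreen hL, mul_comm]

lemma Coercive.greenRegular (hL : 1 ≤ L) (hc : Coercive L q k) : GreenRegular L q.1 k where
  existsUnique := hc.existsUnique hL
  ne_zero := hc.diagGreen_ne_zero hL
  continuous := hc.continuous_diagGreen hL
  periodic := hc.diagGreen_periodic hL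
  memH1 := by
    have := sobSq_one_coeffs_ne_top (by linarith) (hc.isPrim_diagGreen hL)
      (hc.diagGreen_periodic hL) (hc.memLp_deriv_diagGreen hL)
    exact ENNReal.rpow_lt_top_of_nonneg (by norm_num) this

lemma tendsto_sobSq_zero (hL : 0 < L) {l : Filter ι} {f : ι → ℝ → ℂ}
    (hf : ∀ i, MemLp (f i) 2 (perMeasure L))
    (h : Tendsto (fun i => l2 (perMeasure L) (f i)) l (𝓝 0)) (c : ℂ) : Tendsto
    (fun i => sobSq L 0 fun n => c * coeffs L (f i) n) l (𝓝 0) := by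
  have e : ∀ i, sobSq L 0 (fun n => c * coeffs L (f i) n) =
      ofReal ((2 * L)⁻¹ * (‖c‖ * l2 (perMeasure L) (f i)) ^ 2) := fun i => by
    rw [← l2_const_mul, ← sobSq_zero_coeffs hL ((hf i).const_mul c)]
    congr 1; ext n; exact (coeffs_const_mul c (f i) n).symm
  simp only [e]; have := tendsto_ofReal (((h.const_mul ‖c‖).pow 2).const_mul (2 * L)⁻¹)
  simpa using this

lemma hasSobDerivWithin_inv_diagGreen (hL : 1 ≤ L) (hk : (k ^ 2).im ≠ 0) (hϰ : (ϰ ^ 2).im ≠ 0) (h1 :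
    ϰ ^ 2 ≠ k ^ 2) (h2 : ϰ ^ 2 ≠ (conj k) ^ 2) {p : ℝ → Hs L (-1)} {I : Set ℝ} (hp :
    HasDerivWithinAt p (movingField L k (p t)) I t) : HasSobDerivWithin L 0 (fun τ => coeffs L fun x
    => 1 / (2 * diagGreen L (p τ).1 ϰ x)) (ddx L fun n => -(2 * k ^ 5 / (k ^ 2 - ϰ ^ 2)) * coeffs L
    (fun x => diagGreen L (p t).1 k x / diagGreen L (p t).1 ϰ x) n - 2 * (conj k) ^ 5 / ((conj k) ^
    2 - ϰ ^ 2) * coeffs L (fun x => diagGreen L (p t).1 (conj k) x / diagGreen L (p t).1 ϰ x) n) I t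
    := by
  have hL0 : 0 < L := by linarith
  have hc : ∀ q : Hs L (-1), Coercive L q ϰ := coercive_of_im hL hϰ
  have hck := coercive_of_im hL hk (p t); have hck' := coercive_of_im hL (im_conj_sq_ne hk) (p t)
  obtain ⟨w, hw, e1, e2⟩ := exists_weyl_deriv hL hk (hc (p t)) h1 h2 (σ := 1) (Or.inl rfl)
  obtain ⟨w', hw', e1', e2'⟩ := exists_weyl_deriv hL hk (hc (p t)) h1 h2 (σ := -1) (Or.inr rfl)
  have hv : ∀ q : Hs L (-1), L2Per L (weyl L q.1 ϰ 1) := fun q => (hc q).l2Per_weyl hL (Or.inl rfl)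
  have hv' : ∀ q : Hs L (-1), L2Per L (weyl L q.1 ϰ (-1)) := fun q =>
    (hc q).l2Per_weyl hL (Or.inr rfl)
  have T1 := tendsto_sobSq_zero hL0 (fun τ => ((((hv (p τ)).sub (hv (p t))).const_mul
    ((τ - t : ℝ) : ℂ)⁻¹).sub hw).memLp) (tendsto_weyl_slope hL (Or.inl rfl) hp (hc _) hw e1) (1 / 2)
  have T2 := tendsto_sobSq_zero hL0 (fun τ => ((((hv' (p τ)).sub (hv' (p t))).const_mul
    ((τ - t : ℝ) : ℂ)⁻¹).sub hw').memLp) (tendsto_weyl_slope hL (Or.inr rfl) hp (hc _) hw' e1') (-1 / 2)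
  rw [hasSobDerivWithin_iff]
  have hco : ∀ q : Hs L (-1), ∀ n, coeffs L (fun x => 1 / (2 * diagGreen L q.1 ϰ x)) n =
      1 / 2 * (coeffs L (weyl L q.1 ϰ 1) n - coeffs L (weyl L q.1 ϰ (-1)) n) := by
    intro q n
    rw [← coeffs_sub ((hv q).intervalIntegrable hL0 _ _) ((hv' q).intervalIntegrable hL0 _ _),
      ← coeffs_const_mul]
    congr 1; ext x; rw [(hc q).weyl_sub hL]; ring
  have hD : ∀ {l : ℂ}, Coercive L (p t) l → ∀ {σ : ℂ}, (σ = 1 ∨ σ = -1) →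
      ∀ a b, IntervalIntegrable (fun x =>
      diagGreen L (p t).1 l x * weyl L (p t).1 ϰ σ x - deriv (diagGreen L (p t).1 l) x / 2) volume a b :=
    fun hl _ hσ a b => ((l2Per_diagGreen hL hl).integrable_mul hL0 ((hc _).l2Per_weyl hL hσ) a b).sub
      (((hl.isPrim_diagGreen hL).1 a b).div_const 2)
  have hdiff : ∀ {l : ℂ}, Coercive L (p t) l → ∀ n,
      coeffs L (fun x => diagGreen L (p t).1 l x / diagGreen L (p t).1 ϰ x) n =
      coeffs L (fun x => diagGreen L (p t).1 l x * weyl L (p t).1 ϰ 1 x -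
        deriv (diagGreen L (p t).1 l) x / 2) n -
      coeffs L (fun x => diagGreen L (p t).1 l x * weyl L (p t).1 ϰ (-1) x -
        deriv (diagGreen L (p t).1 l) x / 2) n := by
    intro l hl n; rw [← coeffs_sub (hD hl (Or.inl rfl) _ _) (hD hl (Or.inr rfl) _ _)]
    congr 1; ext x; rw [div_eq_mul_inv, ← (hc (p t)).weyl_sub hL]; ring
  refine (tendsto_sobSq_add T1 T2).congr fun τ => ?_; congr 1; ext n
  have s1 := congrFun e2 n; have s2 := congrFun e2' n
  rw [ddx, HkFlow.coeffs_add ((hD hck (Or.inl rfl) _ _).const_mul _)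
    ((hD hck' (Or.inl rfl) _ _).const_mul _), coeffs_const_mul, coeffs_const_mul] at s1
  rw [ddx, HkFlow.coeffs_add ((hD hck (Or.inr rfl) _ _).const_mul _)
    ((hD hck' (Or.inr rfl) _ _).const_mul _), coeffs_const_mul, coeffs_const_mul] at s2
  rw [coeffs_sub ((((hv (p τ)).sub (hv (p t))).const_mul _).intervalIntegrable hL0 _ _)
      (hw.intervalIntegrable hL0 _ _),
    coeffs_sub ((((hv' (p τ)).sub (hv' (p t))).const_mul _).intervalIntegrable hL0 _ _)
      (hw'.intervalIntegrable hL0 _ _), coeffs_const_mul, coeffs_const_mul,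
    coeffs_sub ((hv _).intervalIntegrable hL0 _ _) ((hv _).intervalIntegrable hL0 _ _),
    coeffs_sub ((hv' _).intervalIntegrable hL0 _ _) ((hv' _).intervalIntegrable hL0 _ _),
    hco, hco, ddx, hdiff hck, hdiff hck', s1, s2]
  grind

lemma sobSq_zero_ne_top_of_one {a : ℤ → ℂ} (h : sobSq L 1 a ≠ ⊤) : sobSq L 0 (ddx L a) ≠ ⊤ := by
  refine ne_top_of_le_ne_top h (tsum_le_tsum fun n => ofReal_le_ofReal ?_)
  rw [weight_zero, weight_one, one_mul, ddx, norm_mul, norm_mul, norm_I, one_mul,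
    norm_real, mul_pow, norm_eq_abs, sq_abs]
  gcongr; linarith

lemma sobSq_const_mul (s : ℝ) (c : ℂ) (a : ℤ → ℂ) : sobSq L s (fun n => c * a n) = ofReal (‖c‖ ^ 2)
    * sobSq L s a := by
  rw [sobSq, sobSq, ← ENNReal.tsum_mul_left]; refine tsum_congr fun n => ?_
  rw [← ENNReal.ofReal_mul (by positivity), norm_mul]; congr 1; ring

lemma sobSq_sub_ne_top {a b : ℤ → ℂ} (ha : sobSq L s a ≠ ⊤) (hb : sobSq L s b ≠ ⊤) (c d : ℂ) : sobSq
    L s (fun n => c * a n - d * b n) ≠ ⊤ := by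
  have h := sobSq_add_le (L := L) s (fun n => c * a n) (fun n => -d * b n)
  rw [sobSq_const_mul, sobSq_const_mul] at h
  have e : (fun n => c * a n - d * b n) = fun n => c * a n + -d * b n := by ext n; ring
  rw [e]; refine ne_top_of_le_ne_top ?_ h
  finiteness

lemma ratio_regular (hL : 1 ≤ L) (hk : Coercive L q k) (hϰ : Coercive L q ϰ) : Continuous
    (fun x => diagGreen L q.1 k x / diagGreen L q.1 ϰ x) ∧ Periodic
    (fun x => diagGreen L q.1 k x / diagGreen L q.1 ϰ x) (2 * L) ∧ sobSq L 1
    (coeffs L fun x => diagGreen L q.1 k x / diagGreen L q.1 ϰ x) ≠ ⊤ := by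
  have hL0 : 0 < L := by linarith
  have c1 := hk.continuous_diagGreen hL; have c2 := hϰ.continuous_diagGreen hL
  have z := hϰ.diagGreen_ne_zero hL
  have hP := (hk.isPrim_diagGreen hL).mul ((hϰ.isPrim_diagGreen hL).inv z)
  have hp : Periodic (fun x => diagGreen L q.1 k x / diagGreen L q.1 ϰ x) (2 * L) :=
    fun x => by simp only [hk.diagGreen_periodic hL x, hϰ.diagGreen_periodic hL x]
  refine ⟨c1.div c2 z, hp, ?_⟩
  refine sobSq_one_coeffs_ne_top hL0 (hP.congr (fun x => (div_eq_mul_inv _ _).symm) fun x => rfl)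
    hp ?_
  have m1 := memLp_per_bdd_mul (hk.memLp_deriv_diagGreen hL) (c2.inv₀ z)
  have m2 := memLp_per_bdd_mul (hϰ.memLp_deriv_diagGreen hL)
    (c1.neg.mul ((c2.pow 2).inv₀ fun x => pow_ne_zero 2 (z x)))
  refine (memLp_congr_ae (.of_forall fun x => ?_)).1 (m1.add m2)
  simp only [Pi.add_apply, Pi.neg_apply, Pi.inv_apply, Pi.mul_apply, Pi.pow_apply]; ring

lemma IsHkSolution.hasSobDerivWithin_inv_diagGreen (hL : 1 ≤ L) (hk : (k ^ 2).im ≠ 0)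
    (hϰ : (ϰ ^ 2).im ≠ 0) (h1 : ϰ ^ 2 ≠ k ^ 2) (h2 : ϰ ^ 2 ≠ (conj k) ^ 2) {I : Set ℝ}
    (hI : I.OrdConnected) {u : ℝ → Hs L (-1)} (hu : IsHkSolution L k I u) (ht : t ∈ I) :
    HasSobDerivWithin L 0 (fun τ => coeffs L fun x => 1 / (2 * diagGreen L (u τ).1 ϰ x)) (ddx L
    (coeffs L fun x => (k ^ 2 + (conj k) ^ 2) / diagGreen L (u t).1 ϰ x - 2 * k ^ 5 / (k ^ 2 - ϰ ^ 2) * (diagGreen L (u t).1 k x / diagGreen L (u t).1 ϰ x) - 2 * (conj k) ^ 5 / ((conj k) ^ 2 - ϰ ^ 2) * (diagGreen L (u t).1 (conj k) x / diagGreen L (u t).1 ϰ x)))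
    I t := by
  have hL0 : 0 < L := by linarith
  set c := (4 * k ^ 2).re with hcdef
  set p : ℝ → Hs L (-1) := fun t => (u t).translate (-(c * t)) with hp
  have hup : ∀ τ, u τ = (p τ).translate (c * τ) := fun τ => by
    rw [hp, Hs.translate_translate, add_neg_cancel, Hs.translate_zero]
  have hC := fun (l : ℂ) (hl : (l ^ 2).im ≠ 0) (q : Hs L (-1)) => coercive_of_im hL hl q
  have hg : ∀ l : ℂ, (l ^ 2).im ≠ 0 → ∀ τ x, diagGreen L (u τ).1 l x =
      diagGreen L (p τ).1 l (x + c * τ) := fun l hl τ x => by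
    rw [hup τ]; exact (hC l hl _).diagGreen_translate hL (hC l hl _) x
  have hz : ∀ q : Hs L (-1), ∀ x, diagGreen L q.1 ϰ x ≠ 0 := fun q => (hC ϰ hϰ q).diagGreen_ne_zero hL
  have hk' := im_conj_sq_ne hk; have R1 := ratio_regular hL (hC k hk (p t)) (hC ϰ hϰ (p t))
  have R2 := ratio_regular hL (hC _ hk' (p t)) (hC ϰ hϰ (p t))
  have hPer : ∀ q : Hs L (-1), Periodic (fun x => 1 / (2 * diagGreen L q.1 ϰ x)) (2 * L) :=
    fun q x => by simp only [(hC ϰ hϰ q).diagGreen_periodic hL x]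
  have hcont : Continuous fun x => 1 / (2 * diagGreen L (p t).1 ϰ x) :=
    continuous_const.div (continuous_const.mul ((hC ϰ hϰ (p t)).continuous_diagGreen hL))
      fun x => mul_ne_zero two_ne_zero (hz _ x)
  have H1 : sobSq L 1 (coeffs L fun x => 1 / (2 * diagGreen L (p t).1 ϰ x)) ≠ ⊤ := by
    have hP := ((hC ϰ hϰ (p t)).isPrim_diagGreen hL).inv (hz _) |>.const_mul (1 / 2)
    refine sobSq_one_coeffs_ne_top hL0 (hP.congr (fun x => by ring) fun x => rfl) (hPer _) ?_
    have c2 := (hC ϰ hϰ (p t)).continuous_diagGreen hL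
    have m2 := memLp_per_bdd_mul ((hC ϰ hϰ (p t)).memLp_deriv_diagGreen hL)
      (((c2.pow 2).inv₀ fun x => pow_ne_zero 2 (hz _ x)).const_mul (-1 / 2))
    refine (memLp_congr_ae (.of_forall fun x => ?_)).1 m2; simp only [Pi.inv_apply, Pi.pow_apply]
    ring
  have hpd : HasDerivWithinAt p (movingField L k (p t)) I t := hu.hasDerivWithinAt hL hk hI t ht
  have key := HkFlow.hasSobDerivWithin_inv_diagGreen hL hk hϰ h1 h2 hpd
  have key2 := HasSobDerivWithin.trans (a := c) key (by rw [zero_add]; exact H1) (by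
    exact sobSq_zero_ne_top_of_one (sobSq_sub_ne_top R1.2.2 R2.2.2 _ _))
  have hF : ∀ τ, coeffs L (fun x => 1 / (2 * diagGreen L (u τ).1 ϰ x)) =
      HkFlow.trans L (c * τ) (coeffs L fun x => 1 / (2 * diagGreen L (p τ).1 ϰ x)) := fun τ => by
    rw [← coeffs_translate hL0 (hPer (p τ))]; simp only [hg ϰ hϰ]
  simp only [hF]; refine Eq.mp (congrArg (fun X => HasSobDerivWithin L 0 _ X I t) ?_) key2
  simp only [hg ϰ hϰ, hg k hk, hg _ hk']
  rw [coeffs_translate hL0 (f := fun x => (k ^ 2 + (conj k) ^ 2) / diagGreen L (p t).1 ϰ x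
    - 2 * k ^ 5 / (k ^ 2 - ϰ ^ 2) * (diagGreen L (p t).1 k x / diagGreen L (p t).1 ϰ x)
    - 2 * (conj k) ^ 5 / ((conj k) ^ 2 - ϰ ^ 2) *
      (diagGreen L (p t).1 (conj k) x / diagGreen L (p t).1 ϰ x)) (fun x => by
        simp only [(hC ϰ hϰ (p t)).diagGreen_periodic hL x, (hC k hk (p t)).diagGreen_periodic hL x,
          (hC _ hk' (p t)).diagGreen_periodic hL x]), ddx_trans]
  congr 1; ext n
  have e : (fun x => (k ^ 2 + (conj k) ^ 2) / diagGreen L (p t).1 ϰ x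
    - 2 * k ^ 5 / (k ^ 2 - ϰ ^ 2) * (diagGreen L (p t).1 k x / diagGreen L (p t).1 ϰ x)
    - 2 * (conj k) ^ 5 / ((conj k) ^ 2 - ϰ ^ 2) *
      (diagGreen L (p t).1 (conj k) x / diagGreen L (p t).1 ϰ x)) = fun x =>
      ((c : ℂ) * (1 / (2 * diagGreen L (p t).1 ϰ x)) - 2 * k ^ 5 / (k ^ 2 - ϰ ^ 2) *
      (diagGreen L (p t).1 k x / diagGreen L (p t).1 ϰ x)) -
    2 * (conj k) ^ 5 / ((conj k) ^ 2 - ϰ ^ 2) *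
      (diagGreen L (p t).1 (conj k) x / diagGreen L (p t).1 ϰ x) := by
    ext x; rw [hcdef, Complex.re_eq_add_conj, map_mul, map_pow, conj_ofNat]; ring
  rw [e]; simp only [ddx]
  rw [coeffs_sub (((hcont.intervalIntegrable _ _).const_mul _).sub
      ((R1.1.intervalIntegrable _ _).const_mul _)) ((R2.1.intervalIntegrable _ _).const_mul _),
    coeffs_sub ((hcont.intervalIntegrable _ _).const_mul _)
      ((R1.1.intervalIntegrable _ _).const_mul _), coeffs_const_mul, coeffs_const_mul,
    coeffs_const_mul]
  ring

lemma norm_exp_neg_mul_abs (k : ℂ) (y : ℝ) :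
    ‖exp (-(k * (|y| : ℝ)))‖ = Real.exp (-(k.re * |y|)) := by rw [norm_exp]; simp

lemma integrable_exp_neg_mul_abs (ha : 0 < a) : Integrable
    (fun y : ℝ => Real.exp (-(a * |y|))) := by
  rw [← integrableOn_univ, ← Set.Iic_union_Ioi (a := (0 : ℝ))]; refine IntegrableOn.union ?_ ?_
  · refine (integrableOn_exp_mul_Iic ha 0).congr_fun (fun y hy => ?_) measurableSet_Iic; grind
  · refine (integrableOn_exp_mul_Ioi (neg_lt_zero.2 ha) 0).congr_fun (fun y hy => ?_) measurableSet_Ioi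
    grind

lemma memLp_exp_neg_mul_abs (hk : 0 < k.re) : MemLp (fun y : ℝ => exp (-(k * (|y| : ℝ)))) 2
    volume := by
  rw [memLp_two_iff_integrable_sq_norm
    (by fun_prop : Continuous fun y : ℝ => exp (-(k * (|y| : ℝ)))).aestronglyMeasurable]
  simp only [norm_exp_neg_mul_abs]
  refine (integrable_exp_neg_mul_abs (mul_pos two_pos hk)).congr (.of_forall fun y => ?_); simp only
  rw [← Real.exp_nat_mul]; push_cast; ring_nf

lemma hasH1Deriv_exp_neg_mul_abs (hk : 0 < k.re) : HasH1Deriv (fun y : ℝ => exp (-(k * (|y| : ℝ))))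
    (fun y : ℝ => -(k * (SignType.sign y : ℝ)) * exp (-(k * (|y| : ℝ)))) := by
  have hm : MemLp (fun y : ℝ => -(k * ((SignType.sign y : ℝ) : ℂ)) *
      exp (-(k * (|y| : ℝ)))) 2 volume := by
    refine (memLp_exp_neg_mul_abs hk).of_le_mul (c := ‖k‖) (Measurable.aestronglyMeasurable ?_)
      (.of_forall fun y => ?_)
    · have : Measurable fun y : ℝ => (SignType.sign y : ℝ) := by
        have e : (fun y : ℝ => (SignType.sign y : ℝ)) = fun y =>
          if 0 < y then 1 else if y < 0 then -1 else 0 := by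
          ext y; rw [sign_apply]
          split_ifs <;> simp
        rw [e]
        exact Measurable.ite measurableSet_Ioi measurable_const
          (Measurable.ite measurableSet_Iio measurable_const measurable_const)
      fun_prop
    · rw [norm_mul, norm_neg, norm_mul, norm_real]
      refine mul_le_mul_of_nonneg_right (mul_le_of_le_one_right (norm_nonneg _) ?_) (norm_nonneg _)
      rcases lt_trichotomy y 0 with h | rfl | h
      · simp [sign_neg h]
      · simp
      · simp [sign_pos h]
  refine IsPrim.hasH1Deriv (IsPrim.of_countable (s := {0}) (Set.countable_singleton 0) (by fun_prop)
    (fun y hy => ?_) fun a b => ?_) (memLp_exp_neg_mul_abs hk) hm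
  · have h1 := ((hasDerivAt_abs hy).ofReal_comp.const_mul k).neg.cexp
    exact h1.congr_deriv (by simp only [Pi.neg_apply]; ring)
  · rw [intervalIntegrable_iff]
    exact (hm.locallyIntegrable (by norm_num)).integrableOn_isCompact isCompact_uIcc
      |>.mono_set uIoc_subset_uIcc

lemma exists_integral_pair_exp (hL : 1 ≤ L) (hk : 0 < k.re) : ∃ A : ℂ, ∀ q : Hs L (-1),
    IntervalIntegrable (fun x => pair L q.1 fun y => exp (-(2 * k * (|x - y| : ℝ)))) volume (-L) L ∧
    ∫ x in (-L)..L, pair L q.1 (fun y => exp (-(2 * k * (|x - y| : ℝ)))) = A * q.1 0 := by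
  have hL0 : 0 < L := by linarith
  set H : ℤ → ℂ := fun n => ∫ y : ℝ, exp (I * freq L n * y) *
    (exp (-(k * (|y| : ℝ))) * exp (-(k * (|y| : ℝ)))) with hH
  refine ⟨2 * L * H 0, fun q => ?_⟩
  have hs : Summable fun n => q.1 n * H n :=
    summable_pair hL q (hasH1Deriv_exp_neg_mul_abs hk) (hasH1Deriv_exp_neg_mul_abs hk)
  have e : (fun x => pair L q.1 fun y => exp (-(2 * k * (|x - y| : ℝ)))) = fun x =>
      ∑' n, q.1 n * H n * expi L n x := by
    ext x; refine tsum_congr fun n => ?_; rw [mul_assoc, hH]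
    congr 1; rw [← integral_mul_const, ← integral_add_right_eq_self _ x]; congr 1; ext y
    beta_reduce
    rw [show x - (y + x) = -y by ring, abs_neg, ← exp_add, expi, ← exp_add, ← exp_add, ← exp_add]
    congr 1; push_cast; ring
  have hn : Summable fun n => ‖q.1 n * H n‖ := hs.norm
  have hc : Continuous fun x => ∑' n, q.1 n * H n * expi L n x :=
    continuous_tsum (fun n => continuous_const.mul (continuous_expi L n)) hn fun n x => by
      rw [norm_mul, norm_expi, mul_one]
  rw [e]; refine ⟨hc.intervalIntegrable _ _, ?_⟩
  have h1 := intervalIntegral.hasSum_intervalIntegral_of_summable_norm (a := -L) (b := L)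
    (f := fun n => ⟨fun x => q.1 n * H n * expi L n x, continuous_const.mul (continuous_expi L n)⟩)
    (hn.of_nonneg_of_le (fun n => norm_nonneg _) fun n => by
      refine (ContinuousMap.norm_le _ (norm_nonneg _)).2 fun x => ?_
      change ‖q.1 n * H n * expi L n _‖ ≤ _
      rw [norm_mul, norm_expi, mul_one])
  refine h1.tsum_eq.symm.trans ?_
  have h2 : ∀ n, ∫ x in (-L)..L, q.1 n * H n * expi L n x = q.1 n * H n * (2 * L) * if 0 = n then 1 else 0 := by
    intro n; have := coeffs_expi hL0 n 0; rw [coeffs_zero_eq] at this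
    rw [intervalIntegral.integral_const_mul, ← this]
    have : (L : ℂ) ≠ 0 := by exact_mod_cast hL0.ne'
    field_simp
  refine (tsum_congr h2).trans ?_
  rw [tsum_eq_single 0 fun n hn => by rw [if_neg hn.symm, mul_zero]]; simp; ring

lemma Coercive.alpha_eq (hL : 1 ≤ L) (hk : 0 < k.re) : ∃ A : ℂ, ∀ q : Hs L (-1), Coercive L q k →
    alpha L q.1 k = 2 * L * k - (1 / 2) * ((∫ x in (-L)..L, weyl L q.1 k 1 x) - ∫ x in (-L)..L, weyl
    L q.1 k (-1) x) + A * q.1 0 := by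
  have hL0 : 0 < L := by linarith
  obtain ⟨A, hA⟩ := exists_integral_pair_exp hL hk; refine ⟨1 / 2 * A, fun q hc => ?_⟩
  obtain ⟨h1, h2⟩ := hA q
  have i1 := (hc.l2Per_weyl hL (σ := 1) (Or.inl rfl)).intervalIntegrable hL0 (-L) L
  have i2 := (hc.l2Per_weyl hL (σ := -1) (Or.inr rfl)).intervalIntegrable hL0 (-L) L
  have e : ∀ x, rho L q.1 k x = (k - 1 / 2 * (weyl L q.1 k 1 x - weyl L q.1 k (-1) x)) +
      1 / 2 * pair L q.1 (fun y => exp (-(2 * k * (|x - y| : ℝ)))) := fun x => by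
    rw [rho, hc.weyl_sub hL]; ring
  simp only [alpha, e]
  rw [intervalIntegral.integral_add (intervalIntegrable_const.sub ((i1.sub i2).const_mul _))
      (h1.const_mul _),
    intervalIntegral.integral_sub intervalIntegrable_const ((i1.sub i2).const_mul _),
    intervalIntegral.integral_const_mul, intervalIntegral.integral_const_mul,
    intervalIntegral.integral_sub i1 i2, intervalIntegral.integral_const, h2, real_smul]
  push_cast; ring

lemma Coercive.integral_weyl_sub (hL : 1 ≤ L) (h₀ : Coercive L q₀ k) (h : Coercive L q k)
    (hσ : σ = 1 ∨ σ = -1) (hfp : Periodic f (2 * L))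
    (hf : ∀ a b : ℝ, IntervalIntegrable f volume a b) (hq : ∀ n, (q - q₀).1 n = coeffs L f n) : σ *
    ∫ x in (-L)..L, (weyl L q.1 k σ x - weyl L q₀.1 k σ x) =
    (∫ x in (-L)..L, diagGreen L q₀.1 k x * f x) - ∫ x in (-L)..L, diagGreen L q₀.1 k x *
    ((weyl L q.1 k σ x - weyl L q₀.1 k σ x) * (weyl L q.1 k σ x - weyl L q₀.1 k σ x)) := by
  have hL0 : 0 < L := by linarith
  set v := weyl L q₀.1 k σ with hv; set d := fun x => weyl L q.1 k σ x - v x with hd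
  set g := diagGreen L q₀.1 k with hg; have hvp : L2Per L v := h₀.l2Per_weyl hL hσ
  have hv'p : L2Per L (weyl L q.1 k σ) := h.l2Per_weyl hL hσ; have hdp : L2Per L d := hv'p.sub hvp
  have hsp : L2Per L fun x => weyl L q.1 k σ x + v x := hv'p.add hvp
  have isd := hsp.integrable_mul hL0 hdp
  obtain ⟨r, hr, hrp, hdr⟩ := exists_periodic_prim hL0 hdp
    (F := fun _ => 0) (l2Per_of_continuous continuous_const fun _ => rfl)
    (s := fun x => f x - (weyl L q.1 k σ x + v x) * d x)
    (fun x => by simp only [hfp x, hsp.periodic x, hdp.periodic x])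
    (fun a b => (hf a b).sub (isd a b)) fun n => by
      have := (h.isRiccati hL hσ).sub hL0 (h₀.isRiccati hL hσ) n; rw [hq] at this
      rw [coeffs_sub (hf _ _) (isd _ _), ddx, ddx, coeffs_const hL0]; simp only [ddx] at this; grind
  have hgc := h₀.continuous_diagGreen hL; have hP := (h₀.isPrim_diagGreen hL).mul hr
  have h0 : g L * r L - g (-L) * r (-L) = _ := hP.ftc (-L) L
  have gp : g L = g (-L) := by
    have := h₀.diagGreen_periodic hL (-L); grind
  have rp : r L = r (-L) := by
    have := hrp (-L); grind
  rw [gp, rp, sub_self] at h0; have idd := (hdp.integrable_mul hL0 hdp (-L) L)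
  have ig1 := (hf (-L) L).continuousOn_mul hgc.continuousOn
  have ig2 := idd.continuousOn_mul hgc.continuousOn
  have id' := (hdp.intervalIntegrable hL0 (-L) L).const_mul σ
  have e : ∫ x in (-L)..L, (deriv (diagGreen L q₀.1 k) x * r x + diagGreen L q₀.1 k x *
      (f x - (weyl L q.1 k σ x + v x) * d x)) =
      ∫ x in (-L)..L, ((g x * f x - g x * (d x * d x)) - σ * d x) := by
    refine intervalIntegral.integral_congr_ae ?_
    filter_upwards [hdr] with x hx _
    have h2 := h₀.two_mul_weyl hL σ x; grind
  rw [e, intervalIntegral.integral_sub (ig1.sub ig2) id', intervalIntegral.integral_sub ig1 ig2,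
    intervalIntegral.integral_const_mul] at h0
  linear_combination h0

lemma exists_hs_of_memLp (hL : 0 < L) {f : ℝ → ℝ}
    (hf : MemLp (fun x => (f x : ℂ)) 2 (perMeasure L)) : ∃ p : Hs L (-1), p.1 = rcoeffs L f := by
  refine ⟨Hs.mk (rcoeffs L f) ⟨coeffs_real L f, ?_⟩, rfl⟩
  refine (parseval hL hf).summable.of_nonneg_of_le
    (fun n => mul_nonneg (weight_pos L _ n).le (by positivity)) fun n => ?_
  refine mul_le_of_le_one_left (by positivity) ?_; rw [weight, rpow_neg_one]
  exact inv_le_one_of_one_le₀ (by nlinarith [sq_nonneg (freq L n)])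

lemma hasDerivAt_of_quadratic {E : Type*} [NormedAddCommGroup E] [NormedSpace ℝ E] {F : ℝ → E}
    {D : E} {K : ℝ} (h : ∀ᶠ s in 𝓝 (0 : ℝ), ‖F s - F 0 - s • D‖ ≤ K * s ^ 2) : HasDerivAt F D
    0 := by
  rw [hasDerivAt_iff_isLittleO]; simp only [sub_zero]
  have h1 : (fun s : ℝ => F s - F 0 - s • D) =O[𝓝 0] fun s => s ^ 2 :=
    Asymptotics.IsBigO.of_bound K (by simp [*])
  exact h1.trans_isLittleO (Asymptotics.isLittleO_pow_id one_lt_two)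

lemma Coercive.hasDerivAt_integral_weyl_line (hL : 1 ≤ L) {p : Hs L (-1)} (h₀ : Coercive L q₀ k)
    (hσ : σ = 1 ∨ σ = -1) (hfp : Periodic f (2 * L))
    (hf : ∀ a b : ℝ, IntervalIntegrable f volume a b) (hp : p.1 = coeffs L f) : HasDerivAt
    (fun s : ℝ => σ * ∫ x in (-L)..L, weyl L (q₀ + s • p).1 k σ x)
    (∫ x in (-L)..L, diagGreen L q₀.1 k x * f x) 0 := by
  have hL0 : 0 < L := by linarith
  obtain ⟨K, hK0, hK⟩ := h₀.exists_weyl_lipschitz hL hσ; have hgc := h₀.continuous_diagGreen hL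
  obtain ⟨B, hB⟩ := (isCompact_Icc (a := -L) (b := L)).exists_bound_of_continuousOn hgc.continuousOn
  have hcont : Tendsto (fun s : ℝ => q₀ + s • p) (𝓝 0) (𝓝 q₀) := by
    have : Continuous fun s : ℝ => q₀ + s • p := by fun_prop
    simpa using this.tendsto 0
  refine hasDerivAt_of_quadratic (K := B * (K * ‖p‖) ^ 2) ?_
  filter_upwards [hcont.eventually hK] with s hs
  obtain ⟨hc, hle⟩ := hs; have hv := h₀.l2Per_weyl hL hσ; have hv' := hc.l2Per_weyl hL hσ
  have key := h₀.integral_weyl_sub hL hc hσ (f := fun x => s * f x) (fun x => by simp only [hfp x])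
    (fun a b => (hf a b).const_mul _) fun n => by
      rw [add_sub_cancel_left, coeffs_const_mul, ← hp]; exact real_smul
  rw [intervalIntegral.integral_sub (hv'.intervalIntegrable hL0 _ _) (hv.intervalIntegrable hL0 _ _)]
    at key
  have e1 : ∫ x in (-L)..L, diagGreen L q₀.1 k x * (s * f x) =
      s * ∫ x in (-L)..L, diagGreen L q₀.1 k x * f x := by
    rw [← intervalIntegral.integral_const_mul]; congr 1; ext x; ring
  rw [e1] at key; rw [zero_smul, add_zero, real_smul, ← mul_sub, key, sub_sub_cancel_left, norm_neg]
  have hle2 : l2 (perMeasure L) (fun x => weyl L (q₀ + s • p).1 k σ x - weyl L q₀.1 k σ x) ^ 2 ≤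
      (K * ‖p‖) ^ 2 * s ^ 2 := by
    rw [add_sub_cancel_left, norm_smul, norm_eq_abs] at hle
    refine (pow_le_pow_left₀ (l2_nonneg _ _) hle 2).trans (le_of_eq ?_); rw [← sq_abs s]; ring
  rw [l2_sq, ← integral_perMeasure hL0] at hle2
  refine (intervalIntegral.norm_integral_le_integral_norm (by linarith)).trans ?_
  have idd := (hv'.sub hv).integrable_mul hL0 (hv'.sub hv) (-L) L
  have hB0 : 0 ≤ B := (norm_nonneg _).trans (hB 0 ⟨by linarith, by linarith⟩)
  calc _ ≤ ∫ x in (-L)..L, B * ‖weyl L (q₀ + s • p).1 k σ x - weyl L q₀.1 k σ x‖ ^ 2 := by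
        refine integral_mono_on (by linarith)
          (idd.continuousOn_mul hgc.continuousOn).norm ?_ fun x hx => ?_
        · refine (idd.norm.const_mul B).congr (fun x _ => ?_); rw [norm_mul, sq]
        · rw [norm_mul, norm_mul, ← sq]; gcongr; exact hB x hx
    _ ≤ B * ((K * ‖p‖) ^ 2 * s ^ 2) := by
        rw [intervalIntegral.integral_const_mul]; gcongr
    _ = _ := by ring

lemma IsL2Per.memLp_ofReal {q : ℝ → ℝ} (hq : IsL2Per L q) :
    MemLp (fun x => (q x : ℂ)) 2 (perMeasure L) := hq.memLp.ofReal

lemma IsL2Per.intervalIntegrable (hL : 0 < L) {q : ℝ → ℝ} (hq : IsL2Per L q) (a b : ℝ) :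
    IntervalIntegrable (fun x => (q x : ℂ)) volume a b := by
  refine Periodic.intervalIntegrable (T := 2 * L) (fun x => by simp only [hq.periodic x])
    (by linarith) (t := -L) ?_ a b
  rw [show -L + 2 * L = L by ring]; exact MemLp.perIntegrable hL hq.memLp_ofReal

lemma IsL2Per.integrable_mul (hL : 0 < L) {f g : ℝ → ℝ} (hf : IsL2Per L f) (hg : IsL2Per L g) :
    IntervalIntegrable (fun x => f x * g x) volume (-L) L := by
  rw [intervalIntegrable_iff_integrableOn_Ioc_of_le (by linarith)]
  exact hf.memLp.integrable_mul hg.memLp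

lemma IsL2Per.hasDerivAt_integral_sq (hL : 0 < L) {q f : ℝ → ℝ} (hq : IsL2Per L q)
    (hf : IsL2Per L f) : HasDerivAt (fun s : ℝ => ∫ x in (-L)..L, (q x + s * f x) ^ 2)
    (2 * ∫ x in (-L)..L, q x * f x) 0 := by
  have e : ∀ s : ℝ, ∫ x in (-L)..L, (q x + s * f x) ^ 2 = (∫ x in (-L)..L, q x * q x) +
      (s * (2 * ∫ x in (-L)..L, q x * f x) + s ^ 2 * ∫ x in (-L)..L, f x * f x) := fun s => by
    have i1 := hq.integrable_mul hL hq; have i2 := hq.integrable_mul hL hf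
    have i3 := hf.integrable_mul hL hf
    rw [← intervalIntegral.integral_const_mul, ← intervalIntegral.integral_const_mul,
      ← intervalIntegral.integral_const_mul, ← intervalIntegral.integral_add ((i2.const_mul 2).const_mul s)
        (i3.const_mul _), ← intervalIntegral.integral_add i1 (((i2.const_mul 2).const_mul s).add
        (i3.const_mul _))]
    congr 1; ext x; ring
  simp only [e]
  have h1 := ((hasDerivAt_id (0 : ℝ)).mul_const (2 * ∫ x in (-L)..L, q x * f x)).add
    ((hasDerivAt_pow 2 (0 : ℝ)).mul_const (∫ x in (-L)..L, f x * f x))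
  exact (h1.const_add _).congr_deriv (by simp)

lemma exists_functionalDeriv (hL : 1 ≤ L) (hk0 : 0 < k.re) (hk : (k ^ 2).im ≠ 0) {q : ℝ → ℝ}
    (hq : IsL2Per L q) : ∃ G : ℝ → ℝ, IsFunctionalDeriv L (hamiltonian L k) q G ∧ hkField L k
    (rcoeffs L q) = ddx L (rcoeffs L G) := by
  have hL0 : 0 < L := by linarith
  obtain ⟨A, hA⟩ := Coercive.alpha_eq hL hk0
  obtain ⟨p₀, hp₀⟩ := exists_hs_of_memLp hL0 hq.memLp_ofReal; have hc := coercive_of_im hL hk p₀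
  have hgc := hc.continuous_diagGreen hL; set c : ℂ := -16 * k ^ 5 * A / (2 * L) with hcdef
  set G₁ : ℝ → ℝ := fun x => (16 * k ^ 5 * diagGreen L p₀.1 k x).re with hG₁
  have hG₁m : Continuous G₁ := continuous_re.comp (continuous_const.mul hgc)
  have hG₁i : Continuous fun x => (G₁ x : ℂ) := continuous_ofReal.comp hG₁m
  have hqi := hq.intervalIntegrable hL0 (-L) L
  refine ⟨fun x => (G₁ x + c.re) + (4 * k ^ 2).re * q x, ⟨⟨fun x => ?_, ?_⟩, fun f hf => ?_⟩, ?_⟩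
  · simp only [hG₁, hc.diagGreen_periodic hL x, hq.periodic x]
  · exact MemLp.add (memLp_of_continuous (hG₁i.add (continuous_const (y := ((c.re : ℝ) : ℂ))))).re
      (hq.memLp.const_mul _)
  · obtain ⟨p, hp⟩ := exists_hs_of_memLp hL0 hf.memLp_ofReal
    have hfp : Periodic (fun x => (f x : ℂ)) (2 * L) := fun x => by simp only [hf.periodic x]
    have D1 := hc.hasDerivAt_integral_weyl_line hL (σ := 1) (Or.inl rfl) hfp
      (hf.intervalIntegrable hL0) hp
    have D2 := hc.hasDerivAt_integral_weyl_line hL (σ := -1) (Or.inr rfl) hfp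
      (hf.intervalIntegrable hL0) hp
    have D3 := (hq.hasDerivAt_integral_sq hL0 hf).ofReal_comp
    have D4 : HasDerivAt (fun s : ℝ => (p₀ + s • p).1 0) (p.1 0) 0 := by
      have : HasDerivAt (fun s : ℝ => p₀.1 0 + (s : ℂ) * p.1 0) (p.1 0) 0 := by
        simpa using ((hasDerivAt_id (0 : ℝ)).ofReal_comp.mul_const (p.1 0)).const_add (p₀.1 0)
      refine this.congr_of_eventuallyEq (.of_forall fun s => ?_); change p₀.1 0 + s • p.1 0 = _
      rw [real_smul]
    have hco : ∀ s : ℝ, rcoeffs L (fun x => q x + s * f x) = (p₀ + s • p).1 := fun s => by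
      ext n; change _ = p₀.1 n + s • p.1 n
      rw [hp₀, hp, rcoeffs, rcoeffs, rcoeffs, real_smul, ← coeffs_const_mul,
        ← HkFlow.coeffs_add hqi ((hf.intervalIntegrable hL0 _ _).const_mul _)]
      simp
    have D5 := ((((((D1.add D2).const_mul (1 / 2)).const_sub (2 * L * k)).add (D4.const_mul A)).const_mul
      (-16 * k ^ 5)).add (D3.const_mul (2 * k ^ 2)))
    have D6 := (reCLM.hasFDerivAt.comp_hasDerivAt (0 : ℝ) D5)
    refine (D6.congr_of_eventuallyEq (.of_forall fun s => ?_)).congr_deriv ?_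
    · simp only [hamiltonian, Function.comp, reCLM_apply, hco]; rw [hA _ (coercive_of_im hL hk _)]
      congr 1; simp only [Pi.add_apply]; ring
    · have i1 : IntervalIntegrable (fun x => G₁ x * f x) volume (-L) L :=
        (intervalIntegrable_iff_integrableOn_Ioc_of_le (by linarith)).2
          (MemLp.integrable_mul (memLp_of_continuous hG₁i).re hf.memLp)
      have i2 : IntervalIntegrable f volume (-L) L :=
        (intervalIntegrable_iff_integrableOn_Ioc_of_le (by linarith)).2 (hf.memLp.integrable (by norm_num))
      have i3 := hq.integrable_mul hL0 hf
      have e1 : ∫ x in (-L)..L, (G₁ x + c.re + (4 * k ^ 2).re * q x) * f x =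
          (∫ x in (-L)..L, G₁ x * f x) + c.re * (∫ x in (-L)..L, f x) +
            (4 * k ^ 2).re * ∫ x in (-L)..L, q x * f x := by
        rw [← intervalIntegral.integral_const_mul, ← intervalIntegral.integral_const_mul,
          ← intervalIntegral.integral_add i1 (i2.const_mul _),
          ← intervalIntegral.integral_add (i1.add (i2.const_mul _)) (i3.const_mul _)]
        congr 1; ext x; ring
      have i4 : IntervalIntegrable (fun x => diagGreen L p₀.1 k x * f x) volume (-L) L :=
        (hf.intervalIntegrable hL0 _ _).continuousOn_mul hgc.continuousOn
      have e2 : ∫ x in (-L)..L, G₁ x * f x =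
          (16 * k ^ 5 * ∫ x in (-L)..L, diagGreen L p₀.1 k x * f x).re := by
        rw [← intervalIntegral.integral_const_mul]
        have := reCLM.intervalIntegral_comp_comm (i4.const_mul (16 * k ^ 5))
        rw [reCLM_apply] at this; rw [← this]; congr 1; ext x
        rw [reCLM_apply, ← mul_assoc, re_mul_ofReal]
      have e3 : p.1 0 = 1 / (2 * L) * ((∫ x in (-L)..L, f x : ℝ) : ℂ) := by
        rw [hp, rcoeffs, coeffs_zero_eq, intervalIntegral.integral_ofReal]
      rw [e1, e2, reCLM_apply, e3, ← re_mul_ofReal c, ← re_mul_ofReal, ← add_re, ← add_re, hcdef]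
      congr 1; push_cast; ring
  · ext n
    have e : rcoeffs L (fun x => (G₁ x + c.re) + (4 * k ^ 2).re * q x) n =
        rcoeffs L G₁ n + (if n = 0 then (c.re : ℂ) else 0) + ((4 * k ^ 2).re : ℂ) * rcoeffs L q n := by
      simp only [rcoeffs, Complex.ofReal_add, ofReal_mul]
      rw [HkFlow.coeffs_add ((hG₁i.intervalIntegrable _ _).add intervalIntegrable_const)
        (hqi.const_mul _), HkFlow.coeffs_add (hG₁i.intervalIntegrable _ _) intervalIntegrable_const,
        coeffs_const hL0, coeffs_const_mul]
    rw [hkField, ddx, ddx, e, ← hp₀]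
    rcases eq_or_ne n 0 with rfl | hn
    · rw [freq_zero]; simp
    · rw [if_neg hn, add_zero]

section

/-- Convolution of Fourier coefficients. -/
def conv (a b : ℤ → ℂ) (n : ℤ) : ℂ := ∑' m, a m * b (n - m)

lemma abs_freq (hL : 0 < L) (n : ℤ) : |freq L n| = π / L * |(n : ℝ)| := by
  rw [freq, abs_div, abs_mul, abs_of_pos pi_pos, abs_of_pos hL]; ring

lemma norm_ddx (hL : 0 < L) (c : ℤ → ℂ) (n : ℤ) : ‖ddx L c n‖ = π / L * (|(n : ℝ)| * ‖c n‖) := by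
  rw [ddx, norm_mul, norm_mul, norm_I, one_mul, norm_real, norm_eq_abs, abs_freq hL, mul_assoc]

lemma summable_inv_sq : Summable fun n : ℤ => ((1 + |(n : ℝ)|) ^ 2)⁻¹ := by
  refine (summable_weight_neg_one pi_pos).mul_left 4 |>.of_nonneg_of_le
    (fun n => by positivity) fun n => ?_
  rw [weight, rpow_neg_one, freq, mul_div_cancel_left₀ _ pi_pos.ne', inv_eq_one_div,
    ← div_eq_mul_inv, div_le_div_iff₀ (by positivity) (by positivity), ← sq_abs (n : ℝ)]
  nlinarith [abs_nonneg (n : ℝ)]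

/-- A family of sequences that are `O(|n|^(-j))`, uniformly on `A`. -/
def Decay (j : ℕ) (A : Set ι) (c : ι → ℤ → ℂ) : Prop :=
  ∃ C : ℝ, ∀ i ∈ A, ∀ n : ℤ, (1 + |(n : ℝ)|) ^ j * ‖c i n‖ ≤ C

variable {A : Set ι} {a b c : ι → ℤ → ℂ} {j : ℕ}

namespace Decay

lemma add (ha : Decay j A a) (hb : Decay j A b) : Decay j A fun i n => a i n + b i n := by
  obtain ⟨C, h⟩ := ha; obtain ⟨D, h'⟩ := hb; refine ⟨C + D, fun i hi n => ?_⟩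
  calc _ ≤ (1 + |(n : ℝ)|) ^ j * (‖a i n‖ + ‖b i n‖) := by gcongr; exact norm_add_le _ _
    _ ≤ _ := by linarith [h i hi n, h' i hi n]

lemma const_mul (r : ℂ) (ha : Decay j A a) : Decay j A fun i n => r * a i n := by
  obtain ⟨C, h⟩ := ha; refine ⟨‖r‖ * C, fun i hi n => ?_⟩; rw [norm_mul, mul_left_comm]
  exact mul_le_mul_of_nonneg_left (h i hi n) (norm_nonneg r)

lemma of_le {l : ℕ} (h : l ≤ j) (ha : Decay j A a) : Decay l A a := by
  obtain ⟨C, ha⟩ := ha; refine ⟨C, fun i hi n => le_trans ?_ (ha i hi n)⟩; gcongr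
  linarith [abs_nonneg (n : ℝ)]

lemma ddx (hL : 0 < L) (ha : Decay (j + 1) A a) : Decay j A fun i => ddx L (a i) := by
  obtain ⟨C, ha⟩ := ha; refine ⟨π / L * C, fun i hi n => ?_⟩; rw [norm_ddx hL, mul_left_comm]
  refine mul_le_mul_of_nonneg_left (le_trans ?_ (ha i hi n)) (by positivity)
  rw [pow_succ, mul_assoc]; gcongr; linarith

lemma of_ddx (hL : 0 < L) (ha : Decay j A fun i => HkFlow.ddx L (a i))
    (h0 : ∃ C, ∀ i ∈ A, ‖a i 0‖ ≤ C) : Decay (j + 1) A a := by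
  obtain ⟨C, ha⟩ := ha; obtain ⟨D, h0⟩ := h0; refine ⟨2 * L / π * |C| + |D|, fun i hi n => ?_⟩
  rcases eq_or_ne n 0 with rfl | hn
  · have : 0 ≤ 2 * L / π * |C| := by positivity
    simpa using (h0 i hi).trans (by linarith [le_abs_self D])
  · have h1 : (1 : ℝ) ≤ |(n : ℝ)| := by exact_mod_cast Int.one_le_abs hn
    have h2 := ha i hi n; rw [norm_ddx hL, mul_left_comm, div_mul_eq_mul_div, div_le_iff₀ hL] at h2
    have h3 : (1 + |(n : ℝ)|) ^ (j + 1) * ‖a i n‖ ≤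
        2 * ((1 + |(n : ℝ)|) ^ j * (|(n : ℝ)| * ‖a i n‖)) := by
      have : 0 ≤ (1 + |(n : ℝ)|) ^ j * ‖a i n‖ := by positivity
      rw [pow_succ]; nlinarith
    have h4 : 2 * ((1 + |(n : ℝ)|) ^ j * (|(n : ℝ)| * ‖a i n‖)) ≤ 2 * L / π * |C| := by
      rw [div_mul_eq_mul_div, le_div_iff₀ pi_pos]; nlinarith [le_abs_self C]
    linarith [abs_nonneg D]

lemma bound (ha : Decay j A a) : ∃ C, 0 ≤ C ∧ ∀ i ∈ A, ∀ n : ℤ, ‖a i n‖ ≤ C *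
    ((1 + |(n : ℝ)|) ^ j)⁻¹ := by
  obtain ⟨C, h⟩ := ha; refine ⟨|C|, abs_nonneg C, fun i hi n => ?_⟩
  rw [← div_eq_mul_inv, le_div_iff₀' (by positivity)]; exact (h i hi n).trans (le_abs_self C)

lemma conv (hj : 1 ≤ j) (ha : Decay j A a) (hb : Decay (j + 1) A b) : Decay j A fun i => conv (a i)
    (b i) := by
  obtain ⟨C, hC, h⟩ := ha.bound; obtain ⟨D, hD, h'⟩ := hb.bound; have hs := summable_inv_sq
  have hs' : ∀ n : ℤ, Summable fun m : ℤ => ((1 + |((n - m : ℤ) : ℝ)|) ^ 2)⁻¹ := fun n =>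
    (Equiv.subLeft n).summable_iff.2 hs
  refine ⟨2 ^ j * C * D * (3 * ∑' m : ℤ, ((1 + |(m : ℝ)|) ^ 2)⁻¹), fun i hi n => ?_⟩
  have key : ∀ m : ℤ, (1 + |(n : ℝ)|) ^ j * ‖a i m * b i (n - m)‖ ≤ 2 ^ j * C * D *
      (((1 + |(m : ℝ)|) ^ 2)⁻¹ + 2 * ((1 + |((n - m : ℤ) : ℝ)|) ^ 2)⁻¹) := fun m => by
    have h0 : 1 + |(n : ℝ)| ≤ (1 + |(m : ℝ)|) + (1 + |((n - m : ℤ) : ℝ)|) := by grind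
    have h1 := h i hi m; have h2 := h' i hi (n - m)
    have hx : (1 : ℝ) ≤ 1 + |(m : ℝ)| := by linarith [abs_nonneg (m : ℝ)]
    have hy : (1 : ℝ) ≤ 1 + |((n - m : ℤ) : ℝ)| := by linarith [abs_nonneg ((n - m : ℤ) : ℝ)]
    generalize 1 + |(m : ℝ)| = x at *
    generalize 1 + |((n - m : ℤ) : ℝ)| = y at *
    have hx0 : 0 < x := by linarith
    have hy0 : 0 < y := by linarith
    calc _ ≤ (2 ^ j * (x ^ j + y ^ j)) * ((C * (x ^ j)⁻¹) * (D * (y ^ (j + 1))⁻¹)) := by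
          rw [norm_mul]; gcongr
          refine (pow_le_pow_left₀ (by positivity) h0 j).trans
            ((add_pow_le hx0.le hy0.le j).trans ?_)
          gcongr
          · norm_num
          · omega
      _ = 2 ^ j * C * D * ((y ^ (j + 1))⁻¹ + (x ^ j)⁻¹ * y⁻¹) := by
          rw [pow_succ]; field_simp
      _ ≤ 2 ^ j * C * D * ((x ^ 2)⁻¹ + 2 * (y ^ 2)⁻¹) := by
          have e1 : (y ^ (j + 1))⁻¹ ≤ (y ^ 2)⁻¹ :=
            inv_anti₀ (by positivity) (pow_le_pow_right₀ hy (by omega))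
          have e2 : (x ^ j)⁻¹ * y⁻¹ ≤ x⁻¹ * y⁻¹ := mul_le_mul_of_nonneg_right
            (inv_anti₀ hx0 (le_self_pow₀ hx (by omega))) (by positivity)
          refine mul_le_mul_of_nonneg_left ?_ (by positivity)
          have e3 : x⁻¹ * y⁻¹ ≤ (x ^ 2)⁻¹ + (y ^ 2)⁻¹ := by
            rw [← inv_pow, ← inv_pow]; nlinarith
          linarith
  have hs2 := (hs.add ((hs' n).mul_left 2)).mul_left (2 ^ j * C * D)
  have hs3 : Summable fun m => ‖a i m * b i (n - m)‖ := hs2.of_nonneg_of_le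
    (fun m => norm_nonneg _) fun m => le_trans (le_mul_of_one_le_left (norm_nonneg _)
      (one_le_pow₀ (by linarith [abs_nonneg (n : ℝ)]))) (key m)
  calc _ ≤ (1 + |(n : ℝ)|) ^ j * ∑' m, ‖a i m * b i (n - m)‖ := by
        gcongr; exact norm_tsum_le_tsum_norm hs3
    _ ≤ ∑' m : ℤ, 2 ^ j * C * D *
        (((1 + |(m : ℝ)|) ^ 2)⁻¹ + 2 * ((1 + |((n - m : ℤ) : ℝ)|) ^ 2)⁻¹) := by
        rw [← tsum_mul_left]; exact (hs3.mul_left _).tsum_le_tsum key hs2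
    _ = _ := by
        rw [tsum_mul_left, hs.tsum_add ((hs' n).mul_left 2), tsum_mul_left,
          show ∑' m : ℤ, ((1 + |((n - m : ℤ) : ℝ)|) ^ 2)⁻¹ = _ from
            (Equiv.subLeft n).tsum_eq fun m : ℤ => ((1 + |(m : ℝ)|) ^ 2)⁻¹]
        ring

end Decay

/-- A family of sequences that decay rapidly, uniformly on `A`. -/
def RapidOn (A : Set ι) (c : ι → ℤ → ℂ) : Prop := ∀ j : ℕ, Decay j A c

lemma RapidOn.conv (ha : RapidOn A a) (hb : RapidOn A b) : RapidOn A fun i => conv (a i) (b i) :=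
  fun j => ((ha (j + 1)).conv (by omega) (hb (j + 2))).of_le (by omega)

/-- A continuous curve of rapidly decaying sequences. -/
structure RapidCurve (c : ℝ → ℤ → ℂ) : Prop where
  cont : ∀ n, Continuous fun t => c t n
  rapid : ∀ T : ℝ, RapidOn (Icc (-T) T) c

namespace RapidCurve
variable {a b c a' b' : ℝ → ℤ → ℂ}

lemma add (ha : RapidCurve a) (hb : RapidCurve b) : RapidCurve fun t n => a t n + b t n :=
  ⟨fun n => (ha.cont n).add (hb.cont n), fun T j => (ha.rapid T j).add (hb.rapid T j)⟩

lemma const_mul (r : ℂ) (ha : RapidCurve a) : RapidCurve fun t n => r * a t n :=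
  ⟨fun n => continuous_const.mul (ha.cont n), fun T j => (ha.rapid T j).const_mul r⟩

lemma ddx (hL : 0 < L) (ha : RapidCurve a) : RapidCurve fun t => ddx L (a t) :=
  ⟨fun n => continuous_const.mul (ha.cont n), fun T j => (ha.rapid T (j + 1)).ddx hL⟩

lemma abs_lt_mem (h : t ∈ Ioo (-T) T) : t ∈ Icc (-T) T := Ioo_subset_Icc_self h

lemma mem_Ioo (t : ℝ) : t ∈ Ioo (-(|t| + 1)) (|t| + 1) := abs_lt.1 (by linarith)

lemma exists_conv_bound {A : Set ℝ} (ha : RapidOn A a) (hb : RapidOn A b) : ∃ u : ℤ → ℝ, Summable u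
    ∧ ∀ t ∈ A, ∀ n m, ‖a t m * b t (n - m)‖ ≤ u m := by
  obtain ⟨C, hC, h⟩ := (ha 2).bound; obtain ⟨D, hD, h'⟩ := (hb 0).bound
  refine ⟨_, (summable_inv_sq.mul_left C).mul_right D, fun t ht n m => ?_⟩; rw [norm_mul]; gcongr
  · exact h t ht m
  · simpa using h' t ht (n - m)

lemma continuous_conv (ha : RapidCurve a) (hb : RapidCurve b) (n : ℤ) : Continuous fun t => conv
    (a t) (b t) n := by
  rw [continuous_iff_continuousAt]; intro t
  obtain ⟨u, hu, h⟩ := exists_conv_bound (ha.rapid (|t| + 1)) (hb.rapid (|t| + 1))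
  exact (continuousOn_tsum (s := Ioo (-(|t| + 1)) (|t| + 1))
    (fun m => ((ha.cont m).mul (hb.cont (n - m))).continuousOn) hu
    fun m s hs => h s (abs_lt_mem hs) n m).continuousAt (isOpen_Ioo.mem_nhds (mem_Ioo t))

lemma conv (ha : RapidCurve a) (hb : RapidCurve b) : RapidCurve fun t => conv (a t) (b t) :=
  ⟨ha.continuous_conv hb, fun T => (ha.rapid T).conv (hb.rapid T)⟩

lemma hasDerivAt_conv (ha : RapidCurve a) (hb : RapidCurve b) (ha' : RapidCurve a')
    (hb' : RapidCurve b') (da : ∀ n t, HasDerivAt (fun t => a t n) (a' t n) t)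
    (db : ∀ n t, HasDerivAt (fun t => b t n) (b' t n) t) (n : ℤ) (t : ℝ) : HasDerivAt
    (fun t => HkFlow.conv (a t) (b t) n) (HkFlow.conv (a' t) (b t) n + HkFlow.conv (a t) (b' t) n)
    t := by
  obtain ⟨u, hu, h⟩ := exists_conv_bound (ha'.rapid (|t| + 1)) (hb.rapid (|t| + 1))
  obtain ⟨v, hv, h'⟩ := exists_conv_bound (ha.rapid (|t| + 1)) (hb'.rapid (|t| + 1))
  obtain ⟨w, hw, h''⟩ := exists_conv_bound (ha.rapid (|t| + 1)) (hb.rapid (|t| + 1))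
  have ht := mem_Ioo t
  have e : HkFlow.conv (a' t) (b t) n + HkFlow.conv (a t) (b' t) n =
      ∑' m, (a' t m * b t (n - m) + a t m * b' t (n - m)) :=
    ((Summable.of_norm_bounded hu fun m => h t (abs_lt_mem ht) n m).tsum_add
      (Summable.of_norm_bounded hv fun m => h' t (abs_lt_mem ht) n m)).symm
  rw [e]
  exact hasDerivAt_tsum_of_isPreconnected (hu.add hv) isOpen_Ioo isPreconnected_Ioo
    (fun m s _ => (da m s).mul (db (n - m) s)) (fun m s hs => (norm_add_le _ _).trans
      (add_le_add (h s (abs_lt_mem hs) n m) (h' s (abs_lt_mem hs) n m))) ht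
    (Summable.of_norm_bounded hw fun m => h'' t (abs_lt_mem ht) n m) ht

end RapidCurve

/-- The right-hand side `-q''' + 6 q q'` of KdV. -/
def kdvField (L : ℝ) (c : ℤ → ℂ) (n : ℤ) : ℂ :=
  ddx L (fun n => -1 * ddx L (ddx L c) n + 3 * conv c c n) n

/-- The derivative of the right-hand side of KdV. -/
def kdvLin (L : ℝ) (c d : ℤ → ℂ) (n : ℤ) : ℂ :=
  ddx L (fun n => -1 * ddx L (ddx L d) n + 3 * (conv d c n + conv c d n)) n

lemma RapidCurve.kdvField (hL : 0 < L) {a : ℝ → ℤ → ℂ} (ha : RapidCurve a) : RapidCurve fun t =>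
    kdvField L (a t) :=
  ((((ha.ddx hL).ddx hL).const_mul (-1)).add ((ha.conv ha).const_mul 3)).ddx hL

lemma RapidCurve.kdvLin (hL : 0 < L) {a b : ℝ → ℤ → ℂ} (ha : RapidCurve a) (hb : RapidCurve b) :
    RapidCurve fun t => kdvLin L (a t) (b t) :=
  ((((hb.ddx hL).ddx hL).const_mul (-1)).add (((hb.conv ha).add (ha.conv hb)).const_mul 3)).ddx hL

lemma RapidCurve.hasDerivAt_kdvField {a a' : ℝ → ℤ → ℂ} (ha : RapidCurve a) (ha' : RapidCurve a')
    (da : ∀ n t, HasDerivAt (fun t => a t n) (a' t n) t) (n : ℤ) (t : ℝ) : HasDerivAt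
    (fun t => HkFlow.kdvField L (a t) n) (HkFlow.kdvLin L (a t) (a' t) n) t :=
  ((((((da n t).const_mul _).const_mul _).const_mul (-1)).add
    ((ha.hasDerivAt_conv ha ha' ha' da da n t).const_mul 3)).const_mul _)

/-- Curves that are `m` times differentiable with rapidly decaying derivatives. -/
def SmoothCurve : ℕ → (ℝ → ℤ → ℂ) → Prop
  | 0, c => RapidCurve c
  | m + 1, c => RapidCurve c ∧ ∃ c', (∀ n t, HasDerivAt (fun t => c t n) (c' t n) t) ∧ SmoothCurve m c'

namespace SmoothCurve
variable {a b c : ℝ → ℤ → ℂ} {m : ℕ}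

lemma rapid (h : SmoothCurve m c) : RapidCurve c := by
  cases m with
  | zero => exact h
  | succ m => exact h.1

lemma pred (h : SmoothCurve (m + 1) c) : SmoothCurve m c := by
  induction m generalizing c with
  | zero => exact h.1
  | succ m ih => exact ⟨h.1, h.2.imp fun c' hc => ⟨hc.1, ih hc.2⟩⟩

lemma add (ha : SmoothCurve m a) (hb : SmoothCurve m b) : SmoothCurve m fun t n => a t n + b t n := by
  induction m generalizing a b with
  | zero => exact RapidCurve.add ha hb
  | succ m ih =>
    obtain ⟨ha, a', da, sa⟩ := ha; obtain ⟨hb, b', db, sb⟩ := hb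
    exact ⟨ha.add hb, _, fun n t => (da n t).add (db n t), ih sa sb⟩

lemma const_mul (r : ℂ) (ha : SmoothCurve m a) : SmoothCurve m fun t n => r * a t n := by
  induction m generalizing a with
  | zero => exact RapidCurve.const_mul r ha
  | succ m ih =>
    obtain ⟨ha, a', da, sa⟩ := ha; exact ⟨ha.const_mul r, _, fun n t => (da n t).const_mul r, ih sa⟩

lemma ddx (hL : 0 < L) (ha : SmoothCurve m a) : SmoothCurve m fun t => ddx L (a t) := by
  induction m generalizing a with
  | zero => exact RapidCurve.ddx hL ha
  | succ m ih =>
    obtain ⟨ha, a', da, sa⟩ := ha; exact ⟨ha.ddx hL, _, fun n t => (da n t).const_mul _, ih sa⟩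

lemma conv (ha : SmoothCurve m a) (hb : SmoothCurve m b) : SmoothCurve m fun t => conv (a t) (b t) := by
  induction m generalizing a b with
  | zero => exact RapidCurve.conv ha hb
  | succ m ih =>
    have ha1 := ha.pred; have hb1 := hb.pred; obtain ⟨ha, a', da, sa⟩ := ha
    obtain ⟨hb, b', db, sb⟩ := hb
    exact ⟨ha.conv hb, _, fun n t => ha.hasDerivAt_conv hb sa.rapid sb.rapid da db n t,
      (ih sa hb1).add (ih ha1 sb)⟩

end SmoothCurve

lemma RapidCurve.smoothCurve (hL : 0 < L) {c : ℝ → ℤ → ℂ} (hc : RapidCurve c) (hd : ∀ n t,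
    HasDerivAt (fun t => c t n) (HkFlow.kdvField L (c t) n) t) (m : ℕ) : SmoothCurve m c := by
  induction m with
  | zero => exact hc
  | succ m ih =>
    exact ⟨hc, _, hd, (((((ih.ddx hL).ddx hL).const_mul (-1)).add ((ih.conv ih).const_mul 3)).ddx hL)⟩

end

section

/-- The function with given Fourier coefficients. -/
def synth (L : ℝ) (c : ℤ → ℂ) (x : ℝ) : ℂ := ∑' n, c n * expi L n x

lemma coeffs_expi_mul (L : ℝ) (f : ℝ → ℂ) (m n : ℤ) : coeffs L (fun x => expi L m x * f x) n =
    coeffs L f (n - m) := by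
  rw [coeffs_eq, coeffs_eq]; congr 2 with x; rw [← mul_assoc, ← expi_add]
  congr 2; ring

lemma hasSum_coeffs_mul (hL : 0 < L) {h : ℝ → ℂ} (hf : L2Per L f) (hh : L2Per L h) (n : ℤ) : HasSum
    (fun m => coeffs L f m * coeffs L h (n - m)) (coeffs L (fun x => f x * h x) n) := by
  have e : ∀ s : Finset ℤ, ∑ m ∈ s, coeffs L f m * coeffs L h (n - m) =
      coeffs L (fun x => trigSum L (coeffs L f) s x * h x) n := fun s => by
    rw [coeffs_eq]
    simp_rw [← coeffs_expi_mul, trigSum, Finset.sum_mul, Finset.mul_sum]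
    rw [intervalIntegral.integral_finsetSum, Finset.mul_sum]
    · refine Finset.sum_congr rfl fun m _ => ?_
      rw [coeffs_eq L (fun x => expi L m x * h x), mul_left_comm, ← intervalIntegral.integral_const_mul]
      congr 2 with x; ring
    · intro m _
      simp_rw [mul_assoc]
      exact intervalIntegrable_expi_mul ((intervalIntegrable_expi_mul
        (hh.intervalIntegrable hL _ _) m).const_mul _) _
  unfold HasSum
  simp_rw [e]
  rw [tendsto_iff_norm_sub_tendsto_zero]
  refine squeeze_zero (fun _ => norm_nonneg _) (fun s => ?_)
    (show Tendsto (fun s => (2 * L)⁻¹ * (l2 (perMeasure L)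
      (fun x => f x - trigSum L (coeffs L f) s x) * l2 (perMeasure L) h)) atTop (𝓝 0) by
      simpa using! ((tendsto_trigSum hL hf).mul_const (l2 (perMeasure L) h)).const_mul (2 * L)⁻¹)
  have hd := L2Per.sub hf (l2Per_trigSum hL (coeffs L f) s)
  rw [norm_sub_rev, ← coeffs_sub (hf.integrable_mul hL hh _ _)
    ((l2Per_trigSum hL _ s).integrable_mul hL hh _ _)]
  refine (norm_coeffs_le hL _ n).trans ?_; gcongr; rw [integral_perMeasure hL]
  simp_rw [← sub_mul, norm_mul]
  exact integral_norm_mul_norm_le hd.memLp hh.memLp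

lemma coeffs_mul (hL : 0 < L) {h : ℝ → ℂ} (hf : L2Per L f) (hh : L2Per L h) : coeffs L
    (fun x => f x * h x) = conv (coeffs L f) (coeffs L h) :=
  funext fun n => (hasSum_coeffs_mul hL hf hh n).tsum_eq.symm

lemma eq_of_coeffs_eq (hL : 0 < L) {h : ℝ → ℂ} (hf : Continuous f) (hh : Continuous h)
    (pf : Periodic f (2 * L)) (ph : Periodic h (2 * L)) (e : coeffs L f = coeffs L h) : f = h :=
  (hf.ae_eq_iff_eq volume hh).1 (ae_of_ae_perMeasure hL (fun x => by rw [pf x, ph x])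
    (ae_eq_of_coeffs_eq hL (memLp_of_continuous hf) (memLp_of_continuous hh) e))

section synth
variable {c : ℤ → ℂ}

lemma norm_mul_expi (c : ℤ → ℂ) (n : ℤ) (x : ℝ) : ‖c n * expi L n x‖ = ‖c n‖ := by
  rw [norm_mul, norm_expi, mul_one]

lemma periodic_synth (hL : 0 < L) (c : ℤ → ℂ) : Periodic (synth L c) (2 * L) := fun x =>
  tsum_congr fun n => by rw [expi_periodic hL n x]

lemma continuous_synth (hc : Summable fun n => ‖c n‖) : Continuous (synth L c) :=
  continuous_tsum (fun n => continuous_const.mul (continuous_expi L n)) hc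
    fun n x => (norm_mul_expi c n x).le

lemma coeffs_synth (hL : 0 < L) (hc : Summable fun n => ‖c n‖) : coeffs L (synth L c) = c := by
  ext n
  have h := hasSum_integral_of_summable_integral_norm (μ := perMeasure L)
    (F := fun m x => expi L (-n) x * (c m * expi L m x))
    (fun m => integrable_expi_mul L _ (((memLp_of_continuous (continuous_expi L m)).integrable
      (by norm_num)).const_mul _)) (by
      simp_rw [norm_mul, norm_expi, one_mul, mul_one]
      simpa using hc.mul_left _)
  have e : ∀ m, ∫ x, expi L (-n) x * (c m * expi L m x) ∂(perMeasure L) =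
      if m = n then 2 * L * c n else 0 := fun m => by
    have h1 := coeffs_const_mul (L := L) (c m) (expi L m) n
    rw [coeffs_expi hL, coeffs_eq, integral_perMeasure hL, one_div_mul_eq_div,
      div_eq_iff (by exact_mod_cast (mul_pos two_pos hL).ne')] at h1
    grind
  simp_rw [e, tsum_mul_left] at h
  rw [coeffs_eq, integral_perMeasure hL]
  refine (congrArg _ (h.unique (hasSum_ite_eq n _))).trans ?_
  have : (L : ℂ) ≠ 0 := by exact_mod_cast hL.ne'
  field_simp

lemma hasDerivAt_synth (hc : Summable fun n => ‖c n‖) (hd : Summable fun n => ‖ddx L c n‖) (x : ℝ) :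
    HasDerivAt (synth L c) (synth L (ddx L c) x) x :=
  hasDerivAt_tsum hd (fun n y => (((hasDerivAt_expi L n y).const_mul (c n)).congr_deriv
    (by rw [ddx]; ring)))
    (fun n y => (norm_mul_expi (ddx L c) n y).le) (y₀ := 0)
    (Summable.of_norm_bounded hc fun n => (norm_mul_expi c n 0).le) x

lemma conj_synth (h : ∀ n, c (-n) = conj (c n)) (x : ℝ) : conj (synth L c x) = synth L c x := by
  rw [synth, conj_tsum, ← (Equiv.neg ℤ).tsum_eq]; refine tsum_congr fun n => ?_; simp [h, conj_expi]

end synth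

lemma RapidOn.summable {A : Set ι} {c : ι → ℤ → ℂ} (h : RapidOn A c) {i : ι} (hi : i ∈ A) : Summable
    fun n => ‖c i n‖ := by
  obtain ⟨C, -, hC⟩ := (h 2).bound
  exact (summable_inv_sq.mul_left C).of_nonneg_of_le (fun _ => norm_nonneg _) (hC i hi)

section curve
variable {c : ℝ → ℤ → ℂ}

lemma RapidCurve.summable (h : RapidCurve c) (t : ℝ) : Summable fun n => ‖c t n‖ :=
  (h.rapid |t|).summable ⟨neg_abs_le t, le_abs_self t⟩

lemma RapidCurve.continuous_synth (h : RapidCurve c) : Continuous fun p : ℝ × ℝ => synth L (c p.1)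
    p.2 := by
  rw [continuous_iff_continuousAt]; intro p; obtain ⟨C, -, hC⟩ := (h.rapid (|p.1| + 1) 2).bound
  refine (continuousOn_tsum (s := {r : ℝ × ℝ | |r.1| < |p.1| + 1})
    (fun n => (((h.cont n).comp continuous_fst).mul
      ((continuous_expi L n).comp continuous_snd)).continuousOn)
    (summable_inv_sq.mul_left C) fun n r hr => ?_).continuousAt
    ((isOpen_lt (by fun_prop) (by fun_prop)).mem_nhds (by simp))
  exact (norm_mul_expi _ _ _).trans_le (hC r.1 (abs_le.1 hr.le) n)

lemma RapidCurve.hasDerivAt_synth {c' : ℝ → ℤ → ℂ} (h : RapidCurve c) (h' : RapidCurve c')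
    (hd : ∀ n t, HasDerivAt (fun t => c t n) (c' t n) t) (t x : ℝ) : HasDerivAt
    (fun t => synth L (c t) x) (synth L (c' t) x) t := by
  obtain ⟨C, -, hC⟩ := (h'.rapid (|t| + 1) 2).bound
  exact hasDerivAt_tsum_of_isPreconnected (summable_inv_sq.mul_left C) isOpen_Ioo
    isPreconnected_Ioo (fun n s _ => (hd n s).mul_const _)
    (fun n s hs => (norm_mul_expi _ _ _).trans_le (hC s (RapidCurve.abs_lt_mem hs) n))
    (RapidCurve.mem_Ioo t)
    (Summable.of_norm_bounded (h.summable t) fun n => (norm_mul_expi _ n x).le) (RapidCurve.mem_Ioo t)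

lemma SmoothCurve.contDiff (hL : 0 < L) {m : ℕ} (h : SmoothCurve m c) : ContDiff ℝ m
    (fun p : ℝ × ℝ => synth L (c p.1) p.2) := by
  induction m generalizing c with
  | zero => exact contDiff_zero.2 (RapidCurve.continuous_synth h)
  | succ m ih =>
    have h1 := h.pred.ddx hL; obtain ⟨hr, c', hd, hs⟩ := h
    refine contDiff_succ_iff_hasFDerivAt.2 ⟨fun p =>
      (ContinuousLinearMap.toSpanSingleton ℝ (synth L (c' p.1) p.2)).coprod
      (ContinuousLinearMap.toSpanSingleton ℝ (synth L (HkFlow.ddx L (c p.1)) p.2)), ?_, fun p => ?_⟩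
    · have e : (fun p : ℝ × ℝ => (ContinuousLinearMap.toSpanSingleton ℝ (synth L (c' p.1) p.2)).coprod
          (ContinuousLinearMap.toSpanSingleton ℝ (synth L (HkFlow.ddx L (c p.1)) p.2))) = fun p =>
          (ContinuousLinearMap.fst ℝ ℝ ℝ).smulRight (synth L (c' p.1) p.2) +
          (ContinuousLinearMap.snd ℝ ℝ ℝ).smulRight (synth L (HkFlow.ddx L (c p.1)) p.2) := by
        ext p <;> simp
      rw [e]; exact (contDiff_const.smulRight (ih hs)).add (contDiff_const.smulRight (ih h1))
    · refine (hasStrictFDerivAt_uncurry_coprod (f := fun t x => synth L (c t) x)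
        (f₁ := fun t x => ContinuousLinearMap.toSpanSingleton ℝ (synth L (c' t) x))
        (f₂ := fun t x => ContinuousLinearMap.toSpanSingleton ℝ (synth L (HkFlow.ddx L (c t)) x))
        (.of_forall fun v => ?_) (.of_forall fun v => ?_) ?_ ?_).hasFDerivAt
      · exact (hr.hasDerivAt_synth hs.rapid hd v.1 v.2).hasFDerivAt
      · exact (HkFlow.hasDerivAt_synth (hr.summable v.1) ((hr.ddx hL).summable v.1) v.2).hasFDerivAt
      · exact ((ContinuousLinearMap.toSpanSingletonCLE (𝕜 := ℝ) (E := ℂ)).continuous.comp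
          hs.rapid.continuous_synth).continuousAt
      · exact ((ContinuousLinearMap.toSpanSingletonCLE (𝕜 := ℝ) (E := ℂ)).continuous.comp
          h1.rapid.continuous_synth).continuousAt

end curve

/-- A curve of rapidly decaying sequences that solves KdV. -/
structure RapidKdV (L : ℝ) (c : ℝ → ℤ → ℂ) : Prop extends RapidCurve c where
  hasDerivAt : ∀ n t, HasDerivAt (fun t => c t n) (kdvField L (c t) n) t

lemma RapidKdV.exists_smooth (hL : 0 < L) {c : ℝ → ℤ → ℂ} (h : RapidKdV L c)
    (hc : ∀ t n, c t (-n) = conj (c t n)) : ∃ v : ℝ → ℝ → ℝ, ContDiff ℝ ∞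
    (fun p : ℝ × ℝ => v p.1 p.2) ∧ (∀ t, Periodic (v t) (2 * L)) ∧ (∀ t x, deriv (fun τ => v τ x) t
    = -iteratedDeriv 3 (v t) x + 6 * v t x * deriv (v t) x) ∧ ∀ t, c t = rcoeffs L (v t) := by
  have hr := h.toRapidCurve
  have re : ∀ {f : ℝ → ℂ} {f' : ℂ} {x : ℝ}, HasDerivAt f f' x →
      HasDerivAt (fun x => (f x).re) f'.re x := fun h =>
    reCLM.hasFDerivAt.comp_hasDerivAt _ h
  have dx : ∀ {d : ℝ → ℤ → ℂ}, RapidCurve d → ∀ t x,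
      HasDerivAt (synth L (d t)) (synth L (ddx L (d t)) x) x := fun hd t x =>
    HkFlow.hasDerivAt_synth (hd.summable t) ((hd.ddx hL).summable t) x
  have e : ∀ t x, ((synth L (c t) x).re : ℂ) = synth L (c t) x := fun t x =>
    conj_eq_iff_re.1 (conj_synth (hc t) x)
  refine ⟨fun t x => (synth L (c t) x).re, reCLM.contDiff.comp (contDiff_infty.2 fun m =>
    (hr.smoothCurve hL h.hasDerivAt m).contDiff hL), fun t x => ?_, fun t x => ?_, fun t => ?_⟩
  · simp only [periodic_synth hL _ x]
  · have h1 := hr.ddx hL; have h2 := h1.ddx hL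
    rw [(re (hr.hasDerivAt_synth (hr.kdvField hL) h.hasDerivAt t x)).deriv, iteratedDeriv_succ,
      iteratedDeriv_succ, iteratedDeriv_one, funext fun x => (re (dx hr t x)).deriv,
      funext fun x => (re (dx h1 t x)).deriv, (re (dx h2 t x)).deriv]
    have ps : ∀ {d : ℝ → ℤ → ℂ}, RapidCurve d → L2Per L (synth L (d t)) := fun hd =>
      l2Per_of_continuous (continuous_synth (hd.summable t)) (periodic_synth hL _)
    have h3 := (h2.const_mul (-1)).add ((hr.conv hr).const_mul 3)
    have ec : synth L (fun n => -1 * ddx L (ddx L (c t)) n + 3 * conv (c t) (c t) n) =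
        fun x => -1 * synth L (ddx L (ddx L (c t))) x + 3 * (synth L (c t) x * synth L (c t) x) := by
      have c1 : Continuous (synth L (c t)) := continuous_synth (hr.summable t)
      have c2 : Continuous (synth L (ddx L (ddx L (c t)))) := continuous_synth (h2.summable t)
      refine eq_of_coeffs_eq hL (continuous_synth (h3.summable t)) (by fun_prop)
        (periodic_synth hL _) (fun x => by simp only [periodic_synth hL _ x]) ?_
      ext n
      rw [coeffs_synth hL (h3.summable t), coeffs_add ((by fun_prop : Continuous fun x => -1 * synth L (ddx L (ddx L (c t))) x).intervalIntegrable _ _)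
        ((by fun_prop : Continuous fun x => 3 * (synth L (c t) x * synth L (c t) x)).intervalIntegrable _ _), coeffs_const_mul, coeffs_const_mul,
        coeffs_mul hL (ps hr) (ps hr), coeffs_synth hL (hr.summable t),
        coeffs_synth hL (h2.summable t)]
    have d1 := dx h3 t x; rw [ec] at d1
    have d2 := d1.unique (((dx h2 t x).const_mul (-1)).add
      (((dx hr t x).mul (dx hr t x)).const_mul 3))
    refine (congrArg Complex.re d2).trans ?_
    have e' : ∀ x, synth L (ddx L (c t)) x = ((synth L (ddx L (c t)) x).re : ℂ) := fun x =>
      (conj_eq_iff_re.1 (conj_synth (ddx_conj (hc t)) x)).symm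
    rw [← e t x, e' x]; simp; ring
  · rw [rcoeffs]
    simp_rw [e]
    exact (coeffs_synth hL (hr.summable t)).symm

lemma RapidKdV.isSmoothKdV (hL : 0 < L) {u : ℝ → Hs L (-1)} (h : RapidKdV L fun t => (u t).1) :
    IsSmoothKdV L u := h.exists_smooth hL fun t => (u t).conj_coeff

end

section

section smooth
variable {V : ℝ → ℝ → ℝ}

lemma hasDerivAt_snd (hV : ContDiff ℝ ∞ fun p : ℝ × ℝ => V p.1 p.2) (t x : ℝ) : HasDerivAt (V t)
    (fderiv ℝ (fun p : ℝ × ℝ => V p.1 p.2) (t, x) (0, 1)) x :=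
  (hV.differentiable (by simp) (t, x)).hasFDerivAt.comp_hasDerivAt x
    ((hasDerivAt_const x t).prodMk (hasDerivAt_id x))

lemma hasDerivAt_fst (hV : ContDiff ℝ ∞ fun p : ℝ × ℝ => V p.1 p.2) (t x : ℝ) : HasDerivAt
    (fun τ => V τ x) (fderiv ℝ (fun p : ℝ × ℝ => V p.1 p.2) (t, x) (1, 0)) t :=
  (hV.differentiable (by simp) (t, x)).hasFDerivAt.comp_hasDerivAt (f := fun τ => (τ, x)) t
    ((hasDerivAt_id t).prodMk (hasDerivAt_const t x))

lemma contDiff_deriv_snd (hV : ContDiff ℝ ∞ fun p : ℝ × ℝ => V p.1 p.2) : ContDiff ℝ ∞ fun p : ℝ × ℝ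
    => deriv (V p.1) p.2 := by
  simp_rw [fun p : ℝ × ℝ => (hasDerivAt_snd hV p.1 p.2).deriv]
  fun_prop

lemma contDiff_deriv_fst (hV : ContDiff ℝ ∞ fun p : ℝ × ℝ => V p.1 p.2) : ContDiff ℝ ∞ fun p : ℝ × ℝ
    => deriv (fun τ => V τ p.2) p.1 := by
  simp_rw [fun p : ℝ × ℝ => (hasDerivAt_fst hV p.1 p.2).deriv]
  fun_prop

lemma periodic_deriv {f : ℝ → ℝ} (h : Periodic f T) :
    Periodic (deriv f) T := fun x => by rw [← deriv_comp_add_const, funext h]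

lemma continuous_slice (hV : ContDiff ℝ ∞ fun p : ℝ × ℝ => V p.1 p.2) (t : ℝ) :
    Continuous (V t) := hV.continuous.comp (by fun_prop : Continuous fun x : ℝ => (t, x))

lemma rcoeffs_deriv (hV : ContDiff ℝ ∞ fun p : ℝ × ℝ => V p.1 p.2)
    (hp : ∀ t, Periodic (V t) (2 * L)) (t : ℝ) : rcoeffs L (deriv (V t)) = ddx L
    (rcoeffs L (V t)) :=
  coeffs_deriv_of_periodic (IsPrim.of_hasDerivAt (fun x => by
    have h := hasDerivAt_snd hV t x; rw [← h.deriv] at h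
    exact h.ofReal_comp)
    (continuous_ofReal.comp
      (continuous_slice (V := fun t => deriv (V t)) (contDiff_deriv_snd hV) t)))
    fun x => by rw [hp t x]

lemma exists_slice_bound (hV : ContDiff ℝ ∞ fun p : ℝ × ℝ => V p.1 p.2) (a b L : ℝ) : ∃ C, 0 ≤ C ∧ ∀
    t ∈ Icc a b, ∀ x ∈ Icc (-L) L, |V t x| ≤ C := by
  obtain ⟨C, hC⟩ := (isCompact_Icc.prod isCompact_Icc : IsCompact (Icc a b ×ˢ Icc (-L) L))
    |>.exists_bound_of_continuousOn hV.continuous.continuousOn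
  exact ⟨|C|, abs_nonneg C, fun t ht x hx => (hC (t, x) ⟨ht, hx⟩).trans (le_abs_self C)⟩

lemma exists_rcoeffs_bound (hL : 0 < L) (hV : ContDiff ℝ ∞ fun p : ℝ × ℝ => V p.1 p.2) (T : ℝ) : ∃
    C, ∀ t ∈ Icc (-T) T, ∀ n, ‖rcoeffs L (V t) n‖ ≤ C := by
  obtain ⟨C, hC0, hC⟩ := exists_slice_bound hV (-T) T L
  refine ⟨(2 * L)⁻¹ * (C * |L - -L|), fun t ht n => (norm_coeffs_le hL _ n).trans ?_⟩; gcongr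
  refine (le_abs_self _).trans ((norm_eq_abs _).symm.trans_le
    (intervalIntegral.norm_integral_le_of_norm_le_const fun x hx => ?_))
  rw [uIoc_of_le (by linarith)] at hx; simpa using hC t ht x (Ioc_subset_Icc_self hx)

lemma rapidOn_rcoeffs (hL : 0 < L) (hV : ContDiff ℝ ∞ fun p : ℝ × ℝ => V p.1 p.2)
    (hp : ∀ t, Periodic (V t) (2 * L)) (T : ℝ) :
    RapidOn (Icc (-T) T) fun t => rcoeffs L (V t) := fun j => by
  induction j generalizing V with
  | zero => simpa [Decay] using exists_rcoeffs_bound hL hV T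
  | succ j ih =>
    have h := ih (contDiff_deriv_snd hV) fun t => periodic_deriv (hp t)
    simp_rw [rcoeffs_deriv hV hp] at h
    exact h.of_ddx hL ((exists_rcoeffs_bound hL hV T).imp fun C hC t ht => hC t ht 0)

lemma hasDerivAt_rcoeffs (hL : 0 < L) (hV : ContDiff ℝ ∞ fun p : ℝ × ℝ => V p.1 p.2) (n : ℤ)
    (t : ℝ) : HasDerivAt (fun t => rcoeffs L (V t) n)
    (rcoeffs L (fun x => deriv (fun τ => V τ x) t) n) t := by
  have hV' := contDiff_deriv_fst hV
  obtain ⟨C, hC0, hC⟩ := exists_slice_bound (V := fun t x => deriv (fun τ => V τ x) t) hV' (t - 1) (t + 1) L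
  have hcont : ∀ {W : ℝ → ℝ → ℝ}, ContDiff ℝ ∞ (fun p : ℝ × ℝ => W p.1 p.2) → ∀ s,
      Continuous fun x => expi L (-n) x * (W s x : ℂ) := fun h s =>
    (continuous_expi L _).mul (continuous_ofReal.comp (continuous_slice h s))
  simp_rw [rcoeffs, coeffs_eq]
  refine (intervalIntegral.hasDerivAt_integral_of_dominated_loc_of_deriv_le
    (F' := fun t x => expi L (-n) x * ((deriv (fun τ => V τ x) t : ℝ) : ℂ)) (bound := fun _ => C)
    (Ioo_mem_nhds (show t - 1 < t by linarith) (show t < t + 1 by linarith))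
    (.of_forall fun s => (hcont hV s).aestronglyMeasurable) ((hcont hV t).intervalIntegrable _ _)
    (hcont (W := fun t x => deriv (fun τ => V τ x) t) hV' t).aestronglyMeasurable
    (.of_forall fun x hx s hs => ?_) intervalIntegrable_const (.of_forall fun x _ s _ => ?_)).2.const_mul _
  · rw [uIoc_of_le (by linarith)] at hx; rw [norm_mul, norm_expi, one_mul, norm_real]
    exact hC s (Ioo_subset_Icc_self hs) x (Ioc_subset_Icc_self hx)
  · have h := hasDerivAt_fst hV s x; rw [← h.deriv] at h; exact h.ofReal_comp.const_mul _

end smooth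

lemma IsSmoothKdV.rapidKdV (hL : 0 < L) {u : ℝ → Hs L (-1)} (h : IsSmoothKdV L u) : RapidKdV L fun t
    => (u t).1 := by
  obtain ⟨V, hV, hp, heq, hu⟩ := h
  simp_rw [hu]
  have h1 := contDiff_deriv_snd hV; have h2 := contDiff_deriv_snd (V := fun t => deriv (V t)) h1
  have p1 := fun t => periodic_deriv (hp t)
  refine ⟨⟨fun n => continuous_iff_continuousAt.2 fun t => (hasDerivAt_rcoeffs hL hV n t).continuousAt,
    rapidOn_rcoeffs hL hV hp⟩, fun n t => (hasDerivAt_rcoeffs hL hV n t).congr_deriv ?_⟩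
  have hW : ContDiff ℝ ∞ fun p : ℝ × ℝ => -deriv (deriv (V p.1)) p.2 + 3 * (V p.1 p.2 * V p.1 p.2) :=
    h2.neg.add (contDiff_const.mul (hV.mul hV))
  have e : (fun x => deriv (fun τ => V τ x) t) =
      deriv (fun x => -deriv (deriv (V t)) x + 3 * (V t x * V t x)) := by
    ext x; have d1 := (hasDerivAt_snd hV t x).differentiableAt.hasDerivAt
    have d3 := (hasDerivAt_snd (V := fun t => deriv (deriv (V t)))
      h2 t x).differentiableAt.hasDerivAt
    rw [heq, iteratedDeriv_succ, iteratedDeriv_succ, iteratedDeriv_one]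
    refine Eq.trans ?_ (d3.neg.add ((d1.mul d1).const_mul 3)).deriv.symm; ring
  have hv : L2Per L fun x => (V t x : ℂ) := l2Per_of_continuous
    (continuous_ofReal.comp (continuous_slice hV t)) fun x => by rw [hp t x]
  have hc2 : Continuous fun x => ((deriv (deriv (V t)) x : ℝ) : ℂ) := continuous_ofReal.comp
    (continuous_slice (V := fun t => deriv (deriv (V t))) h2 t)
  have hc1 : Continuous fun x => (V t x : ℂ) := continuous_ofReal.comp (continuous_slice hV t)
  rw [e, rcoeffs_deriv (V := fun t x => -deriv (deriv (V t)) x + 3 * (V t x * V t x)) hW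
    fun t x => by simp only [periodic_deriv (p1 t) x, hp t x]]
  refine congrFun (congrArg (ddx L) (funext fun n => ?_)) n
  have e2 : ddx L (ddx L (rcoeffs L (V t))) = coeffs L fun x => ((deriv (deriv (V t)) x : ℝ) : ℂ) := by
    rw [← rcoeffs_deriv hV hp, ← rcoeffs_deriv (V := fun t => deriv (V t)) h1 p1, rcoeffs]
  rw [e2, rcoeffs, rcoeffs, ← coeffs_mul hL hv hv, ← coeffs_const_mul, ← coeffs_const_mul,
    ← coeffs_add 
      (Continuous.intervalIntegrable (by fun_prop) _ _) (Continuous.intervalIntegrable (by fun_prop) _ _)]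
  congr 1; ext x; push_cast
  ring

/-! ### Curves in `H⁻¹` -/

open Classical in
/-- A bounded sequence, as an element of `H⁻¹`. -/
def toHs (L : ℝ) (c : ℤ → ℂ) : Hs L (-1) :=
  if h : (∀ n, c (-n) = conj (c n)) ∧ Summable fun n => weight L (-1) n * ‖c n‖ ^ 2
  then Hs.mk c h else 0

lemma toHs_coe (hL : 0 < L) {c : ℤ → ℂ} (h : ∀ n, c (-n) = conj (c n)) (hC : ∀ n, ‖c n‖ ≤ C) :
    (toHs L c).1 = c := by
  have : toHs L c = Hs.mk _ _ := dif_pos ⟨h,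
    ((summable_weight_neg_one hL).mul_right (C ^ 2)).of_nonneg_of_le
      (fun n => mul_nonneg (weight_pos L _ n).le (by positivity)) fun n =>
      mul_le_mul_of_nonneg_left (pow_le_pow_left₀ (norm_nonneg _) (hC n) 2) (weight_pos L _ n).le⟩
  rw [this, Hs.mk_coe]

lemma continuous_of_coeff (hL : 0 < L) [TopologicalSpace ι] {p : ι → Hs L (-1)}
    (h : ∀ n, Continuous fun i => (p i).1 n) (hC : ∀ i n, ‖(p i).1 n‖ ≤ C) : Continuous p := by
  rw [continuous_iff_continuousAt]; intro i; refine Hs.tendsto_iff_sobSq.2 ?_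
  have h1 : sobSq L (-1) (fun _ => (1 : ℂ)) ≠ ⊤ := by
    simpa [sobSq] using (summable_weight_neg_one hL).tsum_ofReal_ne_top
  have := tendsto_sobSq_mul (l := 𝓝 i) (s := -1) (m := fun j n => (p j).1 n - (p i).1 n) (B := (2 * C) ^ 2) h1
    (fun n => tendsto_sub_nhds_zero_iff.2 (h n).continuousAt) fun j n => by
      rw [mul_comm]
      refine mul_le_mul_of_nonneg_right (pow_le_pow_left₀ (norm_nonneg _) ?_ 2) (weight_pos L _ n).le
      exact (norm_sub_le _ _).trans (by linarith [hC i n, hC j n])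
  simpa using! this

lemma RapidCurve.continuous_hs (hL : 0 < L) {p : ℝ → Hs L (-1)} (h : RapidCurve fun t => (p t).1) :
    Continuous p := by
  rw [continuous_iff_continuousAt]; intro t; obtain ⟨C, hC⟩ := h.rapid (|t| + 1) 0
  have : ContinuousOn p (Icc (-(|t| + 1)) (|t| + 1)) :=
    continuousOn_iff_continuous_domRestrict.2 (continuous_of_coeff hL (C := C)
      (fun n => (h.cont n).comp continuous_subtype_val) fun i n => by simpa using hC i i.2 n)
  exact this.continuousAt (Icc_mem_nhds (mem_Ioo t).1 (mem_Ioo t).2)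

lemma RapidCurve.hasDerivAt_hs (hL : 0 < L) {p X : ℝ → Hs L (-1)} (hX : RapidCurve fun t => (X t).1)
    (h : ∀ n t, HasDerivAt (fun t => (p t).1 n) ((X t).1 n) t) (t : ℝ) : HasDerivAt p (X t) t :=
  hasDerivWithinAt_univ.1 (hasDerivWithinAt_of_coeff Set.ordConnected_univ
    (hX.continuous_hs hL).continuousOn (fun n t _ => (h n t).hasDerivWithinAt) t (mem_univ t))

lemma conv_conj {a b : ℤ → ℂ} (ha : ∀ n, a (-n) = conj (a n)) (hb : ∀ n, b (-n) = conj (b n))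
    (n : ℤ) : conv a b (-n) = conj (conv a b n) := by
  rw [conv, conv, conj_tsum, ← (Equiv.neg ℤ).tsum_eq]; refine tsum_congr fun m => ?_
  rw [map_mul, ← ha, ← hb, Equiv.neg_apply]; congr 2; ring

lemma kdvField_conj {a : ℤ → ℂ} (ha : ∀ n, a (-n) = conj (a n)) (n : ℤ) : kdvField L a (-n) = conj
    (kdvField L a n) :=
  ddx_conj (fun n => by
    rw [ddx_conj (ddx_conj ha), conv_conj ha ha]
    simp [conj_ofNat]) n

end

section

lemma Coercive.exists_weyl_prim (hL : 1 ≤ L) (hc : Coercive L q k) (hσ : σ = 1 ∨ σ = -1) {Q : ℝ → ℂ}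
    (hQ : L2Per L Q) (hq : coeffs L Q = q.1) : ∃ r, IsPrim r (fun x => Q x + k ^ 2 - r x * r x) ∧
    Periodic r (2 * L) ∧ weyl L q.1 k σ =ᵐ[volume] r := by
  have hL0 : 0 < L := by linarith
  have hv := hc.l2Per_weyl hL hσ
  have hi := fun a b => (hQ.intervalIntegrable hL0 a b).add (intervalIntegrable_const (c := k ^ 2))
  obtain ⟨r, hr, hp, he⟩ := exists_periodic_prim hL0 hv (F := fun _ => 0)
    (l2Per_of_continuous continuous_const fun _ => rfl)
    (s := fun x => Q x + k ^ 2 - weyl L q.1 k σ x * weyl L q.1 k σ x)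
    (fun x => by simp only [hQ.periodic x, hv.periodic x])
    (fun a b => (hi a b).sub (hv.integrable_mul hL0 hv a b)) fun n => by
      have h1 := (hc.isRiccati hL hσ).eqn n
      have h2 : ddx L (coeffs L fun _ => (0 : ℂ)) n = 0 := by
        rw [ddx, coeffs_const hL0, ite_self, mul_zero]
      rw [h2, coeffs_sub (hi _ _) (hv.integrable_mul hL0 hv _ _),
        coeffs_add (hQ.intervalIntegrable hL0 _ _) intervalIntegrable_const, coeffs_const hL0, hq]
      simp only [sq (weyl L q.1 k σ _)] at h1; linear_combination h1
  simp only [zero_add] at he; exact ⟨r, hr.congr_ae (he.mono fun x hx => by simp only [hx]), hp, he⟩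

/-- The logarithmic derivatives of the Weyl solutions, for square integrable potentials. -/
structure WeylPair (L : ℝ) (q : ℤ → ℂ) (k : ℂ) (Q r s : ℝ → ℂ) : Prop where
  prim_left : IsPrim r (fun x => Q x + k ^ 2 - r x * r x)
  prim_right : IsPrim s (fun x => Q x + k ^ 2 - s x * s x)
  ae_left : weyl L q k 1 =ᵐ[volume] r
  ae_right : weyl L q k (-1) =ᵐ[volume] s
  per_left : Periodic r (2 * L)
  per_right : Periodic s (2 * L)
  inv_eq : ∀ x, (diagGreen L q k x)⁻¹ = r x - s x
  prim_green : IsPrim (diagGreen L q k) fun x => (r x + s x) * diagGreen L q k x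

lemma Coercive.exists_weylPair (hL : 1 ≤ L) (hc : Coercive L q k) {Q : ℝ → ℂ} (hQ : L2Per L Q)
    (hq : coeffs L Q = q.1) : ∃ r s, WeylPair L q.1 k Q r s := by
  obtain ⟨r, hr, pr, er⟩ := hc.exists_weyl_prim hL (Or.inl rfl) hQ hq
  obtain ⟨s, hs, ps, es⟩ := hc.exists_weyl_prim hL (Or.inr rfl) hQ hq
  refine ⟨r, s, hr, hs, er, es, pr, ps, congrFun ?_, (hc.isPrim_diagGreen hL).congr_ae ?_⟩
  · refine (Continuous.ae_eq_iff_eq volume ((hc.continuous_diagGreen hL).inv₀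
      (hc.diagGreen_ne_zero hL)) (hr.continuous.sub hs.continuous)).1 ?_
    filter_upwards [er, es] with x h1 h2
    exact (hc.weyl_sub hL x).symm.trans (by rw [h1, h2]; rfl)
  · filter_upwards [er, es] with x h1 h2
    rw [hc.deriv_diagGreen hL, h1, h2]

lemma ddx_of_prims (hL : 0 < L) {Q s : ℝ → ℂ} (hQ : L2Per L Q) (pr : Periodic r (2 * L))
    (ps : Periodic s (2 * L)) (pg : Periodic g (2 * L))
    (hr : IsPrim r (fun x => Q x + lam - r x * r x))
    (hs : IsPrim s (fun x => Q x + lam - s x * s x)) (hg : IsPrim g fun x => (r x + s x) * g x)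
    (n : ℤ) : ddx L (ddx L (ddx L (coeffs L g))) n = 2 * ddx L (conv (coeffs L Q) (coeffs L g)) n +
    2 * conv (coeffs L Q) (ddx L (coeffs L g)) n + 4 * lam * ddx L (coeffs L g) n := by
  have cg := hg.continuous; have cr := hr.continuous; have cs := hs.continuous
  have pg1 : Periodic (fun x => (r x + s x) * g x) (2 * L) := fun x => by
    simp only [pr x, ps x, pg x]
  have lg1 : L2Per L fun x => (r x + s x) * g x := l2Per_of_continuous (by fun_prop) pg1
  have lg : L2Per L g := l2Per_of_continuous cg pg
  have pm : Periodic (fun x => r x * s x * g x) (2 * L) := fun x => by simp only [pr x, ps x, pg x]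
  have e1 := coeffs_deriv_of_periodic hg pg; have i1 := (hQ.integrable_mul hL lg (-L) L).const_mul 2
  have i2 : IntervalIntegrable (fun x => 2 * lam * g x) volume (-L) L :=
    (by fun_prop : Continuous fun x => 2 * lam * g x).intervalIntegrable _ _
  have i3 : IntervalIntegrable (fun x => 2 * (r x * s x * g x)) volume (-L) L :=
    (by fun_prop : Continuous fun x => 2 * (r x * s x * g x)).intervalIntegrable _ _
  have e2 : ddx L (ddx L (coeffs L g)) = fun n => 2 * conv (coeffs L Q) (coeffs L g) n +
      2 * lam * coeffs L g n + 2 * coeffs L (fun x => r x * s x * g x) n := by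
    rw [← e1, ← coeffs_deriv_of_periodic ((hr.add hs).mul hg) pg1, ← coeffs_mul hL hQ lg]; ext n
    rw [← coeffs_const_mul, ← coeffs_const_mul, ← coeffs_const_mul, ← coeffs_add i1 i2,
      ← coeffs_add (i1.add i2) i3]
    congr 1; ext x; ring
  have e3 : ddx L (coeffs L fun x => r x * s x * g x) n =
      conv (coeffs L Q) (ddx L (coeffs L g)) n + lam * ddx L (coeffs L g) n := by
    rw [← coeffs_deriv_of_periodic ((hr.mul hs).mul hg) pm, ← e1,
      ← coeffs_mul hL hQ lg1, ← coeffs_const_mul, ← coeffs_add (hQ.integrable_mul hL lg1 _ _)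
        ((lg1.const_mul _).intervalIntegrable hL _ _)]
    congr 1; ext x; ring
  rw [e2]; simp only [ddx] at e3 ⊢; linear_combination 2 * e3

lemma Coercive.ddx_diagGreen (hL : 1 ≤ L) (hc : Coercive L q k) {Q : ℝ → ℂ} (hQ : L2Per L Q)
    (hq : coeffs L Q = q.1) (n : ℤ) : ddx L (ddx L (ddx L (coeffs L (diagGreen L q.1 k)))) n = 2 *
    ddx L (conv q.1 (coeffs L (diagGreen L q.1 k))) n + 2 * conv q.1
    (ddx L (coeffs L (diagGreen L q.1 k))) n + 4 * k ^ 2 * ddx L (coeffs L (diagGreen L q.1 k))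
    n := by
  obtain ⟨r, s, h⟩ := hc.exists_weylPair hL hQ hq
  have := ddx_of_prims (by linarith) hQ h.per_left h.per_right (hc.diagGreen_periodic hL)
    h.prim_left h.prim_right h.prim_green n
  rwa [hq] at this

section decay
variable {A : Set ι} {a b c : ι → ℤ → ℂ} {j : ℕ}

/-- A family that is bounded in `ℓ²`, uniformly on `A`. -/
def SqBdd (L : ℝ) (A : Set ι) (c : ι → ℤ → ℂ) : Prop :=
  ∃ M : ℝ, 0 ≤ M ∧ ∀ i ∈ A, sobSq L 0 (c i) ≤ ofReal M

lemma sobSq_zero_eq (c : ℤ → ℂ) : sobSq L 0 c = ∑' n, ofReal (‖c n‖ ^ 2) := by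
  simp only [sobSq, weight_zero, one_mul]

lemma SqBdd.const_mul (r : ℂ) (ha : SqBdd L A a) : SqBdd L A fun i n => r * a i n := by
  obtain ⟨M, hM, h⟩ := ha; refine ⟨‖r‖ ^ 2 * M, by positivity, fun i hi => ?_⟩
  rw [sobSq_const_mul, ENNReal.ofReal_mul (by positivity)]; gcongr; exact h i hi

lemma SqBdd.add (ha : SqBdd L A a) (hb : SqBdd L A b) : SqBdd L A fun i n => a i n + b i n := by
  obtain ⟨M, hM, h⟩ := ha; obtain ⟨M', hM', h'⟩ := hb
  refine ⟨2 * M + 2 * M', by positivity, fun i hi => (sobSq_add_le 0 _ _).trans ?_⟩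
  rw [ofReal_add (by positivity) (by positivity), ENNReal.ofReal_mul (by norm_num),
    ENNReal.ofReal_mul (by norm_num), ENNReal.ofReal_ofNat]
  gcongr
  exacts [h i hi, h' i hi]

lemma SqBdd.decay_conv (ha : SqBdd L A a) (hb : SqBdd L A b) : Decay 0 A fun i => conv (a i)
    (b i) := by
  obtain ⟨M, hM, h⟩ := ha; obtain ⟨M', hM', h'⟩ := hb; refine ⟨M + M', fun i hi n => ?_⟩
  rw [pow_zero, one_mul, ← ofReal_le_ofReal_iff (by positivity), ofReal_norm]
  refine enorm_tsum_le_tsum_enorm.trans ?_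
  calc ∑' m, ‖a i m * b i (n - m)‖ₑ
      ≤ ∑' m, (ofReal (‖a i m‖ ^ 2) + ofReal (‖b i (n - m)‖ ^ 2)) := by
        refine tsum_le_tsum fun m => ?_
        rw [← ofReal_norm, ← ofReal_add (by positivity) (by positivity), norm_mul]
        refine ofReal_le_ofReal ?_
        nlinarith [sq_nonneg (‖a i m‖ - ‖b i (n - m)‖), sq_nonneg (‖a i m‖ + ‖b i (n - m)‖)]
    _ = sobSq L 0 (a i) + sobSq L 0 (b i) := by
        rw [ENNReal.tsum_add, sobSq_zero_eq, sobSq_zero_eq]; congr 1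
        exact (Equiv.subLeft n).tsum_eq (fun m => ofReal (‖b i m‖ ^ 2))
    _ ≤ _ := by
        rw [ofReal_add hM hM']; exact add_le_add (h i hi) (h' i hi)

lemma SqBdd.decay_zero (ha : SqBdd L A a) : Decay 0 A a := by
  obtain ⟨M, hM, h⟩ := ha; refine ⟨√M, fun i hi n => ?_⟩; rw [pow_zero, one_mul]
  refine le_sqrt_of_sq_le ((ofReal_le_ofReal_iff hM).1 (le_trans ?_ (h i hi))); rw [sobSq_zero_eq]
  exact ENNReal.le_tsum n

lemma SqBdd.exists_l2Per (hL : 0 < L) (ha : SqBdd L A a) {i : ι} (hi : i ∈ A) : ∃ Q, L2Per L Q ∧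
    coeffs L Q = a i := by
  obtain ⟨M, hM, h⟩ := ha; have := summable_of_sobSq (ne_top_of_le_ne_top ofReal_ne_top (h i hi))
  simp only [weight_zero, one_mul] at this; exact riesz_fischer hL this

lemma decay_diagGreen (hL : 1 ≤ L) {p : ι → Hs L (-1)} (hp : SqBdd L A fun i => (p i).1)
    (hc : ∀ i, Coercive L (p i) k) (h0 : Decay j A fun i => coeffs L (diagGreen L (p i).1 k)) (h1 :
    Decay j A fun i => conv (p i).1 (coeffs L (diagGreen L (p i).1 k))) (h2 : Decay (j - 1) A fun i
    => conv (p i).1 (ddx L (coeffs L (diagGreen L (p i).1 k)))) : Decay (j + 2) A fun i => coeffs L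
    (diagGreen L (p i).1 k) := by
  have hL0 : 0 < L := by linarith
  have z : ∀ c : ι → ℤ → ℂ, ∃ C, ∀ i ∈ A, ‖ddx L (c i) 0‖ ≤ C := fun c =>
    ⟨0, fun i _ => by simp [ddx, freq_zero]⟩
  have b0 : ∀ {c : ι → ℤ → ℂ}, Decay j A c → ∃ C, ∀ i ∈ A, ‖c i 0‖ ≤ C := fun h =>
    (h.of_le (Nat.zero_le j)).imp fun C hC i hi => by simpa using hC i hi 0
  have h3 := (h1.const_mul 2).add (h0.const_mul (4 * k ^ 2))
  have h4 : Decay j A fun i n =>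
      ddx L (ddx L (coeffs L (diagGreen L (p i).1 k))) n -
      (2 * conv (p i).1 (coeffs L (diagGreen L (p i).1 k)) n +
        4 * k ^ 2 * coeffs L (diagGreen L (p i).1 k) n) := by
    refine Decay.of_le (j := j - 1 + 1) (by omega) (Decay.of_ddx hL0 ?_ ?_)
    · obtain ⟨C, hC⟩ := h2.const_mul 2; refine ⟨C, fun i hi n => le_trans (le_of_eq ?_) (hC i hi n)⟩
      obtain ⟨Q, hQ, hq⟩ := hp.exists_l2Per hL0 hi; have := (hc i).ddx_diagGreen hL hQ hq n; congr 2
      simp only [ddx] at this ⊢; linear_combination this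
    · obtain ⟨C, hC⟩ := b0 h3; refine ⟨C, fun i hi => ?_⟩
      rw [ddx, freq_zero, ofReal_zero, mul_zero, zero_mul, zero_sub, norm_neg]; exact hC i hi
  have h5 : Decay j A fun i => ddx L (ddx L (coeffs L (diagGreen L (p i).1 k))) := by
    obtain ⟨C, hC⟩ := h4.add h3; refine ⟨C, fun i hi n => ?_⟩; have := hC i hi n
    beta_reduce at this; rwa [sub_add_cancel] at this
  exact (h5.of_ddx hL0 (z _)).of_ddx hL0 (b0 h0)

lemma exists_weyl_bound_of_isCompact (hL : 1 ≤ L) (hσ : σ = 1 ∨ σ = -1)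
    (hc : ∀ q : Hs L (-1), Coercive L q k) {K : Set (Hs L (-1))} (hK : IsCompact K) : ∃ B, ∀ q ∈ K,
    l2 (perMeasure L) (weyl L q.1 k σ) ≤ B := by
  refine hK.induction_on (p := fun K => ∃ B, ∀ q ∈ K, l2 (perMeasure L) (weyl L q.1 k σ) ≤ B)
    ⟨0, by simp⟩ (fun s t hst ⟨B, hB⟩ => ⟨B, fun q hq => hB q (hst hq)⟩)
    (fun s t ⟨B, hB⟩ ⟨D, hD⟩ => ⟨max B D, fun q hq => hq.elim (fun h => (hB q h).trans
      (le_max_left _ _)) fun h => (hD q h).trans (le_max_right _ _)⟩) fun q _ => ?_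
  obtain ⟨B, hB⟩ := (hc q).exists_weyl_bound hL hσ
  exact ⟨_, mem_nhdsWithin_of_mem_nhds hB, B, fun q hq => hq⟩

lemma l2_mul_le {P : ℝ → ℂ} (hf : MemLp f 2 (perMeasure L)) (hP : Continuous P) {B : ℝ}
    (hB : ∀ x, ‖P x‖ ≤ B) : l2 (perMeasure L) (fun x => P x * f x) ≤ B * l2 (perMeasure L) f := by
  have hB0 : 0 ≤ B := (norm_nonneg _).trans (hB 0)
  refine abs_le_of_sq_le_sq' ?_ (mul_nonneg hB0 (l2_nonneg _ _)) |>.2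
  rw [mul_pow, l2_sq, l2_sq, ← integral_const_mul]
  refine integral_mono (integrable_norm_sq (memLp_per_bdd_mul hf hP))
    ((integrable_norm_sq hf).const_mul _) fun x => ?_
  simp only [norm_mul, mul_pow]; gcongr; exact hB x

lemma sqBdd_diagGreen (hL : 1 ≤ L) (hk : (k ^ 2).im ≠ 0) {p : ι → Hs L (-1)} {K : Set (Hs L (-1))}
    (hK : IsCompact K) (hp : ∀ i ∈ A, p i ∈ K) : SqBdd L A
    (fun i => coeffs L (diagGreen L (p i).1 k)) ∧ SqBdd L A
    (fun i => ddx L (coeffs L (diagGreen L (p i).1 k))) := by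
  have hL0 : 0 < L := by linarith
  have hc := coercive_of_im hL hk; obtain ⟨R, hR⟩ := hK.isBounded.exists_norm_le
  obtain ⟨B, hB, hb, -⟩ := exists_diagGreen_bound hL hk R
  obtain ⟨D, hD⟩ := exists_weyl_bound_of_isCompact hL (Or.inl rfl) hc hK
  obtain ⟨D', hD'⟩ := exists_weyl_bound_of_isCompact hL (Or.inr rfl) hc hK
  have mono : ∀ {f : ℝ → ℂ} {C : ℝ}, l2 (perMeasure L) f ≤ C →
      ofReal ((2 * L)⁻¹ * l2 (perMeasure L) f ^ 2) ≤ ofReal ((2 * L)⁻¹ * C ^ 2) :=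
    fun h => ofReal_le_ofReal (mul_le_mul_of_nonneg_left
      (pow_le_pow_left₀ (l2_nonneg _ _) h 2) (by positivity))
  refine ⟨⟨(2 * L)⁻¹ * (√(2 * L) * B) ^ 2, by positivity, fun i hi => ?_⟩,
    ⟨(2 * L)⁻¹ * (B * (D + D')) ^ 2, by positivity, fun i hi => ?_⟩⟩
  · rw [sobSq_zero_coeffs hL0 (l2Per_diagGreen hL (hc _)).memLp]
    exact mono (l2_le_of_bound hL0 hB (.of_forall fun x => hb _ (hR _ (hp i hi)) x x))
  · have hw := (hc (p i)).l2Per_weyl hL (Or.inl rfl)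
    have hw' := (hc (p i)).l2Per_weyl hL (Or.inr rfl)
    have e : deriv (diagGreen L (p i).1 k) = fun x => diagGreen L (p i).1 k x *
        (weyl L (p i).1 k 1 x + weyl L (p i).1 k (-1) x) := by
      ext x; rw [(hc (p i)).deriv_diagGreen hL, mul_comm]
    beta_reduce; change sobSq L 0 (ddx L (coeffs L (diagGreen L (p i).1 k))) ≤ _
    rw [← coeffs_deriv_diagGreen hL (hc _), e, sobSq_zero_coeffs hL0
      (memLp_per_bdd_mul (hw.add hw').memLp ((hc _).continuous_diagGreen hL))]
    refine mono ((l2_mul_le (hw.add hw').memLp ((hc _).continuous_diagGreen hL)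
      fun x => hb _ (hR _ (hp i hi)) x x).trans (mul_le_mul_of_nonneg_left ?_ hB))
    exact (l2_add_le hw.memLp hw'.memLp).trans (add_le_add (hD _ (hp i hi)) (hD' _ (hp i hi)))

end decay

section gain
variable {Ψ : ℝ → Hs L (-1) → Hs L (-1)} {N : Hs L (-1) → Hs L (-1)} {u : ℝ → Hs L (-1)} {S : ℝ}

/-- The time rectangle `[-S, S] × [-T, T]`. -/
def rect (S T : ℝ) : Set (ℝ × ℝ) := Icc (-S) S ×ˢ Icc (-T) T

lemma norm_sub_le_of_flow {E : Type*} [NormedAddCommGroup E] [NormedSpace ℝ E] {f f' : ℝ → E}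
    (hf : ∀ s, HasDerivAt f (f' s) s) (hC : ∀ s ∈ Icc (-S) S, ‖f' s‖ ≤ C) (hs : s ∈ Icc (-S) S) : ‖f
    s - f 0‖ ≤ C * S := by
  have h0 : (0 : ℝ) ∈ Icc (-S) S := ⟨by linarith [hs.1, hs.2], by linarith [hs.1, hs.2]⟩
  refine ((convex_Icc (-S) S).norm_image_sub_le_of_norm_hasDerivWithin_le
    (fun r _ => (hf r).hasDerivWithinAt) hC h0 hs).trans ?_
  rw [sub_zero]; exact mul_le_mul_of_nonneg_left (abs_le.2 hs) ((norm_nonneg _).trans (hC 0 h0))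

lemma IsFlow.hasDerivAt_coeff (h : IsFlow N Ψ) (q : Hs L (-1)) (n : ℤ) (s : ℝ) : HasDerivAt
    (fun s => (Ψ s q).1 n) ((N (Ψ s q)).1 n) s :=
  (coeffCLM L (-1) n).hasFDerivAt.comp_hasDerivAt s (h.hasDerivAt s q)

lemma IsFlow.decay {j : ℕ} (h : IsFlow N Ψ) (hu : Decay j (Icc (-T) T) fun t => (u t).1)
    (hN : Decay j (rect S T) fun i => (N (Ψ i.1 (u i.2))).1) : Decay j (rect S T) fun i =>
    (Ψ i.1 (u i.2)).1 := by
  obtain ⟨C, hC⟩ := hu; obtain ⟨D, hD⟩ := hN; refine ⟨C + D * S, fun i hi n => ?_⟩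
  have hw : 0 < (1 + |(n : ℝ)|) ^ j := by positivity
  have h1 := norm_sub_le_of_flow (C := D / (1 + |(n : ℝ)|) ^ j) (h.hasDerivAt_coeff (u i.2) n)
    (fun s hs => (le_div_iff₀' hw).2 (hD (s, i.2) ⟨hs, hi.2⟩ n)) hi.1
  rw [div_mul_eq_mul_div, le_div_iff₀' hw, h.init] at h1
  calc _ ≤ (1 + |(n : ℝ)|) ^ j * (‖(u i.2).1 n‖ + ‖(Ψ i.1 (u i.2)).1 n - (u i.2).1 n‖) := by
        gcongr; exact norm_le_insert' _ _
    _ ≤ _ := by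
        rw [mul_add]; exact add_le_add (hC i.2 hi.2 n) h1

lemma IsFlow.sqBdd (h : IsFlow N Ψ) (hu : SqBdd L (Icc (-T) T) fun t => (u t).1)
    (hN : SqBdd L (rect S T) fun i => (N (Ψ i.1 (u i.2))).1) : SqBdd L (rect S T) fun i =>
    (Ψ i.1 (u i.2)).1 := by
  obtain ⟨C, hC0, hC⟩ := hu; obtain ⟨D, hD0, hD⟩ := hN
  have key : ∀ i ∈ rect S T, sobSq L 0 (fun n => (Ψ i.1 (u i.2)).1 n - (u i.2).1 n) ≤
      ofReal (D * S ^ 2) := fun i hi => by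
    rw [sobSq_zero_eq, ENNReal.tsum_eq_iSup_sum]; refine iSup_le fun F => ?_
    rw [← ENNReal.ofReal_sum_of_nonneg fun _ _ => by positivity]; refine ofReal_le_ofReal ?_
    set d : ℤ → ℂ := fun n => (Ψ i.1 (u i.2)).1 n - (u i.2).1 n with hd
    set X := ∑ n ∈ F, ‖d n‖ ^ 2 with hX
    have hX0 : 0 ≤ X := Finset.sum_nonneg fun _ _ => by positivity
    have hS : 0 ≤ S := by linarith [hi.1.1, hi.1.2]
    have h1 : ∀ s ∈ Icc (-S) S, ‖∑ n ∈ F, conj (d n) * (N (Ψ s (u i.2))).1 n‖ ≤ √(X * D) := by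
      intro s hs
      have h2 : ∑ n ∈ F, ‖(N (Ψ s (u i.2))).1 n‖ ^ 2 ≤ D := by
        refine (ofReal_le_ofReal_iff hD0).1 (le_trans ?_ (hD (s, i.2) ⟨hs, hi.2⟩))
        rw [ENNReal.ofReal_sum_of_nonneg fun _ _ => by positivity, sobSq_zero_eq]
        exact ENNReal.sum_le_tsum F
      refine le_sqrt_of_sq_le ?_
      calc _ ≤ (∑ n ∈ F, ‖d n‖ * ‖(N (Ψ s (u i.2))).1 n‖) ^ 2 := by
            gcongr; refine (norm_sum_le _ _).trans (le_of_eq ?_)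
            simp only [norm_mul, RCLike.norm_conj]
        _ ≤ _ := (Finset.sum_mul_sq_le_sq_mul_sq _ _ _).trans (by gcongr)
    have h3 := norm_sub_le_of_flow (f := fun s => ∑ n ∈ F, conj (d n) * (Ψ s (u i.2)).1 n)
      (fun s => HasDerivAt.fun_sum fun n _ => (h.hasDerivAt_coeff (u i.2) n s).const_mul _) h1 hi.1
    have h4 : (X : ℂ) = ∑ n ∈ F, conj (d n) * (Ψ i.1 (u i.2)).1 n -
        ∑ n ∈ F, conj (d n) * (Ψ 0 (u i.2)).1 n := by
      rw [h.init, ← Finset.sum_sub_distrib, hX, Complex.ofReal_sum]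
      refine Finset.sum_congr rfl fun n _ => ?_; rw [← mul_sub, ofReal_pow, ← Complex.conj_mul']
    rw [← h4, norm_real, norm_of_nonneg hX0] at h3
    have h5 : X ^ 2 ≤ X * D * S ^ 2 := by
      calc X ^ 2 ≤ (√(X * D) * S) ^ 2 := by gcongr
        _ = _ := by rw [mul_pow, sq_sqrt (by positivity)]
    by_contra! h6; have h7 : 0 ≤ D * S ^ 2 := by positivity
    nlinarith
  have := SqBdd.add (L := L) (A := rect S T) (a := fun i => (u i.2).1) ⟨C, hC0, fun i hi => hC i.2 hi.2⟩
    ⟨_, by positivity, key⟩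
  simpa using! this

lemma Decay.sqBdd {A : Set ι} {a : ι → ℤ → ℂ} (ha : Decay 1 A a) : SqBdd L A a := by
  obtain ⟨C, hC, h⟩ := ha.bound
  refine ⟨∑' n : ℤ, C ^ 2 * ((1 + |(n : ℝ)|) ^ 2)⁻¹, tsum_nonneg fun n => by positivity,
    fun i hi => ?_⟩
  rw [sobSq_zero_eq, ofReal_tsum_of_nonneg (fun n => by positivity) (summable_inv_sq.mul_left _)]
  refine tsum_le_tsum fun n => ofReal_le_ofReal ?_
  refine (pow_le_pow_left₀ (norm_nonneg _) (h i hi n) 2).trans (le_of_eq ?_)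
  rw [mul_pow, pow_one, inv_pow]

lemma decay_movingField {A : Set ι} {j : ℕ} (hL : 1 ≤ L) (hk : (k ^ 2).im ≠ 0) {p : ι → Hs L (-1)}
    (h : ∀ ϰ ∈ ({k, conj k} : Set ℂ), Decay (j + 1) A fun i => coeffs L (diagGreen L (p i).1 ϰ)) :
    Decay j A fun i => (movingField L k (p i)).1 := by
  have hL0 : 0 < L := by linarith
  obtain ⟨C, hC⟩ := (((h k (by simp)).ddx hL0).const_mul (8 * k ^ 5)).add
    (((h (conj k) (by simp)).ddx hL0).const_mul (8 * conj k ^ 5))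
  refine ⟨C, fun i hi n => le_trans (le_of_eq ?_) (hC i hi n)⟩
  exact congrArg (fun z => (1 + |(n : ℝ)|) ^ j * ‖z‖) (movingField_apply hL hk (p i) n)

lemma IsFlow.rapidOn (hL : 1 ≤ L) (hk : (k ^ 2).im ≠ 0) (h : IsFlow (movingField L k) Ψ)
    (hu : RapidCurve fun t => (u t).1) : RapidOn (rect S T) (fun i => (Ψ i.1 (u i.2)).1) ∧ ∀ ϰ ∈
    ({k, conj k} : Set ℂ), RapidOn (rect S T) fun i => coeffs L
    (diagGreen L (Ψ i.1 (u i.2)).1 ϰ) := by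
  have hL0 : 0 < L := by linarith
  have hκ : ∀ ϰ ∈ ({k, conj k} : Set ℂ), (ϰ ^ 2).im ≠ 0 := fun ϰ hϰ => by
    rcases hϰ with rfl | rfl
    exacts [hk, im_conj_sq_ne hk]
  have hK : IsCompact ((fun i : ℝ × ℝ => Ψ i.1 (u i.2)) '' rect S T) :=
    (isCompact_Icc.prod isCompact_Icc).image
      (h.continuous.comp (continuous_fst.prodMk ((hu.continuous_hs hL0).comp continuous_snd)))
  have hG := fun ϰ (hϰ : ϰ ∈ ({k, conj k} : Set ℂ)) => sqBdd_diagGreen hL (hκ ϰ hϰ) hK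
    fun i hi => Set.mem_image_of_mem (fun i : ℝ × ℝ => Ψ i.1 (u i.2)) hi
  have hζ : SqBdd L (rect S T) fun i => (Ψ i.1 (u i.2)).1 := by
    refine h.sqBdd (hu.rapid T 1).sqBdd ?_
    obtain ⟨M, hM, hb⟩ := ((hG k (by simp)).2.const_mul (8 * k ^ 5)).add
      ((hG (conj k) (by simp)).2.const_mul (8 * conj k ^ 5))
    refine ⟨M, hM, fun i hi => le_trans (le_of_eq ?_) (hb i hi)⟩
    exact congrArg (sobSq L 0) (funext (movingField_apply hL hk _))
  have step : ∀ j : ℕ, (∀ ϰ ∈ ({k, conj k} : Set ℂ),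
      Decay (j + 2) (rect S T) fun i => coeffs L (diagGreen L (Ψ i.1 (u i.2)).1 ϰ)) →
      Decay (j + 1) (rect S T) fun i => (Ψ i.1 (u i.2)).1 := fun j hj =>
    h.decay (hu.rapid T _) (decay_movingField hL hk hj)
  have main : ∀ j : ℕ, ∀ ϰ ∈ ({k, conj k} : Set ℂ),
      Decay (j + 2) (rect S T) fun i => coeffs L (diagGreen L (Ψ i.1 (u i.2)).1 ϰ) := by
    intro j
    induction j with
    | zero =>
      exact fun ϰ hϰ => decay_diagGreen hL hζ (fun i => coercive_of_im hL (hκ ϰ hϰ) _)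
          (hG ϰ hϰ).1.decay_zero (hζ.decay_conv (hG ϰ hϰ).1) (hζ.decay_conv (hG ϰ hϰ).2)
    | succ j ih =>
      intro ϰ hϰ; have h1 := step j ih
      refine decay_diagGreen hL hζ (fun i => coercive_of_im hL (hκ ϰ hϰ) _)
        ((ih ϰ hϰ).of_le (by omega)) (h1.conv (by omega) (ih ϰ hϰ)) ?_
      rcases j with _ | j
      · exact hζ.decay_conv (hG ϰ hϰ).2
      · exact (h1.of_le (by omega)).conv (by omega) ((ih ϰ hϰ).ddx hL0)
  exact ⟨fun j => (step j (main j)).of_le (by omega), fun ϰ hϰ j => (main j ϰ hϰ).of_le (by omega)⟩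

end gain

end

section

section slope

lemma form_sub_eq_pair (hL : 1 ≤ L) (q₁ q₂ : Hs L (-1)) (lam : ℂ) (hu : HasH1Deriv u u')
    (hψ : HasH1Deriv ψ ψ') : form L q₂.1 lam u u' ψ ψ' - form L q₁.1 lam u u' ψ ψ' = pair L
    (q₂ - q₁).1 fun x => u x * ψ x := by
  rw [pair_sub_left hL q₂ q₁ hu hψ]; simp only [form]; ring

lemma CoerciveForm.sqrt_h1sq_sub_le (hL : 1 ≤ L) (h₁ : CoerciveForm L q₁.1 lam ζ)
    (h₂ : CoerciveForm L q₂.1 lam ζ) (hu : HasH1Deriv u u') (hv : HasH1Deriv v v')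
    (eu : ∀ ψ ψ', HasH1Deriv ψ ψ' → form L q₁.1 lam u u' ψ ψ' = ψ y)
    (ev : ∀ ψ ψ', HasH1Deriv ψ ψ' → form L q₂.1 lam v v' ψ ψ' = ψ y) :
    √(h1sq (fun x => u x - v x) fun x => u' x - v' x) ≤ 144 * L ^ 2 * ‖ζ‖ ^ 2 * ‖q₁ - q₂‖ := by
  have hw := hu.sub hv; have h := h₂.le _ _ hw
  rw [form_sub_left hL q₂ lam hu hv hw.conj, ev _ _ hw.conj, ← eu _ _ hw.conj,
    form_sub_eq_pair hL q₁ q₂ lam hu hw.conj] at h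
  have h2 := (re_le_norm _).trans_eq (norm_mul ζ _) |>.trans (mul_le_mul_of_nonneg_left
    (norm_pair_le hL (q₂ - q₁) hu hw.conj) (norm_nonneg ζ))
  rw [h1sq_conj, norm_sub_rev q₂] at h2; have b1 := h₁.sqrt_h1sq_le hu eu
  have h3 := sq_sqrt (h1sq_nonneg (fun x => u x - v x) fun x => u' x - v' x)
  set s := √(h1sq (fun x => u x - v x) fun x => u' x - v' x); have hs : 0 ≤ s := sqrt_nonneg _
  have h4 : ‖ζ‖ * (18 * L ^ 2 * ‖q₁ - q₂‖ * (√(h1sq u u') * s)) ≤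
      ‖ζ‖ * (18 * L ^ 2 * ‖q₁ - q₂‖ * ((4 * ‖ζ‖) * s)) := by gcongr
  rcases hs.eq_or_lt with h0 | h0
  · rw [← h0]; positivity
  · refine le_of_mul_le_mul_right ?_ h0; nlinarith

lemma pair_smul_left (a : ℝ) (q : Hs L (-1)) (f : ℝ → ℂ) : pair L (a • q).1 f = a * pair L q.1 f := by
  rw [pair, pair, ← tsum_mul_left]; refine tsum_congr fun n => ?_; rw [← mul_assoc]
  rfl

lemma inv_mul_diagGreen_sub (hL : 1 ≤ L) {X : Hs L (-1)} (ha : a ≠ 0)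
    (hu : HasH1Deriv (green L q.1 k x) u') (hv : HasH1Deriv (green L (q + a • X).1 k x) v') (eu : ∀
    ψ ψ', HasH1Deriv ψ ψ' → form L q.1 (k ^ 2) (green L q.1 k x) u' ψ ψ' = ψ x) (ev : ∀ ψ ψ',
    HasH1Deriv ψ ψ' → form L (q + a • X).1 (k ^ 2) (green L (q + a • X).1 k x) v' ψ ψ' = ψ x) :
    (a : ℂ)⁻¹ * (diagGreen L (q + a • X).1 k x - diagGreen L q.1 k x) = -pair L X.1 fun t => green L
    (q + a • X).1 k x t * green L q.1 k x t := by
  have h := form_sub_eq_pair hL q (q + a • X) (k ^ 2) hv hu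
  rw [ev _ _ hu, form_comm, eu _ _ hv, add_sub_cancel_left, pair_smul_left] at h
  rw [diagGreen, diagGreen, ← neg_sub, h, mul_neg, inv_mul_cancel_left₀ (by exact_mod_cast ha)]

lemma exists_diagGreen_slope_bound (hL : 1 ≤ L) (hk : (k ^ 2).im ≠ 0) (R : ℝ) : ∃ C, 0 ≤ C ∧ ∀ q X :
    Hs L (-1), ‖q‖ ≤ R → ‖X‖ ≤ R → ∀ a b : ℝ, a ≠ 0 → b ≠ 0 → |a| ≤ 1 → |b| ≤ 1 → ∀ x, ‖(a : ℂ)⁻¹ *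
    (diagGreen L (q + a • X).1 k x - diagGreen L q.1 k x) - (b : ℂ)⁻¹ *
    (diagGreen L (q + b • X).1 k x - diagGreen L q.1 k x)‖ ≤ C * (|a| + |b|) := by
  obtain ⟨ζ, hζ⟩ := exists_coercive_of_im_ne_zero hL (R + R) hk
  refine ⟨18 * L ^ 2 * |R| * (144 * L ^ 2 * ‖ζ‖ ^ 2 * |R| * (4 * ‖ζ‖)), by positivity, fun q X hq hX a b ha hb ha1 hb1 x => ?_⟩
  have hR : 0 ≤ R := (norm_nonneg _).trans hq
  have hn : ∀ c : ℝ, |c| ≤ 1 → ‖q + c • X‖ ≤ R + R := fun c hc => by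
    refine (norm_add_le _ _).trans (add_le_add hq ?_); rw [norm_smul, norm_eq_abs]
    exact (mul_le_of_le_one_left (norm_nonneg _) hc).trans hX
  have h0 := hζ q (hq.trans (by linarith)); have hA := hζ _ (hn a ha1); have hB := hζ _ (hn b hb1)
  obtain ⟨u', hu, eu⟩ := Coercive.exists_deriv hL ⟨ζ, h0⟩ x
  obtain ⟨v', hv, ev⟩ := Coercive.exists_deriv hL ⟨ζ, hA⟩ x
  obtain ⟨w', hw, ew⟩ := Coercive.exists_deriv hL ⟨ζ, hB⟩ x
  rw [inv_mul_diagGreen_sub hL ha hu hv eu ev, inv_mul_diagGreen_sub hL hb hu hw eu ew, abs_of_nonneg hR,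
    neg_sub_neg]
  have e : (pair L X.1 fun t => green L (q + b • X).1 k x t * green L q.1 k x t) -
      (pair L X.1 fun t => green L (q + a • X).1 k x t * green L q.1 k x t) =
      pair L X.1 fun t => (green L (q + b • X).1 k x t - green L (q + a • X).1 k x t) *
        green L q.1 k x t := by
    have := pair_add_fun hL X hw (hv.const_mul (-1)) hu
    simp only [neg_mul, one_mul, ← sub_eq_add_neg] at this
    rw [this, sub_eq_add_neg, ← neg_one_mul (pair L X.1 _), ← pair_const_mul]
    simp only [neg_mul, one_mul]
  rw [e]; refine (norm_pair_le hL X (hw.sub hv) hu).trans ?_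
  have b1 := hB.sqrt_h1sq_sub_le hL hA hw hv ew ev; have b2 := h0.sqrt_h1sq_le hu eu
  have b3 : ‖q + b • X - (q + a • X)‖ ≤ (|a| + |b|) * R := by
    rw [add_sub_add_left_eq_sub, ← sub_smul, norm_smul, norm_eq_abs]
    refine mul_le_mul ?_ hX (norm_nonneg _) (by positivity); rw [add_comm]; exact abs_sub _ _
  calc _ ≤ 18 * L ^ 2 * R * ((144 * L ^ 2 * ‖ζ‖ ^ 2 * ((|a| + |b|) * R)) * (4 * ‖ζ‖)) := by
        gcongr; exact b1.trans (by gcongr)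
    _ = _ := by ring

end slope

section kdv
variable {c : ℤ → ℂ} {Q Q₁ Q₂ Q₃ s : ℝ → ℂ}

/-- `Q` is a periodic function with Fourier coefficients `c` and its first derivatives are
`Q₁`, `Q₂` and `Q₃`. -/
structure SmoothRep (L : ℝ) (c : ℤ → ℂ) (Q Q₁ Q₂ Q₃ : ℝ → ℂ) : Prop where
  prim : IsPrim Q Q₁
  prim₁ : IsPrim Q₁ Q₂
  prim₂ : IsPrim Q₂ Q₃
  cont : Continuous Q₃
  per : Periodic Q (2 * L)
  per₁ : Periodic Q₁ (2 * L)
  per₂ : Periodic Q₂ (2 * L)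
  coeffs_eq : coeffs L Q = c

lemma SmoothRep.l2Per (h : SmoothRep L c Q Q₁ Q₂ Q₃) : L2Per L Q :=
  l2Per_of_continuous h.prim.continuous h.per

lemma exists_smoothRep (hL : 0 < L) (h : RapidCurve fun _ => c) : ∃ Q Q₁ Q₂ Q₃, SmoothRep L c Q Q₁
    Q₂ Q₃ := by
  have h1 := h.ddx hL; have h2 := h1.ddx hL; have h3 := h2.ddx hL
  exact ⟨_, _, _, _, .of_hasDerivAt (hasDerivAt_synth (h.summable 0) (h1.summable 0))
      (continuous_synth (h1.summable 0)),
    .of_hasDerivAt (hasDerivAt_synth (h1.summable 0) (h2.summable 0))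
      (continuous_synth (h2.summable 0)),
    .of_hasDerivAt (hasDerivAt_synth (h2.summable 0) (h3.summable 0))
      (continuous_synth (h3.summable 0)), continuous_synth (h3.summable 0), periodic_synth hL _,
    periodic_synth hL _, periodic_synth hL _, coeffs_synth hL (h.summable 0)⟩

lemma SmoothRep.kdvField_eq (hL : 0 < L) (h : SmoothRep L c Q Q₁ Q₂ Q₃) : kdvField L c = coeffs L
    fun x => 6 * (Q x * Q₁ x) - Q₃ x := by
  have c0 := h.prim.continuous; have c1 := h.prim₁.continuous; have c2 := h.prim₂.continuous
  have e := coeffs_deriv_of_periodic ((h.prim₂.const_mul (-1)).add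
    ((h.prim.mul h.prim).const_mul 3)) (L := L) fun x => by rw [h.per x, h.per₂ x]
  have e2 : coeffs L (fun x => -1 * Q₂ x + 3 * (Q x * Q x)) =
      fun n => -1 * ddx L (ddx L c) n + 3 * conv c c n := by
    rw [← h.coeffs_eq, ← coeffs_deriv_of_periodic h.prim h.per,
      ← coeffs_deriv_of_periodic h.prim₁ h.per₁, ← coeffs_mul hL h.l2Per h.l2Per]
    ext n
    rw [← coeffs_const_mul, ← coeffs_const_mul, ← coeffs_add
      (Continuous.intervalIntegrable (by fun_prop) _ _)
      (Continuous.intervalIntegrable (by fun_prop) _ _)]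
  rw [e2] at e; ext n; rw [kdvField, ← congrFun e n]
  congr 1; ext x; ring

/-- The derivative of the Weyl function in the direction of the KdV vector field. -/
def weylKdV (lam : ℂ) (Q Q₁ Q₂ r : ℝ → ℂ) (x : ℝ) : ℂ :=
  2 * Q₁ x * r x + (2 * Q x - 4 * lam) * (Q x + lam - r x * r x) - Q₂ x

lemma SmoothRep.isPrim_weylKdV (h : SmoothRep L c Q Q₁ Q₂ Q₃)
    (hr : IsPrim r fun x => Q x + lam - r x * r x) : IsPrim (weylKdV lam Q Q₁ Q₂ r) fun x => 6 *
    (Q x * Q₁ x) - Q₃ x - 2 * r x * weylKdV lam Q Q₁ Q₂ r x := by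
  refine (((((h.prim₁.const_mul 2).mul hr).add (((h.prim.const_mul 2).sub
    (IsPrim.const (4 * lam))).mul ((h.prim.add (IsPrim.const lam)).sub (hr.mul hr)))).sub
    h.prim₂)).congr (fun x => rfl) fun x => ?_
  simp only [weylKdV]; ring

lemma SmoothRep.l2Per_weylKdV (h : SmoothRep L c Q Q₁ Q₂ Q₃)
    (hr : IsPrim r fun x => Q x + lam - r x * r x) (hp : Periodic r (2 * L)) : L2Per L
    (weylKdV lam Q Q₁ Q₂ r) :=
  l2Per_of_continuous (h.isPrim_weylKdV hr).continuous
    fun x => by simp only [weylKdV, h.per x, h.per₁ x, h.per₂ x, hp x]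

lemma SmoothRep.ddx_weylKdV (hL : 0 < L) (h : SmoothRep L c Q Q₁ Q₂ Q₃)
    (hr : IsPrim r fun x => Q x + lam - r x * r x) (hp : Periodic r (2 * L)) (hv : v =ᵐ[volume] r)
    (n : ℤ) : ddx L (coeffs L (weylKdV lam Q Q₁ Q₂ r)) n + coeffs L
    (fun x => 2 * v x * weylKdV lam Q Q₁ Q₂ r x) n = kdvField L c n := by
  have hw := h.isPrim_weylKdV hr; have c0 := h.prim.continuous; have c1 := h.prim₁.continuous
  have c2 := hw.continuous; have c3 := hr.continuous; have c4 := h.cont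
  rw [h.kdvField_eq hL, ← coeffs_deriv_of_periodic hw (h.l2Per_weylKdV hr hp).periodic,
    coeffs_congr_ae hL (f := fun x => 2 * v x * weylKdV lam Q Q₁ Q₂ r x) (g := fun x => 2 * r x * weylKdV lam Q Q₁ Q₂ r x)
      (ae_restrict_of_ae (hv.mono fun x hx => by simp only [hx])),
    ← coeffs_add (Continuous.intervalIntegrable (by fun_prop) _ _)
      (Continuous.intervalIntegrable (by fun_prop) _ _)]
  congr 1; ext x; ring

/-- The derivative of the diagonal Green's function in the direction of the KdV vector field. -/
def greenKdV (lam : ℂ) (Q Q₁ r s g : ℝ → ℂ) (x : ℝ) : ℂ :=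
  (2 * Q x - 4 * lam) * ((r x + s x) * g x) - 2 * (Q₁ x * g x)

lemma weylKdV_sub (hg : g x ≠ 0) (h : (g x)⁻¹ = r x - s x) : greenKdV lam Q Q₁ r s g x =
    -(g x * g x) * (weylKdV lam Q Q₁ Q₂ r x - weylKdV lam Q Q₁ Q₂ s x) := by
  have h1 : g x * (r x - s x) = 1 := by rw [← h, mul_inv_cancel₀ hg]
  simp only [weylKdV, greenKdV]
  linear_combination (-(g x * (2 * Q x - 4 * lam) * (r x + s x)) + 2 * Q₁ x * g x) * h1

lemma tendsto_diagGreen_slope (hL : 1 ≤ L) (hk : (k ^ 2).im ≠ 0) {X : Hs L (-1)}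
    (hX : X.1 = kdvField L q.1) (h : SmoothRep L q.1 Q Q₁ Q₂ Q₃) (hw : WeylPair L q.1 k Q r s) :
    Tendsto (fun τ : ℝ => l2 (perMeasure L) fun x => (τ : ℂ)⁻¹ *
    (diagGreen L (q + τ • X).1 k x - diagGreen L q.1 k x) - greenKdV (k ^ 2) Q Q₁ r s
    (diagGreen L q.1 k) x) (𝓝[≠] 0) (𝓝 0) := by
  have hL0 : 0 < L := by linarith
  have hc : ∀ q : Hs L (-1), Coercive L q k := coercive_of_im hL hk
  have hd : HasDerivWithinAt (fun τ : ℝ => q + τ • X) X univ 0 := by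
    have := ((hasDerivAt_id (0 : ℝ)).smul_const X).const_add q; rw [one_smul] at this
    exact this.hasDerivWithinAt
  have e0 : q + (0 : ℝ) • X = q := by rw [zero_smul, add_zero]
  have lw := h.l2Per_weylKdV hw.prim_left hw.per_left
  have lw' := h.l2Per_weylKdV hw.prim_right hw.per_right
  have T1 := tendsto_weyl_slope hL (Or.inl rfl) hd (hc _) lw fun n => by
    rw [e0, hX]; exact h.ddx_weylKdV hL0 hw.prim_left hw.per_left hw.ae_left n
  have T2 := tendsto_weyl_slope hL (Or.inr rfl) hd (hc _) lw' fun n => by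
    rw [e0, hX]; exact h.ddx_weylKdV hL0 hw.prim_right hw.per_right hw.ae_right n
  simp only [e0, sub_zero, ← Set.compl_eq_univ_sdiff] at T1 T2; set g := diagGreen L q.1 k with hg
  set W := fun x => weylKdV (k ^ 2) Q Q₁ Q₂ r x - weylKdV (k ^ 2) Q Q₁ Q₂ s x with hW
  have lW : L2Per L W := lw.sub lw'
  obtain ⟨K, hK, b1, b2⟩ := exists_diagGreen_bound hL hk (‖q‖ + ‖X‖)
  have hn : ∀ τ : ℝ, |τ| ≤ 1 → ‖q + τ • X‖ ≤ ‖q‖ + ‖X‖ := fun τ hτ => by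
    refine (norm_add_le _ _).trans (add_le_add le_rfl ?_); rw [norm_smul, norm_eq_abs]
    exact mul_le_of_le_one_left (norm_nonneg _) hτ
  have cg := fun q => (hc q).continuous_diagGreen hL
  have b : ∀ τ : ℝ, |τ| ≤ 1 → ∀ x, ‖diagGreen L (q + τ • X).1 k x‖ ≤ K := fun τ hτ x =>
    b1 _ (hn τ hτ) x x
  have b0 : ∀ x, ‖g x‖ ≤ K := fun x => b1 q (by linarith [norm_nonneg X]) x x
  have bd : ∀ τ : ℝ, |τ| ≤ 1 → ∀ x, ‖diagGreen L (q + τ • X).1 k x - g x‖ ≤ K * (|τ| * ‖X‖) :=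
    fun τ hτ x => by
      refine (b2 _ q (hn τ hτ) (by linarith [norm_nonneg X]) x x).trans (le_of_eq ?_)
      rw [add_sub_cancel_left, norm_smul, norm_eq_abs]
  have lv := fun q => (hc q).l2Per_weyl hL (Or.inl rfl)
  have lv' := fun q => (hc q).l2Per_weyl hL (Or.inr rfl)
  have hT : Tendsto (fun τ : ℝ => K * K * (l2 (perMeasure L) (fun x => (τ : ℂ)⁻¹ *
        (weyl L (q + τ • X).1 k 1 x - weyl L q.1 k 1 x) - weylKdV (k ^ 2) Q Q₁ Q₂ r x) +
      l2 (perMeasure L) fun x => (τ : ℂ)⁻¹ *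
        (weyl L (q + τ • X).1 k (-1) x - weyl L q.1 k (-1) x) - weylKdV (k ^ 2) Q Q₁ Q₂ s x) +
      K * (|τ| * ‖X‖) * K * l2 (perMeasure L) W) (𝓝[≠] 0) (𝓝 0) := by
    have t0 : Tendsto (fun τ : ℝ => |τ|) (𝓝[≠] 0) (𝓝 0) := by
      simpa using (continuous_abs.tendsto (0 : ℝ)).mono_left nhdsWithin_le_nhds
    have := ((T1.add T2).const_mul (K * K)).add
      ((((t0.mul_const ‖X‖).const_mul K).mul_const K).mul_const (l2 (perMeasure L) W))
    simpa using this
  refine squeeze_zero' (.of_forall fun _ => l2_nonneg _ _) ?_ hT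
  have hev : ∀ᶠ τ : ℝ in 𝓝[≠] 0, |τ| ≤ 1 := by
    filter_upwards [nhdsWithin_le_nhds (Metric.closedBall_mem_nhds (0 : ℝ) one_pos)] with τ hτ
    simpa using hτ
  filter_upwards [hev] with τ hτ
  have l1 := (((lv (q + τ • X)).sub (lv q)).const_mul (τ : ℂ)⁻¹).sub lw
  have l2' := (((lv' (q + τ • X)).sub (lv' q)).const_mul (τ : ℂ)⁻¹).sub lw'
  set E : ℝ → ℂ := fun x => ((τ : ℂ)⁻¹ * (weyl L (q + τ • X).1 k 1 x - weyl L q.1 k 1 x) -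
    weylKdV (k ^ 2) Q Q₁ Q₂ r x) - ((τ : ℂ)⁻¹ *
        (weyl L (q + τ • X).1 k (-1) x - weyl L q.1 k (-1) x) - weylKdV (k ^ 2) Q Q₁ Q₂ s x) with hE
  have lE : L2Per L E := l1.sub l2'
  have e : (fun x => (τ : ℂ)⁻¹ * (diagGreen L (q + τ • X).1 k x - g x) -
      greenKdV (k ^ 2) Q Q₁ r s g x) = fun x => -(diagGreen L (q + τ • X).1 k x * g x) * E x -
        ((diagGreen L (q + τ • X).1 k x - g x) * g x) * W x := by
    ext x; have z := (hc q).diagGreen_ne_zero hL x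
    have z' := (hc (q + τ • X)).diagGreen_ne_zero hL x
    have s1 : weyl L (q + τ • X).1 k 1 x = weyl L (q + τ • X).1 k (-1) x +
        (diagGreen L (q + τ • X).1 k x)⁻¹ := by rw [← (hc _).weyl_sub hL]; ring
    have s2 : weyl L q.1 k 1 x = weyl L q.1 k (-1) x + (g x)⁻¹ := by
      rw [hg, ← (hc _).weyl_sub hL]; ring
    rw [weylKdV_sub (Q₂ := Q₂) z (hw.inv_eq x), hE, hW]; simp only [s1, s2]; rw [← hg] at z ⊢
    field_simp; ring
  rw [e]
  have m1 : Continuous fun x => -(diagGreen L (q + τ • X).1 k x * g x) := ((cg _).mul (cg _)).neg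
  have m2 : Continuous fun x => (diagGreen L (q + τ • X).1 k x - g x) * g x :=
    ((cg _).sub (cg _)).mul (cg _)
  refine (l2_sub_le (memLp_per_bdd_mul lE.memLp m1) (memLp_per_bdd_mul lW.memLp m2)).trans
    (add_le_add ((l2_mul_le lE.memLp m1 (B := K * K) fun x => ?_).trans (mul_le_mul_of_nonneg_left
      (l2_sub_le l1.memLp l2'.memLp) (by positivity))) (l2_mul_le lW.memLp m2 fun x => ?_))
  · rw [norm_neg, norm_mul]; exact mul_le_mul (b τ hτ x) (b0 x) (norm_nonneg _) hK
  · rw [norm_mul]; exact mul_le_mul (bd τ hτ x) (b0 x) (norm_nonneg _) (by positivity)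

end kdv

end

section

variable {c : ℤ → ℂ} {Q Q₁ Q₂ Q₃ s : ℝ → ℂ}

lemma continuous_greenKdV (h : SmoothRep L c Q Q₁ Q₂ Q₃) (hg : Continuous g) (hr : Continuous r)
    (hs : Continuous s) : Continuous (greenKdV lam Q Q₁ r s g) := by
  have := h.prim.continuous; have := h.prim₁.continuous; unfold greenKdV
  fun_prop

lemma exists_diagGreen_kdv_bound (hL : 1 ≤ L) (hk : (k ^ 2).im ≠ 0) (R : ℝ) : ∃ C, 0 ≤ C ∧ ∀ q X :
    Hs L (-1), ‖q‖ ≤ R → ‖X‖ ≤ R → X.1 = kdvField L q.1 → ∀ Q Q₁ Q₂ Q₃ r s, SmoothRep L q.1 Q Q₁ Q₂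
    Q₃ → WeylPair L q.1 k Q r s → ∀ τ : ℝ, τ ≠ 0 → |τ| ≤ 1 → l2 (perMeasure L) (fun x => (τ : ℂ)⁻¹ *
    (diagGreen L (q + τ • X).1 k x - diagGreen L q.1 k x) - greenKdV (k ^ 2) Q Q₁ r s
    (diagGreen L q.1 k) x) ≤ C * |τ| := by
  have hL0 : 0 < L := by linarith
  obtain ⟨C, hC, h⟩ := exists_diagGreen_slope_bound hL hk R
  refine ⟨√(2 * L) * C, by positivity, fun q X hq hX eX Q Q₁ Q₂ Q₃ r s hQ hw τ hτ hτ1 => ?_⟩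
  have hc : ∀ q : Hs L (-1), Coercive L q k := coercive_of_im hL hk
  have cg := fun q => (hc q).continuous_diagGreen hL
  have cP := continuous_greenKdV (lam := k ^ 2) hQ (cg q) hw.prim_left.continuous
    hw.prim_right.continuous
  have T := tendsto_diagGreen_slope hL hk eX hQ hw
  have t0 : Tendsto (fun σ : ℝ => √(2 * L) * (C * (|τ| + |σ|))) (𝓝[≠] 0)
      (𝓝 (√(2 * L) * (C * (|τ| + 0)))) :=
    (((abs_zero (α := ℝ) ▸ (continuous_abs.tendsto (0 : ℝ)).mono_left
      nhdsWithin_le_nhds).const_add |τ|).const_mul _).const_mul _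
  have t1 := t0.add T; rw [add_zero, add_zero, ← mul_assoc] at t1; refine ge_of_tendsto t1 ?_
  filter_upwards [nhdsWithin_le_nhds (Metric.closedBall_mem_nhds (0 : ℝ) one_pos),
    self_mem_nhdsWithin] with σ hσ hσ0
  have hσ1 : |σ| ≤ 1 := by simpa using hσ
  have m1 : MemLp (fun x => (τ : ℂ)⁻¹ * (diagGreen L (q + τ • X).1 k x - diagGreen L q.1 k x) -
      (σ : ℂ)⁻¹ * (diagGreen L (q + σ • X).1 k x - diagGreen L q.1 k x)) 2 (perMeasure L) :=
    memLp_of_continuous (((((cg _).sub (cg _))).const_mul _).sub (((cg _).sub (cg _)).const_mul _))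
  have m2 : MemLp (fun x => (σ : ℂ)⁻¹ * (diagGreen L (q + σ • X).1 k x - diagGreen L q.1 k x) -
      greenKdV (k ^ 2) Q Q₁ r s (diagGreen L q.1 k) x) 2 (perMeasure L) :=
    memLp_of_continuous ((((cg _).sub (cg _)).const_mul _).sub cP)
  have := (l2_add_le m1 m2).trans (add_le_add (l2_le_of_bound hL0 (B := C * (|τ| + |σ|))
    (by positivity) (.of_forall (h q X hq hX τ σ hτ hσ0 hτ1 hσ1))) le_rfl)
  simpa only [sub_add_sub_cancel] using this

lemma SmoothRep.ddx_greenKdV (hL : 0 < L) (h : SmoothRep L c Q Q₁ Q₂ Q₃) (pr : Periodic r (2 * L))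
    (ps : Periodic s (2 * L)) (pg : Periodic g (2 * L))
    (hr : IsPrim r (fun x => Q x + lam - r x * r x))
    (hs : IsPrim s (fun x => Q x + lam - s x * s x)) (hg : IsPrim g fun x => (r x + s x) * g x) :
    ddx L (coeffs L (greenKdV lam Q Q₁ r s g)) = kdvLin L c (ddx L (coeffs L g)) := by
  have cg := hg.continuous; have cr := hr.continuous; have cs := hs.continuous
  have c0 := h.prim.continuous; have c1 := h.prim₁.continuous
  have pg1 : Periodic (fun x => (r x + s x) * g x) (2 * L) := fun x => by
    simp only [pr x, ps x, pg x]
  have lg1 : L2Per L fun x => (r x + s x) * g x := l2Per_of_continuous (by fun_prop) pg1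
  have e1 := coeffs_deriv_of_periodic hg pg; refine congrArg (ddx L) (funext fun n => ?_)
  have e2 := ddx_of_prims hL h.l2Per pr ps pg hr hs hg n
  rw [← coeffs_mul hL h.l2Per (l2Per_of_continuous cg pg), ← coeffs_deriv_of_periodic
    (h.prim.mul hg) fun x => by simp only [h.per x, pg x]] at e2
  rw [← h.coeffs_eq, e2, ← e1, ← coeffs_mul hL h.l2Per lg1, ← coeffs_mul hL lg1 h.l2Per,
    HkFlow.coeffs_add (Continuous.intervalIntegrable (by fun_prop) _ _)
      (Continuous.intervalIntegrable (by fun_prop) _ _)]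
  have e3 : (fun x => (r x + s x) * g x * Q x) = fun x => Q x * ((r x + s x) * g x) := by
    ext x; ring
  have e4 : coeffs L (greenKdV lam Q Q₁ r s g) n = 2 * coeffs L (fun x => Q x * ((r x + s x) * g x)) n
      - 4 * lam * coeffs L (fun x => (r x + s x) * g x) n - 2 * coeffs L (fun x => Q₁ x * g x) n := by
    rw [← coeffs_const_mul, ← coeffs_const_mul, ← coeffs_const_mul,
      ← coeffs_sub (Continuous.intervalIntegrable (by fun_prop) _ _)
        (Continuous.intervalIntegrable (by fun_prop) _ _),
      ← coeffs_sub (Continuous.intervalIntegrable (by fun_prop) _ _)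
        (Continuous.intervalIntegrable (by fun_prop) _ _)]
    congr 1; ext x; simp only [greenKdV]
    ring
  rw [e3, e4]; ring

lemma SmoothRep.kdvLin_coeffs (hL : 0 < L) (h : SmoothRep L c Q Q₁ Q₂ Q₃) (hf : L2Per L f) : kdvLin
    L c (coeffs L f) = ddx L fun n => -1 * ddx L (ddx L (coeffs L f)) n + 6 * coeffs L
    (fun x => Q x * f x) n := by
  refine congrArg (ddx L) (funext fun n => ?_)
  rw [← h.coeffs_eq, ← coeffs_mul hL hf h.l2Per, ← coeffs_mul hL h.l2Per hf]
  have e : (fun x => f x * Q x) = fun x => Q x * f x := by ext x; ring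
  rw [e]; ring

lemma SmoothRep.kdvLin_comb (hL : 0 < L) {e : ℝ → ℂ} (h : SmoothRep L c Q Q₁ Q₂ Q₃) (hf : L2Per L f)
    (he : L2Per L e) (a b : ℂ) (n : ℤ) : kdvLin L c (fun n => a * coeffs L f n + b * coeffs L e n) n
    = a * kdvLin L c (coeffs L f) n + b * kdvLin L c (coeffs L e) n := by
  have hfe := (hf.const_mul a).add (he.const_mul b)
  have e1 : (fun n => a * coeffs L f n + b * coeffs L e n) = coeffs L fun x => a * f x + b * e x := by
    ext n
    rw [L2Per.coeffs_add hL (hf.const_mul a) (he.const_mul b), coeffs_const_mul, coeffs_const_mul]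
  have e2 : coeffs L (fun x => Q x * (a * f x + b * e x)) n =
      a * coeffs L (fun x => Q x * f x) n + b * coeffs L (fun x => Q x * e x) n := by
    rw [← coeffs_const_mul, ← coeffs_const_mul, ← HkFlow.coeffs_add
      ((h.l2Per.integrable_mul hL hf _ _).const_mul a) ((h.l2Per.integrable_mul hL he _ _).const_mul b)]
    congr 1; ext x; ring
  rw [e1, h.kdvLin_coeffs hL hfe, h.kdvLin_coeffs hL hf, h.kdvLin_coeffs hL he, ← e1]
  simp only [ddx, e2]; ring

lemma Hs.norm_le_l2 (hL : 1 ≤ L) {p : Hs L (-1)} (hf : MemLp f 2 (perMeasure L))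
    (h : p.1 = ddx L (coeffs L f)) : ‖p‖ ≤ l2 (perMeasure L) f := by
  refine abs_le_of_sq_le_sq' ?_ (l2_nonneg _ _) |>.2; rw [Hs.norm_sq, h]
  refine (summable_ddx (by linarith) hf).2.trans (mul_le_of_le_one_left (by positivity) ?_)
  exact inv_le_one_of_one_le₀ (by linarith)

lemma exists_movingField_kdv_bound (hL : 1 ≤ L) (hk : (k ^ 2).im ≠ 0) (R : ℝ) : ∃ C, 0 ≤ C ∧ ∀ q X
    Y : Hs L (-1), ‖q‖ ≤ R → ‖X‖ ≤ R → (RapidCurve fun _ => q.1) → X.1 = kdvField L q.1 → Y.1 =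
    kdvLin L q.1 (movingField L k q).1 → ∀ τ : ℝ, |τ| ≤ 1 → ‖movingField L k (q + τ • X) -
    movingField L k q - τ • Y‖ ≤ C * τ ^ 2 := by
  have hL0 : 0 < L := by linarith
  have hk' := im_conj_sq_ne hk; obtain ⟨C, hC, h⟩ := exists_diagGreen_kdv_bound hL hk R
  obtain ⟨C', hC', h'⟩ := exists_diagGreen_kdv_bound hL hk' R
  refine ⟨‖8 * k ^ 5‖ * C + ‖8 * conj k ^ 5‖ * C', by positivity,
    fun q X Y hq hX hr eX eY τ hτ => ?_⟩
  rcases eq_or_ne τ 0 with rfl | hτ0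
  · simp
  obtain ⟨Q, Q₁, Q₂, Q₃, hQ⟩ := exists_smoothRep hL0 hr; have hc := coercive_of_im hL hk
  have hc' := coercive_of_im hL hk'
  obtain ⟨r, s, hw⟩ := (hc q).exists_weylPair hL hQ.l2Per hQ.coeffs_eq
  obtain ⟨r', s', hw'⟩ := (hc' q).exists_weylPair hL hQ.l2Per hQ.coeffs_eq
  have cg := fun q => (hc q).continuous_diagGreen hL
  have cg' := fun q => (hc' q).continuous_diagGreen hL; have pg := (hc q).diagGreen_periodic hL
  have pg' := (hc' q).diagGreen_periodic hL; have cr := hw.prim_left.continuous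
  have cs := hw.prim_right.continuous; have cr' := hw'.prim_left.continuous
  have cs' := hw'.prim_right.continuous
  have cP := continuous_greenKdV (lam := k ^ 2) hQ (cg q) cr cs
  have cP' := continuous_greenKdV (lam := conj k ^ 2) hQ (cg' q) cr' cs'
  have b := h q X hq hX eX _ _ _ _ _ _ hQ hw τ hτ0 hτ
  have b' := h' q X hq hX eX _ _ _ _ _ _ hQ hw' τ hτ0 hτ
  have eP := hQ.ddx_greenKdV hL0 hw.per_left hw.per_right pg hw.prim_left hw.prim_right hw.prim_green
  have eP' := hQ.ddx_greenKdV hL0 hw'.per_left hw'.per_right pg' hw'.prim_left hw'.prim_right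
    hw'.prim_green
  have eg := coeffs_deriv_of_periodic hw.prim_green pg
  have eg' := coeffs_deriv_of_periodic hw'.prim_green pg'
  have eY' : ∀ n, Y.1 n = 8 * k ^ 5 * ddx L (coeffs L
      (greenKdV (k ^ 2) Q Q₁ r s (diagGreen L q.1 k))) n + 8 * conj k ^ 5 * ddx L (coeffs L
      (greenKdV (conj k ^ 2) Q Q₁ r' s' (diagGreen L q.1 (conj k)))) n := fun n => by
    rw [eY, eP, eP', show (movingField L k q).1 = _ from funext (movingField_apply hL hk q), ← eg,
      ← eg']
    exact hQ.kdvLin_comb hL0 (l2Per_of_continuous (by fun_prop) fun x => by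
        simp only [hw.per_left x, hw.per_right x, pg x])
      (l2Per_of_continuous (by fun_prop) fun x => by
        simp only [hw'.per_left x, hw'.per_right x, pg' x]) _ _ n
  generalize greenKdV (k ^ 2) Q Q₁ r s (diagGreen L q.1 k) = P at *
  generalize greenKdV (conj k ^ 2) Q Q₁ r' s' (diagGreen L q.1 (conj k)) = P' at *
  set E : ℝ → ℂ := fun x => (τ : ℂ)⁻¹ * (diagGreen L (q + τ • X).1 k x - diagGreen L q.1 k x) - P x
    with hE
  set E' : ℝ → ℂ := fun x => (τ : ℂ)⁻¹ * (diagGreen L (q + τ • X).1 (conj k) x -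
    diagGreen L q.1 (conj k) x) - P' x with hE'
  have mE : Continuous E := (((cg _).sub (cg _)).const_mul _).sub cP
  have mE' : Continuous E' := (((cg' _).sub (cg' _)).const_mul _).sub cP'
  have hτc : (τ : ℂ) ≠ 0 := by exact_mod_cast hτ0
  have key : (movingField L k (q + τ • X) - movingField L k q - τ • Y).1 = ddx L (coeffs L fun x =>
      (τ : ℂ) * (8 * k ^ 5 * E x + 8 * conj k ^ 5 * E' x)) := by
    ext n; change (movingField L k (q + τ • X)).1 n - (movingField L k q).1 n - τ • Y.1 n = _
    rw [movingField_apply hL hk, movingField_apply hL hk, eY', real_smul]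
    have i : ∀ {f : ℝ → ℂ}, Continuous f → IntervalIntegrable f volume (-L) L :=
      fun hf => hf.intervalIntegrable _ _
    have hco : ∀ {f g P : ℝ → ℂ}, Continuous f → Continuous g → Continuous P →
        coeffs L (fun x => (τ : ℂ)⁻¹ * (f x - g x) - P x) n =
          (τ : ℂ)⁻¹ * (coeffs L f n - coeffs L g n) - coeffs L P n := by
      intro f g P hf hg hP
      rw [coeffs_sub (i (f := fun x => (τ : ℂ)⁻¹ * (f x - g x)) ((hf.sub hg).const_mul _)) (i hP),
        coeffs_const_mul, coeffs_sub (i hf) (i hg)]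
    simp only [ddx]
    rw [coeffs_const_mul, HkFlow.coeffs_add (i (mE.const_mul _)) (i (mE'.const_mul _)),
      coeffs_const_mul, coeffs_const_mul, hE, hE', hco (cg _) (cg _) cP, hco (cg' _) (cg' _) cP']
    field_simp; ring
  refine (Hs.norm_le_l2 hL (memLp_of_continuous (by fun_prop)) key).trans ?_
  rw [l2_const_mul, norm_real, norm_eq_abs, ← sq_abs]
  have := l2_add_le (memLp_of_continuous (L := L) (mE.const_mul (8 * k ^ 5)))
    (memLp_of_continuous (mE'.const_mul (8 * conj k ^ 5)))
  rw [l2_const_mul, l2_const_mul] at this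
  calc _ ≤ |τ| * (‖8 * k ^ 5‖ * (C * |τ|) + ‖8 * conj k ^ 5‖ * (C' * |τ|)) := by
        gcongr; exact this.trans (by gcongr)
    _ = _ := by ring

end

section

section ode
variable {E : Type*} [NormedAddCommGroup E] {N : E → E} {Ψ : ℝ → E → E}

lemma BddLip.continuous (h : BddLip N) : Continuous N := by
  rw [continuous_iff_continuousAt]; intro q; obtain ⟨K, hK, -, hl⟩ := h (‖q‖ + 1)
  have : LipschitzOnWith ⟨K, hK⟩ N (Metric.ball 0 (‖q‖ + 1)) :=
    LipschitzOnWith.of_dist_le_mul fun a ha b hb => by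
      rw [dist_eq_norm, dist_eq_norm]
      exact hl a b (mem_ball_zero_iff.1 ha).le (mem_ball_zero_iff.1 hb).le
  exact this.continuousOn.continuousAt (Metric.isOpen_ball.mem_nhds (by simp))

variable [NormedSpace ℝ E]

lemma IsFlow.hasDerivAt_comp (h : IsFlow N Ψ) (hN : BddLip N) {q : ℝ → E} {F Y : ℝ → E}
    (hq : HasDerivAt q (F 0) t) (hF : ∀ σ, HasDerivAt F (Y σ) σ) (hC : ∀ σ ∈ Icc (-|s|) |s|, ∀ τ :
    ℝ, |τ| ≤ 1 → ‖N (Ψ σ (q t) + τ • F σ) - N (Ψ σ (q t)) - τ • Y σ‖ ≤ C * τ ^ 2) : HasDerivAt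
    (fun t => Ψ s (q t)) (F s) t := by
  obtain ⟨B, hB, hb⟩ := h.bound |s| (‖q t‖ + 1)
  obtain ⟨D, hD⟩ := isCompact_Icc.exists_bound_of_continuousOn (s := Icc (-|s|) |s|)
    fun σ _ => (hF σ).continuousAt.continuousWithinAt
  obtain ⟨K, hK, -, hl⟩ := hN (B + D)
  have hs0 : (0 : ℝ) ∈ Icc (-|s|) |s| := ⟨by simp, abs_nonneg s⟩
  have hD0 : 0 ≤ D := (norm_nonneg _).trans (hD 0 hs0)
  have hmem : ∀ r ∈ Icc (0 : ℝ) 1, r * s ∈ Icc (-|s|) |s| := fun r hr => abs_le.1 (by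
    rw [abs_mul, abs_of_nonneg hr.1]
    exact mul_le_of_le_one_left (abs_nonneg s) hr.2)
  set K' : ℝ := |s| * K + 1 with hK'; have hK0 : 0 < K' := by positivity
  have hsm : ∀ {f : ℝ → E} {f' : E} {r : ℝ}, HasDerivAt f f' (r * s) →
      HasDerivAt (fun r => f (r * s)) (s • f') r := by
    intro f f' r hf; exact HasDerivAt.scomp (h := fun r => r * s) r hf (hasDerivAt_mul_const s)
  have hmain : ∀ᶠ τ in 𝓝 (0 : ℝ), ‖Ψ s (q (t + τ)) - Ψ s (q t) - τ • F s‖ ≤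
      ‖q (t + τ) - q t - τ • F 0‖ * Real.exp K' + |s| * C * τ ^ 2 / K' * (Real.exp K' - 1) := by
    have hc : Tendsto (fun τ => q (t + τ)) (𝓝 0) (𝓝 (q t)) := by
      have : Tendsto (fun τ => t + τ) (𝓝 0) (𝓝 t) := by
        simpa using (continuous_const_add t).tendsto (0 : ℝ)
      exact hq.continuousAt.tendsto.comp this
    filter_upwards [Metric.closedBall_mem_nhds (0 : ℝ) one_pos,
      hc.norm.eventually (ge_mem_nhds (lt_add_one ‖q t‖))] with τ hτ hqτ
    have hτ1 : |τ| ≤ 1 := by simpa using hτ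
    have bF : ∀ r ∈ Icc (0 : ℝ) 1, ‖Ψ (r * s) (q t) + τ • F (r * s)‖ ≤ B + D := fun r hr => by
      refine (norm_add_le _ _).trans (add_le_add (hb _ (by linarith) _ (hmem r hr)) ?_)
      rw [norm_smul, norm_eq_abs]
      exact (mul_le_of_le_one_left (norm_nonneg _) hτ1).trans (hD _ (hmem r hr))
    have dF : ∀ r, HasDerivAt (fun r => Ψ (r * s) (q t) + τ • F (r * s))
        (s • (N (Ψ (r * s) (q t)) + τ • Y (r * s))) r := fun r => by
      exact hsm ((h.hasDerivAt (r * s) (q t)).add ((hF (r * s)).const_smul τ))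
    have dG : ∀ r, HasDerivAt (fun r => Ψ (r * s) (q (t + τ))) (s • N (Ψ (r * s) (q (t + τ)))) r :=
      fun r => hsm (h.hasDerivAt (r * s) (q (t + τ)))
    have key := dist_le_of_approx_trajectories_ODE_of_mem (a := 0) (b := 1) (K := ⟨K', hK0.le⟩)
      (v := fun _ x => s • N x) (s := fun _ => {x | ‖x‖ ≤ B + D})
      (f := fun r => Ψ (r * s) (q (t + τ))) (g := fun r => Ψ (r * s) (q t) + τ • F (r * s))
      (εf := 0) (εg := |s| * C * τ ^ 2) (δ := ‖q (t + τ) - q t - τ • F 0‖)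
      (fun r _ => LipschitzOnWith.of_dist_le_mul fun a ha b hb => by
        rw [dist_eq_norm, dist_eq_norm, ← smul_sub, norm_smul, norm_eq_abs]
        refine (mul_le_mul_of_nonneg_left (hl a b ha hb) (abs_nonneg s)).trans ?_; rw [← mul_assoc]
        exact mul_le_mul_of_nonneg_right (by change _ ≤ K'; linarith) (norm_nonneg _))
      (fun r _ => (dG r).continuousAt.continuousWithinAt) (fun r _ => (dG r).hasDerivWithinAt)
      (fun r _ => (dist_self _).le) (fun r hr => (hb _ hqτ _ (hmem r ⟨hr.1, hr.2.le⟩)).trans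
        (by linarith))
      (fun r _ => (dF r).continuousAt.continuousWithinAt) (fun r _ => (dF r).hasDerivWithinAt)
      (fun r hr => by
        rw [dist_eq_norm, ← smul_sub, norm_smul, norm_eq_abs, mul_assoc, norm_sub_rev, ← sub_sub]
        exact mul_le_mul_of_nonneg_left (hC _ (hmem r ⟨hr.1, hr.2.le⟩) τ hτ1) (abs_nonneg s))
      (fun r hr => bF r ⟨hr.1, hr.2.le⟩)
      (by simp only [zero_mul, h.init, dist_eq_norm, ← sub_sub, le_refl]) 1 (by simp)
    change _ ≤ gronwallBound _ K' _ _ at key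
    rw [gronwallBound_of_K_ne_0 hK0.ne', dist_eq_norm] at key
    simpa only [one_mul, mul_one, sub_zero, zero_add, ← sub_sub] using key
  rw [hasDerivAt_iff_isLittleO_nhds_zero] at hq ⊢
  have h1 : (fun τ : ℝ => τ ^ 2) =o[𝓝 0] fun τ => τ := by
    simpa using Asymptotics.isLittleO_pow_pow (𝕜 := ℝ) (m := 1) (n := 2) (by norm_num)
  have h2 := (hq.norm_left.mul_isBigO (Asymptotics.isBigO_refl (fun _ : ℝ => Real.exp K') (𝓝 0))).trans_isBigO
    (by simpa using! Asymptotics.isBigO_const_mul_self (Real.exp K') (fun τ : ℝ => τ) (𝓝 0) |>.congr_left fun τ => mul_comm _ _)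
  have h3 := h1.const_mul_left (|s| * C / K' * (Real.exp K' - 1))
  refine (Asymptotics.IsBigO.of_bound' ?_).trans_isLittleO (h2.add h3)
  filter_upwards [hmain] with τ hτ
  refine hτ.trans ((le_of_eq ?_).trans (le_abs_self _)); ring

end ode

section commute
variable {Ψ : ℝ → Hs L (-1) → Hs L (-1)} {u : ℝ → Hs L (-1)}

lemma kdvLin_conj {a b : ℤ → ℂ} (ha : ∀ n, a (-n) = conj (a n)) (hb : ∀ n, b (-n) = conj (b n))
    (n : ℤ) : kdvLin L a b (-n) = conj (kdvLin L a b n) :=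
  ddx_conj (fun n => by
    rw [ddx_conj (ddx_conj hb), conv_conj ha hb, conv_conj hb ha]
    simp [conj_ofNat]) n

lemma RapidCurve.toHs_coe (hL : 0 < L) {c : ℝ → ℤ → ℂ} (h : RapidCurve c)
    (hc : ∀ t n, c t (-n) = conj (c t n)) (t : ℝ) : (toHs L (c t)).1 = c t := by
  obtain ⟨C, hC⟩ := h.rapid |t| 0; exact HkFlow.toHs_coe hL (hc t) (C := C) fun n => by grind

lemma RapidCurve.congr {a b : ℝ → ℤ → ℂ} (h : RapidCurve a) (e : ∀ t, b t = a t) : RapidCurve b := by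
  rwa [show b = a from funext e]

lemma RapidCurve.toHs_kdvField_coe (hL : 0 < L) {p : ℝ → Hs L (-1)}
    (h : RapidCurve fun t => (p t).1) (t : ℝ) : (toHs L (HkFlow.kdvField L (p t).1)).1 =
    HkFlow.kdvField L (p t).1 :=
  (h.kdvField hL).toHs_coe hL (fun t => kdvField_conj (p t).conj_coeff) t

lemma RapidCurve.toHs_kdvLin_coe (hL : 0 < L) {p X : ℝ → Hs L (-1)}
    (h : RapidCurve fun t => (p t).1) (h' : RapidCurve fun t => (X t).1) (t : ℝ) :
    (toHs L (HkFlow.kdvLin L (p t).1 (X t).1)).1 = HkFlow.kdvLin L (p t).1 (X t).1 :=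
  (h.kdvLin hL h').toHs_coe hL (fun t => kdvLin_conj (p t).conj_coeff (X t).conj_coeff) t

lemma RapidCurve.hasDerivAt_toHs_kdvField (hL : 0 < L) {p X : ℝ → Hs L (-1)}
    (h : RapidCurve fun t => (p t).1) (h' : RapidCurve fun t => (X t).1)
    (hd : ∀ n t, HasDerivAt (fun t => (p t).1 n) ((X t).1 n) t) (t : ℝ) : HasDerivAt
    (fun t => toHs L (HkFlow.kdvField L (p t).1)) (toHs L (HkFlow.kdvLin L (p t).1 (X t).1)) t :=
  RapidCurve.hasDerivAt_hs hL (X := fun t => toHs L (HkFlow.kdvLin L (p t).1 (X t).1))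
    ((h.kdvLin hL h').congr (h.toHs_kdvLin_coe hL h')) (fun n t => by
      simp only [h.toHs_kdvField_coe hL, h.toHs_kdvLin_coe hL h']
      exact h.hasDerivAt_kdvField h' hd n t) t

lemma RapidKdV.hasDerivAt_hs (hL : 0 < L) (h : RapidKdV L fun t => (u t).1) (t : ℝ) : HasDerivAt u
    (toHs L (HkFlow.kdvField L (u t).1)) t :=
  RapidCurve.hasDerivAt_hs hL (X := fun t => toHs L (HkFlow.kdvField L (u t).1))
    ((h.toRapidCurve.kdvField hL).congr (h.toRapidCurve.toHs_kdvField_coe hL)) (fun n t => by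
      rw [h.toRapidCurve.toHs_kdvField_coe hL]
      exact h.hasDerivAt n t) t

lemma IsFlow.rapidCurve (hL : 1 ≤ L) (hk : (k ^ 2).im ≠ 0) (h : IsFlow (movingField L k) Ψ)
    (hu : RapidCurve fun t => (u t).1) (t : ℝ) : (RapidCurve fun σ => (Ψ σ (u t)).1) ∧ RapidCurve
    fun σ => (movingField L k (Ψ σ (u t))).1 := by
  have hmem : ∀ {S σ : ℝ}, σ ∈ Icc (-S) S → (σ, t) ∈ rect S |t| := fun hσ =>
    ⟨hσ, neg_abs_le t, le_abs_self t⟩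
  have hc : Continuous fun σ => movingField L k (Ψ σ (u t)) :=
    (bddLip_movingField hL hk).continuous.comp
      (continuous_iff_continuousAt.2 fun σ => (h.hasDerivAt σ (u t)).continuousAt)
  refine ⟨⟨fun n => continuous_iff_continuousAt.2 fun σ =>
    (h.hasDerivAt_coeff (u t) n σ).continuousAt, fun S j => ?_⟩,
    ⟨fun n => (coeffCLM L (-1) n).continuous.comp hc, fun S j => ?_⟩⟩
  · obtain ⟨C, hC⟩ := (h.rapidOn (S := S) (T := |t|) hL hk hu).1 j
    exact ⟨C, fun σ hσ => hC (σ, t) (hmem hσ)⟩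
  · have : ∀ ϰ ∈ ({k, conj k} : Set ℂ), Decay (j + 1) (Icc (-S) S) fun σ =>
        coeffs L (diagGreen L (Ψ σ (u t)).1 ϰ) := fun ϰ hϰ => by
      obtain ⟨C, hC⟩ := (h.rapidOn (S := S) (T := |t|) hL hk hu).2 ϰ hϰ (j + 1)
      exact ⟨C, fun σ hσ => hC (σ, t) (hmem hσ)⟩
    exact decay_movingField hL hk this

lemma RapidCurve.const_at {c : ℝ → ℤ → ℂ} (h : RapidCurve c) (t : ℝ) : RapidCurve fun _ => c t :=
  ⟨fun _ => continuous_const, fun T j => by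
    obtain ⟨C, hC⟩ := h.rapid |t| j
    exact ⟨C, fun _ _ => hC t ⟨neg_abs_le t, le_abs_self t⟩⟩⟩

lemma IsFlow.hasDerivAt_comp_kdv (hL : 1 ≤ L) (hk : (k ^ 2).im ≠ 0) (h : IsFlow (movingField L k) Ψ)
    (hu : RapidKdV L fun t => (u t).1) (s t : ℝ) : HasDerivAt (fun t => Ψ s (u t))
    (toHs L (kdvField L (Ψ s (u t)).1)) t := by
  have hL0 : 0 < L := by linarith
  obtain ⟨hζ, hNζ⟩ := h.rapidCurve hL hk hu.toRapidCurve t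
  have hF := hζ.hasDerivAt_toHs_kdvField hL0 hNζ (h.hasDerivAt_coeff (u t))
  have hq := hu.hasDerivAt_hs hL0 t
  nth_rw 1 [← h.init (u t)] at hq
  obtain ⟨B, hB⟩ := isCompact_Icc.exists_bound_of_continuousOn (s := Icc (-|s|) |s|)
    (hζ.continuous_hs hL0).continuousOn
  obtain ⟨D, hD⟩ := isCompact_Icc.exists_bound_of_continuousOn (s := Icc (-|s|) |s|)
    fun σ _ => (hF σ).continuousAt.continuousWithinAt
  obtain ⟨C, -, hC⟩ := exists_movingField_kdv_bound hL hk (max B D)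
  exact h.hasDerivAt_comp (bddLip_movingField hL hk) hq hF fun σ hσ τ hτ =>
    hC _ _ _ ((hB σ hσ).trans (le_max_left _ _)) ((hD σ hσ).trans (le_max_right _ _))
      (hζ.const_at σ) (hζ.toHs_kdvField_coe hL0 σ) (hζ.toHs_kdvLin_coe hL0 hNζ σ) τ hτ

lemma IsFlow.rapidKdV (hL : 1 ≤ L) (hk : (k ^ 2).im ≠ 0) (h : IsFlow (movingField L k) Ψ)
    (hu : RapidKdV L fun t => (u t).1) (s : ℝ) : RapidKdV L fun t => (Ψ s (u t)).1 := by
  have hL0 : 0 < L := by linarith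
  have hr := hu.toRapidCurve
  refine ⟨⟨fun n => (coeffCLM L (-1) n).continuous.comp (h.continuous.comp
    (continuous_const.prodMk (hr.continuous_hs hL0))), fun T j => ?_⟩, fun n t => ?_⟩
  · obtain ⟨C, hC⟩ := (h.rapidOn (S := |s|) (T := T) hL hk hr).1 j
    exact ⟨C, fun t ht => hC (s, t) ⟨⟨neg_abs_le s, le_abs_self s⟩, ht⟩⟩
  · have := (coeffCLM L (-1) n).hasFDerivAt.comp_hasDerivAt t (h.hasDerivAt_comp_kdv hL hk hu s t)
    rw [coeffCLM_apply, (h.rapidCurve hL hk hr t).1.toHs_kdvField_coe hL0] at this; exact this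

end commute

end

section

variable {Ψ Φ : ℝ → Hs L (-1) → Hs L (-1)} {u : ℝ → Hs L (-1)}

lemma norm_trans (a : ℝ) (c : ℤ → ℂ) (n : ℤ) : ‖trans L a c n‖ = ‖c n‖ := by
  rw [trans, norm_mul, norm_expi, one_mul]

lemma conv_trans (a : ℝ) (c d : ℤ → ℂ) : conv (trans L a c) (trans L a d) = trans L a (conv c d) := by
  ext n; rw [conv, trans, conv, ← tsum_mul_left]; refine tsum_congr fun m => ?_
  have : expi L n a = expi L m a * expi L (n - m) a := by rw [← expi_add, add_sub_cancel]
  rw [this, trans, trans]; ring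

lemma kdvField_trans (a : ℝ) (c : ℤ → ℂ) : kdvField L (trans L a c) = trans L a (kdvField L c) := by
  change ddx L _ = trans L a (ddx L _); rw [← ddx_trans, ddx_trans, ddx_trans, conv_trans]
  refine congrArg (ddx L) (funext fun n => ?_); simp only [trans]; ring

lemma RapidKdV.trans (a : ℝ) {c : ℝ → ℤ → ℂ} (h : RapidKdV L c) :
    RapidKdV L fun t => trans L a (c t) where
  cont n := continuous_const.mul (h.cont n)
  rapid T j := by
    obtain ⟨C, hC⟩ := h.rapid T j; exact ⟨C, fun t ht n => by rw [norm_trans]; exact hC t ht n⟩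
  hasDerivAt n t := by
    rw [kdvField_trans]; exact (h.hasDerivAt n t).const_mul _

lemma IsSmoothKdV.hkFlowOf (hL : 1 ≤ L) (hk : (k ^ 2).im ≠ 0) (h : IsFlow (movingField L k) Ψ)
    (hu : IsSmoothKdV L u) (s : ℝ) : IsSmoothKdV L fun t => hkFlowOf L k Ψ s (u t) :=
  have hL0 : 0 < L := by linarith
  ((h.rapidKdV hL hk (hu.rapidKdV hL0) s).trans _).isSmoothKdV hL0

/-- Translation as a linear isometry. -/
def Hs.translateₗᵢ (L s a : ℝ) : Hs L s →ₗᵢ[ℝ] Hs L s where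
  toFun := Hs.translate a
  map_add' p q := Subtype.ext (funext fun n => mul_add (expi L n a) (p.1 n) (q.1 n))
  map_smul' r q := Subtype.ext (funext fun n => mul_smul_comm r (expi L n a) (q.1 n))
  norm_map' := Hs.norm_translate a

lemma IsFlow.translate (hL : 1 ≤ L) (hk : (k ^ 2).im ≠ 0) (h : IsFlow (movingField L k) Ψ) (a t : ℝ)
    (q : Hs L (-1)) : Ψ t (q.translate a) = (Ψ t q).translate a := by
  have := h.unique (bddLip_movingField hL hk) Set.ordConnected_univ (mem_univ 0)
    (α := fun t => (Ψ t q).translate a) (fun t _ => by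
      rw [movingField_translate hL hk]
      exact ((Hs.translateₗᵢ L (-1) a).toContinuousLinearMap.hasFDerivAt.comp_hasDerivAt t
        (h.hasDerivAt t q)).hasDerivWithinAt) t (mem_univ t)
  rw [this, h.init]

lemma IsFlow.hkFlowOf_neg (hL : 1 ≤ L) (hk : (k ^ 2).im ≠ 0) (h : IsFlow (movingField L k) Ψ)
    (s : ℝ) (q : Hs L (-1)) : hkFlowOf L k Ψ (-s) (hkFlowOf L k Ψ s q) = q := by
  rw [hkFlowOf, hkFlowOf, h.translate hL hk, ← h.add (bddLip_movingField hL hk), neg_add_cancel,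
    h.init, Hs.translate_translate, mul_neg, neg_add_cancel, Hs.translate_zero]

lemma IsFlow.hkFlowOf_lip (h : IsFlow (movingField L k) Ψ) (s R : ℝ) : ∃ K, 0 ≤ K ∧ ∀ p q : Hs L
    (-1), ‖p‖ ≤ R → ‖q‖ ≤ R → ‖hkFlowOf L k Ψ s p - hkFlowOf L k Ψ s q‖ ≤ K * ‖p - q‖ := by
  obtain ⟨K, hK, hl⟩ := h.lip |s| R; refine ⟨K, hK, fun p q hp hq => ?_⟩
  rw [hkFlowOf, hkFlowOf, ← Hs.translate_sub, Hs.norm_translate]; grind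

lemma IsKdVSolution.comp (hL : 0 < L)
    (hS : ∀ s u, IsSmoothKdV L u → IsSmoothKdV L fun t => Φ s (u t))
    (hinv : ∀ s q, Φ (-s) (Φ s q) = q) (hc : ∀ s, Continuous (Φ s)) (hlip : ∀ s R, ∃ K, 0 ≤ K ∧ ∀ p
    q, ‖p‖ ≤ R → ‖q‖ ≤ R → ‖Φ s p - Φ s q‖ ≤ K * ‖p - q‖) (hu : IsKdVSolution L u) (s : ℝ) :
    IsKdVSolution L fun t => Φ s (u t) := by
  obtain ⟨⟨v, hv, hv0⟩, hu2⟩ := hu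
  refine ⟨⟨fun j t => Φ s (v j t), fun j => hS s _ (hv j), ((hc s).tendsto _).comp hv0⟩,
    fun w hw hw0 T => ?_⟩
  have hw' := hu2 (fun j t => Φ (-s) (w j t)) (fun j => hS _ _ (hw j)) (by
    have := ((hc (-s)).tendsto _).comp hw0
    rwa [hinv] at this) T
  rw [Metric.tendstoUniformlyOn_iff] at hw' ⊢; obtain ⟨j, hj⟩ := (hw' 1 one_pos).exists
  obtain ⟨B, hB⟩ := isCompact_Icc.exists_bound_of_continuousOn (s := Icc (-T) T)
    (((hS (-s) _ (hw j)).rapidKdV hL).continuous_hs hL).continuousOn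
  have hu1 : ∀ t ∈ Icc (-T) T, ‖u t‖ ≤ B + 1 := fun t ht => by
    have h1 := hj t ht; rw [dist_eq_norm] at h1
    linarith [hB t ht, norm_le_insert' (u t) (Φ (-s) (w j t))]
  obtain ⟨K, hK, hl⟩ := hlip s (B + 2); intro ε hε
  filter_upwards [hw' 1 one_pos, hw' (ε / (K + 1)) (by positivity)] with i h1 h2 t ht
  have h3 := h1 t ht; have h4 := h2 t ht; rw [dist_eq_norm] at h3 h4 ⊢
  have e : w i t = Φ s (Φ (-s) (w i t)) := by grind
  have h5 := hu1 t ht; rw [e]; refine (hl _ _ (by linarith) ?_).trans_lt ?_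
  · linarith [norm_le_insert (u t) (Φ (-s) (w i t))]
  · rw [lt_div_iff₀ (by positivity)] at h4; nlinarith

lemma kdvFlow_eq (hu : IsKdVSolution L u) (t : ℝ) : kdvFlow L t (u 0) = u t := by
  have h : ∃ v, IsKdVSolution L v ∧ v 0 = u 0 := ⟨u, hu, rfl⟩; rw [kdvFlow, dif_pos h]
  exact congrFun (h.choose_spec.1.unique hu h.choose_spec.2) t

lemma kdvFlow_comm (h : ∀ s u, IsKdVSolution L u → IsKdVSolution L fun t => Φ s (u t))
    (hinv : ∀ s q, Φ (-s) (Φ s q) = q) (s t : ℝ) (q : Hs L (-1)) : Φ s (kdvFlow L t q) = kdvFlow L t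
    (Φ s q) := by
  by_cases hq : ∃ u, IsKdVSolution L u ∧ u 0 = q
  · obtain ⟨u, hu, rfl⟩ := hq; rw [kdvFlow_eq hu, kdvFlow_eq (h s u hu)]
  · have hq' : ¬ ∃ u, IsKdVSolution L u ∧ u 0 = Φ s q := fun ⟨u, hu, e⟩ =>
      hq ⟨_, h (-s) u hu, by rw [e, hinv]⟩
    rw [kdvFlow, kdvFlow, dif_neg hq, dif_neg hq']

end

end HkFlow

end

theorem proposition3p1 (C : ℝ) (hC : 1 ≤ C) (L : ℝ) (hL : 1 ≤ L)
    (k : ℂ) (hk : StrictlyAdmissible C k) :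
    -- the diagonal Green's functions that occur below are well defined
    (∀ ϰ : ℂ, StrictlyAdmissible C ϰ → ∀ q : Hs L (-1),
      GreenRegular L q.1 ϰ ∧ GreenRegular L q.1 (starRingEnd ℂ ϰ)) ∧
    -- the vector field is the one induced by the Hamiltonian through the Gardner bracket
    (∀ q : ℝ → ℝ, IsL2Per L q → ∃ G : ℝ → ℝ, IsFunctionalDeriv L (hamiltonian L k) q G ∧
      hkField L k (rcoeffs L q) = ddx L (rcoeffs L G)) ∧
    -- global well-posedness
    (∃ Φ : ℝ → Hs L (-1) → Hs L (-1), IsGlobalHkFlow L k Φ ∧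
      -- commutation with the KdV flow
      (∀ (s : ℝ) (u : ℝ → Hs L (-1)), IsKdVSolution L u → IsKdVSolution L fun t => Φ s (u t)) ∧
      (∀ (s t : ℝ) (q : Hs L (-1)), Φ s (kdvFlow L t q) = kdvFlow L t (Φ s q))) ∧
    -- evolution of the diagonal Green's function
    (∀ ϰ : ℂ, StrictlyAdmissible C ϰ → ϰ ≠ k →
      ∀ (I : Set ℝ) (u : ℝ → Hs L (-1)), I.OrdConnected → IsHkSolution L k I u →
        ∀ t ∈ I, HasSobDerivWithin L 0
          (fun τ => coeffs L fun x => 1 / (2 * diagGreen L (u τ).1 ϰ x))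
          (ddx L (coeffs L fun x =>
            (k ^ 2 + (starRingEnd ℂ k) ^ 2) / diagGreen L (u t).1 ϰ x
              - 2 * k ^ 5 / (k ^ 2 - ϰ ^ 2)
                * (diagGreen L (u t).1 k x / diagGreen L (u t).1 ϰ x)
              - 2 * (starRingEnd ℂ k) ^ 5 / ((starRingEnd ℂ k) ^ 2 - ϰ ^ 2)
                * (diagGreen L (u t).1 (starRingEnd ℂ k) x / diagGreen L (u t).1 ϰ x)))
          I t) := by
  have hk0 := (hk.im_pos hC).ne'
  obtain ⟨Ψ, hΨ⟩ := exists_flow (bddLip_movingField hL hk0) (aprioriBdd_movingField hL hk0)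
  have hΦ := hΨ.isGlobalHkFlow hL hk0
  have hcomm := fun s u hu => IsKdVSolution.comp (u := u) (by linarith)
    (fun s u hu => IsSmoothKdV.hkFlowOf hL hk0 hΨ hu s) (hΨ.hkFlowOf_neg hL hk0)
    (fun s => hΦ.continuous.comp (continuous_const.prodMk continuous_id)) hΨ.hkFlowOf_lip hu s
  refine ⟨fun ϰ hϰ q => ⟨(coercive_of_im hL (hϰ.im_pos hC).ne' q).greenRegular hL,
    (coercive_of_im hL (im_conj_sq_ne (hϰ.im_pos hC).ne') q).greenRegular hL⟩,
    fun q hq => exists_functionalDeriv hL hk.re_pos hk0 hq,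
    ⟨hkFlowOf L k Ψ, hΦ, hcomm, kdvFlow_comm hcomm (hΨ.hkFlowOf_neg hL hk0)⟩,
    fun ϰ hϰ hne I u hI hu t ht => hu.hasSobDerivWithin_inv_diagGreen hL hk0 (hϰ.im_pos hC).ne'
      (hk.sq_ne hϰ hne) (hk.sq_ne_conj hC hϰ) hI ht⟩
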